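/- Let $M$ be a smooth (Hausdorff) manifold with boundary of dimension $n\ge 2$, and let $H$ be a real smooth function on $T^*M\setminus 0$, positively homogeneous of degree two in $\xi$, with $\mathrm dH\neq0$ on $\{H=0\}$ (below: a *Hamiltonian*). A *bicharacteristic* is an integral curve in $T^*M\setminus 0$ of $X_H=H_\xi\partial_x-H_x\partial_\xi$; it is *null* if $H=0$ on it. For $(x,\xi)\in T^*M|_{\partial M}$ let $\xi'$ be the restriction of $\xi$ to $T_x\partial M$; $\mathrm d'$ is the differential on $\partial M$. The map $\exp_x$ sends $\xi$ to the base point at time $1$ of the bicharacteristic issued from $(x,\xi)$; its domain consists of those $\xi\ne0$ for which this bicharacteristic exists in $M$ on $[0,1]$. Let $x_0\neq y_0$ be points of $\partial M$ and let $\gamma_0:[0,1]\to T^*M\setminus0$ be a null bicharacteristic from $(x_0,\xi^0)$ to $(y_0,\eta^0)$, over the interior of $M$ for $0<t<1$, whose velocity $H_\xi$ is transversal to $\partial M$ at both endpoints. Assume that $y_0$ is not conjugate to $x_0$ along $\gamma_0$: $\exp_{x_0}$ is a local diffeomorphism near $\xi^0$, i.e. it maps a neighborhood of $\xi^0$ in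 its domain diffeomorphically onto a neighborhood of $y_0$ in $M$. Then, for every sufficiently small open neighborhood $W$ of $(x_0,\xi^0)$ in $T^*M\setminus 0$ and all sufficiently small (depending on $W$) open neighborhoods $U$ of $x_0$ and $V$ of $y_0$ in $\partial M$, any $x\in U$ and $y\in V$ are joined by exactly one bicharacteristic $\gamma_{[x,y]}:[0,1]\to T^*M\setminus 0$ (not necessarily null) with $\gamma_{[x,y]}(0)\in W$. For any Hamiltonian $\tilde H$ on $T^*M\setminus0$ let $\Sigma(\tilde H)\subset U\times V$ be the set of pairs $(x,y)$ joined by a null bicharacteristic of $\tilde H$ over $[0,1]$ with initial covector in $W$. A *defining function* of $\Sigma(\tilde H)$ is a smooth $r:U\times V\to\mathbb R$ with $\Sigma(\tilde H)=\{r=0\}$, $\mathrm dr\ne0$ on $\Sigma(\tilde H)$, and $r(x,y)>0$ if and only if $x$ and $y$ are joined by a bicharacteristic of $\tilde H$ over $[0,1]$ with initial covector in $W$ and positive energy $\tilde H$. Put $\Sigma=\Sigma(H)$. The following holds. (a) $\Sigma$ is a submanifold of $U\times V$ of codimension one. (b) The local scattering relation $S_0$ at zero energy is well defined: there are conic open neighborhoods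 $A$ of $(x_0,\xi^0)$ in $T^*M\setminus0$ and $\mathcal C$ of $(x_0,\xi^{0\prime})$ in $T^*U$ such that each $(x,\xi')\in\mathcal C$ is the restriction of exactly one null covector $(x,\xi)\in A$, and the bicharacteristic issued from it hits $V$; with $(y,\eta)$ the covector at which it does so for the first time, $S_0(x,\xi')=(y,\eta')$. For any such $A$, $\mathcal C$, $S_0$ and any defining function $r$ of $\Sigma$, the set $$C=\{(x,-\lambda\,\mathrm d'_xr,\;y,\lambda\,\mathrm d'_yr):\ \lambda>0,\ (x,y)\in\Sigma\}$$ coincides with the graph of $S_0$ in a neighborhood of $(x_0,\xi^{0\prime},y_0,\eta^{0\prime})$. (c) Let $\varepsilon>0$, and let $H(\cdot,\cdot;s)$, $|s|<\varepsilon$, be a family of Hamiltonians on $T^*M\setminus 0$, smooth jointly in all variables, with $H(\cdot,\cdot;0)=H$. Let $r_s(x,y)$ be smooth jointly in $(s,x,y)$ and such that $r_s$ is a defining function of $\Sigma(H(\cdot,\cdot;s))$ for each $|s|<\varepsilon$. Then there is a smooth function $\rho>0$ on $U\times V$ such that $$\frac{\partial}{\partial s}\Big|_{s=0}r_s(x,y)=-\rho(x,y)\int_0^1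 f(\gamma_{[x,y]}(t))\,\mathrm dt\qquad\text{for }(x,y)\in\Sigma,\qquad f=\frac{\partial}{\partial s}\Big|_{s=0}H(\cdot,\cdot;s).$$ -/

import Mathlib

open Set Bundle
open scoped Manifold ContDiff Topology

noncomputable section

/-- The model space of covectors in dimension `n`. -/
abbrev Covec (n : ℕ) : Type := EuclideanSpace ℝ (Fin n) →L[ℝ] ℝ

/-- The cotangent bundle `T*M` of a manifold of dimension `n` (possibly with boundary), with its
topology and its structure of a manifold as a vector bundle over `M`. -/
abbrev Cot {n : ℕ} {X : Type*} [TopologicalSpace X]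
    (I : ModelWithCorners ℝ (EuclideanSpace ℝ (Fin n)) X)
    (M : Type*) [TopologicalSpace M] [ChartedSpace X M] [IsManifold I ∞ M] : Type _ :=
  TotalSpace (Covec n) (fun x : M => TangentSpace I x →L[ℝ] Trivial M ℝ x)

/-- The model with corners of `T*M`. -/
abbrev cotModel {n : ℕ} {X : Type*} [TopologicalSpace X]
    (I : ModelWithCorners ℝ (EuclideanSpace ℝ (Fin n)) X) :
    ModelWithCorners ℝ (EuclideanSpace ℝ (Fin n) × Covec n) (ModelProd X (Covec n)) :=
  I.prod 𝓘(ℝ, Covec n)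

section Hamilton

variable {n : ℕ} {X : Type*} [TopologicalSpace X]
  {I : ModelWithCorners ℝ (EuclideanSpace ℝ (Fin n)) X}
  {M : Type*} [TopologicalSpace M] [ChartedSpace X M] [IsManifold I ∞ M]

/-- The dilation `(x, ξ) ↦ (x, c ξ)` of the fibres of `T*M`. -/
def dilate (c : ℝ) (z : Cot I M) : Cot I M := ⟨z.1, c • z.2⟩

/-- The set `T*M ∖ 0` of nonzero covectors. -/
def nonzeroCot (I : ModelWithCorners ℝ (EuclideanSpace ℝ (Fin n)) X)
    (M : Type*) [TopologicalSpace M] [ChartedSpace X M] [IsManifold I ∞ M] : Set (Cot I M) := {z | z.2 ≠ 0}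

/-- A set of covectors is conic if it is invariant under the positive dilations. -/
def IsConic (A : Set (Cot I M)) : Prop := ∀ z ∈ A, ∀ c : ℝ, 0 < c → dilate c z ∈ A

/-- The differential of `H` at `z`, in the canonical coordinates `(x, ξ)` of `T*M` that are
induced by the preferred chart of `M` at the base point of `z`. -/
def diffCot (H : Cot I M → ℝ) (z : Cot I M) : EuclideanSpace ℝ (Fin n) × Covec n →L[ℝ] ℝ :=
  mfderiv (cotModel I) 𝓘(ℝ, ℝ) H z

/-- A smooth function on `T*M ∖ 0`, positively homogeneous of degree two in the fibres, whose
differential has no zero on the zero energy level. (The values on the zero section play no role.) -/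
structure IsHamiltonian (H : Cot I M → ℝ) : Prop where
  smooth : ContMDiffOn (cotModel I) 𝓘(ℝ, ℝ) ∞ H (nonzeroCot I M)
  homogeneous : ∀ z ∈ nonzeroCot I M, ∀ c : ℝ, 0 < c → H (dilate c z) = c ^ 2 * H z
  nondegenerate : ∀ z ∈ nonzeroCot I M, H z = 0 → diffCot H z ≠ 0

/-- The velocity `H_ξ`, a tangent vector to `M`; its `i`-th coordinate is `∂H/∂ξ_i`. -/
def velocity (H : Cot I M → ℝ) (z : Cot I M) : TangentSpace I z.1 :=
  (WithLp.toLp 2 (fun i => diffCot H z (0, EuclideanSpace.proj i)) : EuclideanSpace ℝ (Fin n))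

/-- The force `-H_x`, in the canonical coordinates at `z`. -/
def force (H : Cot I M → ℝ) (z : Cot I M) : Covec n :=
  -((diffCot H z).comp (ContinuousLinearMap.inl ℝ (EuclideanSpace ℝ (Fin n)) (Covec n)))

/-- The Hamiltonian vector field `X_H = H_ξ ∂_x - H_x ∂_ξ` on `T*M`. The tangent space of `T*M` at
`z` is identified with `ℝⁿ × (ℝⁿ)*` by the canonical coordinates `(x, ξ)` at `z`. -/
def hamField (H : Cot I M → ℝ) (z : Cot I M) : TangentSpace (cotModel I) z :=
  ((velocity H z, force H z) : EuclideanSpace ℝ (Fin n) × Covec n)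

/-- `γ`, restricted to `[0, T]`, is a bicharacteristic (Hamiltonian curve) of `H` in `T*M ∖ 0`,
of any energy. -/
structure IsBichar (H : Cot I M → ℝ) (T : ℝ) (γ : ℝ → Cot I M) : Prop where
  integral : IsMIntegralCurveOn γ (hamField H) (Icc 0 T)
  nonzero : ∀ t ∈ Icc 0 T, γ t ∈ nonzeroCot I M

/-- The covectors `ξ` at `x` for which the bicharacteristic issued from `(x, ξ)` exists in `M` for
all times in `[0, 1]`. -/
def expDomain (H : Cot I M → ℝ) (x : M) : Set (Covec n) :=
  {ξ | ∃ γ : ℝ → Cot I M, IsBichar H 1 γ ∧ γ 0 = ⟨x, ξ⟩}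

open Classical in
/-- The exponential map: `exp_x ξ` is the base point at time `1` of the bicharacteristic issued
from `(x, ξ)` (and `x`, by convention, when `ξ` is not in the domain). -/
def expMap (H : Cot I M → ℝ) (x : M) (ξ : Covec n) : M :=
  if h : ξ ∈ expDomain H x then (h.choose 1).1 else x

/-- `exp_x ξ` is not conjugate to `x` along the bicharacteristic issued from `(x, ξ)`:
`exp_x` is a local diffeomorphism near `ξ`, that is, it restricts to a diffeomorphism of a
neighbourhood of `ξ` in its domain onto a neighbourhood of `exp_x ξ` in the manifold `M`.
(When `exp_x ξ` is a boundary point, the bicharacteristics that reach the boundary before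
time `1` do not belong to the domain, and both neighbourhoods have a boundary.) -/
def NotConjugate (H : Cot I M → ℝ) (x : M) (ξ : Covec n) : Prop :=
  ∃ (D : Set (Covec n)) (O : Set M) (g : M → Covec n),
    IsOpen D ∧ ξ ∈ D ∩ expDomain H x ∧ IsOpen O ∧
    BijOn (expMap H x) (D ∩ expDomain H x) O ∧
    LeftInvOn g (expMap H x) (D ∩ expDomain H x) ∧
    ContMDiffOn 𝓘(ℝ, Covec n) I ∞ (expMap H x) (D ∩ expDomain H x) ∧
    ContMDiffOn I 𝓘(ℝ, Covec n) ∞ g O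

end Hamilton

/-- `S` is an (embedded) submanifold of codimension one of the open subset `O` of the manifold `P`:
near each of its points it is the zero set of a smooth function whose differential has no zero on
`S`. -/
def IsHypersurface {F : Type*} [NormedAddCommGroup F] [NormedSpace ℝ F]
    {Y : Type*} [TopologicalSpace Y] (J : ModelWithCorners ℝ F Y)
    {P : Type*} [TopologicalSpace P] [ChartedSpace Y P] (S O : Set P) : Prop :=
  S ⊆ O ∧ ∀ x ∈ S, ∃ (N : Set P) (g : P → ℝ), IsOpen N ∧ x ∈ N ∧ N ⊆ O ∧
    ContMDiffOn J 𝓘(ℝ, ℝ) ∞ g N ∧ (∀ y ∈ N, y ∈ S ↔ g y = 0) ∧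
    ∀ y ∈ N ∩ S, mfderiv J 𝓘(ℝ, ℝ) g y ≠ 0

section Boundary

variable {m : ℕ} {M : Type*} [TopologicalSpace M] [ChartedSpace (EuclideanHalfSpace (m + 1)) M]
  [IsManifold (𝓡∂ (m + 1)) ∞ M]
  {B : Type*} [TopologicalSpace B] [ChartedSpace (EuclideanSpace ℝ (Fin m)) B]
  [IsManifold (𝓡 m) ∞ B]

/-- The map `ι : B → M` is the inclusion of the boundary of `M`: a smooth embedding of the
manifold without boundary `B` onto `∂M`. -/
structure IsBoundaryInclusion (ι : B → M) : Prop where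
  smooth : ContMDiff (𝓡 m) (𝓡∂ (m + 1)) ∞ ι
  embedding : Topology.IsEmbedding ι
  immersive : ∀ p, Function.Injective (mfderiv (𝓡 m) (𝓡∂ (m + 1)) ι p)
  range_eq : range ι = (𝓡∂ (m + 1)).boundary M

/-- The pullback `ι* : T*M → T*∂M`, the restriction `ξ'` of a covector `ξ` at `ι p` to `T_p ∂M`. -/
def restr (ι : B → M) (p : B) (ξ : TangentSpace (𝓡∂ (m + 1)) (ι p) →L[ℝ] Trivial M ℝ (ι p)) :
    Cot (𝓡 m) B :=
  ⟨p, ξ.comp (mfderiv (𝓡 m) (𝓡∂ (m + 1)) ι p)⟩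

/-- The velocity `H_ξ` at a covector over the boundary point `ι p` is transversal to the boundary
(equivalently, `⟨dρ, H_ξ⟩ ≠ 0` for a boundary defining function `ρ`). -/
def IsTransversal (H : Cot (𝓡∂ (m + 1)) M → ℝ) (ι : B → M) (p : B)
    (ξ : TangentSpace (𝓡∂ (m + 1)) (ι p) →L[ℝ] Trivial M ℝ (ι p)) : Prop :=
  velocity H ⟨ι p, ξ⟩ ∉ range (mfderiv (𝓡 m) (𝓡∂ (m + 1)) ι p)

/-- `γ : [0, 1] → T*M ∖ 0` is a bicharacteristic of `H`, not necessarily null, that joins the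
boundary points `p` and `q` and has its initial covector in `W`. -/
structure Joins (H : Cot (𝓡∂ (m + 1)) M → ℝ) (ι : B → M) (W : Set (Cot (𝓡∂ (m + 1)) M))
    (p q : B) (γ : ℝ → Cot (𝓡∂ (m + 1)) M) : Prop where
  bichar : IsBichar H 1 γ
  start_mem : γ 0 ∈ W
  start_eq : (γ 0).1 = ι p
  end_eq : (γ 1).1 = ι q

/-- The set `Σ` of the pairs in `U × V` that are joined by a null bicharacteristic with initial
covector in `W`. -/
def nullPairs (H : Cot (𝓡∂ (m + 1)) M → ℝ) (ι : B → M) (W : Set (Cot (𝓡∂ (m + 1)) M))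
    (U V : Set B) : Set (B × B) :=
  {x | x ∈ U ×ˢ V ∧ ∃ γ, Joins H ι W x.1 x.2 γ ∧ H (γ 0) = 0}

/-- `r` is a defining function of `Σ` on `U × V`. -/
structure IsDefiningFunction (H : Cot (𝓡∂ (m + 1)) M → ℝ) (ι : B → M)
    (W : Set (Cot (𝓡∂ (m + 1)) M)) (U V : Set B) (r : B × B → ℝ) : Prop where
  smooth : ContMDiffOn ((𝓡 m).prod (𝓡 m)) 𝓘(ℝ, ℝ) ∞ r (U ×ˢ V)
  zero_iff : ∀ x ∈ U ×ˢ V, x ∈ nullPairs H ι W U V ↔ r x = 0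
  diff_ne_zero : ∀ x ∈ nullPairs H ι W U V, mfderiv ((𝓡 m).prod (𝓡 m)) 𝓘(ℝ, ℝ) r x ≠ 0
  pos_iff : ∀ x ∈ U ×ˢ V, 0 < r x ↔ ∃ γ, Joins H ι W x.1 x.2 γ ∧ 0 < H (γ 0)

/-- The differential `d'_x r (x, y)` with respect to the first boundary variable. -/
def diffFst (r : B × B → ℝ) (p q : B) : TangentSpace (𝓡 m) p →L[ℝ] Trivial B ℝ p :=
  mfderiv (𝓡 m) 𝓘(ℝ, ℝ) (fun p' => r (p', q)) p

/-- The differential `d'_y r (x, y)` with respect to the second boundary variable. -/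
def diffSnd (r : B × B → ℝ) (p q : B) : TangentSpace (𝓡 m) q →L[ℝ] Trivial B ℝ q :=
  mfderiv (𝓡 m) 𝓘(ℝ, ℝ) (fun q' => r (p, q')) q

/-- The set `{(x, -c d'_x r, y, c d'_y r) : c > 0, (x, y) ∈ S}` in `T*∂M × T*∂M`. -/
def generatedRel (r : B × B → ℝ) (S : Set (B × B)) : Set (Cot (𝓡 m) B × Cot (𝓡 m) B) :=
  {w | ∃ c : ℝ, 0 < c ∧ ∃ x ∈ S,
    w = (⟨x.1, -(c • diffFst r x.1 x.2)⟩, ⟨x.2, c • diffSnd r x.1 x.2⟩)}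

/-- The scattering relation at zero energy, as a set of pairs `(a, b)` in `T*∂M × T*∂M`: `a` is the
restriction of a null covector in `A`, and `b` is the restriction of the covector at which the
bicharacteristic issued from it hits `V` for the first time. -/
def scatteringRel (H : Cot (𝓡∂ (m + 1)) M → ℝ) (ι : B → M) (A : Set (Cot (𝓡∂ (m + 1)) M))
    (V : Set B) : Set (Cot (𝓡 m) B × Cot (𝓡 m) B) :=
  {w | ∃ (p q : B) (ξ : TangentSpace (𝓡∂ (m + 1)) (ι p) →L[ℝ] Trivial M ℝ (ι p))
      (η : TangentSpace (𝓡∂ (m + 1)) (ι q) →L[ℝ] Trivial M ℝ (ι q))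
      (T : ℝ) (γ : ℝ → Cot (𝓡∂ (m + 1)) M),
    w = (restr ι p ξ, restr ι q η) ∧ ⟨ι p, ξ⟩ ∈ A ∧ H ⟨ι p, ξ⟩ = 0 ∧
    0 < T ∧ IsBichar H T γ ∧ γ 0 = ⟨ι p, ξ⟩ ∧ γ T = ⟨ι q, η⟩ ∧ q ∈ V ∧
    ∀ t ∈ Ico 0 T, (γ t).1 ∉ ι '' V}

/-- `S : C → T*V` is the local scattering map `S₀` relative to the covector `ξ₀` over `p₀ ∈ U`:
`A` is a conic neighbourhood of `(p₀, ξ₀)` in `T*M ∖ 0` and `C` a conic neighbourhood of its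
restriction in `T*U`, every covector in `C` is the restriction of exactly one null covector in `A`,
and `S` sends it to the restriction of the endpoint of the bicharacteristic issued from the
latter, where it first hits `V`. -/
structure IsScatteringMap (H : Cot (𝓡∂ (m + 1)) M → ℝ) (ι : B → M) (U V : Set B) (p₀ : B)
    (ξ₀ : TangentSpace (𝓡∂ (m + 1)) (ι p₀) →L[ℝ] Trivial M ℝ (ι p₀))
    (A : Set (Cot (𝓡∂ (m + 1)) M)) (C : Set (Cot (𝓡 m) B))
    (S : Cot (𝓡 m) B → Cot (𝓡 m) B) : Prop where
  isOpen_upstairs : IsOpen A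
  conic_upstairs : IsConic A
  nonzero_upstairs : A ⊆ nonzeroCot (𝓡∂ (m + 1)) M
  mem_upstairs : ⟨ι p₀, ξ₀⟩ ∈ A
  isOpen_source : IsOpen C
  conic_source : IsConic C
  mem_source : restr ι p₀ ξ₀ ∈ C
  source_over : ∀ a ∈ C, a.1 ∈ U
  solvable : ∀ a ∈ C, ∃! ξ : TangentSpace (𝓡∂ (m + 1)) (ι a.1) →L[ℝ] Trivial M ℝ (ι a.1),
    ⟨ι a.1, ξ⟩ ∈ A ∧ H ⟨ι a.1, ξ⟩ = 0 ∧ restr ι a.1 ξ = a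
  value : ∀ a ∈ C, ∀ b, (a, b) ∈ scatteringRel H ι A V ↔ b = S a

end Boundary

end

/-! The bicharacteristics issued from boundary covectors w = (x', ξ) near (x₀, ξ⁰) cross M and leave
it transversally at a time τ(w), at a covector ζ(w), both smooth in w. By homogeneity, replacing ξ
by cξ divides τ by c and keeps the exit point, so the derivative of the exit map w ↦ (x', τ, y')
sends the radial direction (0, ξ⁰) to (0, -1, 0). The local inverse of the exponential map,
restricted to boundary points near y₀, supplies the directions (0, 0, v). Hence the exit map is a
local diffeomorphism (`HitChart.exists_hasFDerivAt_equiv`). Setting τ = 1 gives the joining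
bicharacteristic of x and y, unique among those starting in W, and its energy E(x, y), a smooth
function with zero set Σ (`JoinChart`, `joinEnergy`).

The rest depends on one formula. For a smooth family of bicharacteristics of H_s with energy E and
duration T, running from (x, ξ) to (y, η), the first variation of the endpoints is η dy = ξ dx + T
dE + 2E dT + (∫ ∂H/∂s dt) ds. It follows from Euler's identity ξ·H_ξ = 2H and from conservation of
energy, both differentiated in the parameters (`segment_of_chart`), and it is additive under
concatenation (`Segment.trans`). At T = 1, with endpoints on the boundary, it becomes dE = -(∫ ∂H/∂s
dt) ds - ξ' dx + η' dy (`Segment.hasFDerivAt_energy`).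

On Σ the differential of E in (x, y) does not vanish: if ξ' = 0, then ξ·H_ξ = 2H = 0 and
transversality of H_ξ force ξ = 0. This is (a). A defining function r vanishes on Σ and is positive
where E is, so on Σ its differential is ρ dE with ρ > 0 (`exists_pos_smul_of_sign`). Thus d'_x r =
-ρ ξ' and d'_y r = ρ η', and since the scattering relation is invariant under dilations, the rays
generated by r form its graph near the reference point; this is (b). The same comparison of signs,
made jointly in (s, x, y), relates the s-derivatives with the same factor ρ, which is (c).

The technical difficulty is smoothness up to the boundary, since H is not defined outside M. Near a
transversal crossing the normal coordinate is written as a square u². Composed with this fold, the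
Hamiltonian field becomes smooth on an open set. With u as parameter and the time t as an unknown,
the equation dt/du = 2u/n, where n is the normal velocity, is regular (`FoldFlow`). The time then
has a critical point at the boundary, which is why curves are handled up to reparameterization. For
the scattering map, restriction and energy are local coordinates on covectors over the boundary
where H_ξ is transversal, and null covectors are found by prescribing energy zero
(`exists_null_covectors`). -/

set_option linter.unusedSectionVars false

noncomputable section

/-! ### Smoothness of postcomposition on spaces of continuous functions. -/

section NemytskiiOperator

universe u

variable {X : Type*} [TopologicalSpace X] [CompactSpace X]

/-- Pointwise application of a continuous family of operators to a continuous function. -/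
def pointwiseApply (X : Type*) [TopologicalSpace X] [CompactSpace X]
    {F G L : Type*} [NormedAddCommGroup F] [NormedSpace ℝ F]
    [NormedAddCommGroup G] [NormedSpace ℝ G] [NormedAddCommGroup L] [NormedSpace ℝ L]
    (Λ : L →L[ℝ] F →L[ℝ] G) :
    C(X, L) →L[ℝ] C(X, F) →L[ℝ] C(X, G) :=
  LinearMap.mkContinuous₂
    (LinearMap.mk₂ ℝ (fun (A : C(X, L)) (α : C(X, F)) =>
        (⟨fun x => Λ (A x) (α x), by fun_prop⟩ : C(X, G)))
      (fun _ _ _ => by ext; simp) (fun _ _ _ => by ext; simp)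
      (fun _ _ _ => by ext; simp) (fun _ _ _ => by ext; simp))
    ‖Λ‖ (fun A α => by
      refine (ContinuousMap.norm_le _ (by positivity)).2 fun x => ?_
      refine (Λ.le_opNorm₂ _ _).trans ?_
      gcongr
      · exact A.norm_coe_le_norm x
      · exact α.norm_coe_le_norm x)

/-- The mean value inequality at each x bounds the remainder uniformly in x, because postcomposition
with f' is continuous at α in the sup norm. The derivative is written as Λ (f' x) so that the
derivative operator is again a postcomposition followed by a bounded linear map; this form allows
iteration. -/
theorem hasFDerivAt_postcomp {F G L : Type*} [NormedAddCommGroup F] [NormedSpace ℝ F]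
    [NormedAddCommGroup G] [NormedSpace ℝ G] [NormedAddCommGroup L] [NormedSpace ℝ L]
    (Λ : L →L[ℝ] F →L[ℝ] G) {f : F → G} {f' : F → L}
    (hf : ∀ x, HasFDerivAt f (Λ (f' x)) x) (hc : Continuous f) (hc' : Continuous f')
    (α : C(X, F)) :
    HasFDerivAt (fun β : C(X, F) => ContinuousMap.comp ⟨f, hc⟩ β)
      (pointwiseApply X Λ (ContinuousMap.comp ⟨f', hc'⟩ α)) α := by
  rw [hasFDerivAt_iff_isLittleO_nhds_zero, Asymptotics.isLittleO_iff]
  intro c hc0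
  have hcont : ContinuousAt (fun β : C(X, F) => ContinuousMap.comp ⟨f', hc'⟩ β) α :=
    (ContinuousMap.continuous_postcomp (X := X) ⟨f', hc'⟩).continuousAt
  -- The summand 1 keeps the tolerance meaningful when Λ = 0.
  obtain ⟨δ, hδ, hball⟩ := Metric.continuousAt_iff.1 hcont (c / (‖Λ‖ + 1)) (by positivity)
  filter_upwards [Metric.ball_mem_nhds (0 : C(X, F)) hδ] with β hβ
  refine (ContinuousMap.norm_le _ (by positivity)).2 fun x => ?_
  have hβ' : ‖β‖ < δ := by simpa using hβ
  have key := Convex.norm_image_sub_le_of_norm_hasFDerivWithin_le' (f := f)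
    (f' := fun y => Λ (f' y)) (φ := Λ (f' (α x)))
    (s := Metric.ball (α x) δ ∩ segment ℝ (α x) (α x + β x)) (C := c)
    (x := α x) (y := α x + β x)
    (fun y _ => (hf y).hasFDerivWithinAt) ?_
    ((convex_ball _ _).inter (convex_segment _ _))
    ⟨Metric.mem_ball_self hδ, left_mem_segment _ _ _⟩
    ⟨by simpa using (β.norm_coe_le_norm x).trans_lt hβ', right_mem_segment _ _ _⟩
  · simp only [add_sub_cancel_left] at key
    refine le_trans (le_of_eq ?_) (key.trans
      (mul_le_mul_of_nonneg_left (β.norm_coe_le_norm x) hc0.le))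
    rfl
  · rintro y ⟨-, hy⟩
    rw [segment_eq_image'] at hy
    obtain ⟨θ, ⟨h0, h1⟩, rfl⟩ := hy
    -- A point of the segment is the value at x of the function α + θβ, which is δ-close to α in the
    -- sup norm; the choice of δ therefore applies to it.
    have h2 : dist (α + θ • β) α < δ := by
      rw [dist_eq_norm, add_sub_cancel_left, norm_smul, Real.norm_eq_abs, abs_of_nonneg h0]
      exact (mul_le_of_le_one_left (norm_nonneg _) h1).trans_lt hβ'
    have h3 := (ContinuousMap.dist_apply_le_dist x).trans_lt (hball h2)
    rw [dist_eq_norm] at h3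
    rw [← map_sub]
    refine (Λ.le_opNorm _).trans ?_
    have h4 : ‖f' (α x + θ • (α x + β x - α x)) - f' (α x)‖ ≤ c / (‖Λ‖ + 1) := by
      refine le_trans (le_of_eq ?_) h3.le
      simp
    calc ‖Λ‖ * ‖f' (α x + θ • (α x + β x - α x)) - f' (α x)‖ ≤ (‖Λ‖ + 1) * (c / (‖Λ‖ + 1)) := by
          gcongr; linarith
      _ = c := by field_simp

theorem contDiff_postcomp_succ {k : ℕ} {F G L : Type*} [NormedAddCommGroup F] [NormedSpace ℝ F]
    [NormedAddCommGroup G] [NormedSpace ℝ G] [NormedAddCommGroup L] [NormedSpace ℝ L]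
    (Λ : L →L[ℝ] F →L[ℝ] G) {f : F → G} {f' : F → L}
    (hf : ∀ x, HasFDerivAt f (Λ (f' x)) x) (hc : Continuous f) (hc' : Continuous f')
    (h : ContDiff ℝ k (fun β : C(X, F) => ContinuousMap.comp ⟨f', hc'⟩ β)) :
    ContDiff ℝ (k + 1) (fun β : C(X, F) => ContinuousMap.comp ⟨f, hc⟩ β) :=
  contDiff_succ_iff_hasFDerivAt.2 ⟨fun β => pointwiseApply X Λ (ContinuousMap.comp ⟨f', hc'⟩ β),
    (pointwiseApply X Λ).contDiff.comp h, fun α => hasFDerivAt_postcomp Λ hf hc hc' α⟩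

/-- Induction on k with G varying: the derivative is postcomposition with a map into F →L[ℝ] G,
which is the next target space. Keeping F and G in one universe makes the induction hypothesis
applicable to it. -/
theorem contDiff_postcomp_nat (k : ℕ) {F : Type u} [NormedAddCommGroup F] [NormedSpace ℝ F] :
    ∀ {G : Type u} [NormedAddCommGroup G] [NormedSpace ℝ G] {f : F → G} (hf : ContDiff ℝ k f),
      ContDiff ℝ k (fun β : C(X, F) => ContinuousMap.comp ⟨f, hf.continuous⟩ β) := by
  induction k with
  | zero =>
    intro G _ _ f hf
    exact contDiff_zero.2 (ContinuousMap.continuous_postcomp _)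
  | succ k ih =>
    intro G _ _ f hf
    have hf' : ContDiff ℝ ((k : ℕ∞ω) + 1) f := by exact_mod_cast hf
    obtain ⟨f', hf1, hf2⟩ := contDiff_succ_iff_hasFDerivAt.1 hf'
    push_cast
    exact contDiff_postcomp_succ (ContinuousLinearMap.id ℝ (F →L[ℝ] G)) hf2 hf.continuous
      hf1.continuous (ih hf1)

theorem contDiff_postcomp {F G : Type u} [NormedAddCommGroup F] [NormedSpace ℝ F]
    [NormedAddCommGroup G] [NormedSpace ℝ G] {f : F → G} (hf : ContDiff ℝ ∞ f) :
    ContDiff ℝ ∞ (fun β : C(X, F) => ContinuousMap.comp ⟨f, hf.continuous⟩ β) :=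
  contDiff_infty.2 fun k => contDiff_postcomp_nat k (hf.of_le (by exact_mod_cast le_top))

end NemytskiiOperator

/-! ### The inverse function theorem. -/

section InverseFunction

/-- The inverse function theorem for smooth functions, on a neighbourhood. -/
theorem exists_openPartialHomeomorph_of_contDiffOn {E F : Type*} [NormedAddCommGroup E]
    [NormedSpace ℝ E] [CompleteSpace E] [NormedAddCommGroup F] [NormedSpace ℝ F]
    {f : E → F} {Ω : Set E} (hΩ : IsOpen Ω) (hf : ContDiffOn ℝ ∞ f Ω) {a : E} (ha : a ∈ Ω)
    {f' : E ≃L[ℝ] F} (hf' : HasFDerivAt f (f' : E →L[ℝ] F) a) :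
    ∃ e : OpenPartialHomeomorph E F, a ∈ e.source ∧ e.source ⊆ Ω ∧ (∀ x, e x = f x) ∧
      (∀ x ∈ e.source, ∃ A : E ≃L[ℝ] F, HasFDerivAt f (A : E →L[ℝ] F) x) ∧
      ContDiffOn ℝ ∞ e.symm e.target := by
  have hfa : ContDiffAt ℝ ∞ f a := hf.contDiffAt (hΩ.mem_nhds ha)
  set e₀ := hfa.toOpenPartialHomeomorph f hf' (by simp) with he₀
  have hcont : ContinuousOn (fderiv ℝ f) Ω := hf.continuousOn_fderiv_of_isOpen hΩ (by simp)
  -- Invertible operators form an open set, so the domain can be cut down to the points with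
  -- invertible derivative; the inverse is then smooth on the whole target, not only at one point.
  have hU : IsOpen (Ω ∩ fderiv ℝ f ⁻¹' range ((↑) : (E ≃L[ℝ] F) → E →L[ℝ] F)) :=
    hcont.isOpen_inter_preimage hΩ ContinuousLinearEquiv.isOpen
  set U := Ω ∩ fderiv ℝ f ⁻¹' range ((↑) : (E ≃L[ℝ] F) → E →L[ℝ] F) with hUdef
  refine ⟨e₀.restr U, ?_, ?_, fun x => rfl, ?_, ?_⟩
  · rw [e₀.restr_source' _ hU]
    exact ⟨hfa.mem_toOpenPartialHomeomorph_source hf' _, ha, f', hf'.fderiv.symm⟩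
  · rw [e₀.restr_source' _ hU]
    exact fun x hx => hx.2.1
  · rw [e₀.restr_source' _ hU]
    rintro x ⟨-, hxΩ, A, hA⟩
    refine ⟨A, ?_⟩
    rw [hA]
    exact ((hf.contDiffAt (hΩ.mem_nhds hxΩ)).differentiableAt (by simp)).hasFDerivAt
  · intro y hy
    have hsrc := (e₀.restr U).map_target hy
    rw [e₀.restr_source' _ hU] at hsrc
    obtain ⟨-, hxΩ, A, hA⟩ := hsrc
    have h1 := hf.contDiffAt (hΩ.mem_nhds hxΩ)
    refine (OpenPartialHomeomorph.contDiffAt_symm (e₀.restr U) (f₀' := A) hy ?_ h1).contDiffWithinAt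
    rw [hA]
    exact (h1.differentiableAt (by simp)).hasFDerivAt

end InverseFunction

/-! ### Smooth dependence of local flows on time and initial value. -/

section LocalFlow

variable {F : Type} [NormedAddCommGroup F] [NormedSpace ℝ F]

/-- The primitive on `[0, 1]` that vanishes at `0`. -/
def primitiveMap (F : Type) [NormedAddCommGroup F] [NormedSpace ℝ F] :
    C(unitInterval, F) →L[ℝ] C(unitInterval, F) :=
  LinearMap.mkContinuous
    { toFun := fun α => ⟨fun t => ∫ s in (0 : ℝ)..t, α (projIcc 0 1 zero_le_one s),
        (intervalIntegral.continuous_primitive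
          (fun _ _ => (α.continuous.comp continuous_projIcc).intervalIntegrable _ _) 0).comp
          continuous_subtype_val⟩
      map_add' := fun α β => by
        ext t
        simp only [ContinuousMap.add_apply, ContinuousMap.coe_mk]
        exact intervalIntegral.integral_add
          ((α.continuous.comp continuous_projIcc).intervalIntegrable _ _)
          ((β.continuous.comp continuous_projIcc).intervalIntegrable _ _)
      map_smul' := fun c α => by
        ext t
        simp only [ContinuousMap.smul_apply, ContinuousMap.coe_mk, RingHom.id_apply]
        exact intervalIntegral.integral_smul _ _ }
    1 (fun α => by
      refine (ContinuousMap.norm_le _ (by positivity)).2 fun t => ?_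
      have := intervalIntegral.norm_integral_le_of_norm_le_const (a := 0) (b := (t : ℝ)) (C := ‖α‖)
        (f := fun s => α (projIcc 0 1 zero_le_one s)) (fun s _ => α.norm_coe_le_norm _)
      refine this.trans ?_
      rw [sub_zero, abs_of_nonneg t.2.1, one_mul]
      exact mul_le_of_le_one_right (norm_nonneg _) t.2.2)

/-- A bump function cuts v off. For a globally smooth field the integral equation makes sense for
every curve in C([0, 1], F), without a condition on its range. -/
theorem exists_contDiff_eqOn_ball [FiniteDimensional ℝ F] {G : Type*} [NormedAddCommGroup G]
    [NormedSpace ℝ G] {v : F → G} {Ω : Set F} (hΩ : IsOpen Ω) (hv : ContDiffOn ℝ ∞ v Ω) {a : F}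
    (ha : a ∈ Ω) : ∃ w : F → G, ContDiff ℝ ∞ w ∧ ∃ r > 0, Metric.ball a r ⊆ Ω ∧
      EqOn w v (Metric.ball a r) := by
  obtain ⟨R, hR, hball⟩ := Metric.isOpen_iff.1 hΩ a ha
  let b : ContDiffBump a := ⟨R / 4, R / 2, by positivity, by linarith⟩
  refine ⟨fun x => b x • v x, ?_, R / 4, by positivity,
    (Metric.ball_subset_ball (by linarith)).trans hball, fun x hx => ?_⟩
  · rw [contDiff_iff_contDiffAt]
    intro x
    by_cases hx : x ∈ Ω
    · exact b.contDiffAt.smul (hv.contDiffAt (hΩ.mem_nhds hx))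
    · have hx' : x ∉ tsupport b := fun h => hx (hball (by
        rw [b.tsupport_eq] at h
        exact Metric.closedBall_subset_ball (by change R / 2 < R; linarith) h))
      refine contDiffAt_const (c := (0 : G)) |>.congr_of_eventuallyEq ?_
      filter_upwards [(isClosed_tsupport b).isOpen_compl.mem_nhds hx'] with y hy
      rw [image_eq_zero_of_notMem_tsupport hy, zero_smul]
  · have : b x = 1 := b.one_of_mem_closedBall (Metric.ball_subset_closedBall hx)
    simp [this]

end LocalFlow
section LocalFlow

variable {F : Type} [NormedAddCommGroup F] [NormedSpace ℝ F]

/-- The map `((h, x), α) ↦ ((h, x), α - x - h ∫ v(α))`, whose zeros are the solutions of the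
initial value problem on `[0, h]`, with the time scaled to `[0, 1]`. -/
def integralEquationMap {v : F → F} (hv : Continuous v) (w : (ℝ × F) × C(unitInterval, F)) :
    (ℝ × F) × C(unitInterval, F) :=
  (w.1, w.2 - ContinuousLinearMap.const ℝ unitInterval w.1.2 -
    w.1.1 • primitiveMap F (ContinuousMap.comp ⟨v, hv⟩ w.2))

theorem contDiff_integralEquationMap {v : F → F} (hv : ContDiff ℝ ∞ v) :
    ContDiff ℝ ∞ (integralEquationMap hv.continuous) := by
  refine contDiff_fst.prodMk ((contDiff_snd.sub ?_).sub ?_)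
  · exact (ContinuousLinearMap.const ℝ unitInterval (M := F)).contDiff.comp
      (contDiff_snd.comp contDiff_fst)
  · exact (contDiff_fst.comp contDiff_fst).smul
      ((primitiveMap F).contDiff.comp ((contDiff_postcomp hv).comp contDiff_snd))

/-- The nonlinear term carries the factor h, so at h = 0 its derivative involves only its value at
the constant curve. The differential is a shear over the identity of the parameters and is
invertible whatever v is; no contraction estimate is needed. -/
theorem hasFDerivAt_integralEquationMap {v : F → F} (hv : ContDiff ℝ ∞ v) (a : F) :
    ∃ A : ((ℝ × F) × C(unitInterval, F)) ≃L[ℝ] ((ℝ × F) × C(unitInterval, F)),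
      HasFDerivAt (integralEquationMap hv.continuous)
        (A : ((ℝ × F) × C(unitInterval, F)) →L[ℝ] ((ℝ × F) × C(unitInterval, F)))
        ((0, a), ContinuousLinearMap.const ℝ unitInterval a) := by
  set c : F →L[ℝ] C(unitInterval, F) := ContinuousLinearMap.const ℝ unitInterval with hc
  set β := primitiveMap F (ContinuousMap.comp ⟨v, hv.continuous⟩ (c a)) with hβ
  set L : (ℝ × F) →L[ℝ] C(unitInterval, F) :=
    -(c.comp (ContinuousLinearMap.snd ℝ ℝ F)) - (ContinuousLinearMap.fst ℝ ℝ F).smulRight β with hL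
  refine ⟨ContinuousLinearEquiv.skewProd (ContinuousLinearEquiv.refl ℝ _)
    (ContinuousLinearEquiv.refl ℝ _) L, ?_⟩
  have h1 : HasFDerivAt (fun w : (ℝ × F) × C(unitInterval, F) => w.1)
    (ContinuousLinearMap.fst ℝ (ℝ × F) C(unitInterval, F)) ((0, a), c a) := hasFDerivAt_fst
  have h2 : HasFDerivAt (fun w : (ℝ × F) × C(unitInterval, F) => w.2)
    (ContinuousLinearMap.snd ℝ (ℝ × F) C(unitInterval, F)) ((0, a), c a) := hasFDerivAt_snd
  have h3 : HasFDerivAt (fun w : (ℝ × F) × C(unitInterval, F) => c w.1.2)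
    ((c.comp (ContinuousLinearMap.snd ℝ ℝ F)).comp
      (ContinuousLinearMap.fst ℝ (ℝ × F) C(unitInterval, F))) ((0, a), c a) :=
    ((c.comp (ContinuousLinearMap.snd ℝ ℝ F)).comp
      (ContinuousLinearMap.fst ℝ (ℝ × F) C(unitInterval, F))).hasFDerivAt
  have h4 : HasFDerivAt (fun w : (ℝ × F) × C(unitInterval, F) => w.1.1)
    ((ContinuousLinearMap.fst ℝ ℝ F).comp
      (ContinuousLinearMap.fst ℝ (ℝ × F) C(unitInterval, F))) ((0, a), c a) :=
    ((ContinuousLinearMap.fst ℝ ℝ F).comp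
      (ContinuousLinearMap.fst ℝ (ℝ × F) C(unitInterval, F))).hasFDerivAt
  have h5 : DifferentiableAt ℝ (fun w : (ℝ × F) × C(unitInterval, F) =>
      primitiveMap F (ContinuousMap.comp ⟨v, hv.continuous⟩ w.2)) ((0, a), c a) :=
    (((primitiveMap F).contDiff.comp ((contDiff_postcomp hv).comp contDiff_snd)).differentiable
      (n := ∞) (by simp)).differentiableAt
  have h6 := h1.prodMk ((h2.sub h3).sub (h4.smul h5.hasFDerivAt))
  refine h6.congr_fderiv ?_
  refine ContinuousLinearMap.ext fun w => Prod.ext rfl ?_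
  change w.2 - c w.1.2 - ((0 : ℝ) • _ + w.1.1 • β) = w.2 + (-(c w.1.2) - w.1.1 • β)
  rw [zero_smul]
  abel

theorem integralEquationMap_eq_iff {v : F → F} (hv : Continuous v) (h : ℝ) (x : F)
    (α : C(unitInterval, F)) :
    integralEquationMap hv ((h, x), α) = ((h, x), 0) ↔
      ∀ t : unitInterval, α t = x + h • ∫ s in (0 : ℝ)..t, v (α (projIcc 0 1 zero_le_one s)) := by
  rw [integralEquationMap, Prod.mk.injEq]
  simp only [true_and]
  rw [sub_sub, sub_eq_zero, ContinuousMap.ext_iff]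
  rfl

/-- The initial part of a solution over [0, h], traversed c times slower, solves the problem over
[0, ch]. This relates the solutions for different durations, each of which is found separately by
the inverse function theorem. -/
theorem integralEquationMap_rescale {v : F → F} (hv : Continuous v) {h : ℝ} {x : F}
    {α : C(unitInterval, F)} (hα : integralEquationMap hv ((h, x), α) = ((h, x), 0))
    (c : unitInterval) :
    integralEquationMap hv ((c * h, x), α.comp ⟨fun t => c * t, by fun_prop⟩) =
      ((c * h, x), 0) := by
  rw [integralEquationMap_eq_iff] at hα ⊢
  intro t
  have h1 : ∫ s in (0 : ℝ)..t,
      v (α.comp ⟨fun t => c * t, by fun_prop⟩ (projIcc 0 1 zero_le_one s)) =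
      ∫ s in (0 : ℝ)..t, v (α (projIcc 0 1 zero_le_one ((c : ℝ) * s))) := by
    refine intervalIntegral.integral_congr fun s hs => ?_
    rw [uIcc_of_le t.2.1] at hs
    have hs1 : s ∈ Icc (0 : ℝ) 1 := ⟨hs.1, hs.2.trans t.2.2⟩
    have hs2 : (c : ℝ) * s ∈ Icc (0 : ℝ) 1 := (c * ⟨s, hs1⟩ : unitInterval).2
    rw [projIcc_of_mem _ hs1, projIcc_of_mem _ hs2]
    rfl
  rw [h1, mul_comm (c : ℝ) h, mul_smul, intervalIntegral.smul_integral_comp_mul_left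
    (f := fun s => v (α (projIcc 0 1 zero_le_one s))), mul_zero]
  exact hα (c * t)

/-- The smooth local flow of a smooth vector field. -/
theorem exists_smooth_local_flow [FiniteDimensional ℝ F] {v : F → F} {Ω : Set F} (hΩ : IsOpen Ω)
    (hv : ContDiffOn ℝ ∞ v Ω) {a : F} (ha : a ∈ Ω) :
    ∃ ε > 0, ∃ Φ : ℝ → F → F,
      ContDiffOn ℝ ∞ (fun w : ℝ × F => Φ w.1 w.2) (Ioo (-ε) ε ×ˢ Metric.ball a ε) ∧
      (∀ x ∈ Metric.ball a ε, Φ 0 x = x) ∧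
      ∀ t ∈ Ioo (-ε) ε, ∀ x ∈ Metric.ball a ε, Φ t x ∈ Ω ∧
        HasDerivAt (fun s => Φ s x) (v (Φ t x)) t := by
  obtain ⟨w, hw, r, hr, hrΩ, hwv⟩ := exists_contDiff_eqOn_ball hΩ hv ha
  have hwc := hw.continuous
  obtain ⟨A, hA⟩ := hasFDerivAt_integralEquationMap hw a
  obtain ⟨e, hae, -, heq, -, hsm⟩ := exists_openPartialHomeomorph_of_contDiffOn isOpen_univ
    (contDiff_integralEquationMap hw).contDiffOn (mem_univ _) hA
  set c : F →L[ℝ] C(unitInterval, F) := ContinuousLinearMap.const ℝ unitInterval with hc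
  have hea : e ((0, a), c a) = ((0, a), 0) := by
    rw [heq, integralEquationMap_eq_iff]
    intro t
    simp [hc]
  obtain ⟨ρ₀, hρ₀, hball⟩ := Metric.isOpen_iff.1 e.open_source _ hae
  set ρ := min ρ₀ r with hρ
  have hρpos : 0 < ρ := lt_min hρ₀ hr
  -- `sol (t, x)` is the solution issued from x over the duration t, with time scaled to [0, 1]; the
  -- flow is its value at 1.
  set sol : ℝ × F → C(unitInterval, F) := fun p => (e.symm (p, 0)).2 with hsol
  have htgt : ((0, a), (0 : C(unitInterval, F))) ∈ e.target := hea ▸ e.map_source hae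
  have hincl : Continuous (fun p : ℝ × F => (p, (0 : C(unitInterval, F)))) := by fun_prop
  have hsymm0 : e.symm ((0, a), 0) = ((0, a), c a) := by rw [← hea, e.left_inv hae]
  have hsolc : ContinuousAt sol (0, a) := by
    have h1 : ContinuousAt e.symm ((0, a), 0) := e.symm.continuousAt htgt
    exact continuous_snd.continuousAt.comp
      (ContinuousAt.comp (f := fun p : ℝ × F => (p, (0 : C(unitInterval, F)))) h1
        hincl.continuousAt)
  have hsol0 : sol (0, a) = c a := by simp only [hsol, hsymm0]
  have hev : ∀ᶠ p : ℝ × F in 𝓝 (0, a), (p, (0 : C(unitInterval, F))) ∈ e.target ∧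
      sol p ∈ Metric.ball (c a) ρ := by
    have h1 : ∀ᶠ p : ℝ × F in 𝓝 (0, a), (p, (0 : C(unitInterval, F))) ∈ e.target :=
      hincl.continuousAt.preimage_mem_nhds (e.open_target.mem_nhds htgt)
    have h2 : ∀ᶠ p : ℝ × F in 𝓝 (0, a), sol p ∈ Metric.ball (c a) ρ :=
      hsolc.preimage_mem_nhds (by rw [hsol0]; exact Metric.ball_mem_nhds _ hρpos)
    exact h1.and h2
  obtain ⟨ε₀, hε₀, hεball⟩ := Metric.eventually_nhds_iff_ball.1 hev
  set ε := min ε₀ ρ with hε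
  have hεpos : 0 < ε := lt_min hε₀ hρpos
  have hT : ∀ t ∈ Ioo (-ε) ε, ∀ x ∈ Metric.ball a ε, ((t, x), (0 : C(unitInterval, F))) ∈ e.target ∧
      sol (t, x) ∈ Metric.ball (c a) ρ := by
    intro t ht x hx
    refine hεball _ ?_
    rw [Metric.mem_ball, Prod.dist_eq, max_lt_iff, dist_zero_right, Real.norm_eq_abs]
    exact ⟨(abs_lt.2 ht).trans_le (min_le_left _ _), (Metric.mem_ball.1 hx).trans_le (min_le_left _ _)⟩
  have hsoleq : ∀ t ∈ Ioo (-ε) ε, ∀ x ∈ Metric.ball a ε,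
      e.symm ((t, x), 0) = ((t, x), sol (t, x)) ∧
      integralEquationMap hwc ((t, x), sol (t, x)) = ((t, x), 0) := by
    intro t ht x hx
    have h1 := e.right_inv (hT t ht x hx).1
    have h2 : (e.symm ((t, x), 0)).1 = (t, x) := by
      rw [heq] at h1
      exact congrArg Prod.fst h1
    have h3 : e.symm ((t, x), 0) = ((t, x), sol (t, x)) := Prod.ext h2 rfl
    refine ⟨h3, ?_⟩
    rw [← h3, ← heq, h1]
  -- The slowed-down curve stays close to the constant curve a, hence lies in the source of `e`;
  -- injectivity there identifies it with the solution of duration kt.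
  have hscale : ∀ t ∈ Ioo (-ε) ε, ∀ x ∈ Metric.ball a ε, ∀ k : unitInterval,
      sol (k * t, x) 1 = sol (t, x) k := by
    intro t ht x hx k
    have h1 := integralEquationMap_rescale hwc (hsoleq t ht x hx).2 k
    have hkt : (k : ℝ) * t ∈ Ioo (-ε) ε := by
      refine abs_lt.1 ?_
      rw [abs_mul, abs_of_nonneg k.2.1]
      exact (mul_le_of_le_one_left (abs_nonneg _) k.2.2).trans_lt (abs_lt.2 ht)
    have h2 : (((k : ℝ) * t, x), (sol (t, x)).comp ⟨fun s => k * s, by fun_prop⟩) ∈ e.source := by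
      refine hball ?_
      rw [Metric.mem_ball, Prod.dist_eq, max_lt_iff, Prod.dist_eq, max_lt_iff]
      refine ⟨⟨?_, ?_⟩, ?_⟩
      · rw [dist_zero_right, Real.norm_eq_abs]
        exact (abs_lt.2 hkt).trans_le ((min_le_right _ _).trans (min_le_left _ _))
      · exact (Metric.mem_ball.1 hx).trans_le ((min_le_right _ _).trans (min_le_left _ _))
      · refine lt_of_lt_of_le ?_ (min_le_left ρ₀ r)
        refine (ContinuousMap.dist_lt_iff hρpos).2 fun s => ?_
        exact (ContinuousMap.dist_apply_le_dist (f := sol (t, x)) (g := c a) (k * s)).trans_lt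
          (Metric.mem_ball.1 (hT t ht x hx).2)
    have h3 : e.symm ((k * t, x), 0) = ((k * t, x), (sol (t, x)).comp ⟨fun s => k * s, by fun_prop⟩) := by
      rw [← h1, ← heq, e.left_inv h2]
    change (e.symm ((k * t, x), 0)).2 1 = _
    rw [h3]
    change sol (t, x) (k * 1) = _
    rw [mul_one]
  have hsm' : ContDiffOn ℝ ∞ (fun p : ℝ × F => sol p 1) (Ioo (-ε) ε ×ˢ Metric.ball a ε) := by
    have h1 : ContDiffOn ℝ ∞ sol (Ioo (-ε) ε ×ˢ Metric.ball a ε) := by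
      refine contDiff_snd.comp_contDiffOn (hsm.comp (g := e.symm)
        (f := fun p : ℝ × F => (p, (0 : C(unitInterval, F)))) ?_ ?_)
      · exact (contDiff_id.prodMk contDiff_const).contDiffOn
      · rintro ⟨t, x⟩ ⟨ht, hx⟩
        exact (hT t ht x hx).1
    exact (ContinuousMap.evalCLM ℝ (1 : unitInterval)).contDiff.comp_contDiffOn h1
  have hinball : ∀ t ∈ Ioo (-ε) ε, ∀ x ∈ Metric.ball a ε, sol (t, x) 1 ∈ Metric.ball a r := by
    intro t ht x hx
    exact ((ContinuousMap.dist_apply_le_dist (f := sol (t, x)) (g := c a) 1).trans_lt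
      (Metric.mem_ball.1 (hT t ht x hx).2)).trans_le (min_le_right _ _)
  have hderiv : ∀ t ∈ Ioo (-ε) ε, t ≠ 0 → ∀ x ∈ Metric.ball a ε,
      HasDerivAt (fun s => sol (s, x) 1) (w (sol (t, x) 1)) t := by
    intro t ht ht0 x hx
    -- A slightly longer duration T = kt makes t/T an interior point of [0, 1]. Near t all the
    -- values are then read off one fixed curve, and the fundamental theorem of calculus applies.
    obtain ⟨k, hk1, hk⟩ : ∃ k > (1 : ℝ), k * t ∈ Ioo (-ε) ε := by
      have h1 : ∀ᶠ k : ℝ in 𝓝 1, k * t ∈ Ioo (-ε) ε := by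
        refine ContinuousAt.preimage_mem_nhds (f := fun k : ℝ => k * t) (by fun_prop) ?_
        rw [one_mul]
        exact isOpen_Ioo.mem_nhds ht
      have h2 : ∀ᶠ k : ℝ in 𝓝[>] 1, k * t ∈ Ioo (-ε) ε ∧ 1 < k :=
        (h1.filter_mono nhdsWithin_le_nhds).and self_mem_nhdsWithin
      obtain ⟨k, h3, h4⟩ := h2.exists
      exact ⟨k, h4, h3⟩
    set T := k * t with hTdef
    have hT0 : T ≠ 0 := mul_ne_zero (by linarith) ht0
    set α := sol (T, x) with hα
    have hform : ∀ s : unitInterval, sol ((s : ℝ) * T, x) 1 =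
        x + T • ∫ u in (0 : ℝ)..s, w (α (projIcc 0 1 zero_le_one u)) := by
      intro s
      rw [hscale T hk x hx s]
      exact (integralEquationMap_eq_iff hwc _ _ _).1 (hsoleq T hk x hx).2 s
    have hkt : t / T = k⁻¹ := by rw [hTdef]; field_simp
    have hkmem : t / T ∈ Ioo (0 : ℝ) 1 := by
      rw [hkt]
      exact ⟨by positivity, inv_lt_one_of_one_lt₀ hk1⟩
    have hg : Continuous (fun u : ℝ => w (α (projIcc 0 1 zero_le_one u))) :=
      hwc.comp (α.continuous.comp continuous_projIcc)
    have h1 : HasDerivAt (fun s : ℝ => x + T • ∫ u in (0 : ℝ)..(s / T),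
        w (α (projIcc 0 1 zero_le_one u)))
        (w (α (projIcc 0 1 zero_le_one (t / T)))) t := by
      have h2 := intervalIntegral.integral_hasDerivAt_right (a := 0) (b := t / T)
        (hg.intervalIntegrable _ _) hg.stronglyMeasurable.stronglyMeasurableAtFilter hg.continuousAt
      have h3 : HasDerivAt (fun s : ℝ => s / T) (1 / T) t := (hasDerivAt_id t).div_const T
      have h4 := ((h2.scomp t h3).const_smul T).const_add x
      refine h4.congr_deriv ?_
      rw [smul_smul, mul_one_div_cancel hT0, one_smul]
    have h5 : α (projIcc 0 1 zero_le_one (t / T)) = sol (t, x) 1 := by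
      rw [projIcc_of_mem _ (Ioo_subset_Icc_self hkmem), ← hscale T hk x hx]
      simp only
      rw [div_mul_cancel₀ _ hT0]
    rw [h5] at h1
    refine h1.congr_of_eventuallyEq ?_
    have h6 : ∀ᶠ s in 𝓝 t, s / T ∈ Ioo (0 : ℝ) 1 :=
      ContinuousAt.preimage_mem_nhds (f := fun s : ℝ => s / T) (by fun_prop)
        (isOpen_Ioo.mem_nhds hkmem)
    filter_upwards [h6] with s hs
    have h7 := hform ⟨s / T, Ioo_subset_Icc_self hs⟩
    simp only at h7
    rwa [div_mul_cancel₀ _ hT0] at h7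
  refine ⟨ε, hεpos, fun t x => sol (t, x) 1, hsm', ?_, ?_⟩
  · intro x hx
    have h0 : (0 : ℝ) ∈ Ioo (-ε) ε := ⟨by linarith, hεpos⟩
    have := (integralEquationMap_eq_iff hwc _ _ _).1 (hsoleq 0 h0 x hx).2 1
    simpa using this
  · intro t ht x hx
    refine ⟨hrΩ (hinball t ht x hx), ?_⟩
    rw [← hwv (hinball t ht x hx)]
    have hline : ContDiffOn ℝ ∞ (fun s => sol (s, x) 1) (Ioo (-ε) ε) :=
      hsm'.comp (f := fun s : ℝ => (s, x)) (contDiff_id.prodMk contDiff_const).contDiffOn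
        (fun s hs => ⟨hs, hx⟩)
    -- The rescaling degenerates at t = 0. The flow line is already known to be smooth, so its
    -- derivative there is the limit of its derivatives at t ≠ 0.
    by_cases ht0 : t = 0
    · subst ht0
      have hd : DifferentiableAt ℝ (fun s => sol (s, x) 1) 0 :=
        (hline.contDiffAt (isOpen_Ioo.mem_nhds ht)).differentiableAt (by simp)
      have hdc : ContinuousAt (deriv (fun s => sol (s, x) 1)) 0 :=
        (hline.continuousOn_deriv_of_isOpen isOpen_Ioo (by simp)).continuousAt
          (isOpen_Ioo.mem_nhds ht)
      have hwcont : ContinuousAt (fun s => w (sol (s, x) 1)) 0 :=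
        hwc.continuousAt.comp hd.continuousAt
      have heq' : (deriv (fun s => sol (s, x) 1)) =ᶠ[𝓝[≠] 0] fun s => w (sol (s, x) 1) := by
        filter_upwards [self_mem_nhdsWithin, nhdsWithin_le_nhds (isOpen_Ioo.mem_nhds ht)] with s h1 h2
        exact (hderiv s h2 h1 x hx).deriv
      have hlim := tendsto_nhds_unique
        ((hdc.tendsto.mono_left nhdsWithin_le_nhds).congr' heq')
        (hwcont.tendsto.mono_left (nhdsWithin_le_nhds (s := {0}ᶜ)))
      rw [← hlim]
      exact hd.hasDerivAt
    · exact hderiv t ht ht0 x hx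

end LocalFlow

/-! ### Canonical coordinates on the cotangent bundle. -/

section CotangentCharts

variable {n : ℕ} {X : Type*} [TopologicalSpace X]
  {I : ModelWithCorners ℝ (EuclideanSpace ℝ (Fin n)) X}
  {M : Type*} [TopologicalSpace M] [ChartedSpace X M] [IsManifold I ∞ M]

/-- The covector part of a point of `T*M`, in the preferred coordinates at its base point. -/
def covec (z : Cot I M) : Covec n := z.2

/-- The chart of `T*M` with the canonical coordinates induced by the preferred chart at `x`. -/
abbrev cotChart (I : ModelWithCorners ℝ (EuclideanSpace ℝ (Fin n)) X) {M : Type*}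
    [TopologicalSpace M] [ChartedSpace X M] [IsManifold I ∞ M] (x : M) :
    PartialEquiv (Cot I M) (EuclideanSpace ℝ (Fin n) × Covec n) :=
  extChartAt (cotModel I) (⟨x, 0⟩ : Cot I M)

theorem chartAt_cot_source (x : M) :
    (chartAt (ModelProd X (Covec n)) (⟨x, 0⟩ : Cot I M)).source =
      {z | z.1 ∈ (chartAt X x).source} := by
  rw [FiberBundle.chartedSpace_chartAt]
  ext z
  simp only [OpenPartialHomeomorph.trans_source, mem_inter_iff, mem_preimage,
    OpenPartialHomeomorph.prod_source, OpenPartialHomeomorph.refl_source, mem_prod, mem_univ,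
    and_true, mem_ofPred_eq, Trivialization.coe_coe, Trivialization.mem_source,
    hom_trivializationAt_baseSet]
  have h1 : (trivializationAt (Covec n)
    (fun x => TangentSpace I x →L[ℝ] Trivial M ℝ x) x z).1 = z.1 := rfl
  rw [h1]
  exact ⟨fun h => h.2, fun h => ⟨⟨h, mem_univ _⟩, h⟩⟩

theorem mem_cotChart_source {x : M} {z : Cot I M} :
    z ∈ (cotChart I x).source ↔ z.1 ∈ (chartAt X x).source := by
  rw [extChartAt_source, chartAt_cot_source]
  rfl

/-- The chart of the bundle of homomorphisms precomposes a covector with the inverse of the tangent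
trivialization, which is the change of tangent coordinates from x to the base point; on the trivial
line bundle nothing changes. -/
theorem cotChart_apply {x : M} {z : Cot I M} (hz : z.1 ∈ (chartAt X x).source) :
    cotChart I x z =
      (extChartAt I x z.1, (covec z).comp (tangentCoordChange I x z.1 z.1)) := by
  have := hom_chart (𝕜 := ℝ) (HB := X) (⟨x, 0⟩ : Cot I M) z
  change cotModel I (chartAt (ModelProd X (Covec n)) (⟨x, 0⟩ : Cot I M) z) = _
  rw [this]
  refine Prod.ext rfl ?_
  change ContinuousLinearMap.inCoordinates (EuclideanSpace ℝ (Fin n)) (TangentSpace I (M := M)) ℝ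
    (Trivial M ℝ) x z.1 x z.1 z.2 = _
  rw [ContinuousLinearMap.inCoordinates_eq (by exact hz) (by exact mem_univ _)]
  ext v
  simp only [ContinuousLinearMap.comp_apply]
  have h2 := DFunLike.congr_fun (TangentBundle.symmL_trivializationAt_eq_core (I := I) hz) v
  have h3 := DFunLike.congr_fun (Trivialization.symm_continuousLinearEquivAt_eq' (R := ℝ)
    (trivializationAt (EuclideanSpace ℝ (Fin n)) (TangentSpace I) x) (b := z.1) hz) v
  exact congrArg (covec z) (h3.trans h2)

theorem cotChart_fst (x : M) (z : Cot I M) : (cotChart I x z).1 = extChartAt I x z.1 := by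
  have := hom_chart (𝕜 := ℝ) (HB := X) (⟨x, 0⟩ : Cot I M) z
  change (cotModel I (chartAt (ModelProd X (Covec n)) (⟨x, 0⟩ : Cot I M) z)).1 = _
  rw [this]
  rfl

theorem cotChart_self (z : Cot I M) : cotChart I z.1 z = (extChartAt I z.1 z.1, covec z) := by
  rw [cotChart_apply (mem_chart_source X z.1)]
  congr 1
  ext v
  exact congrArg (covec z) (tangentCoordChange_self (mem_extChartAt_source z.1))

theorem cotChart_snd_apply {x : M} {z : Cot I M} (hz : z.1 ∈ (chartAt X x).source)
    (v : EuclideanSpace ℝ (Fin n)) :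
    (cotChart I x z).2 v = covec z (tangentCoordChange I x z.1 z.1 v) := by
  rw [cotChart_apply hz]
  rfl

/-- The pairing of covectors with vectors does not depend on the chart, as the two coordinate
changes are inverse to each other. -/
theorem cotChart_snd_tangentCoordChange {x : M} {z : Cot I M} (hz : z.1 ∈ (chartAt X x).source)
    (v : EuclideanSpace ℝ (Fin n)) :
    (cotChart I x z).2 (tangentCoordChange I z.1 x z.1 v) = covec z v := by
  rw [cotChart_snd_apply hz, tangentCoordChange_comp, tangentCoordChange_self]
  · exact mem_extChartAt_source _
  · exact ⟨⟨mem_extChartAt_source _, by rwa [extChartAt_source]⟩, mem_extChartAt_source _⟩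

theorem tangentCoordChange_comp_self {x : M} {y : M} (hy : y ∈ (chartAt X x).source)
    (v : EuclideanSpace ℝ (Fin n)) :
    tangentCoordChange I y x y (tangentCoordChange I x y y v) = v := by
  rw [tangentCoordChange_comp, tangentCoordChange_self]
  · rwa [extChartAt_source]
  · exact ⟨⟨by rwa [extChartAt_source], mem_extChartAt_source _⟩, by rwa [extChartAt_source]⟩

theorem cotChart_target (x : M) :
    (cotChart I x).target = (extChartAt I x).target ×ˢ (univ : Set (Covec n)) := by
  rw [FiberBundle.extChartAt_target]
  congr 1
  refine inter_eq_left.2 fun y hy => ?_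
  rw [mem_preimage, hom_trivializationAt_baseSet]
  refine ⟨?_, mem_univ _⟩
  change (extChartAt I x).symm y ∈ (chartAt X x).source
  rw [← extChartAt_source I]
  exact (extChartAt I x).map_target hy

theorem mem_cotChart_target {x : M} {w : EuclideanSpace ℝ (Fin n) × Covec n} :
    w ∈ (cotChart I x).target ↔ w.1 ∈ (extChartAt I x).target := by
  rw [cotChart_target]
  simp

theorem cotChart_symm_fst_mem {x : M} {w : EuclideanSpace ℝ (Fin n) × Covec n}
    (hw : w.1 ∈ (extChartAt I x).target) :
    ((cotChart I x).symm w).1 ∈ (chartAt X x).source :=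
  mem_cotChart_source.1 ((cotChart I x).map_target (mem_cotChart_target.2 hw))

theorem cotChart_symm_fst {x : M} {w : EuclideanSpace ℝ (Fin n) × Covec n}
    (hw : w.1 ∈ (extChartAt I x).target) :
    ((cotChart I x).symm w).1 = (extChartAt I x).symm w.1 := by
  have h1 := cotChart_symm_fst_mem hw
  have h2 := (cotChart I x).right_inv (mem_cotChart_target.2 hw)
  rw [← extChartAt_source I] at h1
  rw [← (extChartAt I x).left_inv h1, ← cotChart_fst x, h2]

theorem covec_eq_zero_iff {x : M} {z : Cot I M} (hz : z.1 ∈ (chartAt X x).source) :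
    covec z = 0 ↔ (cotChart I x z).2 = 0 := by
  constructor
  · intro h
    ext v
    rw [cotChart_snd_apply hz, h]
    rfl
  · intro h
    ext v
    rw [← cotChart_snd_tangentCoordChange hz v, h]
    rfl

theorem mem_nonzeroCot {z : Cot I M} : z ∈ nonzeroCot I M ↔ covec z ≠ 0 := Iff.rfl

theorem isOpen_nonzeroCot : IsOpen (nonzeroCot I M) := by
  rw [isOpen_iff_mem_nhds]
  intro z hz
  have h1 : ContinuousAt (cotChart I z.1) z := continuousAt_extChartAt z
  have h2 : ∀ᶠ z' in 𝓝 z, (cotChart I z.1 z').2 ≠ 0 :=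
    (continuous_snd.continuousAt.comp h1).eventually_ne
      ((covec_eq_zero_iff (mem_chart_source X z.1)).not.1 hz)
  filter_upwards [h2, extChartAt_source_mem_nhds (I := cotModel I) z] with z' h3 h4
  exact (covec_eq_zero_iff (mem_cotChart_source.1 h4)).not.2 h3

theorem continuous_cot_proj : Continuous (fun z : Cot I M => z.1) :=
  FiberBundle.continuous_proj (Covec n) _

/-- Covectors over one point are separated in a chart, the others by their base points. The
uniqueness of bicharacteristics uses this to see that the set of times where two curves agree is
closed. -/
instance cotT2Space [T2Space M] : T2Space (Cot I M) := by
  refine ⟨fun z z' hne => ?_⟩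
  by_cases h : z.1 = z'.1
  · have hz : z ∈ (cotChart I z.1).source := mem_extChartAt_source z
    have hz' : z' ∈ (cotChart I z.1).source :=
      mem_cotChart_source.2 (h ▸ mem_chart_source X z.1)
    have hne' : cotChart I z.1 z ≠ cotChart I z.1 z' := fun e =>
      hne ((cotChart I z.1).injOn hz hz' e)
    obtain ⟨u, v, hu, hv, hzu, hzv, huv⟩ := t2_separation hne'
    have ho : IsOpen (cotChart I z.1).source := isOpen_extChartAt_source _
    have hc : ContinuousOn (cotChart I z.1) (cotChart I z.1).source := continuousOn_extChartAt _
    exact ⟨_, _, hc.isOpen_inter_preimage ho hu, hc.isOpen_inter_preimage ho hv, ⟨hz, hzu⟩,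
      ⟨hz', hzv⟩, (huv.preimage _).mono inter_subset_right inter_subset_right⟩
  · obtain ⟨u, v, hu, hv, hzu, hzv, huv⟩ := t2_separation h
    exact ⟨_, _, hu.preimage continuous_cot_proj, hv.preimage continuous_cot_proj, hzu, hzv,
      huv.preimage _⟩

theorem covec_dilate (c : ℝ) (z : Cot I M) : covec (dilate c z) = c • covec z := rfl

theorem cotChart_dilate {x : M} (c : ℝ) {z : Cot I M} (hz : z.1 ∈ (chartAt X x).source) :
    cotChart I x (dilate c z) = ((cotChart I x z).1, c • (cotChart I x z).2) := by
  rw [cotChart_apply hz, cotChart_apply (z := dilate c z) hz]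
  rfl

theorem dilate_dilate (c c' : ℝ) (z : Cot I M) : dilate c (dilate c' z) = dilate (c * c') z := by
  change (⟨z.1, _⟩ : Cot I M) = ⟨z.1, _⟩
  congr 1
  exact (mul_smul c c' (covec z)).symm

theorem dilate_one (z : Cot I M) : dilate 1 z = z := by
  change (⟨z.1, _⟩ : Cot I M) = ⟨z.1, z.2⟩
  congr 1
  exact one_smul ℝ (covec z)

theorem dilate_mem_nonzeroCot {c : ℝ} (hc : c ≠ 0) {z : Cot I M} (hz : z ∈ nonzeroCot I M) :
    dilate c z ∈ nonzeroCot I M := by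
  rw [mem_nonzeroCot, covec_dilate]
  exact smul_ne_zero hc hz

end CotangentCharts

/-! ### The symplectic gradient and cotangent lifts. -/

section SymplecticGradient

variable {n : ℕ}

/-- The symplectic gradient `(L_ξ, -L_x)` of a covector `L` on phase space. -/
def sgrad (L : EuclideanSpace ℝ (Fin n) × Covec n →L[ℝ] ℝ) :
    EuclideanSpace ℝ (Fin n) × Covec n :=
  (WithLp.toLp 2 (fun i => L (0, EuclideanSpace.proj i)),
    -(L.comp (ContinuousLinearMap.inl ℝ (EuclideanSpace ℝ (Fin n)) (Covec n))))

theorem sgrad_fst_apply (L : EuclideanSpace ℝ (Fin n) × Covec n →L[ℝ] ℝ) (β : Covec n) :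
    β (sgrad L).1 = L (0, β) := by
  have hβ : β = ∑ i, β (EuclideanSpace.single i 1) • (EuclideanSpace.proj i : Covec n) := by
    ext v
    have hv : v = ∑ i, v i • EuclideanSpace.single i (1 : ℝ) := by
      ext j
      simp [Finset.sum_apply, Pi.single_apply]
    conv_lhs => rw [hv]
    rw [map_sum, _root_.sum_apply]
    refine Finset.sum_congr rfl fun i _ => ?_
    rw [map_smul, _root_.smul_apply, smul_eq_mul, smul_eq_mul, mul_comm]
    rfl
  have h2 : ((0 : EuclideanSpace ℝ (Fin n)), β) =
      ∑ i, β (EuclideanSpace.single i 1) •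
        ((0 : EuclideanSpace ℝ (Fin n)), (EuclideanSpace.proj i : Covec n)) := by
    refine Prod.ext ?_ ?_
    · simp [Prod.fst_sum]
    · rw [Prod.snd_sum]
      exact hβ
  rw [h2, map_sum]
  conv_lhs => rw [hβ]
  rw [_root_.sum_apply]
  refine Finset.sum_congr rfl fun i _ => ?_
  rw [map_smul, _root_.smul_apply]
  rfl

/-- In canonical coordinates the symplectic form sends (Y, v) to v.2 Y.1 - Y.2 v.1, and `sgrad L`
represents L by this form. By nondegeneracy (`eq_sgrad`) the relation determines it, so linear maps
that preserve the form carry symplectic gradients to symplectic gradients. -/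
theorem apply_eq_sgrad (L : EuclideanSpace ℝ (Fin n) × Covec n →L[ℝ] ℝ)
    (v : EuclideanSpace ℝ (Fin n) × Covec n) : L v = v.2 (sgrad L).1 - (sgrad L).2 v.1 := by
  rw [sgrad_fst_apply]
  have h2 : (sgrad L).2 v.1 = -L (v.1, 0) := rfl
  rw [h2, sub_neg_eq_add, ← map_add]
  congr 1
  ext1 <;> simp

theorem eq_sgrad {L : EuclideanSpace ℝ (Fin n) × Covec n →L[ℝ] ℝ}
    {Y : EuclideanSpace ℝ (Fin n) × Covec n} (h : ∀ v, L v = v.2 Y.1 - Y.2 v.1) :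
    Y = sgrad L := by
  refine Prod.ext ?_ ?_
  · ext i
    have h1 := h (0, EuclideanSpace.proj i)
    simp only [map_zero, sub_zero] at h1
    exact h1.symm
  · ext v
    have h1 := h (v, 0)
    have h2 : (sgrad L).2 v = -L (v, 0) := rfl
    rw [h2, h1]
    simp

theorem ContDiffOn.sgrad {G : Type*} [NormedAddCommGroup G] [NormedSpace ℝ G] {k : ℕ∞ω}
    {L : G → EuclideanSpace ℝ (Fin n) × Covec n →L[ℝ] ℝ} {s : Set G} (h : ContDiffOn ℝ k L s) :
    ContDiffOn ℝ k (fun w => sgrad (L w)) s :=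
  (contDiffOn_euclidean.2 fun _ => h.clm_apply contDiffOn_const).prodMk
    (h.clm_comp contDiffOn_const).neg

end SymplecticGradient

/-- The cotangent lift of a diffeomorphism preserves the symplectic form. -/
theorem cotangentLift_symplectic {E : Type*} [NormedAddCommGroup E] [NormedSpace ℝ E]
    {K : Set E} (hK : UniqueDiffOn ℝ K) (hKc : K ⊆ closure (interior K)) {ψ : E → E}
    {κ : E × (E →L[ℝ] ℝ) → E × (E →L[ℝ] ℝ)} {w : E × (E →L[ℝ] ℝ)} (hw : w.1 ∈ K)
    (hψ : ContDiffWithinAt ℝ 2 ψ K w.1) {κ' : E × (E →L[ℝ] ℝ) →L[ℝ] E × (E →L[ℝ] ℝ)}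
    (hκ : HasFDerivWithinAt κ κ' (K ×ˢ univ) w)
    (h1 : ∀ᶠ u in 𝓝[K ×ˢ univ] w, (κ u).1 = ψ u.1)
    (h2 : ∀ᶠ u in 𝓝[K ×ˢ univ] w, (κ u).2.comp (fderivWithin ℝ ψ K u.1) = u.2)
    (v v' : E × (E →L[ℝ] ℝ)) :
    (κ' v').2 (κ' v).1 - (κ' v).2 (κ' v').1 = v'.2 v.1 - v.2 v'.1 := by
  have hwK : w ∈ K ×ˢ (univ : Set (E →L[ℝ] ℝ)) := ⟨hw, mem_univ _⟩
  have huniq : UniqueDiffWithinAt ℝ (K ×ˢ (univ : Set (E →L[ℝ] ℝ))) w :=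
    (hK.prod uniqueDiffOn_univ) w hwK
  have hfst : HasFDerivWithinAt (fun u : E × (E →L[ℝ] ℝ) => u.1)
    (ContinuousLinearMap.fst ℝ E (E →L[ℝ] ℝ)) (K ×ˢ univ) w := hasFDerivWithinAt_fst
  have hmaps : MapsTo (fun u : E × (E →L[ℝ] ℝ) => u.1) (K ×ˢ univ) K := fun u hu => hu.1
  have hψ1 : HasFDerivWithinAt ψ (fderivWithin ℝ ψ K w.1) K w.1 :=
    (hψ.differentiableWithinAt (by simp)).hasFDerivWithinAt
  have e1 : ∀ u, (κ' u).1 = fderivWithin ℝ ψ K w.1 u.1 := by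
    have h3 := (hψ1.comp w hfst hmaps).congr_of_eventuallyEq h1 (h1.self_of_nhdsWithin hwK)
    have h4 := huniq.eq hκ.fst h3
    exact fun u => DFunLike.congr_fun h4 u
  have hψ2 : HasFDerivWithinAt (fderivWithin ℝ ψ K)
      (fderivWithin ℝ (fderivWithin ℝ ψ K) K w.1) K w.1 :=
    ((hψ.fderivWithin_right (m := 1) hK (by norm_num) hw).differentiableWithinAt
      (by simp)).hasFDerivWithinAt
  -- The second derivative of ψ is symmetric even at boundary points, because K lies in the closure
  -- of its interior. It is the only term beyond first order and cancels in the antisymmetric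
  -- expression.
  have hsymm : IsSymmSndFDerivWithinAt ℝ ψ K w.1 :=
    hψ.isSymmSndFDerivWithinAt (by simp) hK (hKc hw) hw
  -- This is the derivative, in the direction u, of the identity saying that covectors are pulled
  -- back by the derivative of ψ.
  have e2 : ∀ u b, (κ w).2 (fderivWithin ℝ (fderivWithin ℝ ψ K) K w.1 u.1 b) +
      (κ' u).2 (fderivWithin ℝ ψ K w.1 b) = u.2 b := by
    intro u b
    have h3 := hκ.snd.clm_comp (hψ2.comp w hfst hmaps)
    have h4 : HasFDerivWithinAt (fun u : E × (E →L[ℝ] ℝ) => u.2)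
      (ContinuousLinearMap.snd ℝ E (E →L[ℝ] ℝ)) (K ×ˢ univ) w := hasFDerivWithinAt_snd
    have h5 := huniq.eq (h4.congr_of_eventuallyEq h2 (h2.self_of_nhdsWithin hwK)) h3
    have h6 := DFunLike.congr_fun (DFunLike.congr_fun h5 u) b
    rw [ContinuousLinearMap.coe_snd'] at h6
    rw [h6]
    simp
  have e3 := e2 v' v.1
  have e4 := e2 v v'.1
  have e5 := hsymm v.1 v'.1
  rw [e1, e1]
  rw [e5] at e4
  linarith

/-! ### The Hamiltonian vector field in an arbitrary chart. -/

section HamiltonInCharts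

variable {n : ℕ} {X : Type*} [TopologicalSpace X]
  {I : ModelWithCorners ℝ (EuclideanSpace ℝ (Fin n)) X}
  {M : Type*} [TopologicalSpace M] [ChartedSpace X M] [IsManifold I ∞ M]

theorem range_cotModel : range (cotModel I) = range I ×ˢ (univ : Set (Covec n)) := by
  rw [modelWithCorners_prod_coe, range_prodMap]
  simp

theorem hamField_eq_sgrad (H : Cot I M → ℝ) (z : Cot I M) : hamField H z = sgrad (diffCot H z) :=
  rfl

/-- The local expression of a function on `T*M`. -/
def localRep (I : ModelWithCorners ℝ (EuclideanSpace ℝ (Fin n)) X) {M : Type*}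
    [TopologicalSpace M] [ChartedSpace X M] [IsManifold I ∞ M] (x : M) (H : Cot I M → ℝ)
    (w : EuclideanSpace ℝ (Fin n) × Covec n) : ℝ :=
  H ((cotChart I x).symm w)

/-- The local expression of the Hamiltonian vector field. -/
def hamLoc (x : M) (H : Cot I M → ℝ) (w : EuclideanSpace ℝ (Fin n) × Covec n) :
    EuclideanSpace ℝ (Fin n) × Covec n :=
  sgrad (fderivWithin ℝ (localRep I x H) (range (cotModel I)) w)

/-- The change of the tangent coordinates of `T*M` from those at `z` to those of the chart at `x`. -/
def cotTangentChange (x : M) (z : Cot I M) :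
    EuclideanSpace ℝ (Fin n) × Covec n →L[ℝ] EuclideanSpace ℝ (Fin n) × Covec n :=
  tangentCoordChange (cotModel I) z (⟨x, 0⟩ : Cot I M) z

theorem hasFDerivWithinAt_cotTangentChange {x : M} {z : Cot I M}
    (hz : z.1 ∈ (chartAt X x).source) :
    HasFDerivWithinAt (cotChart I x ∘ (cotChart I z.1).symm) (cotTangentChange x z)
      (range I ×ˢ univ) (cotChart I z.1 z) := by
  rw [← range_cotModel]
  exact hasFDerivWithinAt_tangentCoordChange (I := cotModel I)
    ⟨mem_extChartAt_source z, mem_cotChart_source.2 hz⟩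

theorem eventually_mem_of_cotChart {x : M} {z : Cot I M} (hz : z.1 ∈ (chartAt X x).source) :
    ∀ᶠ u in 𝓝[range I ×ˢ univ] (cotChart I z.1 z), u.1 ∈ (extChartAt I z.1).target ∧
      ((cotChart I z.1).symm u).1 ∈ (chartAt X x).source := by
  rw [← range_cotModel]
  have h1 : ∀ᶠ u in 𝓝[range (cotModel I)] (cotChart I z.1 z), u ∈ (cotChart I z.1).target :=
    extChartAt_target_mem_nhdsWithin z
  have h2 : ∀ᶠ u in 𝓝[range (cotModel I)] (cotChart I z.1 z),
      (cotChart I z.1).symm u ∈ (cotChart I x).source := by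
    have h3 : ContinuousWithinAt (cotChart I z.1).symm (range (cotModel I)) (cotChart I z.1 z) :=
      (continuousAt_extChartAt_symm z).continuousWithinAt
    refine h3.preimage_mem_nhdsWithin ?_
    have h4 : (cotChart I z.1).symm (cotChart I z.1 z) = z := extChartAt_to_inv z
    rw [h4]
    exact (isOpen_extChartAt_source _).mem_nhds (mem_cotChart_source.2 hz)
  filter_upwards [h1, h2] with u h3 h4
  exact ⟨mem_cotChart_target.1 h3, mem_cotChart_source.1 h4⟩

/-- The coordinate changes of T*M are the cotangent lifts of those of M: the base point moves by ψ
and covectors are pulled back by its derivative. -/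
theorem cotTangentChange_symplectic {x : M} {z : Cot I M} (hz : z.1 ∈ (chartAt X x).source)
    (v v' : EuclideanSpace ℝ (Fin n) × Covec n) :
    (cotTangentChange x z v').2 (cotTangentChange x z v).1 -
      (cotTangentChange x z v).2 (cotTangentChange x z v').1 = v'.2 v.1 - v.2 v'.1 := by
  have hev := eventually_mem_of_cotChart (I := I) hz
  have hfst : (cotChart I z.1 z).1 = extChartAt I z.1 z.1 := cotChart_fst z.1 z
  refine cotangentLift_symplectic (ψ := extChartAt I x ∘ (extChartAt I z.1).symm)
    I.uniqueDiffOn I.range_subset_closure_interior (by rw [hfst]; exact mem_range_self _) ?_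
    (hasFDerivWithinAt_cotTangentChange hz) ?_ ?_ v v'
  · rw [hfst]
    have h1 := contDiffWithinAt_ext_coord_change (I := I) (n := ∞) x z.1
      (y := extChartAt I z.1 z.1) ?_
    · exact h1.of_le ENat.LEInfty.out
    · rw [PartialEquiv.trans_source, PartialEquiv.symm_source]
      refine ⟨mem_extChartAt_target z.1, ?_⟩
      rw [mem_preimage, extChartAt_to_inv, extChartAt_source]
      exact hz
  · filter_upwards [hev] with u hu
    rw [Function.comp_apply, cotChart_fst, cotChart_symm_fst hu.1]
    rfl
  · filter_upwards [hev] with u hu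
    ext b
    set ζ := (cotChart I z.1).symm u with hζ
    have hy : (extChartAt I z.1).symm u.1 = ζ.1 := (cotChart_symm_fst hu.1).symm
    have hζz : ζ.1 ∈ (chartAt X z.1).source := cotChart_symm_fst_mem hu.1
    have hφ : extChartAt I z.1 ζ.1 = u.1 := by rw [← hy, (extChartAt I z.1).right_inv hu.1]
    have h1 : fderivWithin ℝ (extChartAt I x ∘ (extChartAt I z.1).symm) (range I) u.1 =
        tangentCoordChange I z.1 x ζ.1 := by
      rw [tangentCoordChange_def, hφ]
    rw [ContinuousLinearMap.comp_apply, h1, Function.comp_apply]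
    change (cotChart I x ζ).2 _ = _
    rw [cotChart_snd_apply hu.2, tangentCoordChange_comp, ← cotChart_snd_apply hζz,
      (cotChart I z.1).right_inv (mem_cotChart_target.2 hu.1)]
    refine ⟨⟨?_, ?_⟩, mem_extChartAt_source _⟩ <;> rw [extChartAt_source]
    · exact hζz
    · exact hu.2

theorem cotTangentChange_right_inv {x : M} {z : Cot I M} (hz : z.1 ∈ (chartAt X x).source)
    (v : EuclideanSpace ℝ (Fin n) × Covec n) :
    cotTangentChange x z (tangentCoordChange (cotModel I) (⟨x, 0⟩ : Cot I M) z z v) = v := by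
  rw [cotTangentChange, tangentCoordChange_comp, tangentCoordChange_self]
  · exact mem_cotChart_source.2 hz
  · exact ⟨⟨mem_cotChart_source.2 hz, mem_extChartAt_source _⟩, mem_cotChart_source.2 hz⟩

theorem cotTangentChange_left_inv {x : M} {z : Cot I M} (hz : z.1 ∈ (chartAt X x).source)
    (v : EuclideanSpace ℝ (Fin n) × Covec n) :
    tangentCoordChange (cotModel I) (⟨x, 0⟩ : Cot I M) z z (cotTangentChange x z v) = v := by
  rw [cotTangentChange, tangentCoordChange_comp, tangentCoordChange_self]
  · exact mem_extChartAt_source _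
  · exact ⟨⟨mem_extChartAt_source _, mem_cotChart_source.2 hz⟩, mem_extChartAt_source _⟩

theorem hasFDerivWithinAt_localRep {x : M} {H : Cot I M → ℝ} {z : Cot I M}
    (hz : z.1 ∈ (chartAt X x).source) (hH : MDifferentiableAt (cotModel I) 𝓘(ℝ, ℝ) H z) :
    HasFDerivWithinAt (localRep I x H)
      (fderivWithin ℝ (localRep I x H) (range (cotModel I)) (cotChart I x z))
      (range (cotModel I)) (cotChart I x z) := by
  have h0 := mem_cotChart_source.2 hz
  have h1 : (cotChart I x).symm (cotChart I x z) = z := (cotChart I x).left_inv h0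
  have h2 : MDifferentiableWithinAt 𝓘(ℝ, EuclideanSpace ℝ (Fin n) × Covec n) (cotModel I)
      (cotChart I x).symm (range (cotModel I)) (cotChart I x z) :=
    mdifferentiableWithinAt_extChartAt_symm ((cotChart I x).map_source h0)
  have h3 : MDifferentiableWithinAt 𝓘(ℝ, EuclideanSpace ℝ (Fin n) × Covec n) 𝓘(ℝ, ℝ)
      (localRep I x H) (range (cotModel I)) (cotChart I x z) := by
    have h4 := MDifferentiableAt.comp_mdifferentiableWithinAt (I' := cotModel I)
      (g := H) (f := (cotChart I x).symm) (cotChart I x z) (h1.symm ▸ hH) h2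
    exact h4
  exact h3.differentiableWithinAt.hasFDerivWithinAt

theorem diffCot_eq_comp {x : M} {H : Cot I M → ℝ} {z : Cot I M}
    (hz : z.1 ∈ (chartAt X x).source) (hH : MDifferentiableAt (cotModel I) 𝓘(ℝ, ℝ) H z) :
    diffCot H z = (fderivWithin ℝ (localRep I x H) (range (cotModel I)) (cotChart I x z)).comp
      (cotTangentChange x z) := by
  have h1 : diffCot H z = fderivWithin ℝ (localRep I z.1 H) (range (cotModel I))
      (cotChart I z.1 z) := hH.mfderiv
  rw [h1]
  have hz0 : (cotChart I z.1).symm (cotChart I z.1 z) = z := extChartAt_to_inv z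
  have h2 := hasFDerivWithinAt_localRep hz hH
  have h3 := hasFDerivWithinAt_cotTangentChange hz
  rw [← range_cotModel] at h3
  have h4 : HasFDerivWithinAt (localRep I z.1 H)
      ((fderivWithin ℝ (localRep I x H) (range (cotModel I)) (cotChart I x z)).comp
        (cotTangentChange x z)) (range (cotModel I)) (cotChart I z.1 z) := by
    have h5 : HasFDerivWithinAt (localRep I x H ∘ (cotChart I x ∘ (cotChart I z.1).symm))
        ((fderivWithin ℝ (localRep I x H) (range (cotModel I)) (cotChart I x z)).comp
        (cotTangentChange x z))
        ((cotChart I z.1).symm ⁻¹' (cotChart I x).source ∩ range (cotModel I))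
          (cotChart I z.1 z) := by
      refine HasFDerivWithinAt.comp (t := range (cotModel I)) _ ?_
        (h3.mono inter_subset_right) ?_
      · rw [Function.comp_apply, hz0]
        exact h2
      · intro u hu
        rw [Function.comp_apply]
        exact extChartAt_target_subset_range (I := cotModel I) (⟨x, 0⟩ : Cot I M)
          ((cotChart I x).map_source hu.1)
    have hmem : (cotChart I z.1).symm ⁻¹' (cotChart I x).source ∩ range (cotModel I) ∈
        𝓝[range (cotModel I)] (cotChart I z.1 z) := by
      have := eventually_mem_of_cotChart (I := I) hz
      rw [← range_cotModel] at this
      filter_upwards [this, self_mem_nhdsWithin] with u hu hu'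
      exact ⟨mem_cotChart_source.2 hu.2, hu'⟩
    have h6 := h5.mono_of_mem_nhdsWithin hmem
    refine h6.congr_of_eventuallyEq ?_ ?_
    · filter_upwards [hmem] with u hu
      simp only [localRep, Function.comp_apply]
      rw [(cotChart I x).left_inv hu.1]
    · simp only [localRep, Function.comp_apply]
      rw [hz0, (cotChart I x).left_inv (mem_cotChart_source.2 hz)]
  exact h4.fderivWithin ((cotModel I).uniqueDiffOn _ (mem_range_self _))

/-- Symplectic coordinate changes respect symplectic gradients. The field is defined at each z by
the preferred chart at the base point of z; this gives Hamilton's equations their usual form in one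
fixed chart along a whole arc. -/
theorem cotTangentChange_hamField {x : M} {H : Cot I M → ℝ} {z : Cot I M}
    (hz : z.1 ∈ (chartAt X x).source) (hH : MDifferentiableAt (cotModel I) 𝓘(ℝ, ℝ) H z) :
    cotTangentChange x z (hamField H z) = hamLoc x H (cotChart I x z) := by
  refine eq_sgrad fun v => ?_
  obtain ⟨u, rfl⟩ : ∃ u, cotTangentChange x z u = v := ⟨_, cotTangentChange_right_inv hz v⟩
  have h1 := DFunLike.congr_fun (diffCot_eq_comp hz hH) u
  rw [ContinuousLinearMap.comp_apply] at h1
  rw [← h1]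
  exact (apply_eq_sgrad _ _).trans (cotTangentChange_symplectic hz _ _).symm

end HamiltonInCharts

/-! ### Bicharacteristics: equations in charts, energy, uniqueness. -/

section Bicharacteristics

variable {n : ℕ} {X : Type*} [TopologicalSpace X]
  {I : ModelWithCorners ℝ (EuclideanSpace ℝ (Fin n)) X}
  {M : Type*} [TopologicalSpace M] [ChartedSpace X M] [IsManifold I ∞ M]

theorem HasDerivWithinAt.changeChart {γ : ℝ → Cot I M} {s : Set ℝ} {t : ℝ}
    (hc : ContinuousWithinAt γ s t) {z z' : Cot I M}
    (hz : γ t ∈ (extChartAt (cotModel I) z).source)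
    (hz' : γ t ∈ (extChartAt (cotModel I) z').source)
    {v : EuclideanSpace ℝ (Fin n) × Covec n}
    (h : HasDerivWithinAt (extChartAt (cotModel I) z ∘ γ) v s t) :
    HasDerivWithinAt (extChartAt (cotModel I) z' ∘ γ)
      (tangentCoordChange (cotModel I) z z' (γ t) v) s t := by
  have h1 := hasFDerivWithinAt_tangentCoordChange (I := cotModel I) ⟨hz, hz'⟩
  have h2 := h1.comp_hasDerivWithinAt t (f := extChartAt (cotModel I) z ∘ γ) h
    (fun u _ => mem_range_self _)
  have hev : ∀ᶠ u in 𝓝[s] t, γ u ∈ (extChartAt (cotModel I) z).source :=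
    hc.preimage_mem_nhdsWithin ((isOpen_extChartAt_source z).mem_nhds hz)
  refine h2.congr_of_eventuallyEq ?_ ?_
  · filter_upwards [hev] with u hu
    simp only [Function.comp_apply]
    rw [(extChartAt (cotModel I) z).left_inv hu]
  · simp only [Function.comp_apply]
    rw [(extChartAt (cotModel I) z).left_inv hz]

/-- The equation of the bicharacteristics in the canonical coordinates of any chart. -/
theorem hasMFDerivWithinAt_hamField_iff {x : M} {H : Cot I M → ℝ} {γ : ℝ → Cot I M} {s : Set ℝ}
    {t : ℝ} (ht : t ∈ s) (hz : (γ t).1 ∈ (chartAt X x).source)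
    (hH : MDifferentiableAt (cotModel I) 𝓘(ℝ, ℝ) H (γ t)) :
    HasMFDerivWithinAt 𝓘(ℝ, ℝ) (cotModel I) γ s t
        ((1 : ℝ →L[ℝ] ℝ).smulRight (hamField H (γ t))) ↔
      ContinuousWithinAt γ s t ∧
        HasDerivWithinAt (cotChart I x ∘ γ) (hamLoc x H (cotChart I x (γ t))) s t := by
  have h0 : HasMFDerivWithinAt 𝓘(ℝ, ℝ) (cotModel I) γ s t
        ((1 : ℝ →L[ℝ] ℝ).smulRight (hamField H (γ t))) ↔
      ContinuousWithinAt γ s t ∧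
        HasDerivWithinAt (extChartAt (cotModel I) (γ t) ∘ γ) (sgrad (diffCot H (γ t))) s t := by
    have h1 : (extChartAt 𝓘(ℝ, ℝ) t).symm ⁻¹' s ∩ range 𝓘(ℝ, ℝ) = s :=
      Set.ext fun u => and_iff_left (mem_range_self u)
    rw [hasDerivWithinAt_iff_hasFDerivWithinAt]
    nth_rewrite 3 [← h1]
    exact Iff.rfl
  have hz1 : γ t ∈ (extChartAt (cotModel I) (γ t)).source := mem_extChartAt_source _
  have hz2 : γ t ∈ (extChartAt (cotModel I) (⟨x, 0⟩ : Cot I M)).source := mem_cotChart_source.2 hz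
  have hch : tangentCoordChange (cotModel I) (γ t) (⟨x, 0⟩ : Cot I M) (γ t)
      (sgrad (diffCot H (γ t))) = hamLoc x H (cotChart I x (γ t)) :=
    cotTangentChange_hamField hz hH
  rw [h0]
  refine and_congr_right fun hc => ⟨fun h => ?_, fun h => ?_⟩
  · have := h.changeChart hc hz1 hz2
    rw [hch] at this
    exact this
  · have h3 := HasDerivWithinAt.changeChart hc hz2 hz1 h
    rw [← hch] at h3
    have h4 := cotTangentChange_left_inv hz (sgrad (diffCot H (γ t)))
    exact h3.congr_deriv h4

/-- A family of functions that is jointly smooth on `(-ε, ε) × (T*M ∖ 0)`. -/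
def SmoothFamily (ε : ℝ) (Hs : ℝ → Cot I M → ℝ) : Prop :=
  ContMDiffOn (𝓘(ℝ, ℝ).prod (cotModel I)) 𝓘(ℝ, ℝ) ∞
    (fun w : ℝ × Cot I M => Hs w.1 w.2) (Ioo (-ε) ε ×ˢ nonzeroCot I M)

theorem smoothFamily_const {H : Cot I M → ℝ}
    (hH : ContMDiffOn (cotModel I) 𝓘(ℝ, ℝ) ∞ H (nonzeroCot I M)) (ε : ℝ) :
    SmoothFamily ε (fun _ => H) :=
  hH.comp contMDiffOn_snd (fun _ hw => hw.2)

theorem SmoothFamily.contMDiffAt {ε : ℝ} {Hs : ℝ → Cot I M → ℝ} (h : SmoothFamily ε Hs)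
    {s : ℝ} (hs : s ∈ Ioo (-ε) ε) {z : Cot I M} (hz : z ∈ nonzeroCot I M) :
    ContMDiffAt (𝓘(ℝ, ℝ).prod (cotModel I)) 𝓘(ℝ, ℝ) ∞
      (fun w : ℝ × Cot I M => Hs w.1 w.2) (s, z) :=
  ContMDiffOn.contMDiffAt h ((isOpen_Ioo.prod isOpen_nonzeroCot).mem_nhds ⟨hs, hz⟩)

theorem SmoothFamily.smooth {ε : ℝ} {Hs : ℝ → Cot I M → ℝ} (h : SmoothFamily ε Hs)
    {s : ℝ} (hs : s ∈ Ioo (-ε) ε) :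
    ContMDiffOn (cotModel I) 𝓘(ℝ, ℝ) ∞ (Hs s) (nonzeroCot I M) :=
  ContMDiffOn.comp (g := fun w : ℝ × Cot I M => Hs w.1 w.2) h
    (contMDiffOn_const.prodMk contMDiffOn_id) (fun _ hz => ⟨hs, hz⟩)

theorem mdifferentiableAt_of_smooth {H : Cot I M → ℝ}
    (hH : ContMDiffOn (cotModel I) 𝓘(ℝ, ℝ) ∞ H (nonzeroCot I M)) {z : Cot I M}
    (hz : z ∈ nonzeroCot I M) : MDifferentiableAt (cotModel I) 𝓘(ℝ, ℝ) H z :=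
  (hH.contMDiffAt (isOpen_nonzeroCot.mem_nhds hz)).mdifferentiableAt (by simp)

theorem cotChart_symm_mem_nonzeroCot {x : M} {w : EuclideanSpace ℝ (Fin n) × Covec n}
    (hw : w.1 ∈ (extChartAt I x).target) (hw2 : w.2 ≠ 0) :
    (cotChart I x).symm w ∈ nonzeroCot I M := by
  rw [mem_nonzeroCot, Ne, covec_eq_zero_iff (cotChart_symm_fst_mem hw),
    (cotChart I x).right_inv (mem_cotChart_target.2 hw)]
  exact hw2

theorem SmoothFamily.contDiffWithinAt_localRep {ε : ℝ} {Hs : ℝ → Cot I M → ℝ}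
    (h : SmoothFamily ε Hs) {s : ℝ} (hs : s ∈ Ioo (-ε) ε) {x : M}
    {w : EuclideanSpace ℝ (Fin n) × Covec n}
    (hw : w.1 ∈ (extChartAt I x).target) (hw2 : w.2 ≠ 0) :
    ContDiffWithinAt ℝ ∞ (fun p : ℝ × (EuclideanSpace ℝ (Fin n) × Covec n) =>
      localRep I x (Hs p.1) p.2) (univ ×ˢ range (cotModel I)) (s, w) := by
  have h1 : ContMDiffWithinAt 𝓘(ℝ, EuclideanSpace ℝ (Fin n) × Covec n) (cotModel I) ∞
      (cotChart I x).symm (range (cotModel I)) w :=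
    contMDiffWithinAt_extChartAt_symm_range (I := cotModel I) _ (mem_cotChart_target.2 hw)
  have h2 : ContMDiffWithinAt 𝓘(ℝ, ℝ × (EuclideanSpace ℝ (Fin n) × Covec n))
      (𝓘(ℝ, ℝ).prod (cotModel I)) ∞
      (fun p : ℝ × (EuclideanSpace ℝ (Fin n) × Covec n) => (p.1, (cotChart I x).symm p.2))
      (univ ×ˢ range (cotModel I)) (s, w) := by
    refine ContMDiffWithinAt.prodMk ?_ ?_
    · exact contDiff_fst.contMDiff.contMDiffAt.contMDiffWithinAt
    · exact ContMDiffWithinAt.comp (t := range (cotModel I)) (s, w) h1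
        contDiff_snd.contMDiff.contMDiffAt.contMDiffWithinAt (fun p hp => hp.2)
  have h3 := (h.contMDiffAt hs (cotChart_symm_mem_nonzeroCot hw hw2)).comp_contMDiffWithinAt
    (s, w) h2
  exact h3.contDiffWithinAt

/-- Derivatives are taken within the range of the model, so the field is smooth jointly in (s, w) up
to the boundary. -/
theorem SmoothFamily.contDiffWithinAt_hamLoc {ε : ℝ} {Hs : ℝ → Cot I M → ℝ}
    (h : SmoothFamily ε Hs) {s : ℝ} (hs : s ∈ Ioo (-ε) ε) {x : M}
    {w : EuclideanSpace ℝ (Fin n) × Covec n}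
    (hw : w.1 ∈ (extChartAt I x).target) (hw2 : w.2 ≠ 0) :
    ContDiffWithinAt ℝ ∞ (fun p : ℝ × (EuclideanSpace ℝ (Fin n) × Covec n) =>
      hamLoc x (Hs p.1) p.2) (univ ×ˢ range (cotModel I)) (s, w) := by
  have hwR : w ∈ range (cotModel I) :=
    extChartAt_target_subset_range _ (mem_cotChart_target.2 hw)
  have h1 : ContDiffWithinAt ℝ ∞ (fun p : ℝ × (EuclideanSpace ℝ (Fin n) × Covec n) =>
      fderivWithin ℝ (localRep I x (Hs p.1)) (range (cotModel I)) p.2)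
      (univ ×ˢ range (cotModel I)) (s, w) := by
    refine ContDiffWithinAt.fderivWithin (f := fun p : ℝ × (EuclideanSpace ℝ (Fin n) × Covec n) =>
      localRep I x (Hs p.1)) (g := Prod.snd) (n := ∞) (t := range (cotModel I)) ?_
      contDiff_snd.contDiffWithinAt (cotModel I).uniqueDiffOn (by simp) ⟨mem_univ _, hwR⟩
      (fun p hp => hp.2)
    have h2 := h.contDiffWithinAt_localRep hs hw hw2 (x := x)
    exact ContDiffWithinAt.comp (t := univ ×ˢ range (cotModel I))
      (g := fun p : ℝ × (EuclideanSpace ℝ (Fin n) × Covec n) => localRep I x (Hs p.1) p.2)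
      (f := fun q : (ℝ × (EuclideanSpace ℝ (Fin n) × Covec n)) ×
        (EuclideanSpace ℝ (Fin n) × Covec n) => (q.1.1, q.2)) ((s, w), w) h2
      ((contDiff_fst.comp contDiff_fst).prodMk contDiff_snd).contDiffWithinAt
      (fun q hq => ⟨mem_univ _, hq.2⟩)
  have h3 : ContDiffOn ℝ ∞ (sgrad (n := n)) univ := ContDiffOn.sgrad contDiffOn_id
  exact (h3.contDiffAt Filter.univ_mem).comp_contDiffWithinAt (s, w) h1

theorem contDiffWithinAt_hamLoc {H : Cot I M → ℝ}
    (hH : ContMDiffOn (cotModel I) 𝓘(ℝ, ℝ) ∞ H (nonzeroCot I M)) {x : M}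
    {w : EuclideanSpace ℝ (Fin n) × Covec n}
    (hw : w.1 ∈ (extChartAt I x).target) (hw2 : w.2 ≠ 0) :
    ContDiffWithinAt ℝ ∞ (hamLoc x H) (range (cotModel I)) w := by
  have h1 := (smoothFamily_const hH 1).contDiffWithinAt_hamLoc (s := 0) (by simp) hw hw2
  exact ContDiffWithinAt.comp (g := fun p : ℝ × (EuclideanSpace ℝ (Fin n) × Covec n) =>
    hamLoc x H p.2) (f := fun u => ((0 : ℝ), u)) w h1
    (contDiff_const.prodMk contDiff_id).contDiffWithinAt (fun u hu => ⟨mem_univ _, hu⟩)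

variable {H : Cot I M → ℝ} {T : ℝ} {γ γ' : ℝ → Cot I M}

theorem IsBichar.continuousOn (h : IsBichar H T γ) : ContinuousOn γ (Icc 0 T) :=
  IsMIntegralCurveOn.continuousOn h.integral

theorem IsBichar.mono (h : IsBichar H T γ) {T' : ℝ} (hT : T' ≤ T) : IsBichar H T' γ :=
  ⟨h.integral.mono (Icc_subset_Icc_right hT), fun t ht => h.nonzero t (Icc_subset_Icc_right hT ht)⟩

theorem IsBichar.congr (h : IsBichar H T γ) (hγ : EqOn γ γ' (Icc 0 T)) : IsBichar H T γ' := by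
  refine ⟨fun t ht => ?_, fun t ht => hγ ht ▸ h.nonzero t ht⟩
  have h1 := h.integral t ht
  rw [← hγ ht]
  exact h1.congr_of_eventuallyEq (Filter.eventuallyEq_of_mem self_mem_nhdsWithin
    fun u hu => (hγ hu).symm) (hγ ht).symm

theorem IsBichar.hasDerivWithinAt
    (hH : ContMDiffOn (cotModel I) 𝓘(ℝ, ℝ) ∞ H (nonzeroCot I M))
    (h : IsBichar H T γ) {t : ℝ} (ht : t ∈ Icc 0 T) {x : M}
    (hx : (γ t).1 ∈ (chartAt X x).source) :
    HasDerivWithinAt (cotChart I x ∘ γ) (hamLoc x H (cotChart I x (γ t))) (Icc 0 T) t :=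
  ((hasMFDerivWithinAt_hamField_iff ht hx
    (mdifferentiableAt_of_smooth hH (h.nonzero t ht))).1 (h.integral t ht)).2

theorem IsBichar.of_hasDerivWithinAt
    (hH : ContMDiffOn (cotModel I) 𝓘(ℝ, ℝ) ∞ H (nonzeroCot I M))
    (hc : ContinuousOn γ (Icc 0 T)) (hn : ∀ t ∈ Icc 0 T, γ t ∈ nonzeroCot I M)
    (h : ∀ t ∈ Icc 0 T, ∃ x, (γ t).1 ∈ (chartAt X x).source ∧
      HasDerivWithinAt (cotChart I x ∘ γ) (hamLoc x H (cotChart I x (γ t))) (Icc 0 T) t) :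
    IsBichar H T γ := by
  refine ⟨fun t ht => ?_, hn⟩
  obtain ⟨x, hx, hd⟩ := h t ht
  exact (hasMFDerivWithinAt_hamField_iff ht hx (mdifferentiableAt_of_smooth hH (hn t ht))).2
    ⟨hc t ht, hd⟩

/-- The symplectic form is antisymmetric; infinitesimally this is conservation of energy. -/
theorem fderivWithin_localRep_hamLoc (x : M) (w : EuclideanSpace ℝ (Fin n) × Covec n) :
    fderivWithin ℝ (localRep I x H) (range (cotModel I)) w (hamLoc x H w) = 0 := by
  rw [apply_eq_sgrad, hamLoc, sub_self]

/-- The energy is constant along the bicharacteristics. -/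
theorem IsBichar.energy_eq (hH : ContMDiffOn (cotModel I) 𝓘(ℝ, ℝ) ∞ H (nonzeroCot I M))
    (h : IsBichar H T γ) {t : ℝ} (ht : t ∈ Icc 0 T) : H (γ t) = H (γ 0) := by
  have hd : ∀ u ∈ Icc 0 T, HasDerivWithinAt (fun u => H (γ u)) 0 (Icc 0 T) u := by
    intro u hu
    have hx : (γ u).1 ∈ (chartAt X (γ u).1).source := mem_chart_source X _
    have h1 := h.hasDerivWithinAt hH hu hx
    have h2 := hasFDerivWithinAt_localRep hx (mdifferentiableAt_of_smooth hH (h.nonzero u hu))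
    have h3 := h2.comp_hasDerivWithinAt u (f := cotChart I (γ u).1 ∘ γ) (s := Icc 0 T) h1
      (fun v _ => mem_range_self _)
    rw [fderivWithin_localRep_hamLoc] at h3
    have hev : ∀ᶠ v in 𝓝[Icc 0 T] u, γ v ∈ (cotChart I (γ u).1).source :=
      (h.continuousOn u hu).preimage_mem_nhdsWithin
        ((isOpen_extChartAt_source _).mem_nhds (mem_cotChart_source.2 hx))
    refine h3.congr_of_eventuallyEq ?_ ?_
    · filter_upwards [hev] with v hv
      simp only [Function.comp_apply, localRep]
      rw [(cotChart I (γ u).1).left_inv hv]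
    · simp only [Function.comp_apply, localRep]
      rw [(cotChart I (γ u).1).left_inv (mem_cotChart_source.2 hx)]
  have hT : 0 ≤ T := ht.1.trans ht.2
  refine constant_of_has_deriv_right_zero (fun u hu => (hd u hu).continuousWithinAt) ?_ t ht
  intro u hu
  exact (hd u (Ico_subset_Icc_self hu)).mono_of_mem_nhdsWithin
    (Filter.mem_of_superset (Icc_mem_nhdsGE hu.2) (Icc_subset_Icc_left hu.1))

/-- A bicharacteristic is determined by its initial covector. -/
theorem IsBichar.eqOn [T2Space M] (hI : Convex ℝ (range I))
    (hH : ContMDiffOn (cotModel I) 𝓘(ℝ, ℝ) ∞ H (nonzeroCot I M))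
    (h : IsBichar H T γ) (h' : IsBichar H T γ') (h0 : γ 0 = γ' 0) : EqOn γ γ' (Icc 0 T) := by
  rcases lt_or_ge T 0 with hT | hT
  · rw [Icc_eq_empty (not_le.2 hT)]
    exact eqOn_empty _ _
  have hclosed : IsClosed ({t | γ t = γ' t} ∩ Icc 0 T) := by
    have h1 := (h.continuousOn.prodMk h'.continuousOn).preimage_isClosed_of_isClosed isClosed_Icc
      (isClosed_diagonal (X := Cot I M))
    rw [inter_comm]
    exact h1
  -- Continuous induction: the set where the curves agree is closed, and local uniqueness for the
  -- differential equation extends it to the right of each of its points.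
  refine fun t ht => hclosed.Icc_subset_of_forall_exists_gt h0 ?_ ht
  rintro t ⟨hteq, htm⟩ y hy
  have htm' : t ∈ Icc 0 T := Ico_subset_Icc_self htm
  have hteq' : γ t = γ' t := hteq
  set x := (γ t).1 with hx
  have hxs : (γ t).1 ∈ (chartAt X x).source := mem_chart_source X _
  set w := cotChart I x (γ t) with hw
  have hwt : w.1 ∈ (extChartAt I x).target :=
    mem_cotChart_target.1 ((cotChart I x).map_source (mem_cotChart_source.2 hxs))
  have hw2 : w.2 ≠ 0 := (covec_eq_zero_iff hxs).not.1 (h.nonzero t htm')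
  have hconv : Convex ℝ (range (cotModel I)) := by
    rw [range_cotModel]
    exact hI.prod convex_univ
  -- The range of the model is convex, so the field is Lipschitz near w within that range, at
  -- boundary points as well. Both curves stay there, and this suffices for Grönwall's argument.
  obtain ⟨K, S, hS, hLip⟩ := ((contDiffWithinAt_hamLoc hH hwt hw2).of_le
    ENat.LEInfty.out).exists_lipschitzOnWith hconv
  have key : ∀ {γ₁ : ℝ → Cot I M}, IsBichar H T γ₁ → γ₁ t = γ t → ∀ᶠ u in 𝓝[≥] t,
      cotChart I x (γ₁ u) ∈ S ∧ γ₁ u ∈ (cotChart I x).source := by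
    intro γ₁ h₁ he
    have hle : 𝓝[≥] t ≤ 𝓝[Icc 0 T] t :=
      nhdsWithin_le_of_mem (Filter.mem_of_superset (Icc_mem_nhdsGE htm.2)
        (Icc_subset_Icc_left htm.1))
    have hsrc : γ₁ t ∈ (cotChart I x).source := he ▸ mem_cotChart_source.2 hxs
    have h1 : ContinuousWithinAt γ₁ (Icc 0 T) t := h₁.continuousOn t htm'
    have h2 : ContinuousWithinAt (fun u => cotChart I x (γ₁ u)) (Icc 0 T) t :=
      (continuousAt_extChartAt' hsrc).comp_continuousWithinAt h1
    have h3 : Filter.Tendsto (fun u => cotChart I x (γ₁ u)) (𝓝[Icc 0 T] t)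
        (𝓝[range (cotModel I)] w) := by
      refine tendsto_nhdsWithin_iff.2 ⟨?_, Filter.Eventually.of_forall fun u => mem_range_self _⟩
      rw [hw, ← he]
      exact h2
    have h4 : ∀ᶠ u in 𝓝[Icc 0 T] t, cotChart I x (γ₁ u) ∈ S := h3 hS
    exact (h4.and (h1.preimage_mem_nhdsWithin
      ((isOpen_extChartAt_source _).mem_nhds hsrc))).filter_mono hle
  obtain ⟨b, hb, hbS⟩ := mem_nhdsGE_iff_exists_Icc_subset.1
    ((key h rfl).and (key h' hteq'.symm))
  set c := min b (min y T) with hc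
  have htc : t < c := lt_min hb (lt_min hy htm.2)
  have hsub : Icc t c ⊆ Icc 0 T := Icc_subset_Icc htm.1
    ((min_le_right _ _).trans (min_le_right _ _))
  have hsub' : ∀ u ∈ Icc t c, (cotChart I x (γ u) ∈ S ∧ γ u ∈ (cotChart I x).source) ∧
      (cotChart I x (γ' u) ∈ S ∧ γ' u ∈ (cotChart I x).source) :=
    fun u hu => hbS ⟨hu.1, hu.2.trans (min_le_left _ _)⟩
  have hder : ∀ {γ₁ : ℝ → Cot I M}, IsBichar H T γ₁ →
      (∀ u ∈ Icc t c, γ₁ u ∈ (cotChart I x).source) →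
      (∀ u ∈ Icc t c, HasDerivWithinAt (cotChart I x ∘ γ₁)
        (hamLoc x H (cotChart I x (γ₁ u))) (Icc t c) u) := by
    intro γ₁ h₁ hs u hu
    exact (h₁.hasDerivWithinAt hH (hsub hu) (mem_cotChart_source.1 (hs u hu))).mono hsub
  have hd1 := hder h fun u hu => (hsub' u hu).1.2
  have hd2 := hder h' fun u hu => (hsub' u hu).2.2
  have heq : EqOn (cotChart I x ∘ γ) (cotChart I x ∘ γ') (Icc t c) := by
    refine ODE_solution_unique_of_mem_Icc_right (v := fun _ => hamLoc x H) (s := fun _ => S)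
      (K := K) (fun _ _ => hLip) (fun u hu => (hd1 u hu).continuousWithinAt) ?_ ?_
      (fun u hu => (hd2 u hu).continuousWithinAt) ?_ ?_ ?_
    · exact fun u hu => (hd1 u (Ico_subset_Icc_self hu)).mono_of_mem_nhdsWithin
        (Filter.mem_of_superset (Icc_mem_nhdsGE hu.2) (Icc_subset_Icc_left hu.1))
    · exact fun u hu => (hsub' u (Ico_subset_Icc_self hu)).1.1
    · exact fun u hu => (hd2 u (Ico_subset_Icc_self hu)).mono_of_mem_nhdsWithin
        (Filter.mem_of_superset (Icc_mem_nhdsGE hu.2) (Icc_subset_Icc_left hu.1))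
    · exact fun u hu => (hsub' u (Ico_subset_Icc_self hu)).2.1
    · simp only [Function.comp_apply]
      rw [hteq']
  have hcm : c ∈ Icc t c := right_mem_Icc.2 htc.le
  refine ⟨c, (cotChart I x).injOn (hsub' c hcm).1.2 (hsub' c hcm).2.2 (heq hcm), htc, ?_⟩
  exact (min_le_right _ _).trans (min_le_left _ _)

end Bicharacteristics

/-! ### Homogeneity; scaling, shifting and gluing bicharacteristics. -/

section Homogeneity

variable {n : ℕ} {X : Type*} [TopologicalSpace X]
  {I : ModelWithCorners ℝ (EuclideanSpace ℝ (Fin n)) X}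
  {M : Type*} [TopologicalSpace M] [ChartedSpace X M] [IsManifold I ∞ M]

/-- A function on `T*M ∖ 0` that is smooth and positively homogeneous of degree two. -/
structure IsHomogeneousSmooth (H : Cot I M → ℝ) : Prop where
  smooth : ContMDiffOn (cotModel I) 𝓘(ℝ, ℝ) ∞ H (nonzeroCot I M)
  homogeneous : ∀ z ∈ nonzeroCot I M, ∀ c : ℝ, 0 < c → H (dilate c z) = c ^ 2 * H z

theorem IsHamiltonian.isHomogeneousSmooth {H : Cot I M → ℝ} (h : IsHamiltonian H) :
    IsHomogeneousSmooth H := ⟨h.smooth, h.homogeneous⟩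

variable {H : Cot I M → ℝ} {T : ℝ} {γ γ' : ℝ → Cot I M}

theorem hasFDerivWithinAt_localRep_fderivWithin
    (hH : ContMDiffOn (cotModel I) 𝓘(ℝ, ℝ) ∞ H (nonzeroCot I M)) {x : M}
    {w : EuclideanSpace ℝ (Fin n) × Covec n}
    (hw : w.1 ∈ (extChartAt I x).target) (hw2 : w.2 ≠ 0) :
    HasFDerivWithinAt (localRep I x H) (fderivWithin ℝ (localRep I x H) (range (cotModel I)) w)
      (range (cotModel I)) w := by
  have h1 := (smoothFamily_const hH 1).contDiffWithinAt_localRep (s := 0) (by simp) hw hw2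
  have h2 : ContDiffWithinAt ℝ ∞ (localRep I x H) (range (cotModel I)) w :=
    ContDiffWithinAt.comp (g := fun p : ℝ × (EuclideanSpace ℝ (Fin n) × Covec n) =>
      localRep I x H p.2) (f := fun u => ((0 : ℝ), u)) w h1
      (contDiff_const.prodMk contDiff_id).contDiffWithinAt (fun u hu => ⟨mem_univ _, hu⟩)
  exact (h2.differentiableWithinAt (by simp)).hasFDerivWithinAt

theorem IsHomogeneousSmooth.localRep_smul (hH : IsHomogeneousSmooth H) {x : M}
    {w : EuclideanSpace ℝ (Fin n) × Covec n} (hw : w.1 ∈ (extChartAt I x).target) (hw2 : w.2 ≠ 0)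
    {c : ℝ} (hc : 0 < c) : localRep I x H (w.1, c • w.2) = c ^ 2 * localRep I x H w := by
  have hz := cotChart_symm_mem_nonzeroCot (M := M) hw hw2
  have hm := mem_cotChart_target.2 hw
  have h1 : (cotChart I x).symm (w.1, c • w.2) = dilate c ((cotChart I x).symm w) := by
    have h2 := cotChart_dilate c (cotChart_symm_fst_mem hw)
    rw [(cotChart I x).right_inv hm] at h2
    rw [← h2, (cotChart I x).left_inv]
    exact mem_cotChart_source.2 (cotChart_symm_fst_mem hw)
  simp only [localRep, h1]
  exact hH.homogeneous _ hz c hc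

theorem target_extChartAt_mem_nhdsWithin_cot {x : M}
    {w : EuclideanSpace ℝ (Fin n) × Covec n} (hw : w.1 ∈ (extChartAt I x).target) (hw2 : w.2 ≠ 0) :
    ∀ᶠ v in 𝓝[range (cotModel I)] w, v.1 ∈ (extChartAt I x).target ∧ v.2 ≠ 0 := by
  have h1 : (cotChart I x).target ∈ 𝓝[range (cotModel I)] w := by
    have h : (cotChart I x).target ∈
        𝓝[range (cotModel I)] (cotChart I x ((cotChart I x).symm w)) :=
      extChartAt_target_mem_nhdsWithin' (I := cotModel I) (x := (⟨x, 0⟩ : Cot I M))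
        ((cotChart I x).map_target (mem_cotChart_target.2 hw))
    rwa [(cotChart I x).right_inv (mem_cotChart_target.2 hw)] at h
  have h2 : ∀ᶠ v in 𝓝[range (cotModel I)] w, v.2 ≠ 0 :=
    (continuous_snd.continuousAt.eventually_ne hw2).filter_mono nhdsWithin_le_nhds
  filter_upwards [h1, h2] with v hv1 hv2
  exact ⟨mem_cotChart_target.1 hv1, hv2⟩

/-- Euler's identity. -/
theorem IsHomogeneousSmooth.euler (hH : IsHomogeneousSmooth H) {x : M}
    {w : EuclideanSpace ℝ (Fin n) × Covec n} (hw : w.1 ∈ (extChartAt I x).target)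
    (hw2 : w.2 ≠ 0) : w.2 (hamLoc x H w).1 = 2 * localRep I x H w := by
  have h1 := hasFDerivWithinAt_localRep_fderivWithin hH.smooth hw hw2
  have h2 : HasDerivAt (fun c : ℝ => (w.1, c • w.2)) (((0 : EuclideanSpace ℝ (Fin n)), w.2)) 1 := by
    have := (hasDerivAt_id (1 : ℝ)).smul_const w.2
    simp only [one_smul] at this
    exact (hasDerivAt_const _ _).prodMk this
  have hwR : ∀ c : ℝ, (w.1, c • w.2) ∈ range (cotModel I) := fun c => by
    rw [range_cotModel]
    exact ⟨extChartAt_target_subset_range _ hw, mem_univ _⟩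
  have h3 : HasDerivWithinAt (fun c : ℝ => localRep I x H (w.1, c • w.2))
      (fderivWithin ℝ (localRep I x H) (range (cotModel I)) w (0, w.2)) univ 1 := by
    refine HasFDerivWithinAt.comp_hasDerivWithinAt (l := localRep I x H)
      (f := fun c : ℝ => (w.1, c • w.2)) (t := range (cotModel I)) 1 ?_
      h2.hasDerivWithinAt (fun c _ => hwR c)
    simpa using h1
  have h4 : HasDerivAt (fun c : ℝ => c ^ 2 * localRep I x H w) (2 * localRep I x H w) 1 := by
    simpa using (hasDerivAt_pow 2 (1 : ℝ)).mul_const (localRep I x H w)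
  have h5 : HasDerivAt (fun c : ℝ => localRep I x H (w.1, c • w.2)) (2 * localRep I x H w) 1 := by
    refine h4.congr_of_eventuallyEq ?_
    filter_upwards [lt_mem_nhds (zero_lt_one (α := ℝ))] with c hc
    exact hH.localRep_smul hw hw2 hc
  rw [hamLoc, sgrad_fst_apply]
  exact (hasDerivWithinAt_univ.1 h3).unique h5

/-- Differentiation of H(x, cξ) = c² H(x, ξ) shows that H_ξ has degree one and H_x degree two in ξ.
-/
theorem IsHomogeneousSmooth.hamLoc_smul (hH : IsHomogeneousSmooth H) {x : M}
    {w : EuclideanSpace ℝ (Fin n) × Covec n} (hw : w.1 ∈ (extChartAt I x).target)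
    (hw2 : w.2 ≠ 0) {c : ℝ} (hc : 0 < c) :
    hamLoc x H (w.1, c • w.2) = (c • (hamLoc x H w).1, c ^ 2 • (hamLoc x H w).2) := by
  set R := range (cotModel I)
  have hwR : w ∈ R := by
    change w ∈ range (cotModel I)
    rw [range_cotModel]
    exact ⟨extChartAt_target_subset_range _ hw, mem_univ _⟩
  have hmaps : MapsTo (fun v : EuclideanSpace ℝ (Fin n) × Covec n => (v.1, c • v.2)) R R := by
    intro v hv
    change _ ∈ range (cotModel I) at hv ⊢
    rw [range_cotModel] at hv ⊢
    exact ⟨hv.1, mem_univ _⟩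
  have h1 := hasFDerivWithinAt_localRep_fderivWithin hH.smooth hw hw2
  have h1' := hasFDerivWithinAt_localRep_fderivWithin (x := x) (w := (w.1, c • w.2)) hH.smooth hw
    (smul_ne_zero hc.ne' hw2)
  let D : EuclideanSpace ℝ (Fin n) × Covec n →L[ℝ] EuclideanSpace ℝ (Fin n) × Covec n :=
    (ContinuousLinearMap.fst ℝ (EuclideanSpace ℝ (Fin n)) (Covec n)).prod
      (c • ContinuousLinearMap.snd ℝ (EuclideanSpace ℝ (Fin n)) (Covec n))
  have hD : HasFDerivWithinAt D D R w := D.hasFDerivAt.hasFDerivWithinAt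
  have h2 := HasFDerivWithinAt.comp (g := localRep I x H) (f := D) (t := R) w h1' hD hmaps
  have h3 : HasFDerivWithinAt (fun v => c ^ 2 * localRep I x H v)
      (c ^ 2 • fderivWithin ℝ (localRep I x H) R w) R w := h1.const_mul (c ^ 2)
  have h4 := h3.congr_of_eventuallyEq (f₁ := localRep I x H ∘ D) ?_ (hH.localRep_smul hw hw2 hc)
  swap
  · filter_upwards [target_extChartAt_mem_nhdsWithin_cot hw hw2] with v hv
    exact hH.localRep_smul hv.1 hv.2 hc
  have h5 := (cotModel I).uniqueDiffOn.eq hwR h2 h4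
  symm
  refine eq_sgrad fun v => ?_
  have h6 := DFunLike.congr_fun h5 (v.1, c⁻¹ • v.2)
  simp only [D, ContinuousLinearMap.comp_apply, ContinuousLinearMap.prod_apply,
    ContinuousLinearMap.coe_fst', smul_apply, ContinuousLinearMap.coe_snd',
    smul_smul, mul_inv_cancel₀ hc.ne', one_smul, Prod.mk.eta] at h6
  rw [h6, apply_eq_sgrad]
  change c ^ 2 • (((c⁻¹ • v.2) (hamLoc x H w).1) - _) = _
  simp only [smul_apply, map_smul, smul_eq_mul]
  have : (sgrad (fderivWithin ℝ (localRep I x H) R w)).2 = (hamLoc x H w).2 := rfl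
  rw [this]
  field_simp

theorem continuous_dilate : Continuous (fun p : ℝ × Cot I M => dilate p.1 p.2) := by
  rw [continuous_iff_continuousAt]
  rintro ⟨c, z⟩
  have hz : z ∈ (cotChart I z.1).source := mem_extChartAt_source z
  have hsrc : ∀ᶠ p : ℝ × Cot I M in 𝓝 (c, z), p.2 ∈ (cotChart I z.1).source :=
    continuous_snd.continuousAt.preimage_mem_nhds ((isOpen_extChartAt_source _).mem_nhds hz)
  have hc : ContinuousAt (cotChart I z.1) z := continuousAt_extChartAt z
  have h1 : ContinuousAt (fun p : ℝ × Cot I M =>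
      ((cotChart I z.1 p.2).1, p.1 • (cotChart I z.1 p.2).2)) (c, z) := by
    have h2 : ContinuousAt (fun p : ℝ × Cot I M => cotChart I z.1 p.2) (c, z) :=
      ContinuousAt.comp (g := cotChart I z.1) (f := Prod.snd) hc continuous_snd.continuousAt
    exact h2.fst.prodMk (continuous_fst.continuousAt.smul h2.snd)
  have hmem : ∀ p : ℝ × Cot I M, p.2 ∈ (cotChart I z.1).source →
      ((cotChart I z.1 p.2).1, p.1 • (cotChart I z.1 p.2).2) ∈ (cotChart I z.1).target :=
    fun p hp => mem_cotChart_target.2 (mem_cotChart_target.1 ((cotChart I z.1).map_source hp))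
  have h3 : ContinuousWithinAt (cotChart I z.1).symm (cotChart I z.1).target
      ((cotChart I z.1 z).1, c • (cotChart I z.1 z).2) :=
    continuousOn_extChartAt_symm _ _ (hmem (c, z) hz)
  have h4 : ContinuousAt (fun p : ℝ × Cot I M => (cotChart I z.1).symm
      ((cotChart I z.1 p.2).1, p.1 • (cotChart I z.1 p.2).2)) (c, z) := by
    refine Filter.Tendsto.comp (y := 𝓝[(cotChart I z.1).target]
      ((cotChart I z.1 z).1, c • (cotChart I z.1 z).2)) ?_
      (tendsto_nhdsWithin_iff.2 ⟨h1, hsrc.mono hmem⟩)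
    exact h3
  refine h4.congr ?_
  filter_upwards [hsrc] with p hp
  rw [← cotChart_dilate _ (mem_cotChart_source.1 hp)]
  exact (cotChart I z.1).left_inv (mem_cotChart_source.2 (mem_cotChart_source.1 hp))

/-- H_ξ has degree one and H_x degree two, so a dilated bicharacteristic is traversed c times faster
over the same base curve. Travel times can thereby be normalized to 1. -/
theorem IsBichar.rescale (hH : IsHomogeneousSmooth H) (h : IsBichar H T γ) {c : ℝ} (hc : 0 < c) :
    IsBichar H (T / c) (fun t => dilate c (γ (c * t))) := by
  have hmaps : ∀ t ∈ Icc 0 (T / c), c * t ∈ Icc 0 T := fun t ht =>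
    ⟨mul_nonneg hc.le ht.1, by rw [mul_comm]; exact (le_div_iff₀ hc).1 ht.2⟩
  have hcont : ContinuousOn (fun t => γ (c * t)) (Icc 0 (T / c)) :=
    h.continuousOn.comp (by fun_prop) hmaps
  refine .of_hasDerivWithinAt hH.smooth
    (continuous_dilate.comp_continuousOn (continuousOn_const.prodMk hcont))
    (fun t ht => dilate_mem_nonzeroCot hc.ne' (h.nonzero _ (hmaps t ht))) ?_
  intro t ht
  set x := (γ (c * t)).1 with hx
  have hxs : (γ (c * t)).1 ∈ (chartAt X x).source := mem_chart_source X _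
  have hw : (cotChart I x (γ (c * t))).1 ∈ (extChartAt I x).target :=
    mem_cotChart_target.1 ((cotChart I x).map_source (mem_cotChart_source.2 hxs))
  have hw2 : (cotChart I x (γ (c * t))).2 ≠ 0 :=
    (covec_eq_zero_iff hxs).not.1 (h.nonzero _ (hmaps t ht))
  refine ⟨x, hxs, ?_⟩
  rw [cotChart_dilate c hxs, hH.hamLoc_smul hw hw2 hc]
  have h1 := h.hasDerivWithinAt hH.smooth (hmaps t ht) hxs
  have h2 : HasDerivWithinAt (fun u => c * u) c (Icc 0 (T / c)) t := by
    simpa using ((hasDerivAt_id t).const_mul c).hasDerivWithinAt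
  have h3 : HasDerivWithinAt (fun u => cotChart I x (γ (c * u)))
      (c • hamLoc x H (cotChart I x (γ (c * t)))) (Icc 0 (T / c)) t :=
    HasDerivWithinAt.scomp (g₁ := cotChart I x ∘ γ) t h1 h2 hmaps
  have h4 := ((ContinuousLinearMap.fst ℝ (EuclideanSpace ℝ (Fin n)) (Covec n)).prod
      (c • ContinuousLinearMap.snd ℝ (EuclideanSpace ℝ (Fin n)) (Covec n))).hasFDerivAt.comp_hasDerivWithinAt
        t h3
  have hev : ∀ᶠ u in 𝓝[Icc 0 (T / c)] t, γ (c * u) ∈ (cotChart I x).source :=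
    (hcont t ht).preimage_mem_nhdsWithin
      ((isOpen_extChartAt_source _).mem_nhds (mem_cotChart_source.2 hxs))
  refine (h4.congr_of_eventuallyEq ?_ (cotChart_dilate c hxs)).congr_deriv ?_
  · filter_upwards [hev] with u hu
    exact cotChart_dilate c (mem_cotChart_source.1 hu)
  · simp [pow_two, mul_smul]

theorem IsBichar.shift (hH : ContMDiffOn (cotModel I) 𝓘(ℝ, ℝ) ∞ H (nonzeroCot I M))
    (h : IsBichar H T γ) {a T' : ℝ} (ha : 0 ≤ a) (hT : a + T' ≤ T) :
    IsBichar H T' (fun t => γ (a + t)) := by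
  have hmaps : ∀ t ∈ Icc 0 T', a + t ∈ Icc 0 T := fun t ht =>
    ⟨add_nonneg ha ht.1, (by linarith [ht.2])⟩
  refine .of_hasDerivWithinAt hH (h.continuousOn.comp (by fun_prop) hmaps)
    (fun t ht => h.nonzero _ (hmaps t ht)) fun t ht => ?_
  refine ⟨(γ (a + t)).1, mem_chart_source X _, ?_⟩
  have h1 := h.hasDerivWithinAt hH (hmaps t ht) (mem_chart_source X _)
  have h2 : HasDerivWithinAt (fun u => a + u) 1 (Icc 0 T') t :=
    ((hasDerivAt_id t).const_add a).hasDerivWithinAt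
  have h3 := HasDerivWithinAt.scomp (g₁ := cotChart I (γ (a + t)).1 ∘ γ) t h1 h2 hmaps
  rw [one_smul] at h3
  exact h3

/-- At the joint both one-sided derivatives are the value of the field at the common covector. -/
theorem IsBichar.glue (hH : ContMDiffOn (cotModel I) 𝓘(ℝ, ℝ) ∞ H (nonzeroCot I M))
    {T' : ℝ} (hT : 0 ≤ T) (h : IsBichar H T γ) (h' : IsBichar H T' γ')
    (he : γ T = γ' 0) :
    IsBichar H (T + T') (fun t => if t ≤ T then γ t else γ' (t - T)) := by
  set ρ : ℝ → Cot I M := fun t => if t ≤ T then γ t else γ' (t - T) with hρ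
  have e1 : EqOn ρ γ (Icc 0 T) := fun t ht => if_pos ht.2
  have e2 : EqOn ρ (fun t => γ' (t - T)) (Icc T (T + T')) := by
    intro t ht
    rcases ht.1.eq_or_lt with rfl | hlt
    · simp [hρ, he]
    · exact if_neg (not_le.2 hlt)
  have hmaps : ∀ t ∈ Icc T (T + T'), t - T ∈ Icc 0 T' := fun t ht =>
    ⟨sub_nonneg.2 ht.1, by linarith [ht.2]⟩
  have hc1 : ContinuousOn ρ (Icc 0 T) := h.continuousOn.congr e1
  have hc2 : ContinuousOn ρ (Icc T (T + T')) :=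
    ContinuousOn.congr (f := fun t => γ' (t - T))
      (h'.continuousOn.comp (f := fun t => t - T) (by fun_prop) hmaps) e2
  have hd1 : ∀ t ∈ Icc 0 T, ∀ x, (ρ t).1 ∈ (chartAt X x).source →
      HasDerivWithinAt (cotChart I x ∘ ρ) (hamLoc x H (cotChart I x (ρ t))) (Icc 0 T) t := by
    intro t ht x hx
    rw [e1 ht] at hx ⊢
    exact (h.hasDerivWithinAt hH ht hx).congr (fun u hu => congrArg _ (e1 hu)) (congrArg _ (e1 ht))
  have hd2 : ∀ t ∈ Icc T (T + T'), ∀ x, (ρ t).1 ∈ (chartAt X x).source →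
      HasDerivWithinAt (cotChart I x ∘ ρ) (hamLoc x H (cotChart I x (ρ t)))
        (Icc T (T + T')) t := by
    intro t ht x hx
    rw [e2 ht] at hx ⊢
    have h2 : HasDerivWithinAt (fun u => u - T) 1 (Icc T (T + T')) t :=
      ((hasDerivAt_id t).sub_const T).hasDerivWithinAt
    have h3 := HasDerivWithinAt.scomp (g₁ := cotChart I x ∘ γ') (h := fun u => u - T) t
      (h'.hasDerivWithinAt hH (hmaps t ht) hx) h2 hmaps
    rw [one_smul] at h3
    exact h3.congr (fun u hu => congrArg _ (e2 hu)) (congrArg _ (e2 ht))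
  rcases lt_or_ge T' 0 with hT' | hT'
  · exact (h.congr (fun t ht => (e1 ht).symm)).mono (by linarith)
  have hU : Icc 0 (T + T') = Icc 0 T ∪ Icc T (T + T') :=
    (Icc_union_Icc_eq_Icc hT (by linarith)).symm
  refine .of_hasDerivWithinAt hH ?_ ?_ ?_
  · rw [hU]
    exact hc1.union_of_isClosed hc2 isClosed_Icc isClosed_Icc
  · intro t ht
    rw [hU] at ht
    rcases ht with ht | ht
    · rw [e1 ht]
      exact h.nonzero t ht
    · rw [e2 ht]
      exact h'.nonzero _ (hmaps t ht)
  · intro t ht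
    refine ⟨(ρ t).1, mem_chart_source X _, ?_⟩
    rcases lt_trichotomy t T with hlt | heq | hgt
    · refine (hd1 t ⟨ht.1, hlt.le⟩ _ (mem_chart_source X _)).mono_of_mem_nhdsWithin ?_
      filter_upwards [self_mem_nhdsWithin, nhdsWithin_le_nhds (Iio_mem_nhds hlt)] with u hu hu'
      exact ⟨hu.1, le_of_lt hu'⟩
    · rw [hU]
      exact (hd1 t ⟨ht.1, heq.le⟩ _ (mem_chart_source X _)).union
        (hd2 t ⟨heq.ge, ht.2⟩ _ (mem_chart_source X _))
    · refine (hd2 t ⟨hgt.le, ht.2⟩ _ (mem_chart_source X _)).mono_of_mem_nhdsWithin ?_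
      filter_upwards [self_mem_nhdsWithin, nhdsWithin_le_nhds (Ioi_mem_nhds hgt)] with u hu hu'
      exact ⟨le_of_lt hu', hu.2⟩

end Homogeneity

/-! ### Reparameterization and mixed derivatives. -/

/-- A curve `w` with `w' = τ' X ∘ w` becomes a solution of `w' = X ∘ w` when it is reparameterized
by `τ`, which may have critical points at the ends. -/
theorem exists_reparam {G : Type*} [NormedAddCommGroup G] [NormedSpace ℝ G] {a b : ℝ} (hab : a < b)
    {τ τ' : ℝ → ℝ} {w v : ℝ → G} (hτ : ContinuousOn τ (Icc a b))
    (hτ' : ∀ u ∈ Ioo a b, HasDerivAt τ (τ' u) u) (hpos : ∀ u ∈ Ioo a b, 0 < τ' u)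
    (hw : ContinuousOn w (Icc a b)) (hv : ContinuousOn v (Icc a b))
    (hw' : ∀ u ∈ Ioo a b, HasDerivAt w (τ' u • v u) u) :
    τ a < τ b ∧ ∃ κ : ℝ → ℝ, κ (τ a) = a ∧ κ (τ b) = b ∧ ContinuousOn κ (Icc (τ a) (τ b)) ∧
      MapsTo κ (Icc (τ a) (τ b)) (Icc a b) ∧ MapsTo κ (Ioo (τ a) (τ b)) (Ioo a b) ∧
      (∀ u ∈ Icc a b, τ u ∈ Icc (τ a) (τ b) ∧ κ (τ u) = u) ∧
      ∀ t ∈ Icc (τ a) (τ b), HasDerivWithinAt (w ∘ κ) (v (κ t)) (Icc (τ a) (τ b)) t := by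
  have hmono : StrictMonoOn τ (Icc a b) := by
    refine strictMonoOn_of_deriv_pos (convex_Icc a b) hτ fun u hu => ?_
    rw [interior_Icc] at hu
    rw [(hτ' u hu).deriv]
    exact hpos u hu
  have ha : a ∈ Icc a b := left_mem_Icc.2 hab.le
  have hb : b ∈ Icc a b := right_mem_Icc.2 hab.le
  have hlt : τ a < τ b := hmono ha hb hab
  have hsurj : τ '' Icc a b = Icc (τ a) (τ b) := by
    refine Subset.antisymm ?_ (intermediate_value_Icc hab.le hτ)
    rintro _ ⟨u, hu, rfl⟩
    exact ⟨hmono.monotoneOn ha hu hu.1, hmono.monotoneOn hu hb hu.2⟩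
  have hbij : BijOn τ (Icc a b) (Icc (τ a) (τ b)) := hsurj ▸ hmono.injOn.bijOn_image
  set κ := Function.invFunOn τ (Icc a b) with hκ
  have hinv : InvOn κ τ (Icc a b) (Icc (τ a) (τ b)) := hbij.invOn_invFunOn
  have hκmaps : MapsTo κ (Icc (τ a) (τ b)) (Icc a b) := hbij.surjOn.mapsTo_invFunOn
  have hκmono : StrictMonoOn κ (Icc (τ a) (τ b)) := by
    intro s hs t ht hst
    rw [← hmono.lt_iff_lt (hκmaps hs) (hκmaps ht), hinv.2 hs, hinv.2 ht]
    exact hst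
  have hκa : κ (τ a) = a := hinv.1 ha
  have hκb : κ (τ b) = b := hinv.1 hb
  have hκimage : κ '' Icc (τ a) (τ b) = Icc a b := by
    rw [← hsurj]
    exact hinv.1.image_image
  have hta : τ a ∈ Icc (τ a) (τ b) := left_mem_Icc.2 hlt.le
  have htb : τ b ∈ Icc (τ a) (τ b) := right_mem_Icc.2 hlt.le
  have hκIoo : MapsTo κ (Ioo (τ a) (τ b)) (Ioo a b) := fun t ht =>
    ⟨hκa ▸ hκmono hta (Ioo_subset_Icc_self ht) ht.1, hκb ▸ hκmono (Ioo_subset_Icc_self ht) htb ht.2⟩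
  -- The inverse of a continuous bijection of a compact interval is continuous: preimages of closed
  -- sets under κ are images of compact sets under τ.
  have hκcont : ContinuousOn κ (Icc (τ a) (τ b)) := by
    refine continuousOn_iff_isClosed.2 fun C hC => ⟨τ '' (Icc a b ∩ C), ?_, ?_⟩
    · exact ((isCompact_Icc.inter_right hC).image_of_continuousOn
        (hτ.mono inter_subset_left)).isClosed
    · ext t
      constructor
      · rintro ⟨h1, h2⟩
        exact ⟨⟨κ t, ⟨hκmaps h2, h1⟩, hinv.2 h2⟩, h2⟩
      · rintro ⟨⟨u, hu, rfl⟩, h2⟩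
        refine ⟨?_, h2⟩
        change κ (τ u) ∈ C
        rw [hinv.1 hu.1]
        exact hu.2
  have hcont : ContinuousOn (w ∘ κ) (Icc (τ a) (τ b)) := hw.comp hκcont hκmaps
  have hvcont : ContinuousOn (v ∘ κ) (Icc (τ a) (τ b)) := hv.comp hκcont hκmaps
  have hint : ∀ t ∈ Ioo (τ a) (τ b), HasDerivAt (w ∘ κ) (v (κ t)) t := by
    intro t ht
    have hu := hκIoo ht
    have h1 : HasDerivAt κ (τ' (κ t))⁻¹ t := by
      refine HasDerivAt.of_local_left_inverse ((hκcont t (Ioo_subset_Icc_self ht)).continuousAt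
        (Icc_mem_nhds ht.1 ht.2)) (hτ' _ hu) (hpos _ hu).ne' ?_
      filter_upwards [Ioo_mem_nhds ht.1 ht.2] with s hs
      exact hinv.2 (Ioo_subset_Icc_self hs)
    have h2 := HasDerivAt.scomp t (hw' _ hu) h1
    rwa [smul_smul, inv_mul_cancel₀ (hpos _ hu).ne', one_smul] at h2
  refine ⟨hlt, κ, hκa, hκb, hκcont, hκmaps, hκIoo,
    fun u hu => ⟨hbij.mapsTo hu, hinv.1 hu⟩, fun t ht => ?_⟩
  -- At the ends τ' may vanish and κ need not be differentiable. The composite w ∘ κ still has a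
  -- one-sided derivative, namely the limit of its derivatives from inside.
  rcases ht.1.eq_or_lt with h | h
  · subst h
    refine HasDerivWithinAt.mono ?_ Icc_subset_Ici_self
    refine hasDerivWithinAt_Ici_of_tendsto_deriv (s := Ioo (τ a) (τ b)) ?_ ?_
      (Ioo_mem_nhdsGT hlt) ?_
    · exact fun s hs => (hint s hs).differentiableAt.differentiableWithinAt
    · exact (hcont _ hta).mono Ioo_subset_Icc_self
    · have h1 : Filter.Tendsto (v ∘ κ) (𝓝[>] (τ a)) (𝓝 (v (κ (τ a)))) :=
        (hvcont _ hta).mono_of_mem_nhdsWithin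
          (Filter.mem_of_superset (Ioo_mem_nhdsGT hlt) Ioo_subset_Icc_self)
      refine h1.congr' ?_
      filter_upwards [Ioo_mem_nhdsGT hlt] with s hs
      exact (hint s hs).deriv.symm
  rcases ht.2.eq_or_lt with h' | h'
  · subst h'
    refine HasDerivWithinAt.mono ?_ Icc_subset_Iic_self
    refine hasDerivWithinAt_Iic_of_tendsto_deriv (s := Ioo (τ a) (τ b)) ?_ ?_
      (Ioo_mem_nhdsLT hlt) ?_
    · exact fun s hs => (hint s hs).differentiableAt.differentiableWithinAt
    · exact (hcont _ htb).mono Ioo_subset_Icc_self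
    · have h1 : Filter.Tendsto (v ∘ κ) (𝓝[<] (τ b)) (𝓝 (v (κ (τ b)))) :=
        (hvcont _ htb).mono_of_mem_nhdsWithin
          (Filter.mem_of_superset (Ioo_mem_nhdsLT hlt) Ioo_subset_Icc_self)
      refine h1.congr' ?_
      filter_upwards [Ioo_mem_nhdsLT hlt] with s hs
      exact (hint s hs).deriv.symm
  · exact (hint t ⟨h, h'⟩).hasDerivWithinAt

/-- The mixed second derivative of a smooth map on `P × ℝ`, computed in either order. -/
theorem exists_mixed_deriv {P G : Type*} [NormedAddCommGroup P] [NormedSpace ℝ P]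
    [NormedAddCommGroup G] [NormedSpace ℝ G] {W : P × ℝ → G} {q₀ : P} {u : ℝ}
    (hW : ContDiffAt ℝ ∞ W (q₀, u)) (δ : P) :
    ∃ D : G, HasDerivAt (fun u' => fderiv ℝ W (q₀, u') (δ, 0)) D u ∧
      HasDerivAt (fun h : ℝ => fderiv ℝ W (q₀ + h • δ, u) (0, 1)) D 0 := by
  have h1 : ContDiffAt ℝ 1 (fderiv ℝ W) (q₀, u) :=
    hW.fderiv_right (m := 1) (by norm_num; exact ENat.LEInfty.out)
  have h2 : HasFDerivAt (fderiv ℝ W) (fderiv ℝ (fderiv ℝ W) (q₀, u)) (q₀, u) :=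
    (h1.differentiableAt (by simp)).hasFDerivAt
  have hs : IsSymmSndFDerivAt ℝ W (q₀, u) :=
    hW.isSymmSndFDerivAt (by simp only [minSmoothness_of_isRCLikeNormedField]; exact ENat.LEInfty.out)
  refine ⟨fderiv ℝ (fderiv ℝ W) (q₀, u) (0, 1) (δ, 0), ?_, ?_⟩
  · have h3 : HasDerivAt (fun u' : ℝ => (q₀, u')) ((0 : P), (1 : ℝ)) u :=
      (hasDerivAt_const _ _).prodMk (hasDerivAt_id u)
    have h4 := HasFDerivAt.comp_hasDerivAt (l := fderiv ℝ W) u h2 h3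
    have h5 := h4.clm_apply (hasDerivAt_const u ((δ, 0) : P × ℝ))
    simpa using h5
  · have h3 : HasDerivAt (fun h : ℝ => (q₀ + h • δ, u)) (δ, (0 : ℝ)) 0 := by
      have := ((hasDerivAt_id (0 : ℝ)).smul_const δ).const_add q₀
      simp only [one_smul] at this
      exact this.prodMk (hasDerivAt_const _ _)
    have h2' : HasFDerivAt (fderiv ℝ W) (fderiv ℝ (fderiv ℝ W) (q₀, u))
        (q₀ + (0 : ℝ) • δ, u) := by simpa using h2
    have h4 := HasFDerivAt.comp_hasDerivAt (l := fderiv ℝ W)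
      (f := fun h : ℝ => (q₀ + h • δ, u)) 0 h2' h3
    have h5 := h4.clm_apply (hasDerivAt_const 0 ((0, 1) : P × ℝ))
    simp only [map_zero, add_zero] at h5
    rw [hs.eq (δ, 0) (0, 1)] at h5
    exact h5

theorem hasDerivAt_line {P G : Type*} [NormedAddCommGroup P] [NormedSpace ℝ P]
    [NormedAddCommGroup G] [NormedSpace ℝ G] {f : P → G} {q₀ : P} (δ : P)
    (hf : DifferentiableAt ℝ f q₀) :
    HasDerivAt (fun h : ℝ => f (q₀ + h • δ)) (fderiv ℝ f q₀ δ) 0 := by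
  have h3 : HasDerivAt (fun h : ℝ => q₀ + h • δ) δ 0 := by
    have := ((hasDerivAt_id (0 : ℝ)).smul_const δ).const_add q₀
    simpa only [one_smul, id] using this
  have h2 : HasFDerivAt f (fderiv ℝ f q₀) (q₀ + (0 : ℝ) • δ) := by simpa using hf.hasFDerivAt
  exact HasFDerivAt.comp_hasDerivAt (l := f) (f := fun h : ℝ => q₀ + h • δ) 0 h2 h3

/-! ### Families of bicharacteristics and the variation of their endpoints. -/

section Families

variable {n : ℕ} {X : Type*} [TopologicalSpace X]
  {I : ModelWithCorners ℝ (EuclideanSpace ℝ (Fin n)) X}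
  {M : Type*} [TopologicalSpace M] [ChartedSpace X M] [IsManifold I ∞ M]

theorem isInteriorPoint_iff_chart {x y : M} (hy : y ∈ (chartAt X x).source) :
    I.IsInteriorPoint y ↔ extChartAt I x y ∈ interior (range I) := by
  rw [I.isInteriorPoint_iff_of_mem_atlas (n := ∞) (by simp) (chart_mem_atlas X x) hy]
  change extChartAt I x y ∈ interior (extChartAt I x).target ↔ _
  constructor
  · exact fun h => interior_mono (extChartAt_target_subset_range x) h
  · intro h
    rw [mem_interior_iff_mem_nhds] at h ⊢
    have h1 := extChartAt_target_mem_nhdsWithin' (I := I) (x := x) (y := y)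
      (by rwa [extChartAt_source])
    rwa [nhdsWithin_eq_nhds.2 h] at h1

/-- A smooth family of functions on `T*M ∖ 0` that are homogeneous of degree two. -/
structure HamFamily (ε : ℝ) (Hs : ℝ → Cot I M → ℝ) : Prop where
  smooth : SmoothFamily ε Hs
  homogeneous : ∀ s ∈ Ioo (-ε) ε, ∀ z ∈ nonzeroCot I M, ∀ c : ℝ, 0 < c →
    Hs s (dilate c z) = c ^ 2 * Hs s z

theorem HamFamily.isHomogeneousSmooth {ε : ℝ} {Hs : ℝ → Cot I M → ℝ} (h : HamFamily ε Hs) {s : ℝ}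
    (hs : s ∈ Ioo (-ε) ε) : IsHomogeneousSmooth (Hs s) :=
  ⟨h.smooth.smooth hs, h.homogeneous s hs⟩

theorem hamFamily_const {H : Cot I M → ℝ} (h : IsHomogeneousSmooth H) (ε : ℝ) :
    HamFamily ε (fun _ => H) :=
  ⟨smoothFamily_const h.smooth ε, fun _ _ => h.homogeneous⟩

theorem SmoothFamily.exists_hasFDerivWithinAt {ε : ℝ} {Hs : ℝ → Cot I M → ℝ}
    (h : SmoothFamily ε Hs) {s : ℝ} (hs : s ∈ Ioo (-ε) ε) {x : M}
    {w : EuclideanSpace ℝ (Fin n) × Covec n}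
    (hw : w.1 ∈ (extChartAt I x).target) (hw2 : w.2 ≠ 0) :
    ∃ J : ℝ × (EuclideanSpace ℝ (Fin n) × Covec n) →L[ℝ] ℝ,
      HasFDerivWithinAt (fun p : ℝ × (EuclideanSpace ℝ (Fin n) × Covec n) =>
        localRep I x (Hs p.1) p.2) J (univ ×ˢ range (cotModel I)) (s, w) ∧
      ∀ a v, J (a, v) = a * deriv (fun s => localRep I x (Hs s) w) s +
        fderivWithin ℝ (localRep I x (Hs s)) (range (cotModel I)) w v := by
  have hwR : w ∈ range (cotModel I) := by
    rw [range_cotModel]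
    exact ⟨extChartAt_target_subset_range _ hw, mem_univ _⟩
  have h1 := ((h.contDiffWithinAt_localRep hs hw hw2).differentiableWithinAt
    (by simp)).hasFDerivWithinAt
  set J := fderivWithin ℝ (fun p : ℝ × (EuclideanSpace ℝ (Fin n) × Covec n) =>
    localRep I x (Hs p.1) p.2) (univ ×ˢ range (cotModel I)) (s, w)
  have h2 : HasDerivAt (fun s => localRep I x (Hs s) w) (J (1, 0)) s := by
    have h3 : HasDerivWithinAt (fun s' : ℝ => (s', w))
        ((1 : ℝ), (0 : EuclideanSpace ℝ (Fin n) × Covec n)) univ s :=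
      ((hasDerivAt_id s).prodMk (hasDerivAt_const _ _)).hasDerivWithinAt
    exact hasDerivWithinAt_univ.1 (h1.comp_hasDerivWithinAt (f := fun s' : ℝ => (s', w)) s h3
      (fun s' _ => ⟨mem_univ _, hwR⟩))
  have h4 : fderivWithin ℝ (localRep I x (Hs s)) (range (cotModel I)) w =
      J.comp (ContinuousLinearMap.inr ℝ ℝ (EuclideanSpace ℝ (Fin n) × Covec n)) := by
    refine HasFDerivWithinAt.fderivWithin ?_ ((cotModel I).uniqueDiffOn w hwR)
    exact HasFDerivWithinAt.comp (f := fun v => (s, v)) w h1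
      (hasFDerivAt_prodMk_right s w).hasFDerivWithinAt
      (fun v hv => ⟨mem_univ _, hv⟩)
  refine ⟨J, h1, fun a v => ?_⟩
  rw [h2.deriv, h4]
  have : ((a, v) : ℝ × (EuclideanSpace ℝ (Fin n) × Covec n)) = a • (1, 0) + (0, v) := by simp
  rw [this, map_add, map_smul]
  rfl

/-- In a chart the s-derivative is a partial derivative of a function smooth up to the boundary. Its
continuity makes the integrand of the variation formula continuous along each bicharacteristic. -/
theorem SmoothFamily.continuousOn_deriv {ε : ℝ} {Hs : ℝ → Cot I M → ℝ}
    (h : SmoothFamily ε Hs) {s : ℝ} (hs : s ∈ Ioo (-ε) ε) :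
    ContinuousOn (fun z => deriv (fun s => Hs s z) s) (nonzeroCot I M) := by
  intro z hz
  refine ContinuousAt.continuousWithinAt ?_
  set x := z.1 with hx
  have hzs : z ∈ (cotChart I x).source := mem_extChartAt_source z
  have hsrc : ∀ᶠ z' in 𝓝 z, z' ∈ (cotChart I x).source :=
    (isOpen_extChartAt_source _).mem_nhds hzs
  have hw : (cotChart I x z).1 ∈ (extChartAt I x).target :=
    mem_cotChart_target.1 ((cotChart I x).map_source hzs)
  have hw2 : (cotChart I x z).2 ≠ 0 :=
    (covec_eq_zero_iff (mem_chart_source X _)).not.1 hz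
  have hwR : cotChart I x z ∈ range (cotModel I) := mem_range_self _
  -- the partial derivative in the chart
  have h1 : ContDiffWithinAt ℝ ∞ (fun w : EuclideanSpace ℝ (Fin n) × Covec n =>
      fderivWithin ℝ (fun s' : ℝ => localRep I x (Hs s') w) univ s)
      (range (cotModel I)) (cotChart I x z) := by
    refine ContDiffWithinAt.fderivWithin (f := fun (w : EuclideanSpace ℝ (Fin n) × Covec n)
      (s' : ℝ) => localRep I x (Hs s') w) (g := fun _ => s) (n := ∞) (t := univ) ?_
      contDiffWithinAt_const uniqueDiffOn_univ (by simp) hwR (fun p hp => mem_univ _)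
    exact ContDiffWithinAt.comp (t := univ ×ˢ range (cotModel I))
      (g := fun p : ℝ × (EuclideanSpace ℝ (Fin n) × Covec n) => localRep I x (Hs p.1) p.2)
      (f := fun q : (EuclideanSpace ℝ (Fin n) × Covec n) × ℝ => (q.2, q.1)) (cotChart I x z, s)
      (h.contDiffWithinAt_localRep hs hw hw2)
      (contDiff_snd.prodMk contDiff_fst).contDiffWithinAt (fun q hq => ⟨mem_univ _, hq.1⟩)
  have h2 : ContinuousWithinAt (fun w : EuclideanSpace ℝ (Fin n) × Covec n =>
      deriv (fun s' : ℝ => localRep I x (Hs s') w) s) (range (cotModel I)) (cotChart I x z) := by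
    have h3 := h1.continuousWithinAt.clm_apply (continuousWithinAt_const (b := (1 : ℝ)))
    simpa only [fderivWithin_univ, fderiv_apply_one_eq_deriv] using h3
  have h4 : ContinuousAt (fun z' => deriv (fun s' : ℝ => localRep I x (Hs s') (cotChart I x z')) s)
      z := by
    refine Filter.Tendsto.comp (y := 𝓝[range (cotModel I)] (cotChart I x z)) h2 ?_
    exact tendsto_nhdsWithin_iff.2 ⟨continuousAt_extChartAt z,
      Filter.Eventually.of_forall fun z' => mem_range_self _⟩
  refine h4.congr ?_
  filter_upwards [hsrc] with z' hz'
  simp only [localRep, (cotChart I x).left_inv hz']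

theorem IsBichar.intervalIntegrable_deriv {ε : ℝ} {Hs : ℝ → Cot I M → ℝ}
    (h : SmoothFamily ε Hs) {s : ℝ} (hs : s ∈ Ioo (-ε) ε) {T : ℝ} {γ : ℝ → Cot I M}
    (hγ : IsBichar (Hs s) T γ) {a b : ℝ} (ha : 0 ≤ a) (hab : a ≤ b) (hb : b ≤ T) :
    IntervalIntegrable (fun t => deriv (fun s => Hs s (γ t)) s) MeasureTheory.volume a b := by
  refine ContinuousOn.intervalIntegrable ?_
  rw [uIcc_of_le hab]
  exact ((h.continuousOn_deriv hs).comp hγ.continuousOn hγ.nonzero).mono (Icc_subset_Icc ha hb)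

variable {P : Type*} [NormedAddCommGroup P] [NormedSpace ℝ P]

theorem contDiffAt_cotChart {ζ : P → Cot I M} {q₀ : P}
    (hζ : ContMDiffAt 𝓘(ℝ, P) (cotModel I) ∞ ζ q₀) {x : M}
    (hx : (ζ q₀).1 ∈ (chartAt X x).source) :
    ContDiffAt ℝ ∞ (fun q => cotChart I x (ζ q)) q₀ := by
  have h1 : ContMDiffAt (cotModel I) 𝓘(ℝ, EuclideanSpace ℝ (Fin n) × Covec n) ∞
      (cotChart I x) (ζ q₀) :=
    contMDiffAt_extChartAt' (by rw [chartAt_cot_source]; exact hx)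
  exact (ContMDiffAt.comp q₀ h1 hζ).contDiffAt

/-- The pullback of the canonical one-form `ξ dx` of `T*M` under the map `ζ`. -/
def liouville (I : ModelWithCorners ℝ (EuclideanSpace ℝ (Fin n)) X) {M : Type*}
    [TopologicalSpace M] [ChartedSpace X M] [IsManifold I ∞ M] {P : Type*} [NormedAddCommGroup P]
    [NormedSpace ℝ P] (ζ : P → Cot I M) (q₀ δ : P) : ℝ :=
  covec (ζ q₀) (mfderiv 𝓘(ℝ, P) I (fun q => (ζ q).1) q₀ δ)

/-- The one-form ξ dx has the same expression in all canonical charts. The definition uses the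
preferred chart at the base point, while computations use one fixed chart. -/
theorem liouville_eq {ζ : P → Cot I M} {q₀ : P}
    (hζ : ContMDiffAt 𝓘(ℝ, P) (cotModel I) ∞ ζ q₀) {x : M}
    (hx : (ζ q₀).1 ∈ (chartAt X x).source) (δ : P) :
    liouville I ζ q₀ δ = (cotChart I x (ζ q₀)).2 (fderiv ℝ (fun q => cotChart I x (ζ q)) q₀ δ).1 := by
  set y := (ζ q₀).1 with hy
  have hys : y ∈ (extChartAt I y).source := mem_extChartAt_source y
  have hyx : y ∈ (extChartAt I x).source := by rwa [extChartAt_source]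
  have hb : ContMDiffAt 𝓘(ℝ, P) I ∞ (fun q => (ζ q).1) q₀ :=
    ContMDiffAt.comp q₀ (contMDiff_proj _ _) hζ
  have hmd : MDifferentiableAt 𝓘(ℝ, P) I (fun q => (ζ q).1) q₀ := hb.mdifferentiableAt (by simp)
  obtain ⟨D, h1, hD⟩ : ∃ D : P →L[ℝ] EuclideanSpace ℝ (Fin n),
      HasFDerivAt (extChartAt I y ∘ fun q => (ζ q).1) D q₀ ∧
        ∀ δ, liouville I ζ q₀ δ = covec (ζ q₀) (D δ) := by
    refine ⟨mfderiv 𝓘(ℝ, P) I (fun q => (ζ q).1) q₀, ?_, fun _ => rfl⟩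
    have h0 := hmd.hasMFDerivAt.2
    rw [ModelWithCorners.range_eq_univ] at h0
    exact hasFDerivWithinAt_univ.1 h0
  have h2 := (hasFDerivWithinAt_tangentCoordChange (I := I) ⟨hys, hyx⟩).comp_hasFDerivAt q₀
    (f := extChartAt I y ∘ fun q => (ζ q).1) h1
    (Filter.Eventually.of_forall fun u => mem_range_self _)
  have hev : ∀ᶠ q in 𝓝 q₀, (ζ q).1 ∈ (extChartAt I y).source :=
    hb.continuousAt.preimage_mem_nhds ((isOpen_extChartAt_source y).mem_nhds hys)
  have h3 : HasFDerivAt (fun q => (cotChart I x (ζ q)).1)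
      ((tangentCoordChange I y x y).comp D) q₀ := by
    refine h2.congr_of_eventuallyEq ?_
    filter_upwards [hev] with q hq
    simp only [Function.comp_apply, cotChart_fst]
    rw [(extChartAt I y).left_inv hq]
  have h4 : HasFDerivAt (fun q => (cotChart I x (ζ q)).1)
      ((ContinuousLinearMap.fst ℝ _ _).comp (fderiv ℝ (fun q => cotChart I x (ζ q)) q₀)) q₀ :=
    ((contDiffAt_cotChart hζ hx).differentiableAt (by simp)).hasFDerivAt.fst
  have h5 := DFunLike.congr_fun (h3.unique h4) δ
  rw [hD, ← cotChart_snd_tangentCoordChange hx (D δ)]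
  exact congrArg (cotChart I x (ζ q₀)).2 h5

/-- A smooth family of bicharacteristics of `Hs (σ q)` from `Z q` to `ζ q` over the time interval
`[0, τ q]`, in the interior of `M` except for the endpoints, together with the formula for the first
variation of the endpoints. -/
structure Segment (Hs : ℝ → Cot I M → ℝ) (σ : P →L[ℝ] ℝ) (q₀ : P) (Z ζ : P → Cot I M)
    (τ : P → ℝ) : Prop where
  smooth_start : ∀ᶠ q in 𝓝 q₀, ContMDiffAt 𝓘(ℝ, P) (cotModel I) ∞ Z q
  smooth_end : ∀ᶠ q in 𝓝 q₀, ContMDiffAt 𝓘(ℝ, P) (cotModel I) ∞ ζ q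
  smooth_time : ∀ᶠ q in 𝓝 q₀, ContDiffAt ℝ ∞ τ q
  exists_bichar : ∀ᶠ q in 𝓝 q₀, 0 < τ q ∧ ∃ γ, IsBichar (Hs (σ q)) (τ q) γ ∧ γ 0 = Z q ∧
    γ (τ q) = ζ q ∧ ∀ t ∈ Ioo 0 (τ q), I.IsInteriorPoint (γ t).1
  variation : ∀ γ, IsBichar (Hs (σ q₀)) (τ q₀) γ → γ 0 = Z q₀ → ∀ δ,
    liouville I ζ q₀ δ = liouville I Z q₀ δ +
      τ q₀ * fderiv ℝ (fun q => Hs (σ q) (Z q)) q₀ δ +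
      2 * Hs (σ q₀) (Z q₀) * fderiv ℝ τ q₀ δ +
      σ δ * ∫ t in (0 : ℝ)..τ q₀, deriv (fun s => Hs s (γ t)) (σ q₀)

variable [T2Space M] {ε : ℝ} {Hs : ℝ → Cot I M → ℝ} {σ : P →L[ℝ] ℝ} {q₀ : P}

/-- In the sum of the two variation formulas the terms at the joint cancel, and the integrals and
the times add up. The energy at the joint equals the energy at the start, so the terms in dE and in
dτ combine. The joint has to be an interior point because a segment controls only its open time
interval. -/
theorem Segment.trans (hI : Convex ℝ (range I)) (hHs : SmoothFamily ε Hs)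
    (hσ : σ q₀ ∈ Ioo (-ε) ε) {Z ζ ζ' : P → Cot I M} {τ τ' : P → ℝ}
    (h : Segment Hs σ q₀ Z ζ τ) (h' : Segment Hs σ q₀ ζ ζ' τ') (hint : I.IsInteriorPoint (ζ q₀).1) :
    Segment Hs σ q₀ Z ζ' (fun q => τ q + τ' q) := by
  have hσ' : ∀ᶠ q in 𝓝 q₀, σ q ∈ Ioo (-ε) ε :=
    σ.continuous.continuousAt.preimage_mem_nhds (isOpen_Ioo.mem_nhds hσ)
  have hcont : ContinuousAt (fun q => (ζ q).1) q₀ :=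
    continuous_cot_proj.continuousAt.comp h.smooth_end.self_of_nhds.continuousAt
  have hint' : ∀ᶠ q in 𝓝 q₀, I.IsInteriorPoint (ζ q).1 :=
    hcont.preimage_mem_nhds ((I.isOpen_interior (n := ∞) (M := M) (by simp)).mem_nhds hint)
  -- The equality is needed on a neighbourhood of q₀, since the differential of the energy enters
  -- the formula.
  have henergy : (fun q => Hs (σ q) (ζ q)) =ᶠ[𝓝 q₀] fun q => Hs (σ q) (Z q) := by
    filter_upwards [h.exists_bichar, hσ'] with q hq hs
    obtain ⟨hpos, γ, hγ, h0, h1, -⟩ := hq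
    rw [← h0, ← h1]
    exact hγ.energy_eq (hHs.smooth hs) ⟨hpos.le, le_rfl⟩
  refine ⟨h.smooth_start, h'.smooth_end, ?_, ?_, ?_⟩
  · filter_upwards [h.smooth_time, h'.smooth_time] with q h1 h2
    exact h1.add h2
  · filter_upwards [h.exists_bichar, h'.exists_bichar, hint', hσ'] with q h1 h2 h3 hs
    obtain ⟨hp, γ, hγ, h0, h1, hi⟩ := h1
    obtain ⟨hp', γ', hγ', h0', h1', hi'⟩ := h2
    refine ⟨add_pos hp hp', _, hγ.glue (hHs.smooth hs) hp.le hγ' (h1.trans h0'.symm), ?_, ?_, ?_⟩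
    · rw [if_pos hp.le, h0]
    · rw [if_neg (by linarith), add_sub_cancel_left, h1']
    · intro t ht
      rcases lt_trichotomy t (τ q) with hlt | heq | hgt
      · rw [if_pos hlt.le]
        exact hi t ⟨ht.1, hlt⟩
      · rw [if_pos heq.le, heq, h1]
        exact h3
      · rw [if_neg (not_le.2 hgt)]
        exact hi' _ ⟨sub_pos.2 hgt, by linarith [ht.2]⟩
  · intro γ hγ h0 δ
    obtain ⟨hp, γ₁, hγ₁, h0₁, h1₁, -⟩ := h.exists_bichar.self_of_nhds
    have hp' := h'.exists_bichar.self_of_nhds.1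
    have hγa : IsBichar (Hs (σ q₀)) (τ q₀) γ := hγ.mono (by linarith)
    have he : γ (τ q₀) = ζ q₀ := by
      rw [← h1₁]
      exact hγa.eqOn hI (hHs.smooth hσ) hγ₁ (h0.trans h0₁.symm) ⟨hp.le, le_rfl⟩
    have hγb : IsBichar (Hs (σ q₀)) (τ' q₀) (fun t => γ (τ q₀ + t)) :=
      hγ.shift (hHs.smooth hσ) hp.le le_rfl
    have v1 := h.variation γ hγa h0 δ
    have v2 := h'.variation _ hγb (by simpa using he) δ
    have e2 : Hs (σ q₀) (ζ q₀) = Hs (σ q₀) (Z q₀) := henergy.self_of_nhds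
    rw [henergy.fderiv_eq, e2, v1] at v2
    rw [v2]
    have hint1 : ∫ t in (0 : ℝ)..(τ q₀ + τ' q₀), deriv (fun s => Hs s (γ t)) (σ q₀) =
        (∫ t in (0 : ℝ)..τ q₀, deriv (fun s => Hs s (γ t)) (σ q₀)) +
        ∫ t in (0 : ℝ)..τ' q₀, deriv (fun s => Hs s (γ (τ q₀ + t))) (σ q₀) := by
      rw [intervalIntegral.integral_comp_add_left
        (fun t => deriv (fun s => Hs s (γ t)) (σ q₀)), add_zero,
        intervalIntegral.integral_add_adjacent_intervals]
      · exact hγ.intervalIntegrable_deriv hHs hσ le_rfl hp.le (by linarith)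
      · exact hγ.intervalIntegrable_deriv hHs hσ hp.le (by linarith) le_rfl
    rw [hint1, fderiv_fun_add (h.smooth_time.self_of_nhds.differentiableAt (by simp))
      (h'.smooth_time.self_of_nhds.differentiableAt (by simp)), add_apply]
    ring

end Families

theorem HasDerivAt.pairing {E : Type*} [NormedAddCommGroup E] [NormedSpace ℝ E]
    {w v : ℝ → E × (E →L[ℝ] ℝ)} {w' v' : E × (E →L[ℝ] ℝ)} {u : ℝ} (hw : HasDerivAt w w' u)
    (hv : HasDerivAt v v' u) :
    HasDerivAt (fun h => (w h).2 (v h).1) (w'.2 (v u).1 + (w u).2 v'.1) u := by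
  have h1 : HasDerivAt (fun h => (w h).2) w'.2 u := (ContinuousLinearMap.snd ℝ E (E →L[ℝ] ℝ)).hasFDerivAt.comp_hasDerivAt u hw
  have h2 : HasDerivAt (fun h => (v h).1) v'.1 u := (ContinuousLinearMap.fst ℝ E (E →L[ℝ] ℝ)).hasFDerivAt.comp_hasDerivAt u hv
  exact h1.clm_apply h2

/-! ### Segments inside one chart and the first variation formula. -/

section ChartSegments

variable {n : ℕ} {X : Type*} [TopologicalSpace X]
  {I : ModelWithCorners ℝ (EuclideanSpace ℝ (Fin n)) X}
  {M : Type*} [TopologicalSpace M] [ChartedSpace X M] [IsManifold I ∞ M]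

theorem contMDiffAt_cotChart_symm {P : Type*} [NormedAddCommGroup P] [NormedSpace ℝ P] {x : M}
    {W : P → EuclideanSpace ℝ (Fin n) × Covec n} {q : P} (hW : ContDiffAt ℝ ∞ W q)
    (hmem : ∀ᶠ q' in 𝓝 q, (W q').1 ∈ (extChartAt I x).target) :
    ContMDiffAt 𝓘(ℝ, P) (cotModel I) ∞ (fun q' => (cotChart I x).symm (W q')) q := by
  have h1 : ContMDiffWithinAt 𝓘(ℝ, EuclideanSpace ℝ (Fin n) × Covec n) (cotModel I) ∞
      (cotChart I x).symm (range (cotModel I)) (W q) :=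
    contMDiffWithinAt_extChartAt_symm_range (I := cotModel I) _
      (mem_cotChart_target.2 hmem.self_of_nhds)
  have h2 : ContMDiffWithinAt 𝓘(ℝ, P) (cotModel I) ∞ (fun q' => (cotChart I x).symm (W q'))
      (W ⁻¹' range (cotModel I)) q :=
    ContMDiffWithinAt.comp (t := range (cotModel I)) q h1 hW.contMDiffAt.contMDiffWithinAt
      (fun q' hq' => hq')
  refine h2.contMDiffAt ?_
  filter_upwards [hmem] with q' hq'
  rw [mem_preimage, range_cotModel]
  exact ⟨extChartAt_target_subset_range _ hq', mem_univ _⟩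

variable {H : Cot I M → ℝ}

/-- A curve in a chart that is a bicharacteristic up to a change of the time, which may have
critical points at the ends. -/
theorem exists_isBichar_of_chart (hH : ContMDiffOn (cotModel I) 𝓘(ℝ, ℝ) ∞ H (nonzeroCot I M)) {x : M}
    {w : ℝ → EuclideanSpace ℝ (Fin n) × Covec n} {τ τ' : ℝ → ℝ}
    (hw : ∀ u ∈ Icc (0 : ℝ) 1, (w u).1 ∈ (extChartAt I x).target ∧ (w u).2 ≠ 0)
    (hint : ∀ u ∈ Ioo (0 : ℝ) 1, (w u).1 ∈ interior (range I))
    (hwd : ∀ u ∈ Icc (0 : ℝ) 1, HasDerivAt w (τ' u • hamLoc x H (w u)) u)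
    (hτ : ∀ u ∈ Icc (0 : ℝ) 1, HasDerivAt τ (τ' u) u) (hpos : ∀ u ∈ Ioo (0 : ℝ) 1, 0 < τ' u)
    (hτ0 : τ 0 = 0) :
    0 < τ 1 ∧ ∃ γ, IsBichar H (τ 1) γ ∧
      (∀ u ∈ Icc (0 : ℝ) 1, τ u ∈ Icc 0 (τ 1) ∧ γ (τ u) = (cotChart I x).symm (w u)) ∧
      ∀ t ∈ Ioo 0 (τ 1), I.IsInteriorPoint (γ t).1 := by
  have hwR : ∀ u ∈ Icc (0 : ℝ) 1, w u ∈ range (cotModel I) := by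
    intro u hu
    rw [range_cotModel]
    exact ⟨extChartAt_target_subset_range _ (hw u hu).1, mem_univ _⟩
  have hwc : ContinuousOn w (Icc 0 1) := fun u hu => (hwd u hu).continuousAt.continuousWithinAt
  have hv : ContinuousOn (fun u => hamLoc x H (w u)) (Icc 0 1) := by
    intro u hu
    exact ContinuousWithinAt.comp (g := hamLoc x H) (t := range (cotModel I))
      (contDiffWithinAt_hamLoc hH (hw u hu).1 (hw u hu).2).continuousWithinAt (hwc u hu) hwR
  obtain ⟨hlt, κ, h0, h1, hκc, hκm, hκi, hκinv, hκd⟩ := exists_reparam zero_lt_one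
    (fun u hu => (hτ u hu).continuousAt.continuousWithinAt)
    (fun u hu => hτ u (Ioo_subset_Icc_self hu)) hpos hwc hv
    (fun u hu => hwd u (Ioo_subset_Icc_self hu))
  rw [hτ0] at hlt h0 hκc hκm hκi hκinv hκd
  have hsrc : ∀ t ∈ Icc 0 (τ 1), ((cotChart I x).symm (w (κ t))).1 ∈ (chartAt X x).source :=
    fun t ht => cotChart_symm_fst_mem (hw _ (hκm ht)).1
  have hright : ∀ t ∈ Icc 0 (τ 1), cotChart I x ((cotChart I x).symm (w (κ t))) = w (κ t) :=
    fun t ht => (cotChart I x).right_inv (mem_cotChart_target.2 (hw _ (hκm ht)).1)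
  refine ⟨hlt, fun t => (cotChart I x).symm (w (κ t)), ?_, ?_, ?_⟩
  · refine .of_hasDerivWithinAt hH ?_ ?_ ?_
    · exact (continuousOn_extChartAt_symm _).comp (hwc.comp hκc hκm)
        fun t ht => mem_cotChart_target.2 (hw _ (hκm ht)).1
    · exact fun t ht => cotChart_symm_mem_nonzeroCot (hw _ (hκm ht)).1 (hw _ (hκm ht)).2
    · intro t ht
      refine ⟨x, hsrc t ht, ?_⟩
      rw [hright t ht]
      exact (hκd t ht).congr (fun s hs => hright s hs) (hright t ht)
  · intro u hu
    refine ⟨(hκinv u hu).1, ?_⟩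
    simp only [(hκinv u hu).2]
  · intro t ht
    have ht' := Ioo_subset_Icc_self ht
    rw [isInteriorPoint_iff_chart (hsrc t ht'), ← cotChart_fst, hright t ht']
    exact hint _ (hκi ht)

variable {P : Type*} [NormedAddCommGroup P] [NormedSpace ℝ P]
  [T2Space M] {ε : ℝ} {Hs : ℝ → Cot I M → ℝ} {σ : P →L[ℝ] ℝ} {q₀ : P}

/-- With W = (x, ξ), f the s-derivative of the family, and δ a direction of the parameters, the
quantity ξ·δx - 2E δτ - τ δE - δs ∫₀^τ f dt is constant along the curve. Its u-derivative vanishes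
by Euler's identity and conservation of energy, both differentiated in the direction δ; comparing u
= 0 with u = 1 gives the variation formula. The curve is parameterized by u ∈ [0, 1] and the time is
a function τ(q, u) that may be critical at the ends, as needed for folded coordinates at the
boundary. -/
theorem segment_of_chart (hI : Convex ℝ (range I)) (hHs : HamFamily ε Hs)
    (hσ : σ q₀ ∈ Ioo (-ε) ε) {x : M} {W : P × ℝ → EuclideanSpace ℝ (Fin n) × Covec n}
    {τ : P × ℝ → ℝ}
    (hW : ∀ᶠ q in 𝓝 q₀, ∀ u ∈ Icc (0 : ℝ) 1, ContDiffAt ℝ ∞ W (q, u))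
    (hτ : ∀ᶠ q in 𝓝 q₀, ∀ u ∈ Icc (0 : ℝ) 1, ContDiffAt ℝ ∞ τ (q, u))
    (hmem : ∀ᶠ q in 𝓝 q₀, ∀ u ∈ Icc (0 : ℝ) 1,
      (W (q, u)).1 ∈ (extChartAt I x).target ∧ (W (q, u)).2 ≠ 0)
    (hint : ∀ᶠ q in 𝓝 q₀, ∀ u ∈ Ioo (0 : ℝ) 1, (W (q, u)).1 ∈ interior (range I))
    (hτ0 : ∀ᶠ q in 𝓝 q₀, τ (q, 0) = 0)
    (hpos : ∀ᶠ q in 𝓝 q₀, ∀ u ∈ Ioo (0 : ℝ) 1, 0 < fderiv ℝ τ (q, u) (0, 1))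
    (hflow : ∀ᶠ q in 𝓝 q₀, ∀ u ∈ Icc (0 : ℝ) 1,
      fderiv ℝ W (q, u) (0, 1) = fderiv ℝ τ (q, u) (0, 1) • hamLoc x (Hs (σ q)) (W (q, u))) :
    Segment Hs σ q₀ (fun q => (cotChart I x).symm (W (q, 0)))
      (fun q => (cotChart I x).symm (W (q, 1))) (fun q => τ (q, 1)) := by
  have hσ' : ∀ᶠ q in 𝓝 q₀, σ q ∈ Ioo (-ε) ε :=
    σ.continuous.continuousAt.preimage_mem_nhds (isOpen_Ioo.mem_nhds hσ)
  have h01 : (0 : ℝ) ∈ Icc (0 : ℝ) 1 := ⟨le_rfl, zero_le_one⟩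
  have h11 : (1 : ℝ) ∈ Icc (0 : ℝ) 1 := ⟨zero_le_one, le_rfl⟩
  have hpart : ∀ {G : Type} [NormedAddCommGroup G] [NormedSpace ℝ G] {f : P × ℝ → G} {q : P}
      {u : ℝ}, ContDiffAt ℝ ∞ f (q, u) →
      HasDerivAt (fun u => f (q, u)) (fderiv ℝ f (q, u) (0, 1)) u := by
    intro G _ _ f q u hf
    exact HasFDerivAt.comp_hasDerivAt (l := f) u (hf.differentiableAt (by simp)).hasFDerivAt
      ((hasDerivAt_const u q).prodMk (hasDerivAt_id u))
  have hex : ∀ᶠ q in 𝓝 q₀, 0 < τ (q, 1) ∧ ∃ γ, IsBichar (Hs (σ q)) (τ (q, 1)) γ ∧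
      (∀ u ∈ Icc (0 : ℝ) 1, τ (q, u) ∈ Icc 0 (τ (q, 1)) ∧
        γ (τ (q, u)) = (cotChart I x).symm (W (q, u))) ∧
      ∀ t ∈ Ioo 0 (τ (q, 1)), I.IsInteriorPoint (γ t).1 := by
    filter_upwards [hσ', hW, hτ, hmem, hint, hτ0, hpos, hflow] with q h1 h2 h3 h4 h5 h6 h7 h8
    exact exists_isBichar_of_chart (hHs.smooth.smooth h1) (w := fun u => W (q, u))
      (τ := fun u => τ (q, u)) (τ' := fun u => fderiv ℝ τ (q, u) (0, 1)) h4 h5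
      (fun u hu => (hpart (h2 u hu)).congr_deriv (h8 u hu)) (fun u hu => hpart (h3 u hu)) h7 h6
  have hsmooth : ∀ u ∈ Icc (0 : ℝ) 1, ∀ᶠ q in 𝓝 q₀,
      ContMDiffAt 𝓘(ℝ, P) (cotModel I) ∞ (fun q => (cotChart I x).symm (W (q, u))) q := by
    intro u hu
    filter_upwards [hW, hmem.eventually_nhds] with q h1 h2
    refine contMDiffAt_cotChart_symm ((h1 u hu).comp q
      (contDiff_id.prodMk contDiff_const).contDiffAt) (h2.mono fun q' h => (h u hu).1)
  refine ⟨hsmooth 0 h01, hsmooth 1 h11, ?_, ?_, ?_⟩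
  · filter_upwards [hτ] with q h
    exact (h 1 h11).comp q (contDiff_id.prodMk contDiff_const).contDiffAt
  · filter_upwards [hex, hτ0] with q h h'
    obtain ⟨hp, γ, hγ, h1, h2⟩ := h
    refine ⟨hp, γ, hγ, ?_, (h1 1 h11).2, h2⟩
    rw [← (h1 0 h01).2, h']
  intro γ hγ hγ0 δ
  set E : P → ℝ := fun q => Hs (σ q) ((cotChart I x).symm (W (q, 0))) with hE
  set T := τ (q₀, 1) with hT
  -- the energy in the chart
  have henergy : ∀ᶠ q in 𝓝 q₀, ∀ u ∈ Icc (0 : ℝ) 1,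
      localRep I x (Hs (σ q)) (W (q, u)) = E q := by
    filter_upwards [hex, hσ', hτ0] with q h hs h0 u hu
    obtain ⟨hp, γ', hγ', h1, -⟩ := h
    rw [localRep, hE, ← (h1 u hu).2]
    have h3 := (h1 0 h01).2
    rw [h0] at h3
    simp only
    rw [← h3]
    exact hγ'.energy_eq (hHs.smooth.smooth hs) (h1 u hu).1
  obtain ⟨hTpos, hγW⟩ : 0 < T ∧ ∀ u ∈ Icc (0 : ℝ) 1, τ (q₀, u) ∈ Icc 0 T ∧
      γ (τ (q₀, u)) = (cotChart I x).symm (W (q₀, u)) := by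
    obtain ⟨hp, γ', hγ', h1, -⟩ := hex.self_of_nhds
    refine ⟨hp, fun u hu => ⟨(h1 u hu).1, ?_⟩⟩
    rw [← (h1 u hu).2]
    refine hγ.eqOn hI (hHs.smooth.smooth hσ) hγ' ?_ (h1 u hu).1
    rw [hγ0, ← (h1 0 h01).2, hτ0.self_of_nhds]
  have hW₀ := hW.self_of_nhds
  have hτ₀ := hτ.self_of_nhds
  have hmem₀ := hmem.self_of_nhds
  have hflow₀ := hflow.self_of_nhds
  have hEd : DifferentiableAt ℝ E q₀ := by
    have h1 : ContMDiffAt 𝓘(ℝ, P) (𝓘(ℝ, ℝ).prod (cotModel I)) ∞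
        (fun q => (σ q, (cotChart I x).symm (W (q, 0)))) q₀ :=
      σ.contDiff.contMDiff.contMDiffAt.prodMk (hsmooth 0 h01).self_of_nhds
    have h2 := ContMDiffAt.comp q₀ (hHs.smooth.contMDiffAt hσ
      (cotChart_symm_mem_nonzeroCot (hmem₀ 0 h01).1 (hmem₀ 0 h01).2)) h1
    exact (h2.contDiffAt).differentiableAt (by simp)
  -- the primitive of the derivative of the family along the curve
  set φ : ℝ → ℝ := IccExtend hTpos.le
    ((Icc 0 T).domRestrict fun t => deriv (fun s => Hs s (γ t)) (σ q₀)) with hφ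
  -- The extension by constants outside [0, T] is continuous on ℝ, so its primitive is
  -- differentiable at 0 and T as well.
  have hφc : Continuous φ := by
    refine Continuous.Icc_extend' ?_
    exact ((hHs.smooth.continuousOn_deriv hσ).comp hγ.continuousOn hγ.nonzero).domRestrict
  have hφeq : ∀ t ∈ Icc 0 T, φ t = deriv (fun s => Hs s (γ t)) (σ q₀) := fun t ht =>
    IccExtend_of_mem _ _ ht
  have hφint : ∫ t in (0 : ℝ)..T, φ t = ∫ t in (0 : ℝ)..T, deriv (fun s => Hs s (γ t)) (σ q₀) := by
    refine intervalIntegral.integral_congr fun t ht => ?_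
    rw [uIcc_of_le hTpos.le] at ht
    exact hφeq t ht
  -- the quantity that is constant along the curve
  set A : ℝ → ℝ := fun u => (W (q₀, u)).2 (fderiv ℝ W (q₀, u) (δ, 0)).1 -
    2 * E q₀ * fderiv ℝ τ (q₀, u) (δ, 0) - τ (q₀, u) * fderiv ℝ E q₀ δ -
    σ δ * ∫ t in (0 : ℝ)..τ (q₀, u), φ t with hA
  have hAd : ∀ u ∈ Icc (0 : ℝ) 1, HasDerivAt A 0 u := by
    intro u hu
    obtain ⟨DW, hDW, hDW'⟩ := exists_mixed_deriv (hW₀ u hu) δ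
    obtain ⟨Dτ, hDτ, hDτ'⟩ := exists_mixed_deriv (hτ₀ u hu) δ
    have hWl := hasDerivAt_line (f := fun q => W (q, u)) δ
      (((hW₀ u hu).comp q₀ (contDiff_id.prodMk contDiff_const).contDiffAt).differentiableAt
        (by simp))
    have hXeq : fderiv ℝ (fun q => W (q, u)) q₀ δ = fderiv ℝ W (q₀, u) (δ, 0) := by
      have := HasFDerivAt.comp q₀ (g := W) (f := fun q => (q, u))
        ((hW₀ u hu).differentiableAt (by simp)).hasFDerivAt (hasFDerivAt_prodMk_left q₀ u)
      have e : fderiv ℝ (fun q => W (q, u)) q₀ = _ := this.fderiv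
      rw [e]
      rfl
    rw [hXeq] at hWl
    have hEl := hasDerivAt_line δ hEd
    have hline : Filter.Tendsto (fun h : ℝ => q₀ + h • δ) (𝓝 0) (𝓝 q₀) := by
      have : ContinuousAt (fun h : ℝ => q₀ + h • δ) 0 := by fun_prop
      simpa [ContinuousAt] using this
    set a := hamLoc x (Hs (σ q₀)) (W (q₀, u)) with ha
    set Xu := fderiv ℝ W (q₀, u) (δ, 0) with hX
    set tu := fderiv ℝ τ (q₀, u) (0, 1) with htu
    -- Euler's identity, differentiated
    have euler : Xu.2 (tu • a).1 + (W (q₀, u)).2 DW.1 =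
        2 * (Dτ * E q₀ + tu * fderiv ℝ E q₀ δ) := by
      have e1 : HasDerivAt (fun h : ℝ => (W (q₀ + h • δ, u)).2
          (fderiv ℝ W (q₀ + h • δ, u) (0, 1)).1)
          (Xu.2 (fderiv ℝ W (q₀ + (0 : ℝ) • δ, u) (0, 1)).1 +
            (W (q₀ + (0 : ℝ) • δ, u)).2 DW.1) 0 :=
        hWl.pairing hDW'
      have e2 : HasDerivAt (fun h : ℝ => 2 * (fderiv ℝ τ (q₀ + h • δ, u) (0, 1) * E (q₀ + h • δ)))
          (2 * (Dτ * E (q₀ + (0 : ℝ) • δ) +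
            fderiv ℝ τ (q₀ + (0 : ℝ) • δ, u) (0, 1) * fderiv ℝ E q₀ δ)) 0 :=
        (hDτ'.mul hEl).const_mul 2
      have e3 : (fun h : ℝ => (W (q₀ + h • δ, u)).2 (fderiv ℝ W (q₀ + h • δ, u) (0, 1)).1)
          =ᶠ[𝓝 0] fun h : ℝ => 2 * (fderiv ℝ τ (q₀ + h • δ, u) (0, 1) * E (q₀ + h • δ)) := by
        refine hline.eventually (p := fun q => (W (q, u)).2 (fderiv ℝ W (q, u) (0, 1)).1 =
          2 * (fderiv ℝ τ (q, u) (0, 1) * E q)) ?_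
        filter_upwards [hflow, hmem, henergy, hσ'] with q f1 f2 f3 f4
        rw [f1 u hu, Prod.smul_fst, map_smul, (hHs.isHomogeneousSmooth f4).euler (f2 u hu).1
          (f2 u hu).2, f3 u hu, smul_eq_mul]
        ring
      have e4 := e1.unique (e2.congr_of_eventuallyEq e3)
      simpa only [zero_smul, add_zero, hflow₀ u hu] using e4
    -- conservation of the energy, differentiated
    have energy : fderiv ℝ E q₀ δ = σ δ * φ (τ (q₀, u)) + (Xu.2 a.1 - a.2 Xu.1) := by
      obtain ⟨J, hJ, hJ'⟩ := hHs.smooth.exists_hasFDerivWithinAt hσ (hmem₀ u hu).1 (hmem₀ u hu).2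
      have e1 : HasDerivAt (fun h : ℝ => (σ (q₀ + h • δ), W (q₀ + h • δ, u))) (σ δ, Xu) 0 := by
        have := hasDerivAt_line (f := σ) (q₀ := q₀) δ σ.differentiableAt
        rw [ContinuousLinearMap.fderiv] at this
        exact this.prodMk hWl
      have e1m : ∀ᶠ h : ℝ in 𝓝 0, (σ (q₀ + h • δ), W (q₀ + h • δ, u)) ∈
          (univ : Set ℝ) ×ˢ range (cotModel I) := by
        refine (hline.eventually hmem).mono fun h hh => ⟨mem_univ _, ?_⟩
        rw [range_cotModel]
        exact ⟨extChartAt_target_subset_range _ (hh u hu).1, mem_univ _⟩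
      have e2 : HasDerivAt (fun h : ℝ => localRep I x (Hs (σ (q₀ + h • δ))) (W (q₀ + h • δ, u)))
          (J (σ δ, Xu)) 0 := by
        have hJ0 : HasFDerivWithinAt (fun p : ℝ × (EuclideanSpace ℝ (Fin n) × Covec n) =>
            localRep I x (Hs p.1) p.2) J (univ ×ˢ range (cotModel I))
            (σ (q₀ + (0 : ℝ) • δ), W (q₀ + (0 : ℝ) • δ, u)) := by
          simpa only [zero_smul, add_zero] using hJ
        exact hJ0.comp_hasDerivAt (f := fun h : ℝ => (σ (q₀ + h • δ), W (q₀ + h • δ, u))) 0 e1 e1m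
      have e3 := e2.unique (hEl.congr_of_eventuallyEq
        ((hline.eventually henergy).mono fun h hh => hh u hu))
      rw [← e3, hJ', apply_eq_sgrad, hφeq _ (hγW u hu).1, (hγW u hu).2]
      rfl
    have hτu : HasDerivAt (fun u => τ (q₀, u)) tu u := hpart (hτ₀ u hu)
    have hWu : HasDerivAt (fun u => W (q₀, u)) (tu • a) u :=
      (hpart (hW₀ u hu)).congr_deriv (hflow₀ u hu)
    have hF : HasDerivAt (fun u => ∫ t in (0 : ℝ)..τ (q₀, u), φ t) (φ (τ (q₀, u)) * tu) u :=
      HasDerivAt.comp (h₂ := fun v => ∫ t in (0 : ℝ)..v, φ t) u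
        (intervalIntegral.integral_hasDerivAt_right (hφc.intervalIntegrable _ _)
          (hφc.stronglyMeasurableAtFilter _ _) hφc.continuousAt) hτu
    have hd := (((hWu.pairing hDW).sub (hDτ.const_mul (2 * E q₀))).sub
      (hτu.mul_const (fderiv ℝ E q₀ δ))).sub (hF.const_mul (σ δ))
    refine hd.congr_deriv ?_
    simp only [Prod.smul_fst, Prod.smul_snd, smul_apply, map_smul, smul_eq_mul] at euler energy ⊢
    -- The mixed derivatives of W and τ enter only through Euler's identity; what remains is tu
    -- times the differentiated energy identity.
    linear_combination euler + tu * energy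
  have hA01 : A 1 = A 0 := by
    obtain ⟨c, -, hc⟩ := exists_hasDerivAt_eq_slope A (fun _ => 0) zero_lt_one
      (fun u hu => (hAd u hu).continuousAt.continuousWithinAt)
      (fun u hu => hAd u (Ioo_subset_Icc_self hu))
    simp only [sub_zero, div_one] at hc
    linarith
  have hli : ∀ u ∈ Icc (0 : ℝ) 1, liouville I (fun q => (cotChart I x).symm (W (q, u))) q₀ δ =
      (W (q₀, u)).2 (fderiv ℝ W (q₀, u) (δ, 0)).1 := by
    intro u hu
    rw [liouville_eq (hsmooth u hu).self_of_nhds (cotChart_symm_fst_mem (hmem₀ u hu).1)]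
    have e1 : (fun q => cotChart I x ((cotChart I x).symm (W (q, u)))) =ᶠ[𝓝 q₀]
        fun q => W (q, u) := by
      filter_upwards [hmem] with q hq
      exact (cotChart I x).right_inv (mem_cotChart_target.2 (hq u hu).1)
    have e2 := HasFDerivAt.comp q₀ (g := W) (f := fun q => (q, u))
        ((hW₀ u hu).differentiableAt (by simp)).hasFDerivAt (hasFDerivAt_prodMk_left q₀ u)
    have e3 : fderiv ℝ (fun q => W (q, u)) q₀ = _ := e2.fderiv
    have e4 := e1.self_of_nhds
    simp only at e4
    rw [e1.fderiv_eq, e4, e3]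
    rfl
  have hdτ : ∀ u ∈ Icc (0 : ℝ) 1, fderiv ℝ (fun q => τ (q, u)) q₀ δ =
      fderiv ℝ τ (q₀, u) (δ, 0) := by
    intro u hu
    have e2 := HasFDerivAt.comp q₀ (g := τ) (f := fun q => (q, u))
        ((hτ₀ u hu).differentiableAt (by simp)).hasFDerivAt (hasFDerivAt_prodMk_left q₀ u)
    have e3 : fderiv ℝ (fun q => τ (q, u)) q₀ = _ := e2.fderiv
    rw [e3]
    rfl
  -- All curves of the family start at time 0, so at u = 0 only the term ξ·δx is left.
  have hτ00 : fderiv ℝ τ (q₀, 0) (δ, 0) = 0 := by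
    rw [← hdτ 0 h01]
    have e : (fun q => τ (q, 0)) =ᶠ[𝓝 q₀] fun _ => (0 : ℝ) := hτ0
    rw [e.fderiv_eq, fderiv_fun_const]
    rfl
  have hτ00' : τ (q₀, 0) = 0 := hτ0.self_of_nhds
  simp only [hA, hτ00, hτ00', intervalIntegral.integral_same, mul_zero, zero_mul, sub_zero] at hA01
  rw [hli 1 h11, hli 0 h01, hdτ 1 h11, ← hφint]
  linear_combination hA01

end ChartSegments

theorem eq_of_hasDerivAt_zero {G : Type*} [NormedAddCommGroup G] [NormedSpace ℝ G] {r : ℝ}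
    {f : ℝ → G} (hf : ∀ t ∈ Ioo (-r) r, HasDerivAt f 0 t) {t : ℝ} (ht : t ∈ Ioo (-r) r) :
    f t = f 0 := by
  have hr : 0 < r := by linarith [ht.1, ht.2]
  refine (convex_Ioo (-r) r).is_const_of_fderivWithin_eq_zero (𝕜 := ℝ)
    (fun u hu => (hf u hu).differentiableAt.differentiableWithinAt) ?_ ht ⟨by linarith, hr⟩
  intro u hu
  rw [fderivWithin_of_mem_nhds (Ioo_mem_nhds hu.1 hu.2)]
  have h1 := (hf u hu).hasFDerivAt.fderiv
  rw [h1]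
  ext
  simp

theorem fderiv_apply_zero_one {P G : Type*} [NormedAddCommGroup P] [NormedSpace ℝ P]
    [NormedAddCommGroup G] [NormedSpace ℝ G] {f : P × ℝ → G} {q : P} {u : ℝ} {v : G}
    (hf : ContDiffAt ℝ ∞ f (q, u)) (h : HasDerivAt (fun u => f (q, u)) v u) :
    fderiv ℝ f (q, u) (0, 1) = v :=
  (HasFDerivAt.comp_hasDerivAt (l := f) u (hf.differentiableAt (by simp)).hasFDerivAt
    ((hasDerivAt_const u q).prodMk (hasDerivAt_id u))).unique h

/-! ### Propagation through the interior. -/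

section Propagation

variable {n : ℕ} {X : Type*} [TopologicalSpace X]
  {I : ModelWithCorners ℝ (EuclideanSpace ℝ (Fin n)) X}
  {M : Type*} [TopologicalSpace M] [ChartedSpace X M] [IsManifold I ∞ M]
  {P : Type*} [NormedAddCommGroup P] [NormedSpace ℝ P]
  {ε : ℝ} {Hs : ℝ → Cot I M → ℝ} {σ : P →L[ℝ] ℝ} {q₀ : P}

theorem Segment.congr {Z Z' ζ ζ' : P → Cot I M} {τ τ' : P → ℝ} (h : Segment Hs σ q₀ Z ζ τ)
    (hZ : Z =ᶠ[𝓝 q₀] Z') (hζ : ζ =ᶠ[𝓝 q₀] ζ') (hτ : τ =ᶠ[𝓝 q₀] τ') :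
    Segment Hs σ q₀ Z' ζ' τ' := by
  have hli : ∀ {f g : P → Cot I M}, ContMDiffAt 𝓘(ℝ, P) (cotModel I) ∞ f q₀ → f =ᶠ[𝓝 q₀] g →
      ∀ δ, liouville I f q₀ δ = liouville I g q₀ δ := by
    intro f g hf hfg δ
    have hfg₀ : f q₀ = g q₀ := hfg.self_of_nhds
    have hg : ContMDiffAt 𝓘(ℝ, P) (cotModel I) ∞ g q₀ := hf.congr_of_eventuallyEq hfg.symm
    rw [liouville_eq hf (mem_chart_source X _),
      liouville_eq hg (x := (f q₀).1) (by rw [← hfg₀]; exact mem_chart_source X _)]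
    have e1 : (fun q => cotChart I (f q₀).1 (f q)) =ᶠ[𝓝 q₀] fun q => cotChart I (f q₀).1 (g q) :=
      hfg.fun_comp _
    rw [e1.fderiv_eq, hfg₀]
  refine ⟨?_, ?_, ?_, ?_, ?_⟩
  · filter_upwards [h.smooth_start, hZ.eventually_nhds] with q h1 h2
    exact h1.congr_of_eventuallyEq (Filter.EventuallyEq.symm h2)
  · filter_upwards [h.smooth_end, hζ.eventually_nhds] with q h1 h2
    exact h1.congr_of_eventuallyEq (Filter.EventuallyEq.symm h2)
  · filter_upwards [h.smooth_time, hτ.eventually_nhds] with q h1 h2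
    exact h1.congr_of_eventuallyEq (Filter.EventuallyEq.symm h2)
  · filter_upwards [h.exists_bichar, hZ, hζ, hτ] with q h1 h2 h3 h4
    rw [← h2, ← h3, ← h4]
    exact h1
  · intro γ hγ h0 δ
    have e1 : Z q₀ = Z' q₀ := hZ.self_of_nhds
    have e2 : τ q₀ = τ' q₀ := hτ.self_of_nhds
    have e3 : (fun q => Hs (σ q) (Z q)) =ᶠ[𝓝 q₀] fun q => Hs (σ q) (Z' q) :=
      hZ.mono fun q hq => by simp only [hq]
    have h1 := h.variation γ (e2 ▸ hγ) (h0.trans e1.symm) δ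
    rw [← hli h.smooth_end.self_of_nhds hζ, ← hli h.smooth_start.self_of_nhds hZ, ← e3.fderiv_eq, ← hτ.fderiv_eq, ← e1, ← e2]
    exact h1

variable [T2Space M]

theorem Segment.end_eq (hI : Convex ℝ (range I)) (hHs : SmoothFamily ε Hs)
    (hσ : σ q₀ ∈ Ioo (-ε) ε) {Z ζ : P → Cot I M} {τ : P → ℝ} (h : Segment Hs σ q₀ Z ζ τ)
    {γ : ℝ → Cot I M} {T : ℝ} (hγ : IsBichar (Hs (σ q₀)) T γ) (hT : τ q₀ ≤ T) (h0 : γ 0 = Z q₀) :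
    ζ q₀ = γ (τ q₀) := by
  obtain ⟨hp, γ', hγ', h0', h1', -⟩ := h.exists_bichar.self_of_nhds
  rw [← h1']
  exact hγ'.eqOn hI (hHs.smooth hσ) (hγ.mono hT) (h0'.trans h0.symm) ⟨hp.le, le_rfl⟩

/-- The flow near an interior point, over any short time interval. -/
theorem exists_interior_segment (hI : Convex ℝ (range I)) (hHs : HamFamily ε Hs)
    (hσ : σ q₀ ∈ Ioo (-ε) ε) {z₀ : Cot I M} (hz₀ : z₀ ∈ nonzeroCot I M)
    (hint : I.IsInteriorPoint z₀.1) :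
    ∃ r > 0, ∀ᶠ z in 𝓝 z₀, ∀ a ∈ Ioo 0 r, ∀ ζ : P → Cot I M, ζ q₀ = z →
      (∀ᶠ q in 𝓝 q₀, ContMDiffAt 𝓘(ℝ, P) (cotModel I) ∞ ζ q) →
      ∃ ζ', Segment Hs σ q₀ ζ ζ' (fun _ => a) := by
  set x := z₀.1 with hx
  have hzs : z₀ ∈ (cotChart I x).source := mem_extChartAt_source z₀
  set w₀ := cotChart I x z₀ with hw₀
  set Ω : Set (ℝ × (EuclideanSpace ℝ (Fin n) × Covec n)) :=
    Ioo (-ε) ε ×ˢ (interior (extChartAt I x).target ×ˢ {ξ | ξ ≠ 0}) with hΩ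
  have hΩo : IsOpen Ω := isOpen_Ioo.prod (isOpen_interior.prod isOpen_ne)
  have hmem : (σ q₀, w₀) ∈ Ω := by
    refine ⟨hσ, ?_, (covec_eq_zero_iff (mem_chart_source X _)).not.1 hz₀⟩
    rw [hw₀, cotChart_fst]
    exact (I.isInteriorPoint_iff_of_mem_atlas (n := ∞) (by simp) (chart_mem_atlas X x)
      (mem_chart_source X _)).1 hint
  -- The parameter s is carried along as a state variable with zero velocity; a single flow is then
  -- smooth in s and in the covector.
  have hv : ContDiffOn ℝ ∞ (fun p : ℝ × (EuclideanSpace ℝ (Fin n) × Covec n) =>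
      ((0 : ℝ), hamLoc x (Hs p.1) p.2)) Ω := by
    rintro ⟨s, w⟩ ⟨hs, hw, hw2⟩
    have h1 := hHs.smooth.contDiffWithinAt_hamLoc hs (x := x) (interior_subset hw) hw2
    have h2 : (univ : Set ℝ) ×ˢ range (cotModel I) ∈ 𝓝 (s, w) := by
      rw [range_cotModel]
      refine Filter.mem_of_superset ((isOpen_univ.prod
        (isOpen_interior.prod isOpen_univ)).mem_nhds ⟨mem_univ _, hw, mem_univ _⟩) ?_
      rintro ⟨s', w'⟩ ⟨-, h3, -⟩
      exact ⟨mem_univ _, extChartAt_target_subset_range _ (interior_subset h3), mem_univ _⟩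
    exact (contDiffAt_const.prodMk (h1.contDiffAt h2)).contDiffWithinAt
  obtain ⟨r, hr, Φ, hΦ, h0, hΦ'⟩ := exists_smooth_local_flow hΩo hv hmem
  have hst : ∀ t ∈ Ioo (-r) r, ∀ y ∈ Metric.ball (σ q₀, w₀) r, (Φ t y).1 = y.1 := by
    intro t ht y hy
    have h1 := eq_of_hasDerivAt_zero (f := fun t => (Φ t y).1) (fun u hu =>
      (ContinuousLinearMap.fst ℝ ℝ
        (EuclideanSpace ℝ (Fin n) × Covec n)).hasFDerivAt.comp_hasDerivAt u ((hΦ' u hu y hy).2)) ht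
    exact h1.trans (congrArg _ (h0 y hy))
  have hN : ∀ᶠ z in 𝓝 z₀, z ∈ (cotChart I x).source ∧ cotChart I x z ∈ Metric.ball w₀ r := by
    refine Filter.Eventually.and ((isOpen_extChartAt_source _).mem_nhds hzs) ?_
    exact (continuousAt_extChartAt' (I := cotModel I) hzs).preimage_mem_nhds
      (Metric.ball_mem_nhds w₀ hr)
  refine ⟨r, hr, hN.mono ?_⟩
  rintro z ⟨hz, hzr⟩ a ⟨ha, har⟩ ζ hζz hζ
  have hζ₀ := hζ.self_of_nhds
  have hsrc : ∀ᶠ q in 𝓝 q₀, ζ q ∈ (cotChart I x).source :=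
    hζ₀.continuousAt.preimage_mem_nhds ((isOpen_extChartAt_source _).mem_nhds (hζz ▸ hz))
  have hball : ∀ᶠ q in 𝓝 q₀, (σ q, cotChart I x (ζ q)) ∈ Metric.ball (σ q₀, w₀) r := by
    have h1 : ContinuousAt (fun q => (σ q, cotChart I x (ζ q))) q₀ :=
      σ.continuous.continuousAt.prodMk (contDiffAt_cotChart hζ₀
        (mem_cotChart_source.1 (hζz ▸ hz))).continuousAt
    refine h1.preimage_mem_nhds (Metric.isOpen_ball.mem_nhds ?_)
    rw [← ball_prod_same]
    exact ⟨Metric.mem_ball_self hr, by rw [hζz]; exact hzr⟩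
  have hua : ∀ u ∈ Icc (0 : ℝ) 1, u * a ∈ Ioo (-r) r := fun u hu =>
    ⟨by nlinarith [hu.1], by nlinarith [hu.2]⟩
  set W : P × ℝ → EuclideanSpace ℝ (Fin n) × Covec n :=
    fun p => (Φ (p.2 * a) (σ p.1, cotChart I x (ζ p.1))).2 with hWdef
  have hW : ∀ᶠ q in 𝓝 q₀, ∀ u ∈ Icc (0 : ℝ) 1, ContDiffAt ℝ ∞ W (q, u) := by
    filter_upwards [hball, hζ, hsrc] with q h1 h2 h3 u hu
    have h4 : ContDiffAt ℝ ∞ (fun w : ℝ × (ℝ × (EuclideanSpace ℝ (Fin n) × Covec n)) =>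
        Φ w.1 w.2) (u * a, (σ q, cotChart I x (ζ q))) :=
      hΦ.contDiffAt ((isOpen_Ioo.prod Metric.isOpen_ball).mem_nhds ⟨hua u hu, h1⟩)
    have h5 : ContDiffAt ℝ ∞ (fun q => cotChart I x (ζ q)) (q, u).1 :=
      contDiffAt_cotChart h2 (mem_cotChart_source.1 h3)
    have h6 : ContDiffAt ℝ ∞ (fun p : P × ℝ => (p.2 * a, (σ p.1, cotChart I x (ζ p.1)))) (q, u) :=
      (contDiffAt_snd.mul contDiffAt_const).prodMk
        ((σ.contDiff.contDiffAt.comp _ contDiffAt_fst).prodMk (h5.comp _ contDiffAt_fst))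
    have h7 := ContDiffAt.comp (g := fun w : ℝ × (ℝ × (EuclideanSpace ℝ (Fin n) × Covec n)) =>
      Φ w.1 w.2) (q, u) h4 h6
    exact contDiff_snd.contDiffAt.comp (q, u) h7
  refine ⟨fun q => (cotChart I x).symm (W (q, 1)), (segment_of_chart hI hHs hσ (W := W)
    (τ := fun p => p.2 * a) hW ?_ ?_ ?_ ?_ ?_ ?_).congr ?_ (Filter.EventuallyEq.refl _ _) ?_⟩
  · exact Filter.Eventually.of_forall fun q u hu => contDiffAt_snd.mul contDiffAt_const
  · filter_upwards [hball] with q h1 u hu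
    obtain ⟨-, h2, h3⟩ := (hΦ' _ (hua u hu) _ h1).1
    exact ⟨interior_subset h2, h3⟩
  · filter_upwards [hball] with q h1 u hu
    obtain ⟨-, h2, -⟩ := (hΦ' _ (hua u (Ioo_subset_Icc_self hu)) _ h1).1
    exact interior_mono (extChartAt_target_subset_range x) h2
  · exact Filter.Eventually.of_forall fun q => zero_mul a
  · refine Filter.Eventually.of_forall fun q u hu => ?_
    rw [fderiv_apply_zero_one (v := a) (contDiffAt_snd.mul contDiffAt_const)
      (by simpa using (hasDerivAt_id u).mul_const a)]
    exact ha
  · filter_upwards [hball, hW] with q h1 h2 u hu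
    rw [fderiv_apply_zero_one (v := a) (contDiffAt_snd.mul contDiffAt_const)
      (by simpa using (hasDerivAt_id u).mul_const a)]
    have h3 : HasDerivAt (fun u => u * a) a u := by simpa using (hasDerivAt_id u).mul_const a
    have h4 := HasDerivAt.scomp (g₁ := fun t => Φ t (σ q, cotChart I x (ζ q))) u
      (hΦ' _ (hua u hu) _ h1).2 h3
    have h5 := (ContinuousLinearMap.snd ℝ ℝ
      (EuclideanSpace ℝ (Fin n) × Covec n)).hasFDerivAt.comp_hasDerivAt u h4
    rw [fderiv_apply_zero_one (h2 u hu) h5]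
    change a • hamLoc x (Hs (Φ (u * a) (σ q, cotChart I x (ζ q))).1) _ = _
    rw [hst _ (hua u hu) _ h1]
  · filter_upwards [hball, hsrc] with q h1 h2
    simp only [hWdef, zero_mul, h0 _ h1]
    exact (cotChart I x).left_inv h2
  · exact Filter.Eventually.of_forall fun q => one_mul a

/-- A segment that ends at `γ b` extends to a segment that ends at `γ c`, when `γ` stays in the
interior over `[b, c]`. -/
theorem Segment.extend (hI : Convex ℝ (range I)) (hHs : HamFamily ε Hs)
    (hσ : σ q₀ ∈ Ioo (-ε) ε) {Z ζ : P → Cot I M} {τ : P → ℝ} (h : Segment Hs σ q₀ Z ζ τ)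
    {γ : ℝ → Cot I M} {T c : ℝ} (hγ : IsBichar (Hs (σ q₀)) T γ) (h0 : γ 0 = Z q₀)
    (hτc : τ q₀ < c) (hc : c ≤ T) (hint : ∀ t ∈ Icc (τ q₀) c, I.IsInteriorPoint (γ t).1) :
    ∃ ζ', Segment Hs σ q₀ Z ζ' (fun q => τ q + (c - τ q₀)) ∧ ζ' q₀ = γ c := by
  have hp := h.exists_bichar.self_of_nhds.1
  have hsub : Icc (τ q₀) c ⊆ Icc 0 T := Icc_subset_Icc hp.le hc
  have hcpt : IsCompact (γ '' Icc (τ q₀) c) :=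
    isCompact_Icc.image_of_continuousOn (hγ.continuousOn.mono hsub)
  -- By compactness of the arc one bound r on the step length serves all its points.
  obtain ⟨r, hr, hstep⟩ : ∃ r > 0, ∀ z ∈ γ '' Icc (τ q₀) c, ∀ a ∈ Ioo 0 r, ∀ ζ : P → Cot I M,
      ζ q₀ = z → (∀ᶠ q in 𝓝 q₀, ContMDiffAt 𝓘(ℝ, P) (cotModel I) ∞ ζ q) →
      ∃ ζ', Segment Hs σ q₀ ζ ζ' (fun _ => a) := by
    refine hcpt.induction_on (p := fun s => ∃ r > 0, ∀ z ∈ s, ∀ a ∈ Ioo 0 r, ∀ ζ : P → Cot I M,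
      ζ q₀ = z → (∀ᶠ q in 𝓝 q₀, ContMDiffAt 𝓘(ℝ, P) (cotModel I) ∞ ζ q) →
      ∃ ζ', Segment Hs σ q₀ ζ ζ' (fun _ => a)) ⟨1, one_pos, fun z hz => hz.elim⟩ ?_ ?_ ?_
    · rintro s t hst ⟨r, hr, h1⟩
      exact ⟨r, hr, fun z hz => h1 z (hst hz)⟩
    · rintro s t ⟨r, hr, h1⟩ ⟨r', hr', h2⟩
      refine ⟨min r r', lt_min hr hr', ?_⟩
      rintro z (hz | hz) a ⟨ha, ha'⟩
      · exact h1 z hz a ⟨ha, ha'.trans_le (min_le_left _ _)⟩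
      · exact h2 z hz a ⟨ha, ha'.trans_le (min_le_right _ _)⟩
    · rintro _ ⟨t, ht, rfl⟩
      obtain ⟨r, hr, h1⟩ := exists_interior_segment (P := P) hI hHs hσ (hγ.nonzero t (hsub ht))
        (hint t ht)
      exact ⟨_, nhdsWithin_le_nhds h1, r, hr, fun z hz => hz⟩
  obtain ⟨K, hK⟩ := exists_nat_gt ((c - τ q₀) / r)
  have hK0 : (0 : ℝ) < K := (div_pos (sub_pos.2 hτc) hr).trans hK
  set a := (c - τ q₀) / K with ha
  have ha0 : 0 < a := div_pos (sub_pos.2 hτc) hK0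
  have har : a < r := by
    rw [ha, div_lt_iff₀ hK0]
    rw [div_lt_iff₀ hr] at hK
    linarith
  have hKa : K * a = c - τ q₀ := mul_div_cancel₀ _ hK0.ne'
  -- The remaining time is covered by K steps of equal length a < r. Each step adds the same
  -- constant to the time for every q, so the dependence of the duration on q does not change.
  have hind : ∀ k : ℕ, k ≤ K → ∃ ζ', Segment Hs σ q₀ Z ζ' (fun q => τ q + k * a) := by
    intro k
    induction k with
    | zero => exact fun _ => ⟨ζ, h.congr (.refl _ _) (.refl _ _) (.of_forall fun q => by simp)⟩
    | succ k ih =>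
      intro hk
      obtain ⟨ζ', hζ'⟩ := ih (by omega)
      have hkK : ((k : ℝ) + 1) * a ≤ c - τ q₀ := by
        rw [← hKa]
        exact mul_le_mul_of_nonneg_right (by exact_mod_cast hk) ha0.le
      have hka : 0 ≤ (k : ℝ) * a := by positivity
      have htm : τ q₀ + k * a ∈ Icc (τ q₀) c := ⟨by linarith, by linarith⟩
      have he : ζ' q₀ = γ (τ q₀ + k * a) :=
        hζ'.end_eq hI hHs.smooth hσ hγ (by linarith [htm.2]) h0
      obtain ⟨ζ'', hζ''⟩ := hstep _ ⟨_, htm, rfl⟩ a ⟨ha0, har⟩ ζ' he hζ'.smooth_end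
      refine ⟨ζ'', (hζ'.trans hI hHs.smooth hσ hζ'' (by rw [he]; exact hint _ htm)).congr
        (.refl _ _) (.refl _ _) (.of_forall fun q => ?_)⟩
      push_cast
      ring
  obtain ⟨ζ', hζ'⟩ := hind K le_rfl
  rw [hKa] at hζ'
  refine ⟨ζ', hζ', ?_⟩
  have := hζ'.end_eq hI hHs.smooth hσ hγ (by linarith) h0
  rw [this]
  congr 1
  ring

end Propagation

/-! ### Transversal crossing of the boundary in folded coordinates. -/

section Fold

variable {m : ℕ}

/-- The inner normal vector of the half space. -/
def normalVec (m : ℕ) : EuclideanSpace ℝ (Fin (m + 1)) := EuclideanSpace.single 0 1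

theorem normalVec_zero : normalVec m 0 = 1 := by simp [normalVec]

/-- The map `(x₀, x', ξ) ↦ (x₀², x', ξ)` onto the phase space of the half space. -/
def foldMap (w : EuclideanSpace ℝ (Fin (m + 1)) × Covec (m + 1)) :
    EuclideanSpace ℝ (Fin (m + 1)) × Covec (m + 1) :=
  (w.1 + (w.1 0 ^ 2 - w.1 0) • normalVec m, w.2)

theorem foldMap_fst_zero (w : EuclideanSpace ℝ (Fin (m + 1)) × Covec (m + 1)) :
    (foldMap w).1 0 = w.1 0 ^ 2 := by
  simp [foldMap, normalVec_zero]

theorem foldMap_eq_self {w : EuclideanSpace ℝ (Fin (m + 1)) × Covec (m + 1)} (h : w.1 0 = 0) :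
    foldMap w = w := by
  simp [foldMap, h]

theorem contDiff_coord_zero {k : ℕ∞ω} :
    ContDiff ℝ k (fun w : EuclideanSpace ℝ (Fin (m + 1)) × Covec (m + 1) => w.1 0) :=
  (EuclideanSpace.proj (𝕜 := ℝ) (0 : Fin (m + 1))).contDiff.comp contDiff_fst

theorem contDiff_foldMap {k : ℕ∞ω} : ContDiff ℝ k (foldMap (m := m)) := by
  refine ContDiff.prodMk ?_ contDiff_snd
  exact contDiff_fst.add (((contDiff_coord_zero.pow 2).sub contDiff_coord_zero).smul contDiff_const)

theorem foldMap_mem_range (w : EuclideanSpace ℝ (Fin (m + 1)) × Covec (m + 1)) :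
    (foldMap w).1 ∈ range (𝓡∂ (m + 1)) := by
  rw [range_modelWithCornersEuclideanHalfSpace]
  change 0 ≤ (foldMap w).1 0
  rw [foldMap_fst_zero]
  positivity

theorem HasDerivAt.coord_zero {w : ℝ → EuclideanSpace ℝ (Fin (m + 1)) × Covec (m + 1)}
    {w' : EuclideanSpace ℝ (Fin (m + 1)) × Covec (m + 1)} {u : ℝ} (h : HasDerivAt w w' u) :
    HasDerivAt (fun u => (w u).1 0) (w'.1 0) u :=
  ((EuclideanSpace.proj (𝕜 := ℝ) (0 : Fin (m + 1))).comp
    (ContinuousLinearMap.fst ℝ (EuclideanSpace ℝ (Fin (m + 1)))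
      (Covec (m + 1)))).hasFDerivAt.comp_hasDerivAt u h

theorem HasDerivAt.foldMap {w : ℝ → EuclideanSpace ℝ (Fin (m + 1)) × Covec (m + 1)}
    {w' : EuclideanSpace ℝ (Fin (m + 1)) × Covec (m + 1)} {u : ℝ} (h : HasDerivAt w w' u) :
    HasDerivAt (fun u => foldMap (w u))
      (w'.1 + (2 * (w u).1 0 * w'.1 0 - w'.1 0) • normalVec m, w'.2) u := by
  have h1 := (ContinuousLinearMap.fst ℝ (EuclideanSpace ℝ (Fin (m + 1)))
      (Covec (m + 1))).hasFDerivAt.comp_hasDerivAt u h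
  have h2 := (ContinuousLinearMap.snd ℝ (EuclideanSpace ℝ (Fin (m + 1)))
      (Covec (m + 1))).hasFDerivAt.comp_hasDerivAt u h
  have h3 : HasDerivAt (fun u => (w u).1 0 ^ 2 - (w u).1 0)
      (2 * (w u).1 0 * w'.1 0 - w'.1 0) u := by
    exact ((h.coord_zero.pow 2).sub h.coord_zero).congr_deriv (by simp)
  exact (h1.add (h3.smul_const _)).prodMk h2

variable {M : Type*} [TopologicalSpace M] [ChartedSpace (EuclideanHalfSpace (m + 1)) M]
  [IsManifold (𝓡∂ (m + 1)) ∞ M] {ε : ℝ} {Hs : ℝ → Cot (𝓡∂ (m + 1)) M → ℝ}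

/-- A square is nonnegative for every real argument, so the fold maps into the half space and a
field smooth up to the boundary becomes smooth on an open set, without extending the Hamiltonian.
The middle factor ℝ is reserved for the time. -/
theorem HamFamily.contDiffOn_hamLoc_foldMap (hHs : HamFamily ε Hs) (x : M) :
    IsOpen {p : ℝ × (ℝ × (EuclideanSpace ℝ (Fin (m + 1)) × Covec (m + 1))) |
        p.1 ∈ Ioo (-ε) ε ∧ (foldMap p.2.2).1 ∈ (extChartAt (𝓡∂ (m + 1)) x).target ∧ p.2.2.2 ≠ 0} ∧
      ContDiffOn ℝ ∞ (fun p : ℝ × (ℝ × (EuclideanSpace ℝ (Fin (m + 1)) × Covec (m + 1))) =>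
        hamLoc x (Hs p.1) (foldMap p.2.2))
      {p : ℝ × (ℝ × (EuclideanSpace ℝ (Fin (m + 1)) × Covec (m + 1))) |
        p.1 ∈ Ioo (-ε) ε ∧ (foldMap p.2.2).1 ∈ (extChartAt (𝓡∂ (m + 1)) x).target ∧
          p.2.2.2 ≠ 0} := by
  constructor
  · refine IsOpen.and (isOpen_Ioo.preimage continuous_fst) (IsOpen.and ?_ ?_)
    · have h1 : {p : ℝ × (ℝ × (EuclideanSpace ℝ (Fin (m + 1)) × Covec (m + 1))) |
          (foldMap p.2.2).1 ∈ (extChartAt (𝓡∂ (m + 1)) x).target} =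
          (fun p : ℝ × (ℝ × (EuclideanSpace ℝ (Fin (m + 1)) × Covec (m + 1))) =>
            (𝓡∂ (m + 1)).symm (foldMap p.2.2).1) ⁻¹'
            (chartAt (EuclideanHalfSpace (m + 1)) x).target := by
        ext p
        rw [mem_ofPred_eq, extChartAt_target]
        exact and_iff_left (foldMap_mem_range _)
      rw [h1]
      exact (chartAt _ x).open_target.preimage ((𝓡∂ (m + 1)).continuous_symm.comp
        (continuous_fst.comp (contDiff_foldMap (k := 0).continuous.comp
          (continuous_snd.comp continuous_snd))))
    · exact isOpen_ne.preimage (continuous_snd.comp (continuous_snd.comp continuous_snd))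
  · rintro ⟨s, t, w⟩ ⟨hs, hw, hw2⟩
    have h1 := hHs.smooth.contDiffWithinAt_hamLoc hs (x := x) (w := foldMap w) hw hw2
    refine ContDiffAt.contDiffWithinAt ?_
    rw [← contDiffWithinAt_univ]
    refine ContDiffWithinAt.comp (t := univ ×ˢ range (cotModel (𝓡∂ (m + 1))))
      (g := fun p : ℝ × (EuclideanSpace ℝ (Fin (m + 1)) × Covec (m + 1)) => hamLoc x (Hs p.1) p.2)
      (f := fun p : ℝ × (ℝ × (EuclideanSpace ℝ (Fin (m + 1)) × Covec (m + 1))) =>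
        (p.1, foldMap p.2.2)) (s, t, w) h1 ?_ ?_
    · exact (contDiff_fst.prodMk (contDiff_foldMap.comp
        (contDiff_snd.comp contDiff_snd))).contDiffWithinAt
    · intro p _
      refine ⟨mem_univ _, ?_⟩
      rw [range_cotModel]
      exact ⟨foldMap_mem_range _, mem_univ _⟩

/-- A flow near a boundary point where the velocity is transversal to the boundary, in the
coordinates in which the defining function of the boundary is a square. The time is a coordinate
of the flow; the parameter of the flow is the square root of the defining function. -/
structure FoldFlow (Hs : ℝ → Cot (𝓡∂ (m + 1)) M → ℝ) (x : M) (κ s₀ : ℝ)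
    (w₀ : EuclideanSpace ℝ (Fin (m + 1)) × Covec (m + 1)) (r : ℝ)
    (Ψ : ℝ → ℝ → EuclideanSpace ℝ (Fin (m + 1)) × Covec (m + 1) →
      ℝ × (EuclideanSpace ℝ (Fin (m + 1)) × Covec (m + 1))) : Prop where
  smooth : ContDiffOn ℝ ∞ (fun p : ℝ × (ℝ × (EuclideanSpace ℝ (Fin (m + 1)) × Covec (m + 1))) =>
    Ψ p.1 p.2.1 p.2.2) (Ioo (-r) r ×ˢ (Metric.ball s₀ r ×ˢ Metric.ball w₀ r))
  zero : ∀ s ∈ Metric.ball s₀ r, ∀ w ∈ Metric.ball w₀ r, Ψ 0 s w = (0, w)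
  flow : ∀ u ∈ Ioo (-r) r, ∀ s ∈ Metric.ball s₀ r, ∀ w ∈ Metric.ball w₀ r,
    (foldMap (Ψ u s w).2).1 ∈ (extChartAt (𝓡∂ (m + 1)) x).target ∧
    (foldMap (Ψ u s w).2).2 ≠ 0 ∧
    0 < κ * (hamLoc x (Hs s) (foldMap (Ψ u s w).2)).1 0 ∧
    (Ψ u s w).2.1 0 = w.1 0 + u ∧
    HasDerivAt (fun u => (Ψ u s w).1)
      (2 * (w.1 0 + u) / (hamLoc x (Hs s) (foldMap (Ψ u s w).2)).1 0) u ∧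
    HasDerivAt (fun u => foldMap (Ψ u s w).2)
      ((2 * (w.1 0 + u) / (hamLoc x (Hs s) (foldMap (Ψ u s w).2)).1 0) •
        hamLoc x (Hs s) (foldMap (Ψ u s w).2)) u

/-- If the normal coordinate is u² and its velocity is n ≠ 0, then 2u du = n dt. With u as parameter
the time satisfies dt/du = 2u/n, and the other variables move with 2u/n times their Hamiltonian
velocity; these equations are smooth across u = 0. The number κ records the sign of n. -/
theorem exists_foldFlow (hHs : HamFamily ε Hs) {x : M} {s₀ κ : ℝ} (hs₀ : s₀ ∈ Ioo (-ε) ε)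
    {w₀ : EuclideanSpace ℝ (Fin (m + 1)) × Covec (m + 1)}
    (hw : w₀.1 ∈ (extChartAt (𝓡∂ (m + 1)) x).target) (hw2 : w₀.2 ≠ 0) (hw0 : w₀.1 0 = 0)
    (hκ : 0 < κ * (hamLoc x (Hs s₀) w₀).1 0) : ∃ r > 0, ∃ Ψ, FoldFlow Hs x κ s₀ w₀ r Ψ := by
  obtain ⟨hΩ₁, hg⟩ := hHs.contDiffOn_hamLoc_foldMap x
  set Ω₁ := {p : ℝ × (ℝ × (EuclideanSpace ℝ (Fin (m + 1)) × Covec (m + 1))) |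
    p.1 ∈ Ioo (-ε) ε ∧ (foldMap p.2.2).1 ∈ (extChartAt (𝓡∂ (m + 1)) x).target ∧ p.2.2.2 ≠ 0}
  set g := fun p : ℝ × (ℝ × (EuclideanSpace ℝ (Fin (m + 1)) × Covec (m + 1))) =>
    hamLoc x (Hs p.1) (foldMap p.2.2) with hgdef
  have hg0 : ContDiffOn ℝ ∞ (fun p => (g p).1 0) Ω₁ := contDiff_coord_zero.comp_contDiffOn hg
  set Ω := Ω₁ ∩ (fun p => κ * (g p).1 0) ⁻¹' Ioi 0 with hΩdef
  have hΩ : IsOpen Ω :=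
    (continuousOn_const.mul hg0.continuousOn).isOpen_inter_preimage hΩ₁ isOpen_Ioi
  have hne : ∀ p ∈ Ω, (g p).1 0 ≠ 0 := by
    intro p hp h
    have h1 : 0 < κ * (g p).1 0 := hp.2
    rw [h, mul_zero] at h1
    exact lt_irrefl _ h1
  set lam := fun p : ℝ × (ℝ × (EuclideanSpace ℝ (Fin (m + 1)) × Covec (m + 1))) =>
    2 * p.2.2.1 0 / (g p).1 0 with hlam
  have hcoord : ContDiff ℝ ∞ (fun p : ℝ × (ℝ × (EuclideanSpace ℝ (Fin (m + 1)) ×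
      Covec (m + 1))) => p.2.2.1 0) :=
    contDiff_coord_zero.comp (contDiff_snd.comp contDiff_snd)
  have hlamd : ContDiffOn ℝ ∞ lam Ω :=
    (contDiff_const.mul hcoord).contDiffOn.div (hg0.mono inter_subset_left) hne
  -- The correction along the normal gives the unfolded normal coordinate unit speed. After folding,
  -- its speed is 2 times itself, which is `lam` times the normal velocity, as the Hamiltonian field
  -- requires.
  have hv : ContDiffOn ℝ ∞ (fun p => ((0 : ℝ), (lam p,
      (lam p • (g p).1 + (1 - 2 * p.2.2.1 0) • normalVec m, lam p • (g p).2)))) Ω := by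
    have hg' := hg.mono (inter_subset_left : Ω ⊆ Ω₁)
    exact contDiffOn_const.prodMk (hlamd.prodMk (((hlamd.smul hg'.fst).add
      ((contDiff_const.sub (contDiff_const.mul hcoord)).contDiffOn.smul contDiffOn_const)).prodMk
      (hlamd.smul hg'.snd)))
  have ha : (s₀, ((0 : ℝ), w₀)) ∈ Ω := by
    have hf := foldMap_eq_self hw0
    refine ⟨⟨hs₀, ?_, hw2⟩, ?_⟩
    · simp only [hf]
      exact hw
    · simp only [hgdef, mem_preimage, hf]
      exact hκ
  obtain ⟨r, hr, Φ, hΦ, h0, hΦ'⟩ := exists_smooth_local_flow hΩ hv ha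
  have hmem : ∀ s ∈ Metric.ball s₀ r, ∀ w ∈ Metric.ball w₀ r,
      (s, ((0 : ℝ), w)) ∈ Metric.ball (s₀, ((0 : ℝ), w₀)) r := by
    intro s hs w hw
    rw [← ball_prod_same, ← ball_prod_same]
    exact ⟨hs, Metric.mem_ball_self hr, hw⟩
  refine ⟨r, hr, fun u s w => (Φ u (s, (0, w))).2, ?_, ?_, ?_⟩
  · refine contDiff_snd.comp_contDiffOn (ContDiffOn.comp hΦ (f := fun p : ℝ × (ℝ ×
      (EuclideanSpace ℝ (Fin (m + 1)) × Covec (m + 1))) => (p.1, (p.2.1, ((0 : ℝ), p.2.2)))) ?_ ?_)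
    · exact (contDiff_fst.prodMk ((contDiff_fst.comp contDiff_snd).prodMk
        (contDiff_const.prodMk (contDiff_snd.comp contDiff_snd)))).contDiffOn
    · rintro ⟨u, s, w⟩ ⟨hu, hs, hw⟩
      exact ⟨hu, hmem s hs w hw⟩
  · intro s hs w hw
    simp only [h0 _ (hmem s hs w hw)]
  intro u hu s hs w hw
  have hd := fun u hu => (hΦ' u hu _ (hmem s hs w hw)).2
  have hΩu := fun u hu => (hΦ' u hu _ (hmem s hs w hw)).1
  have hs' : (Φ u (s, (0, w))).1 = s := by
    have h1 := eq_of_hasDerivAt_zero (f := fun u => (Φ u (s, (0, w))).1) (fun u hu =>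
      (ContinuousLinearMap.fst ℝ ℝ (ℝ × (EuclideanSpace ℝ (Fin (m + 1)) ×
        Covec (m + 1)))).hasFDerivAt.comp_hasDerivAt u (hd u hu)) hu
    exact h1.trans (congrArg _ (h0 _ (hmem s hs w hw)))
  have hdt : ∀ u ∈ Ioo (-r) r, HasDerivAt (fun u => (Φ u (s, (0, w))).2.1)
      (lam (Φ u (s, (0, w)))) u := fun u hu =>
    ((ContinuousLinearMap.fst ℝ ℝ (EuclideanSpace ℝ (Fin (m + 1)) × Covec (m + 1))).comp
      (ContinuousLinearMap.snd ℝ ℝ (ℝ × (EuclideanSpace ℝ (Fin (m + 1)) ×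
        Covec (m + 1))))).hasFDerivAt.comp_hasDerivAt u (hd u hu)
  have hdw : ∀ u ∈ Ioo (-r) r, HasDerivAt (fun u => (Φ u (s, (0, w))).2.2)
      (lam (Φ u (s, (0, w))) • (g (Φ u (s, (0, w)))).1 +
        (1 - 2 * (Φ u (s, (0, w))).2.2.1 0) • normalVec m,
        lam (Φ u (s, (0, w))) • (g (Φ u (s, (0, w)))).2) u := fun u hu =>
    ((ContinuousLinearMap.snd ℝ ℝ (EuclideanSpace ℝ (Fin (m + 1)) × Covec (m + 1))).comp
      (ContinuousLinearMap.snd ℝ ℝ (ℝ × (EuclideanSpace ℝ (Fin (m + 1)) ×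
        Covec (m + 1))))).hasFDerivAt.comp_hasDerivAt u (hd u hu)
  have hone : ∀ p ∈ Ω, (lam p • (g p).1 + (1 - 2 * p.2.2.1 0) • normalVec m) 0 = 1 := by
    intro p hp
    have := hne p hp
    simp only [PiLp.add_apply, PiLp.smul_apply, smul_eq_mul, normalVec_zero, hlam]
    field_simp
    ring
  have hx0 : (Φ u (s, (0, w))).2.2.1 0 = w.1 0 + u := by
    have h1 := eq_of_hasDerivAt_zero (r := r) (f := fun u => (Φ u (s, (0, w))).2.2.1 0 - u)
      (fun u hu => by
        have h2 := (hdw u hu).coord_zero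
        simp only [hone _ (hΩu u hu)] at h2
        exact (h2.sub (hasDerivAt_id u)).congr_deriv (by simp)) hu
    simp only [h0 _ (hmem s hs w hw)] at h1
    linarith
  have hlam' : lam (Φ u (s, (0, w))) =
      2 * (w.1 0 + u) / (hamLoc x (Hs s) (foldMap (Φ u (s, (0, w))).2.2)).1 0 := by
    simp only [hlam, hgdef, hx0, hs']
  have hg' : g (Φ u (s, (0, w))) = hamLoc x (Hs s) (foldMap (Φ u (s, (0, w))).2.2) := by
    simp only [hgdef, hs']
  obtain ⟨⟨h1, h2, h3⟩, h4⟩ := hΩu u hu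
  refine ⟨h2, h3, ?_, hx0, ?_, ?_⟩
  · rw [← hg']
    exact h4
  · rw [← hlam']
    exact hdt u hu
  · rw [← hlam', ← hg']
    have h5 := (hdw u hu).foldMap
    refine h5.congr_deriv ?_
    simp only [hone _ (hΩu u hu)]
    refine Prod.ext ?_ rfl
    simp only [Prod.smul_fst]
    module

theorem convex_range_halfSpace : Convex ℝ (range (𝓡∂ (m + 1))) := by
  rw [range_modelWithCornersEuclideanHalfSpace]
  exact convex_halfSpace_ge (EuclideanSpace.proj (𝕜 := ℝ) (0 : Fin (m + 1))).isLinear 0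

theorem mem_chart_of_mem_cotChart_source {x : M} {z : Cot (𝓡∂ (m + 1)) M}
    (hz : z.1 ∈ (chartAt (EuclideanHalfSpace (m + 1)) x).source)
    (hz0 : z ∈ nonzeroCot (𝓡∂ (m + 1)) M) :
    (cotChart (𝓡∂ (m + 1)) x z).1 ∈ (extChartAt (𝓡∂ (m + 1)) x).target ∧
      (cotChart (𝓡∂ (m + 1)) x z).2 ≠ 0 :=
  ⟨mem_cotChart_target.1 ((cotChart (𝓡∂ (m + 1)) x).map_source (mem_cotChart_source.2 hz)),
    (covec_eq_zero_iff hz).not.1 hz0⟩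

theorem isInteriorPoint_iff_coord_pos {x : M} {z : Cot (𝓡∂ (m + 1)) M}
    (hz : z.1 ∈ (chartAt (EuclideanHalfSpace (m + 1)) x).source) :
    (𝓡∂ (m + 1)).IsInteriorPoint z.1 ↔ 0 < (cotChart (𝓡∂ (m + 1)) x z).1 0 := by
  rw [isInteriorPoint_iff_chart hz, interior_range_modelWithCornersEuclideanHalfSpace, cotChart_fst]
  rfl

theorem cotChart_coord_nonneg (x : M) (z : Cot (𝓡∂ (m + 1)) M) :
    0 ≤ (cotChart (𝓡∂ (m + 1)) x z).1 0 := by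
  have h : (cotChart (𝓡∂ (m + 1)) x z).1 ∈ range (𝓡∂ (m + 1)) := by
    rw [cotChart_fst]
    exact mem_range_self _
  rw [range_modelWithCornersEuclideanHalfSpace] at h
  exact h

variable [T2Space M] {P : Type*} [NormedAddCommGroup P] [NormedSpace ℝ P]
  {σ : P →L[ℝ] ℝ} {q₀ : P}

/-- The flow is followed from ν q by the signed amount d q. Time increases when d times the current
unfolded coordinate has the sign κ of the normal velocity. For curves issued from the boundary κ =
1, d > 0 and the coordinate grows from 0; for arriving curves κ = -1, d < 0 and it decreases to 0.
-/
theorem FoldFlow.segment (hHs : HamFamily ε Hs) (hσ : σ q₀ ∈ Ioo (-ε) ε) {x : M} {κ r : ℝ}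
    {w₀ : EuclideanSpace ℝ (Fin (m + 1)) × Covec (m + 1)}
    {Ψ : ℝ → ℝ → EuclideanSpace ℝ (Fin (m + 1)) × Covec (m + 1) →
      ℝ × (EuclideanSpace ℝ (Fin (m + 1)) × Covec (m + 1))}
    (hr : 0 < r) (F : FoldFlow Hs x κ (σ q₀) w₀ r Ψ)
    {ν : P → EuclideanSpace ℝ (Fin (m + 1)) × Covec (m + 1)} {d : P → ℝ}
    (hν : ∀ᶠ q in 𝓝 q₀, ContDiffAt ℝ ∞ ν q) (hd : ∀ᶠ q in 𝓝 q₀, ContDiffAt ℝ ∞ d q)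
    (hν₀ : ν q₀ ∈ Metric.ball w₀ r) (hd₀ : d q₀ ∈ Ioo (-r) r)
    (hpos : ∀ᶠ q in 𝓝 q₀, ∀ u ∈ Ioo (0 : ℝ) 1, 0 < κ * (d q * ((ν q).1 0 + u * d q))) :
    Segment Hs σ q₀ (fun q => (cotChart (𝓡∂ (m + 1)) x).symm (foldMap (ν q)))
      (fun q => (cotChart (𝓡∂ (m + 1)) x).symm (foldMap (Ψ (d q) (σ q) (ν q)).2))
      (fun q => (Ψ (d q) (σ q) (ν q)).1) := by
  have hσb : ∀ᶠ q in 𝓝 q₀, σ q ∈ Metric.ball (σ q₀) r :=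
    σ.continuous.continuousAt.preimage_mem_nhds (Metric.ball_mem_nhds _ hr)
  have hνb : ∀ᶠ q in 𝓝 q₀, ν q ∈ Metric.ball w₀ r :=
    hν.self_of_nhds.continuousAt.preimage_mem_nhds (Metric.isOpen_ball.mem_nhds hν₀)
  have hdb : ∀ᶠ q in 𝓝 q₀, d q ∈ Ioo (-r) r :=
    hd.self_of_nhds.continuousAt.preimage_mem_nhds (isOpen_Ioo.mem_nhds hd₀)
  have hscale : ∀ {c u : ℝ}, c ∈ Ioo (-r) r → u ∈ Icc (0 : ℝ) 1 → u * c ∈ Ioo (-r) r := by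
    rintro c u ⟨h1, h2⟩ ⟨h3, h4⟩
    constructor <;> nlinarith
  have hΨ : ∀ᶠ q in 𝓝 q₀, ∀ u ∈ Icc (0 : ℝ) 1,
      ContDiffAt ℝ ∞ (fun p : P × ℝ => Ψ (p.2 * d p.1) (σ p.1) (ν p.1)) (q, u) := by
    filter_upwards [hσb, hνb, hdb, hν, hd] with q h1 h2 h3 h4 h5 u hu
    have h6 : ContDiffAt ℝ ∞ (fun p : ℝ × (ℝ × (EuclideanSpace ℝ (Fin (m + 1)) ×
        Covec (m + 1))) => Ψ p.1 p.2.1 p.2.2) (u * d q, (σ q, ν q)) :=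
      F.smooth.contDiffAt ((isOpen_Ioo.prod (Metric.isOpen_ball.prod
        Metric.isOpen_ball)).mem_nhds ⟨hscale h3 hu, h1, h2⟩)
    have h4' : ContDiffAt ℝ ∞ ν (q, u).1 := h4
    have h5' : ContDiffAt ℝ ∞ d (q, u).1 := h5
    have h7 : ContDiffAt ℝ ∞ (fun p : P × ℝ => (p.2 * d p.1, (σ p.1, ν p.1))) (q, u) :=
      (contDiffAt_snd.mul (h5'.comp _ contDiffAt_fst)).prodMk
        ((σ.contDiff.contDiffAt.comp _ contDiffAt_fst).prodMk (h4'.comp _ contDiffAt_fst))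
    exact ContDiffAt.comp (g := fun p : ℝ × (ℝ × (EuclideanSpace ℝ (Fin (m + 1)) ×
        Covec (m + 1))) => Ψ p.1 p.2.1 p.2.2) (q, u) h6 h7
  set W : P × ℝ → EuclideanSpace ℝ (Fin (m + 1)) × Covec (m + 1) := fun p =>
    foldMap (Ψ (p.2 * d p.1) (σ p.1) (ν p.1)).2 with hWdef
  set τ : P × ℝ → ℝ := fun p => (Ψ (p.2 * d p.1) (σ p.1) (ν p.1)).1 with hτdef
  have hW : ∀ᶠ q in 𝓝 q₀, ∀ u ∈ Icc (0 : ℝ) 1, ContDiffAt ℝ ∞ W (q, u) :=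
    hΨ.mono fun q h u hu => contDiff_foldMap.contDiffAt.comp (q, u)
      (contDiff_snd.contDiffAt.comp (q, u) (h u hu))
  have hτ : ∀ᶠ q in 𝓝 q₀, ∀ u ∈ Icc (0 : ℝ) 1, ContDiffAt ℝ ∞ τ (q, u) :=
    hΨ.mono fun q h u hu => contDiff_fst.contDiffAt.comp (q, u) (h u hu)
  have hmul : ∀ (q : P) (u : ℝ), HasDerivAt (fun u => u * d q) (d q) u := fun q u => by
    simpa using (hasDerivAt_id u).mul_const (d q)
  have hτu : ∀ᶠ q in 𝓝 q₀, ∀ u ∈ Icc (0 : ℝ) 1, fderiv ℝ τ (q, u) (0, 1) =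
      2 * ((ν q).1 0 + u * d q) / (hamLoc x (Hs (σ q)) (W (q, u))).1 0 * d q := by
    filter_upwards [hσb, hνb, hdb, hτ] with q h1 h2 h3 h4 u hu
    obtain ⟨-, -, -, -, h5, -⟩ := F.flow _ (hscale h3 hu) _ h1 _ h2
    exact fderiv_apply_zero_one (h4 u hu) (HasDerivAt.comp
      (h₂ := fun u => (Ψ u (σ q) (ν q)).1) u h5 (hmul q u))
  refine (segment_of_chart convex_range_halfSpace hHs hσ hW hτ ?_ ?_ ?_ ?_ ?_ (x := x)).congr
    ?_ ?_ ?_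
  · filter_upwards [hσb, hνb, hdb] with q h1 h2 h3 u hu
    obtain ⟨h4, h5, -⟩ := F.flow _ (hscale h3 hu) _ h1 _ h2
    exact ⟨h4, h5⟩
  · filter_upwards [hσb, hνb, hdb, hpos] with q h1 h2 h3 h4 u hu
    obtain ⟨-, -, -, h5, -⟩ := F.flow _ (hscale h3 (Ioo_subset_Icc_self hu)) _ h1 _ h2
    rw [interior_range_modelWithCornersEuclideanHalfSpace, mem_ofPred_eq]
    simp only [hWdef, foldMap_fst_zero, h5]
    refine sq_pos_iff.2 fun h => ?_
    have h6 := h4 u hu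
    rw [h, mul_zero, mul_zero] at h6
    exact lt_irrefl _ h6
  · filter_upwards [hσb, hνb] with q h1 h2
    simp only [hτdef, zero_mul, F.zero _ h1 _ h2]
  · filter_upwards [hσb, hνb, hdb, hpos, hτu] with q h1 h2 h3 h4 h6 u hu
    obtain ⟨-, -, h5, -⟩ := F.flow _ (hscale h3 (Ioo_subset_Icc_self hu)) _ h1 _ h2
    rw [h6 u (Ioo_subset_Icc_self hu)]
    have h7 := h4 u hu
    change 0 < κ * (hamLoc x (Hs (σ q)) (W (q, u))).1 0 at h5
    set a := (hamLoc x (Hs (σ q)) (W (q, u))).1 0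
    set y := (ν q).1 0 + u * d q
    have h8 : a ≠ 0 := fun h => by simp [h] at h5
    have h9 : 0 < κ ^ 2 * a ^ 2 := by rw [← mul_pow]; exact pow_pos h5 2
    -- Multiplication by κ² exhibits the speed of the time as a quotient of products of the positive
    -- quantities κ d y and κ a.
    have h10 : 2 * y / a * d q = 2 * (κ * (d q * y)) * (κ * a) / (κ ^ 2 * a ^ 2) := by
      have : κ ≠ 0 := fun h => by simp [h] at h5
      field_simp
    rw [h10]
    positivity
  · filter_upwards [hσb, hνb, hdb, hW, hτu] with q h1 h2 h3 h4 h6 u hu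
    obtain ⟨-, -, -, -, -, h5⟩ := F.flow _ (hscale h3 hu) _ h1 _ h2
    rw [h6 u hu, fderiv_apply_zero_one (h4 u hu) (HasDerivAt.scomp
      (g₁ := fun u => foldMap (Ψ u (σ q) (ν q)).2) u h5 (hmul q u)), smul_smul, mul_comm (d q)]
  · filter_upwards [hσb, hνb] with q h1 h2
    simp only [hWdef, zero_mul, F.zero _ h1 _ h2]
  · exact .of_forall fun q => by simp only [hWdef, one_mul]
  · exact .of_forall fun q => by simp only [hτdef, one_mul]

/-- A short family of bicharacteristics issued from the boundary. -/
theorem exists_start_segment (hHs : HamFamily ε Hs) (hσ : σ q₀ ∈ Ioo (-ε) ε) {x : M}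
    {Z : P → Cot (𝓡∂ (m + 1)) M}
    (hZ : ∀ᶠ q in 𝓝 q₀, ContMDiffAt 𝓘(ℝ, P) (cotModel (𝓡∂ (m + 1))) ∞ Z q)
    (hZ0 : Z q₀ ∈ nonzeroCot (𝓡∂ (m + 1)) M)
    (hx : (Z q₀).1 ∈ (chartAt (EuclideanHalfSpace (m + 1)) x).source)
    (hb : ∀ᶠ q in 𝓝 q₀, (cotChart (𝓡∂ (m + 1)) x (Z q)).1 0 = 0)
    (hn : 0 < (hamLoc x (Hs (σ q₀)) (cotChart (𝓡∂ (m + 1)) x (Z q₀))).1 0) {T : ℝ} (hT : 0 < T) :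
    ∃ ζ τ, Segment Hs σ q₀ Z ζ τ ∧ τ q₀ < T ∧ (𝓡∂ (m + 1)).IsInteriorPoint (ζ q₀).1 := by
  set w₀ := cotChart (𝓡∂ (m + 1)) x (Z q₀) with hw₀
  obtain ⟨hwt, hw2⟩ := mem_chart_of_mem_cotChart_source hx hZ0
  have hb₀ : w₀.1 0 = 0 := hb.self_of_nhds
  obtain ⟨r, hr, Ψ, F⟩ := exists_foldFlow hHs (κ := 1) hσ hwt hw2 hb₀ (by rwa [one_mul])
  have hsrc : ∀ᶠ q in 𝓝 q₀, Z q ∈ (cotChart (𝓡∂ (m + 1)) x).source :=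
    hZ.self_of_nhds.continuousAt.preimage_mem_nhds
      ((isOpen_extChartAt_source _).mem_nhds (mem_cotChart_source.2 hx))
  have hν : ∀ᶠ q in 𝓝 q₀, ContDiffAt ℝ ∞ (fun q => cotChart (𝓡∂ (m + 1)) x (Z q)) q := by
    filter_upwards [hZ, hsrc] with q h1 h2
    exact contDiffAt_cotChart h1 (mem_cotChart_source.1 h2)
  have hw₀b : w₀ ∈ Metric.ball w₀ r := Metric.mem_ball_self hr
  have hsb : σ q₀ ∈ Metric.ball (σ q₀) r := Metric.mem_ball_self hr
  have h0r : (0 : ℝ) ∈ Ioo (-r) r := ⟨by linarith, hr⟩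
  -- a short time
  obtain ⟨b, hb0, hbr, hbT⟩ : ∃ b, 0 < b ∧ b < r ∧ (Ψ b (σ q₀) w₀).1 < T := by
    have h1 : ContinuousAt (fun b => (Ψ b (σ q₀) w₀).1) 0 :=
      (F.flow 0 h0r _ hsb _ hw₀b).2.2.2.2.1.continuousAt
    have h2 : ∀ᶠ b in 𝓝 (0 : ℝ), (Ψ b (σ q₀) w₀).1 < T := by
      refine h1.eventually_lt continuousAt_const ?_
      rw [F.zero _ hsb _ hw₀b]
      exact hT
    have h3 : ∀ᶠ b in 𝓝[>] (0 : ℝ), 0 < b ∧ b < r ∧ (Ψ b (σ q₀) w₀).1 < T := by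
      filter_upwards [self_mem_nhdsWithin, nhdsWithin_le_nhds h2,
        nhdsWithin_le_nhds (Iio_mem_nhds hr)] with b h4 h5 h6
      exact ⟨h4, h6, h5⟩
    exact h3.exists
  have hbm : b ∈ Ioo (-r) r := ⟨by linarith, hbr⟩
  have hseg := F.segment hHs hσ hr hν (d := fun _ => b)
    (.of_forall fun q => contDiffAt_const) hw₀b hbm ?_
  · refine ⟨_, _, hseg.congr ?_ (.refl _ _) (.refl _ _), hbT, ?_⟩
    · filter_upwards [hb, hsrc] with q h1 h2
      rw [foldMap_eq_self h1]
      exact (cotChart (𝓡∂ (m + 1)) x).left_inv h2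
    · obtain ⟨h1, h2, -, h3, -⟩ := F.flow b hbm _ hsb _ hw₀b
      rw [isInteriorPoint_iff_coord_pos (cotChart_symm_fst_mem h1),
        (cotChart (𝓡∂ (m + 1)) x).right_inv (mem_cotChart_target.2 h1), foldMap_fst_zero, h3, hb₀]
      positivity
  · filter_upwards [hb] with q h1 u hu
    rw [h1, zero_add, one_mul]
    have := hu.1
    positivity

/-- The map `(x₀, x', ξ) ↦ (√x₀, x', ξ)`. -/
def unfoldMap (w : EuclideanSpace ℝ (Fin (m + 1)) × Covec (m + 1)) :
    EuclideanSpace ℝ (Fin (m + 1)) × Covec (m + 1) :=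
  (w.1 + (√(w.1 0) - w.1 0) • normalVec m, w.2)

theorem unfoldMap_fst_zero (w : EuclideanSpace ℝ (Fin (m + 1)) × Covec (m + 1)) :
    (unfoldMap w).1 0 = √(w.1 0) := by
  simp [unfoldMap, normalVec_zero]

theorem foldMap_unfoldMap {w : EuclideanSpace ℝ (Fin (m + 1)) × Covec (m + 1)} (h : 0 ≤ w.1 0) :
    foldMap (unfoldMap w) = w := by
  refine Prod.ext ?_ rfl
  change (unfoldMap w).1 + ((unfoldMap w).1 0 ^ 2 - (unfoldMap w).1 0) • normalVec m = w.1
  rw [unfoldMap_fst_zero, Real.sq_sqrt h]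
  simp only [unfoldMap]
  module

theorem continuous_unfoldMap : Continuous (unfoldMap (m := m)) := by
  have h := (contDiff_coord_zero (m := m) (k := 0)).continuous
  exact (continuous_fst.add (((Real.continuous_sqrt.comp h).sub h).smul
    continuous_const)).prodMk continuous_snd

theorem contDiffAt_unfoldMap {w : EuclideanSpace ℝ (Fin (m + 1)) × Covec (m + 1)}
    (h : w.1 0 ≠ 0) : ContDiffAt ℝ ∞ (unfoldMap (m := m)) w := by
  have h1 : ContDiffAt ℝ ∞ (fun w : EuclideanSpace ℝ (Fin (m + 1)) × Covec (m + 1) => w.1 0) w :=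
    contDiff_coord_zero.contDiffAt
  exact (contDiffAt_fst.add (((h1.sqrt h).sub h1).smul contDiffAt_const)).prodMk contDiffAt_snd

/-- A short family of bicharacteristics that end at the boundary. -/
theorem exists_end_segment (hHs : HamFamily ε Hs) (hσ : σ q₀ ∈ Ioo (-ε) ε) {x : M}
    {z₁ : Cot (𝓡∂ (m + 1)) M} (hz₁ : z₁ ∈ nonzeroCot (𝓡∂ (m + 1)) M)
    (hx : z₁.1 ∈ (chartAt (EuclideanHalfSpace (m + 1)) x).source)
    (hb : (cotChart (𝓡∂ (m + 1)) x z₁).1 0 = 0)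
    (hn : (hamLoc x (Hs (σ q₀)) (cotChart (𝓡∂ (m + 1)) x z₁)).1 0 < 0) :
    ∀ᶠ z in 𝓝 z₁, (𝓡∂ (m + 1)).IsInteriorPoint z.1 → ∀ ζ : P → Cot (𝓡∂ (m + 1)) M, ζ q₀ = z →
      (∀ᶠ q in 𝓝 q₀, ContMDiffAt 𝓘(ℝ, P) (cotModel (𝓡∂ (m + 1))) ∞ ζ q) →
      ∃ ζ' τ, Segment Hs σ q₀ ζ ζ' τ ∧
        ∀ᶠ q in 𝓝 q₀, (ζ' q).1 ∈ (chartAt (EuclideanHalfSpace (m + 1)) x).source ∧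
          (cotChart (𝓡∂ (m + 1)) x (ζ' q)).1 0 = 0 ∧
          (hamLoc x (Hs (σ q)) (cotChart (𝓡∂ (m + 1)) x (ζ' q))).1 0 < 0 := by
  set w₀ := cotChart (𝓡∂ (m + 1)) x z₁ with hw₀
  obtain ⟨hwt, hw2⟩ := mem_chart_of_mem_cotChart_source hx hz₁
  obtain ⟨r, hr, Ψ, F⟩ := exists_foldFlow hHs (κ := -1) hσ hwt hw2 hb (by rw [← hw₀]; linarith)
  have hw₀u : unfoldMap w₀ = w₀ := by
    refine Prod.ext ?_ rfl
    simp [unfoldMap, hb]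
  have hz₁s : z₁ ∈ (cotChart (𝓡∂ (m + 1)) x).source := mem_cotChart_source.2 hx
  have hch : ContinuousAt (cotChart (𝓡∂ (m + 1)) x) z₁ := continuousAt_extChartAt' hz₁s
  have hball : ∀ᶠ z in 𝓝 z₁, unfoldMap (cotChart (𝓡∂ (m + 1)) x z) ∈ Metric.ball w₀ r := by
    refine (continuous_unfoldMap.continuousAt.comp hch).preimage_mem_nhds
      (Metric.isOpen_ball.mem_nhds ?_)
    change unfoldMap w₀ ∈ _
    rw [hw₀u]
    exact Metric.mem_ball_self hr
  have hsqrt : ∀ᶠ z in 𝓝 z₁, √((cotChart (𝓡∂ (m + 1)) x z).1 0) < r := by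
    have h1 : ContinuousAt (fun z => √((cotChart (𝓡∂ (m + 1)) x z).1 0)) z₁ :=
      (Real.continuous_sqrt.comp (contDiff_coord_zero (k := 0)).continuous).continuousAt.comp hch
    refine h1.eventually_lt continuousAt_const ?_
    rw [← hw₀, hb, Real.sqrt_zero]
    exact hr
  have hsource : ∀ᶠ z in 𝓝 z₁, z ∈ (cotChart (𝓡∂ (m + 1)) x).source :=
    (isOpen_extChartAt_source _).mem_nhds hz₁s
  filter_upwards [hball, hsqrt, hsource] with z h1 h2 h3 hint ζ hζz hζ
  have hsrc : ∀ᶠ q in 𝓝 q₀, ζ q ∈ (cotChart (𝓡∂ (m + 1)) x).source :=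
    hζ.self_of_nhds.continuousAt.preimage_mem_nhds
      ((isOpen_extChartAt_source _).mem_nhds (hζz ▸ h3))
  have hpos : ∀ᶠ q in 𝓝 q₀, 0 < (cotChart (𝓡∂ (m + 1)) x (ζ q)).1 0 := by
    have h4 : ContinuousAt (fun q => (cotChart (𝓡∂ (m + 1)) x (ζ q)).1 0) q₀ :=
      (contDiff_coord_zero (k := 0)).continuous.continuousAt.comp
        (contDiffAt_cotChart hζ.self_of_nhds (mem_cotChart_source.1 (hζz ▸ h3))).continuousAt
    refine continuousAt_const.eventually_lt h4 ?_
    rw [hζz, ← isInteriorPoint_iff_coord_pos (mem_cotChart_source.1 h3)]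
    exact hint
  have hνd : ∀ᶠ q in 𝓝 q₀,
      ContDiffAt ℝ ∞ (fun q => unfoldMap (cotChart (𝓡∂ (m + 1)) x (ζ q))) q := by
    filter_upwards [hζ, hsrc, hpos] with q h4 h5 h6
    exact (contDiffAt_unfoldMap h6.ne').comp q (contDiffAt_cotChart h4 (mem_cotChart_source.1 h5))
  -- The unfolded coordinate has to reach 0 from √x₀, with x₀ the normal coordinate of ζ q; hence d
  -- = -√x₀. It is smooth in q because ζ q is interior, so x₀ > 0.
  have hdd : ∀ᶠ q in 𝓝 q₀,
      ContDiffAt ℝ ∞ (fun q => -√((cotChart (𝓡∂ (m + 1)) x (ζ q)).1 0)) q := by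
    filter_upwards [hζ, hsrc, hpos] with q h4 h5 h6
    have h7 : ContDiffAt ℝ ∞ (fun q => (cotChart (𝓡∂ (m + 1)) x (ζ q)).1 0) q :=
      contDiff_coord_zero.contDiffAt.comp q (contDiffAt_cotChart h4 (mem_cotChart_source.1 h5))
    exact (h7.sqrt h6.ne').neg
  have hdr : -√((cotChart (𝓡∂ (m + 1)) x (ζ q₀)).1 0) ∈ Ioo (-r) r := by
    rw [hζz]
    exact ⟨by linarith, by linarith [Real.sqrt_nonneg ((cotChart (𝓡∂ (m + 1)) x z).1 0)]⟩
  have hseg := F.segment hHs hσ hr hνd hdd (hζz ▸ h1) hdr ?_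
  swap
  · filter_upwards [hpos] with q h4 u hu
    have h5 := Real.sqrt_pos.2 h4
    rw [unfoldMap_fst_zero]
    nlinarith [mul_pos (mul_pos h5 h5) (sub_pos.2 hu.2)]
  refine ⟨_, _, hseg.congr ?_ (.refl _ _) (.refl _ _), ?_⟩
  · filter_upwards [hsrc] with q h4
    rw [foldMap_unfoldMap (cotChart_coord_nonneg x _)]
    exact (cotChart (𝓡∂ (m + 1)) x).left_inv h4
  · have hσb : ∀ᶠ q in 𝓝 q₀, σ q ∈ Metric.ball (σ q₀) r :=
      σ.continuous.continuousAt.preimage_mem_nhds (Metric.ball_mem_nhds _ hr)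
    have hνb : ∀ᶠ q in 𝓝 q₀, unfoldMap (cotChart (𝓡∂ (m + 1)) x (ζ q)) ∈ Metric.ball w₀ r :=
      hνd.self_of_nhds.continuousAt.preimage_mem_nhds (Metric.isOpen_ball.mem_nhds (hζz ▸ h1))
    have hdb : ∀ᶠ q in 𝓝 q₀, -√((cotChart (𝓡∂ (m + 1)) x (ζ q)).1 0) ∈ Ioo (-r) r :=
      hdd.self_of_nhds.continuousAt.preimage_mem_nhds (isOpen_Ioo.mem_nhds hdr)
    filter_upwards [hσb, hνb, hdb] with q h4 h5 h6
    obtain ⟨f1, f2, f3, f4, -⟩ := F.flow _ h6 _ h4 _ h5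
    refine ⟨cotChart_symm_fst_mem f1, ?_, ?_⟩
    · rw [(cotChart (𝓡∂ (m + 1)) x).right_inv (mem_cotChart_target.2 f1), foldMap_fst_zero, f4,
        unfoldMap_fst_zero]
      simp
    · rw [(cotChart (𝓡∂ (m + 1)) x).right_inv (mem_cotChart_target.2 f1)]
      linarith

end Fold

/-! ### Arrival at the boundary. -/

section Hitting

variable {m : ℕ} {M : Type*} [TopologicalSpace M] [ChartedSpace (EuclideanHalfSpace (m + 1)) M]
  [IsManifold (𝓡∂ (m + 1)) ∞ M] {H : Cot (𝓡∂ (m + 1)) M → ℝ} {T : ℝ}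
  {γ γ' : ℝ → Cot (𝓡∂ (m + 1)) M}

theorem IsBichar.hasDerivWithinAt_coord
    (hH : ContMDiffOn (cotModel (𝓡∂ (m + 1))) 𝓘(ℝ, ℝ) ∞ H (nonzeroCot (𝓡∂ (m + 1)) M))
    (h : IsBichar H T γ) {t : ℝ} (ht : t ∈ Icc 0 T) {x : M}
    (hx : (γ t).1 ∈ (chartAt (EuclideanHalfSpace (m + 1)) x).source) :
    HasDerivWithinAt (fun t => (cotChart (𝓡∂ (m + 1)) x (γ t)).1 0)
      ((hamLoc x H (cotChart (𝓡∂ (m + 1)) x (γ t))).1 0) (Icc 0 T) t :=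
  ((EuclideanSpace.proj (𝕜 := ℝ) (0 : Fin (m + 1))).comp
    (ContinuousLinearMap.fst ℝ (EuclideanSpace ℝ (Fin (m + 1)))
      (Covec (m + 1)))).hasFDerivAt.comp_hasDerivWithinAt t (h.hasDerivWithinAt hH ht hx)

/-- A curve at a boundary point enters the manifold. -/
theorem IsBichar.normal_nonneg
    (hH : ContMDiffOn (cotModel (𝓡∂ (m + 1))) 𝓘(ℝ, ℝ) ∞ H (nonzeroCot (𝓡∂ (m + 1)) M))
    (h : IsBichar H T γ) {t : ℝ} (ht : t ∈ Ico 0 T) {x : M}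
    (hx : (γ t).1 ∈ (chartAt (EuclideanHalfSpace (m + 1)) x).source)
    (hb : (cotChart (𝓡∂ (m + 1)) x (γ t)).1 0 = 0) :
    0 ≤ (hamLoc x H (cotChart (𝓡∂ (m + 1)) x (γ t))).1 0 := by
  have h1 := (h.hasDerivWithinAt_coord hH (Ico_subset_Icc_self ht) hx).mono
    (Icc_subset_Icc_left ht.1)
  have h2 : HasDerivWithinAt (fun t => (cotChart (𝓡∂ (m + 1)) x (γ t)).1 0)
      ((hamLoc x H (cotChart (𝓡∂ (m + 1)) x (γ t))).1 0) (Ioi t) t :=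
    (h1.mono_of_mem_nhdsWithin (Icc_mem_nhdsGE ht.2)).Ioi_of_Ici
  rw [hasDerivWithinAt_iff_tendsto_slope' (by simp)] at h2
  refine ge_of_tendsto h2 ?_
  filter_upwards [self_mem_nhdsWithin] with u hu
  rw [slope_def_field, hb, sub_zero]
  exact div_nonneg (cotChart_coord_nonneg x _) (sub_pos.2 hu).le

/-- A curve at a boundary point came from the manifold. -/
theorem IsBichar.normal_nonpos
    (hH : ContMDiffOn (cotModel (𝓡∂ (m + 1))) 𝓘(ℝ, ℝ) ∞ H (nonzeroCot (𝓡∂ (m + 1)) M))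
    (h : IsBichar H T γ) {t : ℝ} (ht : t ∈ Ioc 0 T) {x : M}
    (hx : (γ t).1 ∈ (chartAt (EuclideanHalfSpace (m + 1)) x).source)
    (hb : (cotChart (𝓡∂ (m + 1)) x (γ t)).1 0 = 0) :
    (hamLoc x H (cotChart (𝓡∂ (m + 1)) x (γ t))).1 0 ≤ 0 := by
  have h1 := (h.hasDerivWithinAt_coord hH (Ioc_subset_Icc_self ht) hx).mono
    (Icc_subset_Icc_right ht.2)
  have h2 : HasDerivWithinAt (fun t => (cotChart (𝓡∂ (m + 1)) x (γ t)).1 0)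
      ((hamLoc x H (cotChart (𝓡∂ (m + 1)) x (γ t))).1 0) (Iio t) t :=
    (h1.mono_of_mem_nhdsWithin (Icc_mem_nhdsLE ht.1)).Iio_of_Iic
  rw [hasDerivWithinAt_iff_tendsto_slope' (by simp)] at h2
  refine le_of_tendsto h2 ?_
  filter_upwards [self_mem_nhdsWithin] with u hu
  rw [slope_def_field, hb, sub_zero]
  exact div_nonpos_of_nonneg_of_nonpos (cotChart_coord_nonneg x _) (sub_neg.2 hu).le

variable [T2Space M]

/-- A bicharacteristic that runs in the interior until it leaves `M` transversally at time `T` is at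
the boundary at no other positive time. -/
theorem IsBichar.hit_unique
    (hH : ContMDiffOn (cotModel (𝓡∂ (m + 1))) 𝓘(ℝ, ℝ) ∞ H (nonzeroCot (𝓡∂ (m + 1)) M))
    (h : IsBichar H T γ) (hT : 0 < T)
    (hint : ∀ t ∈ Ioo 0 T, (𝓡∂ (m + 1)).IsInteriorPoint (γ t).1) {x : M}
    (hx : (γ T).1 ∈ (chartAt (EuclideanHalfSpace (m + 1)) x).source)
    (hb : (cotChart (𝓡∂ (m + 1)) x (γ T)).1 0 = 0)
    (hn : (hamLoc x H (cotChart (𝓡∂ (m + 1)) x (γ T))).1 0 < 0)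
    {T' : ℝ} (hT' : 0 < T') (h' : IsBichar H T' γ') (h0 : γ' 0 = γ 0)
    (hb' : ¬ (𝓡∂ (m + 1)).IsInteriorPoint (γ' T').1) : T' = T := by
  rcases lt_trichotomy T' T with hlt | heq | hgt
  · have h1 := h'.eqOn convex_range_halfSpace hH (h.mono hlt.le) h0 ⟨hT'.le, le_rfl⟩
    rw [h1] at hb'
    exact absurd (hint T' ⟨hT', hlt⟩) hb'
  · exact heq
  -- If γ' lived beyond T, it would be at the boundary at time T with outgoing velocity and could
  -- not stay in M afterwards.
  · have h1 : γ' T = γ T := (h'.mono hgt.le).eqOn convex_range_halfSpace hH h h0 ⟨hT.le, le_rfl⟩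
    have h2 := h'.normal_nonneg hH ⟨hT.le, hgt⟩ (x := x) (by rwa [h1]) (by rwa [h1])
    rw [h1] at h2
    exact absurd hn (not_lt.2 h2)

variable {P : Type*} [NormedAddCommGroup P] [NormedSpace ℝ P] {ε : ℝ}
  {Hs : ℝ → Cot (𝓡∂ (m + 1)) M → ℝ} {σ : P →L[ℝ] ℝ} {q₀ : P}

/-- The bicharacteristics close to a given one that joins two boundary points. -/
theorem exists_hitting_segment (hHs : HamFamily ε Hs) (hσ : σ q₀ ∈ Ioo (-ε) ε) {x x' : M}
    {Z : P → Cot (𝓡∂ (m + 1)) M}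
    (hZ : ∀ᶠ q in 𝓝 q₀, ContMDiffAt 𝓘(ℝ, P) (cotModel (𝓡∂ (m + 1))) ∞ Z q)
    (hx : (Z q₀).1 ∈ (chartAt (EuclideanHalfSpace (m + 1)) x).source)
    (hb : ∀ᶠ q in 𝓝 q₀, (cotChart (𝓡∂ (m + 1)) x (Z q)).1 0 = 0)
    (hn : 0 < (hamLoc x (Hs (σ q₀)) (cotChart (𝓡∂ (m + 1)) x (Z q₀))).1 0)
    (hγ : IsBichar (Hs (σ q₀)) 1 γ) (h0 : γ 0 = Z q₀)
    (hint : ∀ t ∈ Ioo (0 : ℝ) 1, (𝓡∂ (m + 1)).IsInteriorPoint (γ t).1)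
    (hx' : (γ 1).1 ∈ (chartAt (EuclideanHalfSpace (m + 1)) x').source)
    (hb' : (cotChart (𝓡∂ (m + 1)) x' (γ 1)).1 0 = 0)
    (hn' : (hamLoc x' (Hs (σ q₀)) (cotChart (𝓡∂ (m + 1)) x' (γ 1))).1 0 < 0) :
    ∃ ζ τ, Segment Hs σ q₀ Z ζ τ ∧ τ q₀ = 1 ∧ ζ q₀ = γ 1 ∧
      ∀ᶠ q in 𝓝 q₀, (ζ q).1 ∈ (chartAt (EuclideanHalfSpace (m + 1)) x').source ∧
        (cotChart (𝓡∂ (m + 1)) x' (ζ q)).1 0 = 0 ∧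
        (hamLoc x' (Hs (σ q)) (cotChart (𝓡∂ (m + 1)) x' (ζ q))).1 0 < 0 := by
  have hI := convex_range_halfSpace (m := m)
  have h1m : (1 : ℝ) ∈ Icc (0 : ℝ) 1 := ⟨zero_le_one, le_rfl⟩
  have hend := exists_end_segment (P := P) hHs hσ (hγ.nonzero 1 h1m) hx' hb' hn'
  -- The final segment can start at any interior point close to γ 1, in particular at γ c for some c
  -- < 1 close to 1; the arc before it is covered by a short initial segment and by interior
  -- propagation.
  obtain ⟨c, hc0, hc1, hc⟩ : ∃ c : ℝ, 0 < c ∧ c < 1 ∧ ((𝓡∂ (m + 1)).IsInteriorPoint (γ c).1 →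
      ∀ ζ : P → Cot (𝓡∂ (m + 1)) M, ζ q₀ = γ c →
      (∀ᶠ q in 𝓝 q₀, ContMDiffAt 𝓘(ℝ, P) (cotModel (𝓡∂ (m + 1))) ∞ ζ q) →
      ∃ ζ' τ, Segment Hs σ q₀ ζ ζ' τ ∧
        ∀ᶠ q in 𝓝 q₀, (ζ' q).1 ∈ (chartAt (EuclideanHalfSpace (m + 1)) x').source ∧
          (cotChart (𝓡∂ (m + 1)) x' (ζ' q)).1 0 = 0 ∧
          (hamLoc x' (Hs (σ q)) (cotChart (𝓡∂ (m + 1)) x' (ζ' q))).1 0 < 0) := by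
    have h2 : Filter.Tendsto γ (𝓝[<] 1) (𝓝 (γ 1)) :=
      (hγ.continuousOn 1 h1m).mono_of_mem_nhdsWithin
        (Filter.mem_of_superset (Ioo_mem_nhdsLT zero_lt_one) Ioo_subset_Icc_self)
    obtain ⟨c, hc, hcm⟩ := ((h2.eventually hend).and (Ioo_mem_nhdsLT zero_lt_one)).exists
    exact ⟨c, hcm.1, hcm.2, hc⟩
  have hZ0 : Z q₀ ∈ nonzeroCot (𝓡∂ (m + 1)) M := h0 ▸ hγ.nonzero 0 ⟨le_rfl, zero_le_one⟩
  obtain ⟨ζ₁, τ₁, hs₁, hτ₁, -⟩ := exists_start_segment hHs hσ hZ hZ0 hx hb hn hc0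
  have hp₁ := hs₁.exists_bichar.self_of_nhds.1
  obtain ⟨ζ₂, hs₂, hζ₂⟩ := hs₁.extend hI hHs hσ hγ h0 hτ₁ hc1.le
    (fun t ht => hint t ⟨hp₁.trans_le ht.1, ht.2.trans_lt hc1⟩)
  have hci := hint c ⟨hc0, hc1⟩
  obtain ⟨ζ₃, τ₃, hs₃, hend₃⟩ := hc hci ζ₂ hζ₂ hs₂.smooth_end
  have hs := hs₂.trans hI hHs.smooth hσ hs₃ (by rw [hζ₂]; exact hci)
  obtain ⟨hp, γ₁, hγ₁, h0₁, h1₁, hi₁⟩ := hs.exists_bichar.self_of_nhds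
  obtain ⟨e1, e2, e3⟩ := hend₃.self_of_nhds
  -- The composed segment and γ start at the same covector, and each is at the boundary at its final
  -- time. A transversal exit admits only one such positive time.
  have hone : 1 = τ₁ q₀ + (c - τ₁ q₀) + τ₃ q₀ := by
    refine hγ₁.hit_unique (hHs.smooth.smooth hσ) hp hi₁ (x := x') (by rw [h1₁]; exact e1)
      (by rw [h1₁]; exact e2) (by rw [h1₁]; exact e3) zero_lt_one hγ (h0.trans h0₁.symm) ?_
    rw [isInteriorPoint_iff_coord_pos hx', hb']
    exact lt_irrefl _
  refine ⟨ζ₃, _, hs, hone.symm, ?_, hend₃⟩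
  have := hs.end_eq hI hHs.smooth hσ hγ hone.ge h0
  rw [this, ← hone]

end Hitting

/-! ### Coordinates for covectors over the boundary of the half space. -/

section BoundaryCoordinates

/-- The inclusion `x' ↦ (0, x')` of the boundary of the half space. -/
def bdryIncl (m : ℕ) : EuclideanSpace ℝ (Fin m) →L[ℝ] EuclideanSpace ℝ (Fin (m + 1)) :=
  LinearMap.toContinuousLinearMap
    { toFun := fun a => WithLp.toLp 2 (Fin.cons 0 fun i => a i)
      map_add' := fun a b => by
        ext i
        refine Fin.cases ?_ (fun i => ?_) i <;> simp
      map_smul' := fun c a => by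
        ext i
        refine Fin.cases ?_ (fun i => ?_) i <;> simp }

/-- The projection `(x₀, x') ↦ x'`. -/
def bdryProj (m : ℕ) : EuclideanSpace ℝ (Fin (m + 1)) →L[ℝ] EuclideanSpace ℝ (Fin m) :=
  LinearMap.toContinuousLinearMap
    { toFun := fun a => WithLp.toLp 2 fun i => a i.succ
      map_add' := fun a b => by ext i; simp
      map_smul' := fun c a => by ext i; simp }

variable {m : ℕ}

theorem bdryIncl_zero (a : EuclideanSpace ℝ (Fin m)) : bdryIncl m a 0 = 0 := by
  simp [bdryIncl]

theorem bdryProj_bdryIncl (a : EuclideanSpace ℝ (Fin m)) : bdryProj m (bdryIncl m a) = a := by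
  ext i
  simp [bdryIncl, bdryProj]

theorem bdryIncl_bdryProj {a : EuclideanSpace ℝ (Fin (m + 1))} (h : a 0 = 0) :
    bdryIncl m (bdryProj m a) = a := by
  ext i
  refine Fin.cases ?_ (fun i => ?_) i
  · rw [bdryIncl_zero, h]
  · simp [bdryIncl, bdryProj]

theorem bdryIncl_mem_range (a : EuclideanSpace ℝ (Fin m)) :
    bdryIncl m a ∈ range (𝓡∂ (m + 1)) := by
  rw [range_modelWithCornersEuclideanHalfSpace]
  exact (bdryIncl_zero a).ge

theorem isOpen_bdryIncl_target {M : Type*} [TopologicalSpace M]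
    [ChartedSpace (EuclideanHalfSpace (m + 1)) M] (x : M) :
    IsOpen {a : EuclideanSpace ℝ (Fin m) | bdryIncl m a ∈ (extChartAt (𝓡∂ (m + 1)) x).target} := by
  have h1 : {a : EuclideanSpace ℝ (Fin m) | bdryIncl m a ∈ (extChartAt (𝓡∂ (m + 1)) x).target} =
      (fun a => (𝓡∂ (m + 1)).symm (bdryIncl m a)) ⁻¹'
        (chartAt (EuclideanHalfSpace (m + 1)) x).target := by
    ext a
    rw [mem_ofPred_eq, extChartAt_target]
    exact and_iff_left (bdryIncl_mem_range _)
  rw [h1]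
  exact (chartAt _ x).open_target.preimage
    ((𝓡∂ (m + 1)).continuous_symm.comp (bdryIncl m).continuous)

variable {M : Type*} [TopologicalSpace M] [ChartedSpace (EuclideanHalfSpace (m + 1)) M]
  [IsManifold (𝓡∂ (m + 1)) ∞ M] {H : Cot (𝓡∂ (m + 1)) M → ℝ}

/-- The covector over the boundary with coordinates `(0, x', ξ)` in the chart at `x`. -/
def bdryCot (x : M) (w : EuclideanSpace ℝ (Fin m) × Covec (m + 1)) : Cot (𝓡∂ (m + 1)) M :=
  (cotChart (𝓡∂ (m + 1)) x).symm (bdryIncl m w.1, w.2)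

theorem cotChart_bdryCot {x : M} {w : EuclideanSpace ℝ (Fin m) × Covec (m + 1)}
    (hw : bdryIncl m w.1 ∈ (extChartAt (𝓡∂ (m + 1)) x).target) :
    (bdryCot x w).1 ∈ (chartAt (EuclideanHalfSpace (m + 1)) x).source ∧
      cotChart (𝓡∂ (m + 1)) x (bdryCot x w) = (bdryIncl m w.1, w.2) := by
  have h : (bdryIncl m w.1, w.2) ∈ (cotChart (𝓡∂ (m + 1)) x).target := mem_cotChart_target.2 hw
  exact ⟨cotChart_symm_fst_mem hw, (cotChart (𝓡∂ (m + 1)) x).right_inv h⟩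

theorem bdryCot_eq {x : M} {z : Cot (𝓡∂ (m + 1)) M}
    (hz : z.1 ∈ (chartAt (EuclideanHalfSpace (m + 1)) x).source)
    (hb : (cotChart (𝓡∂ (m + 1)) x z).1 0 = 0) :
    bdryCot x (bdryProj m (cotChart (𝓡∂ (m + 1)) x z).1, (cotChart (𝓡∂ (m + 1)) x z).2) = z := by
  rw [bdryCot]
  simp only [bdryIncl_bdryProj hb, Prod.mk.eta]
  exact (cotChart (𝓡∂ (m + 1)) x).left_inv (mem_cotChart_source.2 hz)

theorem bdryCot_smul {x : M} {w : EuclideanSpace ℝ (Fin m) × Covec (m + 1)}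
    (hw : bdryIncl m w.1 ∈ (extChartAt (𝓡∂ (m + 1)) x).target) (c : ℝ) :
    bdryCot x (w.1, c • w.2) = dilate c (bdryCot x w) := by
  obtain ⟨h1, h2⟩ := cotChart_bdryCot hw
  have h3 := cotChart_dilate c h1
  rw [h2] at h3
  rw [bdryCot, ← h3]
  exact (cotChart (𝓡∂ (m + 1)) x).left_inv (mem_cotChart_source.2 h1)

theorem bdryCot_mem_nonzeroCot {x : M} {w : EuclideanSpace ℝ (Fin m) × Covec (m + 1)}
    (hw : bdryIncl m w.1 ∈ (extChartAt (𝓡∂ (m + 1)) x).target) (hw2 : w.2 ≠ 0) :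
    bdryCot x w ∈ nonzeroCot (𝓡∂ (m + 1)) M :=
  cotChart_symm_mem_nonzeroCot hw hw2

theorem contMDiffAt_bdryCot {P : Type*} [NormedAddCommGroup P] [NormedSpace ℝ P] {x : M}
    {w : P → EuclideanSpace ℝ (Fin m) × Covec (m + 1)} {q : P} (hw : ContDiffAt ℝ ∞ w q)
    (hq : bdryIncl m (w q).1 ∈ (extChartAt (𝓡∂ (m + 1)) x).target) :
    ContMDiffAt 𝓘(ℝ, P) (cotModel (𝓡∂ (m + 1))) ∞ (fun q => bdryCot x (w q)) q := by
  refine contMDiffAt_cotChart_symm (W := fun q => (bdryIncl m (w q).1, (w q).2)) ?_ ?_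
  · exact ((bdryIncl m).contDiff.contDiffAt.comp q hw.fst).prodMk hw.snd
  · exact (hw.continuousAt.fst).preimage_mem_nhds ((isOpen_bdryIncl_target x).mem_nhds hq)

theorem continuousAt_normal (hH : ContMDiffOn (cotModel (𝓡∂ (m + 1))) 𝓘(ℝ, ℝ) ∞ H
    (nonzeroCot (𝓡∂ (m + 1)) M)) {x : M} {w : EuclideanSpace ℝ (Fin m) × Covec (m + 1)}
    (hw : bdryIncl m w.1 ∈ (extChartAt (𝓡∂ (m + 1)) x).target) (hw2 : w.2 ≠ 0) :
    ContinuousAt (fun w : EuclideanSpace ℝ (Fin m) × Covec (m + 1) =>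
      (hamLoc x H (bdryIncl m w.1, w.2)).1 0) w := by
  have h1 : ContinuousWithinAt (hamLoc x H) (range (cotModel (𝓡∂ (m + 1)))) (bdryIncl m w.1, w.2) :=
    (contDiffWithinAt_hamLoc hH hw hw2).continuousWithinAt
  have h2 : ContinuousAt (fun w : EuclideanSpace ℝ (Fin m) × Covec (m + 1) =>
      hamLoc x H (bdryIncl m w.1, w.2)) w := by
    refine Filter.Tendsto.comp (y := 𝓝[range (cotModel (𝓡∂ (m + 1)))] (bdryIncl m w.1, w.2)) h1 ?_
    refine tendsto_nhdsWithin_iff.2 ⟨?_, .of_forall fun w => ?_⟩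
    · exact (((bdryIncl m).continuous.comp continuous_fst).prodMk continuous_snd).continuousAt
    · rw [range_cotModel]
      exact ⟨bdryIncl_mem_range _, mem_univ _⟩
  exact (contDiff_coord_zero (k := 0)).continuous.continuousAt.comp h2

end BoundaryCoordinates

/-! ### Exit time and exit point as functions of the initial covector. -/

section HitCharts

variable {m : ℕ} {M : Type*} [TopologicalSpace M] [ChartedSpace (EuclideanHalfSpace (m + 1)) M]
  [IsManifold (𝓡∂ (m + 1)) ∞ M] {H : Cot (𝓡∂ (m + 1)) M → ℝ}

/-- For the boundary covectors with coordinates `(0, w)`, `w ∈ Ω`, the bicharacteristic enters `M`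
transversally and leaves it transversally at the time `τ w`, at the covector `ζ w`. -/
structure HitChart (H : Cot (𝓡∂ (m + 1)) M → ℝ) (x₀ x₁ : M)
    (Ω : Set (EuclideanSpace ℝ (Fin m) × Covec (m + 1)))
    (ζ : EuclideanSpace ℝ (Fin m) × Covec (m + 1) → Cot (𝓡∂ (m + 1)) M)
    (τ : EuclideanSpace ℝ (Fin m) × Covec (m + 1) → ℝ) : Prop where
  start_mem : ∀ w ∈ Ω, bdryIncl m w.1 ∈ (extChartAt (𝓡∂ (m + 1)) x₀).target ∧ w.2 ≠ 0
  start_normal : ∀ w ∈ Ω, 0 < (hamLoc x₀ H (bdryIncl m w.1, w.2)).1 0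
  bichar : ∀ w ∈ Ω, 0 < τ w ∧ ∃ γ, IsBichar H (τ w) γ ∧ γ 0 = bdryCot x₀ w ∧ γ (τ w) = ζ w ∧
    ∀ t ∈ Ioo 0 (τ w), (𝓡∂ (m + 1)).IsInteriorPoint (γ t).1
  end_chart : ∀ w ∈ Ω, (ζ w).1 ∈ (chartAt (EuclideanHalfSpace (m + 1)) x₁).source ∧
    (cotChart (𝓡∂ (m + 1)) x₁ (ζ w)).1 0 = 0 ∧
    (hamLoc x₁ H (cotChart (𝓡∂ (m + 1)) x₁ (ζ w))).1 0 < 0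
  smooth_end : ∀ w ∈ Ω, ContMDiffAt 𝓘(ℝ, EuclideanSpace ℝ (Fin m) × Covec (m + 1))
    (cotModel (𝓡∂ (m + 1))) ∞ ζ w
  smooth_time : ∀ w ∈ Ω, ContDiffAt ℝ ∞ τ w

/-- The map `(x', ξ) ↦ (x', (τ, y'))` to the exit time and the exit point. -/
def hitMap (x₁ : M) (ζ : EuclideanSpace ℝ (Fin m) × Covec (m + 1) → Cot (𝓡∂ (m + 1)) M)
    (τ : EuclideanSpace ℝ (Fin m) × Covec (m + 1) → ℝ)
    (w : EuclideanSpace ℝ (Fin m) × Covec (m + 1)) :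
    EuclideanSpace ℝ (Fin m) × (ℝ × EuclideanSpace ℝ (Fin m)) :=
  (w.1, (τ w, bdryProj m (cotChart (𝓡∂ (m + 1)) x₁ (ζ w)).1))

variable {x₀ x₁ : M} {Ω : Set (EuclideanSpace ℝ (Fin m) × Covec (m + 1))}
  {ζ : EuclideanSpace ℝ (Fin m) × Covec (m + 1) → Cot (𝓡∂ (m + 1)) M}
  {τ : EuclideanSpace ℝ (Fin m) × Covec (m + 1) → ℝ}
  {w : EuclideanSpace ℝ (Fin m) × Covec (m + 1)}

theorem HitChart.mono (h : HitChart H x₀ x₁ Ω ζ τ)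
    {Ω' : Set (EuclideanSpace ℝ (Fin m) × Covec (m + 1))} (hΩ : Ω' ⊆ Ω) :
    HitChart H x₀ x₁ Ω' ζ τ :=
  ⟨fun w hw => h.start_mem w (hΩ hw), fun w hw => h.start_normal w (hΩ hw),
    fun w hw => h.bichar w (hΩ hw), fun w hw => h.end_chart w (hΩ hw),
    fun w hw => h.smooth_end w (hΩ hw), fun w hw => h.smooth_time w (hΩ hw)⟩

theorem HitChart.contDiffAt_hitMap (h : HitChart H x₀ x₁ Ω ζ τ) (hw : w ∈ Ω) :
    ContDiffAt ℝ ∞ (hitMap x₁ ζ τ) w := by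
  have h1 := contDiffAt_cotChart (h.smooth_end w hw) (h.end_chart w hw).1
  exact contDiffAt_fst.prodMk ((h.smooth_time w hw).prodMk
    ((bdryProj m).contDiff.contDiffAt.comp w h1.fst))

theorem HitChart.end_not_interior (h : HitChart H x₀ x₁ Ω ζ τ) (hw : w ∈ Ω) :
    ¬ (𝓡∂ (m + 1)).IsInteriorPoint (ζ w).1 := by
  rw [isInteriorPoint_iff_coord_pos (h.end_chart w hw).1, (h.end_chart w hw).2.1]
  exact lt_irrefl _

variable [T2Space M]

/-- Before the exit the curve is in the interior, and after a transversal exit it has no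
continuation in M. Being at the boundary at a positive time therefore identifies both the time and
the covector. -/
theorem HitChart.unique (hH : ContMDiffOn (cotModel (𝓡∂ (m + 1))) 𝓘(ℝ, ℝ) ∞ H
    (nonzeroCot (𝓡∂ (m + 1)) M)) (h : HitChart H x₀ x₁ Ω ζ τ) (hw : w ∈ Ω)
    {γ : ℝ → Cot (𝓡∂ (m + 1)) M} {T : ℝ} (hT : 0 < T) (hγ : IsBichar H T γ)
    (h0 : γ 0 = bdryCot x₀ w) (hb : ¬ (𝓡∂ (m + 1)).IsInteriorPoint (γ T).1) :
    T = τ w ∧ γ T = ζ w ∧ ∀ t ∈ Ioo 0 T, (𝓡∂ (m + 1)).IsInteriorPoint (γ t).1 := by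
  obtain ⟨hp, γ', hγ', h0', h1', hi⟩ := h.bichar w hw
  obtain ⟨e1, e2, e3⟩ := h.end_chart w hw
  have hTe : T = τ w := hγ'.hit_unique hH hp hi (x := x₁) (by rwa [h1']) (by rwa [h1'])
    (by rwa [h1']) hT hγ (h0.trans h0'.symm) hb
  subst hTe
  have he := hγ.eqOn convex_range_halfSpace hH hγ' (h0.trans h0'.symm)
  refine ⟨rfl, ?_, fun t ht => ?_⟩
  · rw [← h1']
    exact he ⟨hp.le, le_rfl⟩
  · rw [he (Ioo_subset_Icc_self ht)]
    exact hi t ht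

/-- The dilated bicharacteristic starts at the dilated covector and is at the boundary at time τ/c;
uniqueness of the exit gives the rest. -/
theorem HitChart.smul (hH : IsHomogeneousSmooth H) (h : HitChart H x₀ x₁ Ω ζ τ) (hw : w ∈ Ω)
    {c : ℝ} (hc : 0 < c) (hcw : (w.1, c • w.2) ∈ Ω) :
    τ (w.1, c • w.2) = τ w / c ∧ ζ (w.1, c • w.2) = dilate c (ζ w) := by
  obtain ⟨hp, γ, hγ, h0, h1, hi⟩ := h.bichar w hw
  have hcd : c * (τ w / c) = τ w := by field_simp
  obtain ⟨e1, e2, -⟩ := h.unique hH.smooth hcw (div_pos hp hc) (hγ.rescale hH hc)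
    (by simp only [mul_zero, h0]; exact (bdryCot_smul (h.start_mem w hw).1 c).symm)
    (by
      simp only [hcd, h1]
      exact h.end_not_interior hw)
  refine ⟨e1.symm, ?_⟩
  rw [← e2]
  simp only [hcd, h1]

/-- A bicharacteristic that joins two boundary points transversally is surrounded by such. -/
theorem exists_hitChart (hH : IsHomogeneousSmooth H) {γ : ℝ → Cot (𝓡∂ (m + 1)) M}
    (hw : bdryIncl m w.1 ∈ (extChartAt (𝓡∂ (m + 1)) x₀).target) (hγ : IsBichar H 1 γ)
    (h0 : γ 0 = bdryCot x₀ w) (hn : 0 < (hamLoc x₀ H (bdryIncl m w.1, w.2)).1 0)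
    (hint : ∀ t ∈ Ioo (0 : ℝ) 1, (𝓡∂ (m + 1)).IsInteriorPoint (γ t).1)
    (hx₁ : (γ 1).1 ∈ (chartAt (EuclideanHalfSpace (m + 1)) x₁).source)
    (hb₁ : (cotChart (𝓡∂ (m + 1)) x₁ (γ 1)).1 0 = 0)
    (hn₁ : (hamLoc x₁ H (cotChart (𝓡∂ (m + 1)) x₁ (γ 1))).1 0 < 0) :
    ∃ Ω ζ τ, HitChart H x₀ x₁ Ω ζ τ ∧ IsOpen Ω ∧ w ∈ Ω ∧ τ w = 1 ∧ ζ w = γ 1 := by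
  obtain ⟨hs, hc⟩ := cotChart_bdryCot hw
  have hw2 : w.2 ≠ 0 := by
    have h1 := (covec_eq_zero_iff hs).not.1 (h0 ▸ hγ.nonzero 0 ⟨le_rfl, zero_le_one⟩)
    rwa [hc] at h1
  have hmem : ∀ᶠ v : EuclideanSpace ℝ (Fin m) × Covec (m + 1) in 𝓝 w,
      bdryIncl m v.1 ∈ (extChartAt (𝓡∂ (m + 1)) x₀).target ∧ v.2 ≠ 0 := by
    refine Filter.Eventually.and ?_ (continuous_snd.continuousAt.eventually_ne hw2)
    exact continuous_fst.continuousAt.preimage_mem_nhds ((isOpen_bdryIncl_target x₀).mem_nhds hw)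
  have hnorm : ∀ᶠ v : EuclideanSpace ℝ (Fin m) × Covec (m + 1) in 𝓝 w,
      0 < (hamLoc x₀ H (bdryIncl m v.1, v.2)).1 0 :=
    continuousAt_const.eventually_lt (continuousAt_normal hH.smooth hw hw2) hn
  -- Only the initial covector varies here: the family is constant, σ = 0, and the bound 1 on the
  -- parameter is arbitrary.
  obtain ⟨ζ, τ, hseg, hτ, hζ, hend⟩ := exists_hitting_segment (hamFamily_const hH 1)
    (P := EuclideanSpace ℝ (Fin m) × Covec (m + 1)) (σ := 0) (q₀ := w) (Z := bdryCot x₀)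
    (x := x₀) (x' := x₁) (γ := γ) (by simp)
    (hmem.mono fun v hv => contMDiffAt_bdryCot contDiffAt_id hv.1) hs
    (hmem.mono fun v hv => by rw [(cotChart_bdryCot hv.1).2]; exact bdryIncl_zero _)
    (by rw [hc]; exact hn) hγ h0 hint hx₁ hb₁ hn₁
  obtain ⟨Ω, hΩ, hΩo, hwΩ⟩ := eventually_nhds_iff.1
    (hmem.and (hnorm.and (hseg.exists_bichar.and (hend.and
      (hseg.smooth_end.and hseg.smooth_time)))))
  exact ⟨Ω, ζ, τ, ⟨fun v hv => (hΩ v hv).1, fun v hv => (hΩ v hv).2.1,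
    fun v hv => (hΩ v hv).2.2.1, fun v hv => (hΩ v hv).2.2.2.1,
    fun v hv => (hΩ v hv).2.2.2.2.1, fun v hv => (hΩ v hv).2.2.2.2.2⟩, hΩo, hwΩ, hτ, hζ⟩

theorem finrank_covec (n : ℕ) : Module.finrank ℝ (Covec n) = n := by
  rw [← LinearEquiv.finrank_eq (LinearMap.toContinuousLinearMap (𝕜 := ℝ)
    (E := EuclideanSpace ℝ (Fin n)) (F' := ℝ)), Module.finrank_linearMap]
  simp

/-- When the endpoints are not conjugate, the exit time and the exit point are coordinates. -/
theorem HitChart.exists_hasFDerivAt_equiv (hH : IsHomogeneousSmooth H)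
    (h : HitChart H x₀ x₁ Ω ζ τ) (hΩ : IsOpen Ω) {ξ₀ : Covec (m + 1)}
    (hw : w ∈ Ω) (hwe : w = (bdryProj m (extChartAt (𝓡∂ (m + 1)) x₀ x₀), ξ₀))
    (hx₀ : extChartAt (𝓡∂ (m + 1)) x₀ x₀ 0 = 0) (hτ : τ w = 1) (hζ : (ζ w).1 = x₁)
    (hconj : NotConjugate H x₀ ξ₀) :
    ∃ L : (EuclideanSpace ℝ (Fin m) × Covec (m + 1)) ≃L[ℝ]
        EuclideanSpace ℝ (Fin m) × (ℝ × EuclideanSpace ℝ (Fin m)),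
      HasFDerivAt (hitMap x₁ ζ τ) (L : (EuclideanSpace ℝ (Fin m) × Covec (m + 1)) →L[ℝ]
        EuclideanSpace ℝ (Fin m) × (ℝ × EuclideanSpace ℝ (Fin m))) w := by
  obtain ⟨D, O, g, hD, hξ₀, hO, hbij, hleft, -, hg⟩ := hconj
  have hstart : ∀ ξ : Covec (m + 1), bdryCot x₀ (w.1, ξ) = ⟨x₀, ξ⟩ := by
    intro ξ
    have h1 := bdryCot_eq (x := x₀) (z := (⟨x₀, ξ⟩ : Cot (𝓡∂ (m + 1)) M))
      (mem_chart_source _ x₀) (by rw [cotChart_fst]; exact hx₀)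
    have h2 : cotChart (𝓡∂ (m + 1)) x₀ (⟨x₀, ξ⟩ : Cot (𝓡∂ (m + 1)) M) =
        (extChartAt (𝓡∂ (m + 1)) x₀ x₀, ξ) := cotChart_self (⟨x₀, ξ⟩ : Cot (𝓡∂ (m + 1)) M)
    rw [h2] at h1
    rw [hwe]
    exact h1
  have hwξ : (w.1, ξ₀) = w := by rw [hwe]
  -- the exponential map
  have hexp : ∀ ξ ∈ expDomain H x₀, ∃ γ, IsBichar H 1 γ ∧ γ 0 = ⟨x₀, ξ⟩ ∧
      (γ 1).1 = expMap H x₀ ξ := by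
    intro ξ hξ
    have h1 : ∃ γ : ℝ → Cot (𝓡∂ (m + 1)) M, IsBichar H 1 γ ∧ γ 0 = ⟨x₀, ξ⟩ := hξ
    refine ⟨h1.choose, h1.choose_spec.1, h1.choose_spec.2, ?_⟩
    rw [expMap, dif_pos hξ]
  have hexp₀ : expMap H x₀ ξ₀ = x₁ := by
    obtain ⟨γ, hγ, h0, h1⟩ := hexp ξ₀ hξ₀.2
    obtain ⟨-, γ', hγ', h0', h1', -⟩ := h.bichar w hw
    rw [hτ] at hγ' h1'
    rw [← h1, ← hζ, ← h1', hγ.eqOn convex_range_halfSpace hH.smooth hγ' ?_ ⟨zero_le_one, le_rfl⟩]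
    rw [h0, h0', ← hwξ, hstart]
  have hgx₁ : g x₁ = ξ₀ := hexp₀ ▸ hleft hξ₀
  have hx₁O : x₁ ∈ O := hexp₀ ▸ hbij.mapsTo hξ₀
  set F := fderiv ℝ (hitMap x₁ ζ τ) w with hF
  have hFd : HasFDerivAt (hitMap x₁ ζ τ) F w :=
    ((h.contDiffAt_hitMap hw).differentiableAt (by simp)).hasFDerivAt
  have hF1 : ∀ v, (F v).1 = v.1 := by
    intro v
    have h1 : HasFDerivAt (fun w => (hitMap x₁ ζ τ w).1)
        ((ContinuousLinearMap.fst ℝ _ _).comp F) w := hFd.fst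
    exact DFunLike.congr_fun (h1.unique hasFDerivAt_fst) v
  set N : Covec (m + 1) →L[ℝ] ℝ × EuclideanSpace ℝ (Fin m) :=
    (ContinuousLinearMap.snd ℝ _ _).comp (F.comp (ContinuousLinearMap.inr ℝ _ _)) with hN
  have hNd : HasFDerivAt (fun ξ => (hitMap x₁ ζ τ (w.1, ξ)).2) N ξ₀ := by
    have h1 : HasFDerivAt (hitMap x₁ ζ τ) F (w.1, ξ₀) := by rwa [hwξ]
    exact (h1.comp ξ₀ (hasFDerivAt_prodMk_right w.1 ξ₀)).snd
  -- the direction of the dilations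
  have hN1 : N ξ₀ = (-1, 0) := by
    have h1 : HasDerivAt (fun c : ℝ => c • ξ₀) ξ₀ 1 := by
      simpa using (hasDerivAt_id (1 : ℝ)).smul_const ξ₀
    have hNd' : HasFDerivAt (fun ξ => (hitMap x₁ ζ τ (w.1, ξ)).2) N ((1 : ℝ) • ξ₀) := by
      rwa [one_smul]
    have h2 := hNd'.comp_hasDerivAt (f := fun c : ℝ => c • ξ₀) 1 h1
    -- Along the ray c ξ₀ the exit time is 1/c and the exit point is fixed.
    have h3 : HasDerivAt (fun c : ℝ => (c⁻¹, (hitMap x₁ ζ τ w).2.2))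
        ((-1 : ℝ), (0 : EuclideanSpace ℝ (Fin m))) 1 := by
      refine HasDerivAt.prodMk ?_ (hasDerivAt_const _ _)
      simpa using hasDerivAt_inv (one_ne_zero (α := ℝ))
    refine h2.unique (h3.congr_of_eventuallyEq ?_)
    have h4 : ContinuousAt (fun c : ℝ => (w.1, c • ξ₀)) 1 := by fun_prop
    have h5 : ∀ᶠ c : ℝ in 𝓝 1, (w.1, c • ξ₀) ∈ Ω :=
      h4.preimage_mem_nhds (hΩ.mem_nhds (by simpa [hwξ] using hw))
    filter_upwards [h5, lt_mem_nhds (zero_lt_one (α := ℝ))] with c h6 h7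
    have hw2 : w.2 = ξ₀ := by rw [hwe]
    obtain ⟨h8, h9⟩ := h.smul hH hw h7 (by rwa [hw2])
    rw [hw2] at h8 h9
    simp only [Function.comp_apply, hitMap, h8, h9, hτ, one_div]
    rw [cotChart_dilate c (h.end_chart w hw).1]
  -- the directions tangent to the boundary
  have hN2 : ∀ v : EuclideanSpace ℝ (Fin m), ∃ δ, N δ = (0, v) := by
    set y₀ : EuclideanSpace ℝ (Fin m) := bdryProj m (extChartAt (𝓡∂ (m + 1)) x₁ x₁) with hy₀
    have hx₁0 : extChartAt (𝓡∂ (m + 1)) x₁ x₁ 0 = 0 := by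
      have h1 := (h.end_chart w hw).2.1
      rwa [cotChart_fst, hζ] at h1
    have hjy : bdryIncl m y₀ = extChartAt (𝓡∂ (m + 1)) x₁ x₁ := bdryIncl_bdryProj hx₁0
    have htar : bdryIncl m y₀ ∈ (extChartAt (𝓡∂ (m + 1)) x₁).target := by
      rw [hjy]
      exact mem_extChartAt_target x₁
    set p : EuclideanSpace ℝ (Fin m) → M := fun y =>
      (extChartAt (𝓡∂ (m + 1)) x₁).symm (bdryIncl m y) with hp
    have hpy : p y₀ = x₁ := by
      simp only [hp, hjy]
      exact extChartAt_to_inv x₁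
    have hpd : ContMDiffAt 𝓘(ℝ, EuclideanSpace ℝ (Fin m)) (𝓡∂ (m + 1)) ∞ p y₀ := by
      have h1 : ContMDiffWithinAt 𝓘(ℝ, EuclideanSpace ℝ (Fin (m + 1))) (𝓡∂ (m + 1)) ∞
          (extChartAt (𝓡∂ (m + 1)) x₁).symm (range (𝓡∂ (m + 1))) (bdryIncl m y₀) :=
        contMDiffWithinAt_extChartAt_symm_range _ htar
      have h2 := ContMDiffWithinAt.comp (t := range (𝓡∂ (m + 1))) (s := univ) y₀ h1
        ((bdryIncl m).contDiff.contMDiff.contMDiffAt.contMDiffWithinAt)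
        (fun y _ => bdryIncl_mem_range y)
      exact h2.contMDiffAt Filter.univ_mem
    have hGd : ContDiffAt ℝ ∞ (fun y => g (p y)) y₀ := by
      have h1 : ContMDiffAt (𝓡∂ (m + 1)) 𝓘(ℝ, Covec (m + 1)) ∞ g (p y₀) := by
        rw [hpy]
        exact hg.contMDiffAt (hO.mem_nhds hx₁O)
      exact (ContMDiffAt.comp y₀ h1 hpd).contDiffAt
    have hG := (hGd.differentiableAt (by simp)).hasFDerivAt
    have hGy : g (p y₀) = ξ₀ := by rw [hpy, hgx₁]
    have hNd' : HasFDerivAt (fun ξ => (hitMap x₁ ζ τ (w.1, ξ)).2) N (g (p y₀)) := by rwa [hGy]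
    have h1 := hNd'.comp y₀ (f := fun y => g (p y)) hG
    -- The covector g (p y) reaches the boundary point p y at time 1. By uniqueness of the exit its
    -- exit time is 1 and its exit point has coordinates y, so g ∘ p is a section along which only
    -- the exit point moves.
    have h2 : ((fun ξ => (hitMap x₁ ζ τ (w.1, ξ)).2) ∘ fun y => g (p y)) =ᶠ[𝓝 y₀]
        fun y => ((1 : ℝ), y) := by
      have e1 : ∀ᶠ y in 𝓝 y₀, p y ∈ O :=
        hpd.continuousAt.preimage_mem_nhds (hO.mem_nhds (by rwa [hpy]))
      have e2 : ∀ᶠ y in 𝓝 y₀, (w.1, g (p y)) ∈ Ω := by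
        have h3 : ContinuousAt (fun y => (w.1, g (p y))) y₀ :=
          continuousAt_const.prodMk hGd.continuousAt
        exact h3.preimage_mem_nhds (hΩ.mem_nhds (by rw [hGy, hwξ]; exact hw))
      have e3 : ∀ᶠ y in 𝓝 y₀, bdryIncl m y ∈ (extChartAt (𝓡∂ (m + 1)) x₁).target :=
        (isOpen_bdryIncl_target x₁).mem_nhds htar
      filter_upwards [e1, e2, e3] with y f1 f2 f3
      obtain ⟨ξ, hξ, hξp⟩ := hbij.surjOn f1
      have hgp : g (p y) = ξ := by rw [← hξp]; exact hleft hξ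
      obtain ⟨γ, hγ, hγ0, hγ1⟩ := hexp ξ hξ.2
      have f4 : p y ∈ (chartAt (EuclideanHalfSpace (m + 1)) x₁).source := by
        rw [← extChartAt_source (𝓡∂ (m + 1))]
        exact (extChartAt (𝓡∂ (m + 1)) x₁).map_target f3
      have f5 : extChartAt (𝓡∂ (m + 1)) x₁ (p y) = bdryIncl m y :=
        (extChartAt (𝓡∂ (m + 1)) x₁).right_inv f3
      have hnint : ¬ (𝓡∂ (m + 1)).IsInteriorPoint (γ 1).1 := by
        rw [hγ1, hξp, isInteriorPoint_iff_chart f4, f5,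
          interior_range_modelWithCornersEuclideanHalfSpace, mem_ofPred_eq, bdryIncl_zero]
        exact lt_irrefl _
      rw [hgp] at f2
      obtain ⟨g1, g2, -⟩ := h.unique hH.smooth f2 zero_lt_one hγ
        (by rw [hγ0, hstart]) hnint
      simp only [Function.comp_apply, hgp, hitMap, ← g1, ← g2, cotChart_fst, hγ1, hξp, f5,
        bdryProj_bdryIncl]
    have h3 := h1.unique ((hasFDerivAt_prodMk_right (1 : ℝ) y₀).congr_of_eventuallyEq h2)
    intro v
    exact ⟨_, DFunLike.congr_fun h3 v⟩
  have hsurj : Function.Surjective N := by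
    rintro ⟨a, v⟩
    obtain ⟨δ, hδ⟩ := hN2 v
    refine ⟨-a • ξ₀ + δ, ?_⟩
    rw [map_add, map_smul, hN1, hδ]
    simp
  have hinj : Function.Injective N := by
    have h1 : Module.finrank ℝ (Covec (m + 1)) =
        Module.finrank ℝ (ℝ × EuclideanSpace ℝ (Fin m)) := by
      rw [finrank_covec, Module.finrank_prod]
      simp [add_comm]
    exact (LinearMap.injective_iff_surjective_of_finrank_eq_finrank
      (f := (N : Covec (m + 1) →ₗ[ℝ] ℝ × EuclideanSpace ℝ (Fin m))) h1).2 hsurj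
  -- The first component of F is the identity on the base point, so injectivity reduces to that of N
  -- on the fibre.
  have hFinj : Function.Injective F := by
    refine (injective_iff_map_eq_zero F).2 fun v hv => ?_
    have h1 : v.1 = 0 := by rw [← hF1 v, hv]; rfl
    have h2 : v = (0, v.2) := Prod.ext h1 rfl
    have h3 : N v.2 = 0 := by
      change (F (0, v.2)).2 = 0
      rw [← h2, hv]
      rfl
    rw [h2, hinj (h3.trans (map_zero N).symm)]
    rfl
  have hrank : Module.finrank ℝ (EuclideanSpace ℝ (Fin m) × Covec (m + 1)) =
      Module.finrank ℝ (EuclideanSpace ℝ (Fin m) × (ℝ × EuclideanSpace ℝ (Fin m))) := by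
    rw [Module.finrank_prod, Module.finrank_prod, finrank_covec, Module.finrank_prod]
    simp [add_comm]
  refine ⟨(LinearEquiv.ofInjectiveOfFinrankEq
    (F : EuclideanSpace ℝ (Fin m) × Covec (m + 1) →ₗ[ℝ] _) hFinj hrank).toContinuousLinearEquiv, ?_⟩
  convert! hFd using 1

end HitCharts

/-! ### The energy at unit time and its differential. -/

section EnergyVariation

theorem hamField_congr {n : ℕ} {X : Type*} [TopologicalSpace X]
    {I : ModelWithCorners ℝ (EuclideanSpace ℝ (Fin n)) X}
    {M : Type*} [TopologicalSpace M] [ChartedSpace X M] [IsManifold I ∞ M]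
    {H H' : Cot I M → ℝ} (h : EqOn H H' (nonzeroCot I M)) {z : Cot I M}
    (hz : z ∈ nonzeroCot I M) : hamField H z = hamField H' z := by
  have h1 : H =ᶠ[𝓝 z] H' := Filter.eventuallyEq_of_mem (isOpen_nonzeroCot.mem_nhds hz) h
  have h2 : diffCot H z = diffCot H' z := by
    exact h1.mfderiv_eq
  rw [hamField_eq_sgrad, hamField_eq_sgrad, h2]

theorem IsBichar.congr_ham {n : ℕ} {X : Type*} [TopologicalSpace X]
    {I : ModelWithCorners ℝ (EuclideanSpace ℝ (Fin n)) X}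
    {M : Type*} [TopologicalSpace M] [ChartedSpace X M] [IsManifold I ∞ M]
    {H H' : Cot I M → ℝ} (h : EqOn H H' (nonzeroCot I M)) {T : ℝ} {γ : ℝ → Cot I M}
    (hγ : IsBichar H T γ) : IsBichar H' T γ := by
  refine ⟨fun t ht => ?_, hγ.nonzero⟩
  have h1 := hγ.integral t ht
  rwa [hamField_congr h (hγ.nonzero t ht)] at h1

/-- The implicit function theorem with parameters. -/
theorem exists_implicit_with_parameters {A C D : Type*} [NormedAddCommGroup A] [NormedSpace ℝ A]
    [NormedAddCommGroup C] [NormedSpace ℝ C] [NormedAddCommGroup D] [NormedSpace ℝ D]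
    [FiniteDimensional ℝ A] [FiniteDimensional ℝ C] [FiniteDimensional ℝ D]
    {g : ℝ × (A × C) → D} {w : A × C} (hg : ∀ᶠ q in 𝓝 ((0 : ℝ), w), ContDiffAt ℝ ∞ g q)
    {L : (A × C) ≃L[ℝ] A × D}
    (hL : HasFDerivAt (fun v : A × C => (v.1, g (0, v))) (L : (A × C) →L[ℝ] A × D) w) :
    ∃ κ : ℝ × (A × D) → C, κ (0, (w.1, g (0, w))) = w.2 ∧
      ContDiffAt ℝ ∞ κ (0, (w.1, g (0, w))) ∧
      ∀ᶠ p in 𝓝 ((0 : ℝ), (w.1, g (0, w))), g (p.1, (p.2.1, κ p)) = p.2.2 := by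
  have hLd : ∀ v, (L v).2 = fderiv ℝ g (0, w) (0, v) := by
    intro v
    have f1 : HasFDerivAt (fun v : A × C => g (0, v)) ((ContinuousLinearMap.snd ℝ A D).comp
      (L : (A × C) →L[ℝ] A × D)) w := hL.snd
    have f2 := (hg.self_of_nhds.differentiableAt (by simp)).hasFDerivAt.comp w
      (hasFDerivAt_prodMk_right (0 : ℝ) w)
    exact DFunLike.congr_fun (f1.unique f2) v
  have hLa : ∀ v, (L v).1 = v.1 := by
    intro v
    have f1 : HasFDerivAt (fun v : A × C => v.1) ((ContinuousLinearMap.fst ℝ A D).comp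
      (L : (A × C) →L[ℝ] A × D)) w := hL.fst
    exact DFunLike.congr_fun (f1.unique hasFDerivAt_fst) v
  set G : ℝ × (A × C) → ℝ × (A × D) := fun q => (q.1, (q.2.1, g q)) with hG
  have hGs : ∀ᶠ q in 𝓝 ((0 : ℝ), w), ContDiffAt ℝ ∞ G q := hg.mono fun q hq =>
    contDiffAt_fst.prodMk ((contDiffAt_fst.comp q contDiffAt_snd).prodMk hq)
  obtain ⟨Ω, hΩ, hΩo, hqΩ⟩ := eventually_nhds_iff.1 hGs
  set D' : ℝ × (A × C) →L[ℝ] ℝ × (A × D) := (ContinuousLinearMap.fst ℝ ℝ (A × C)).prod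
    (((ContinuousLinearMap.fst ℝ A C).comp (ContinuousLinearMap.snd ℝ ℝ (A × C))).prod
      (fderiv ℝ g (0, w))) with hD'
  have hGd : HasFDerivAt G D' (0, w) := hasFDerivAt_fst.prodMk
    ((ContinuousLinearMap.hasFDerivAt ((ContinuousLinearMap.fst ℝ A C).comp
      (ContinuousLinearMap.snd ℝ ℝ (A × C)))).prodMk
      (hg.self_of_nhds.differentiableAt (by simp)).hasFDerivAt)
  -- The first two components of D' recover the parameter and the A-variable; with the parameter
  -- direction zero, what remains is the invertible L.
  have hinj : Function.Injective D' := by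
    refine (injective_iff_map_eq_zero D').2 fun v hv => ?_
    have f1 : v.1 = 0 := congrArg Prod.fst hv
    have f2 : v.2.1 = 0 := congrArg (fun v => v.2.1) hv
    have f3 : fderiv ℝ g (0, w) v = 0 := congrArg (fun v => v.2.2) hv
    have f4 : v = (0, v.2) := Prod.ext f1 rfl
    rw [f4, ← hLd] at f3
    have f5 : L v.2 = 0 := Prod.ext ((hLa _).trans f2) f3
    rw [f4, L.map_eq_zero_iff.1 f5]
    rfl
  have hrank : Module.finrank ℝ (ℝ × (A × C)) = Module.finrank ℝ (ℝ × (A × D)) := by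
    rw [Module.finrank_prod, Module.finrank_prod (M' := A × D), L.toLinearEquiv.finrank_eq]
  have hGd' : HasFDerivAt G ((LinearEquiv.ofInjectiveOfFinrankEq
      (D' : ℝ × (A × C) →ₗ[ℝ] _) hinj hrank).toContinuousLinearEquiv : _ →L[ℝ] _) (0, w) := by
    convert! hGd using 1
  obtain ⟨e, heq₀, hes, heG, -, hesm⟩ := exists_openPartialHomeomorph_of_contDiffOn hΩo
    (fun q hq => (hΩ q hq).contDiffWithinAt) hqΩ hGd'
  have ht : ((0 : ℝ), (w.1, g (0, w))) ∈ e.target := by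
    have f1 := e.map_source heq₀
    rwa [heG] at f1
  have hs0 : e.symm ((0 : ℝ), (w.1, g (0, w))) = (0, w) := by
    have f1 := e.left_inv heq₀
    rwa [heG] at f1
  refine ⟨fun p => (e.symm p).2.2, congrArg (fun v => v.2.2) hs0, ?_, ?_⟩
  · have f1 := hesm.contDiffAt (e.open_target.mem_nhds ht)
    exact f1.snd.snd
  · filter_upwards [e.open_target.mem_nhds ht] with p hp
    have f1 := e.right_inv hp
    rw [heG] at f1
    have f2 : (e.symm p).1 = p.1 := congrArg Prod.fst f1
    have f3 : (e.symm p).2.1 = p.2.1 := congrArg (fun v => v.2.1) f1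
    have f4 : e.symm p = (p.1, (p.2.1, (e.symm p).2.2)) := Prod.ext f2 (Prod.ext f3 rfl)
    rw [← f4]
    exact congrArg (fun v => v.2.2) f1

variable {m : ℕ} {M : Type*} [TopologicalSpace M] [ChartedSpace (EuclideanHalfSpace (m + 1)) M]
  [IsManifold (𝓡∂ (m + 1)) ∞ M] [T2Space M] {ε : ℝ} {Hs : ℝ → Cot (𝓡∂ (m + 1)) M → ℝ}
  {x₀ x₁ : M} {Ω : Set (EuclideanSpace ℝ (Fin m) × Covec (m + 1))}
  {ζ : EuclideanSpace ℝ (Fin m) × Covec (m + 1) → Cot (𝓡∂ (m + 1)) M}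
  {τ : EuclideanSpace ℝ (Fin m) × Covec (m + 1) → ℝ}
  {w : EuclideanSpace ℝ (Fin m) × Covec (m + 1)}

/-- The variation of the energy along a segment whose parameter is restricted to unit time. -/
theorem Segment.hasFDerivAt_energy (hHs : HamFamily ε Hs)
    (hε : 0 < ε) {ζ' : ℝ × (EuclideanSpace ℝ (Fin m) × Covec (m + 1)) → Cot (𝓡∂ (m + 1)) M}
    {τ' : ℝ × (EuclideanSpace ℝ (Fin m) × Covec (m + 1)) → ℝ}
    (hseg : Segment Hs (ContinuousLinearMap.fst ℝ ℝ (EuclideanSpace ℝ (Fin m) × Covec (m + 1)))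
      (0, w) (fun q => bdryCot x₀ q.2) ζ' τ')
    (hwt : bdryIncl m w.1 ∈ (extChartAt (𝓡∂ (m + 1)) x₀).target) (hw2 : w.2 ≠ 0)
    {γ : ℝ → Cot (𝓡∂ (m + 1)) M} (hγ : IsBichar (Hs 0) 1 γ) (h0 : γ 0 = bdryCot x₀ w)
    (hτ' : τ' (0, w) = 1)
    (hend : (ζ' (0, w)).1 ∈ (chartAt (EuclideanHalfSpace (m + 1)) x₁).source)
    {κ : ℝ × (EuclideanSpace ℝ (Fin m) × EuclideanSpace ℝ (Fin m)) → Covec (m + 1)}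
    {y : EuclideanSpace ℝ (Fin m)} (hκ0 : κ (0, (w.1, y)) = w.2)
    (hκs : ContDiffAt ℝ ∞ κ (0, (w.1, y)))
    (hκτ : ∀ᶠ p in 𝓝 ((0 : ℝ), (w.1, y)), τ' (p.1, (p.2.1, κ p)) = 1)
    (hκζ : ∀ᶠ p in 𝓝 ((0 : ℝ), (w.1, y)),
      (cotChart (𝓡∂ (m + 1)) x₁ (ζ' (p.1, (p.2.1, κ p)))).1 = bdryIncl m p.2.2) :
    ∃ Λ : ℝ × (EuclideanSpace ℝ (Fin m) × EuclideanSpace ℝ (Fin m)) →L[ℝ] ℝ,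
      HasFDerivAt (fun p => Hs p.1 (bdryCot x₀ (p.2.1, κ p))) Λ (0, (w.1, y)) ∧
      ∀ δ, Λ δ = -(δ.1 * ∫ t in (0 : ℝ)..1, deriv (fun s => Hs s (γ t)) 0) -
        w.2 (bdryIncl m δ.2.1) + (cotChart (𝓡∂ (m + 1)) x₁ (ζ' (0, w))).2 (bdryIncl m δ.2.2) := by
  obtain ⟨hzs, hzc⟩ := cotChart_bdryCot hwt
  let A := EuclideanSpace ℝ (Fin m)
  let C := Covec (m + 1)
  set E : ℝ × (A × C) → ℝ := fun q => Hs q.1 (bdryCot x₀ q.2) with hE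
  have hEd : HasFDerivAt E (fderiv ℝ E (0, w)) (0, w) := by
    have f1 : ContMDiffAt 𝓘(ℝ, ℝ × (A × C)) (𝓘(ℝ, ℝ).prod (cotModel (𝓡∂ (m + 1)))) ∞
        (fun q : ℝ × (A × C) => (q.1, bdryCot x₀ q.2)) (0, w) :=
      contDiff_fst.contMDiff.contMDiffAt.prodMk hseg.smooth_start.self_of_nhds
    have f2 := ContMDiffAt.comp ((0 : ℝ), w) (hHs.smooth.contMDiffAt
      (show (0 : ℝ) ∈ Ioo (-ε) ε from ⟨by linarith, hε⟩) (bdryCot_mem_nonzeroCot hwt hw2)) f1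
    exact (f2.contDiffAt.differentiableAt (by simp)).hasFDerivAt
  set κ' := fderiv ℝ κ (0, (w.1, y)) with hκ'
  have hκd : HasFDerivAt κ κ' (0, (w.1, y)) := (hκs.differentiableAt (by simp)).hasFDerivAt
  let P1 : ℝ × (A × A) →L[ℝ] A :=
    (ContinuousLinearMap.fst ℝ A A).comp (ContinuousLinearMap.snd ℝ ℝ (A × A))
  let P2 : ℝ × (A × A) →L[ℝ] A :=
    (ContinuousLinearMap.snd ℝ A A).comp (ContinuousLinearMap.snd ℝ ℝ (A × A))
  set K : ℝ × (A × A) → ℝ × (A × C) := fun p => (p.1, (p.2.1, κ p)) with hK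
  have hKp : K (0, (w.1, y)) = (0, w) := by simp only [hK, hκ0, Prod.mk.eta]
  set K' : ℝ × (A × A) →L[ℝ] ℝ × (A × C) :=
    (ContinuousLinearMap.fst ℝ ℝ (A × A)).prod (P1.prod κ') with hK'
  have hKd : HasFDerivAt K K' (0, (w.1, y)) :=
    hasFDerivAt_fst.prodMk (P1.hasFDerivAt.prodMk hκd)
  have hcomp : ∀ {F : Type} [NormedAddCommGroup F] [NormedSpace ℝ F] {φ : ℝ × (A × C) → F}
      {φ' : ℝ × (A × C) →L[ℝ] F}, HasFDerivAt φ φ' (0, w) →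
      HasFDerivAt (fun p => φ (K p)) (φ'.comp K') (0, (w.1, y)) := by
    intro F _ _ φ φ' hφ
    rw [← hKp] at hφ
    exact hφ.comp _ hKd
  refine ⟨(fderiv ℝ E (0, w)).comp K', hcomp hEd, fun δ => ?_⟩
  -- K' δ is tangent to the family of unit-time bicharacteristics. In such directions dτ = 0, and
  -- the variation formula can be solved for the differential of the energy.
  have hvar := hseg.variation γ (by rw [hτ']; exact hγ) h0 (K' δ)
  have v3 : fderiv ℝ τ' (0, w) (K' δ) = 0 := by
    have f1 := hcomp (hseg.smooth_time.self_of_nhds.differentiableAt (by simp)).hasFDerivAt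
    exact DFunLike.congr_fun (f1.unique
      ((hasFDerivAt_const (1 : ℝ) _).congr_of_eventuallyEq hκτ)) δ
  have v4 : liouville (𝓡∂ (m + 1)) (fun q : ℝ × (A × C) => bdryCot x₀ q.2) (0, w) (K' δ) =
      w.2 (bdryIncl m δ.2.1) := by
    rw [liouville_eq hseg.smooth_start.self_of_nhds hzs]
    let Q : ℝ × (A × C) →L[ℝ] EuclideanSpace ℝ (Fin (m + 1)) × C :=
      ((bdryIncl m).comp ((ContinuousLinearMap.fst ℝ A C).comp
        (ContinuousLinearMap.snd ℝ ℝ (A × C)))).prod ((ContinuousLinearMap.snd ℝ A C).comp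
        (ContinuousLinearMap.snd ℝ ℝ (A × C)))
    have hmem : ∀ᶠ q in 𝓝 ((0 : ℝ), w), bdryIncl m q.2.1 ∈ (extChartAt (𝓡∂ (m + 1)) x₀).target := by
      have hc : ContinuousAt (fun q : ℝ × (A × C) => q.2.1) (0, w) := by fun_prop
      exact hc.preimage_mem_nhds ((isOpen_bdryIncl_target x₀).mem_nhds hwt)
    have f1 : HasFDerivAt (fun q : ℝ × (A × C) => cotChart (𝓡∂ (m + 1)) x₀ (bdryCot x₀ q.2))
        Q (0, w) := Q.hasFDerivAt.congr_of_eventuallyEq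
          (hmem.mono fun q hq => (cotChart_bdryCot hq).2)
    rw [f1.fderiv]
    change (cotChart (𝓡∂ (m + 1)) x₀ (bdryCot x₀ w)).2 (bdryIncl m δ.2.1) = _
    rw [hzc]
  have v5 : liouville (𝓡∂ (m + 1)) ζ' (0, w) (K' δ) =
      (cotChart (𝓡∂ (m + 1)) x₁ (ζ' (0, w))).2 (bdryIncl m δ.2.2) := by
    have hse := hseg.smooth_end.self_of_nhds
    rw [liouville_eq hse hend]
    have f1 := hcomp ((contDiffAt_cotChart hse hend).differentiableAt (by simp)).hasFDerivAt.fst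
    have f2 := f1.unique (((bdryIncl m).comp P2).hasFDerivAt.congr_of_eventuallyEq hκζ)
    exact congrArg _ (DFunLike.congr_fun f2 δ)
  rw [v3, v4, v5, hτ'] at hvar
  change fderiv ℝ E (0, w) (K' δ) = _
  have hσ : (ContinuousLinearMap.fst ℝ ℝ (A × C)) (K' δ) = δ.1 := rfl
  have hσ0 : (ContinuousLinearMap.fst ℝ ℝ (A × C)) (0, w) = 0 := rfl
  rw [hσ, hσ0] at hvar
  change _ = _ + 1 * fderiv ℝ E (0, w) (K' δ) + _ + _ at hvar
  linarith

/-- The energy of the bicharacteristics that join two boundary points in unit time, as a function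
of the boundary points and of the parameter, and its differential. -/
theorem HitChart.exists_energy (hHs : HamFamily ε Hs) (hε : 0 < ε)
    (h : HitChart (Hs 0) x₀ x₁ Ω ζ τ) (hΩ : IsOpen Ω) (hw : w ∈ Ω) (hτ : τ w = 1)
    {L : (EuclideanSpace ℝ (Fin m) × Covec (m + 1)) ≃L[ℝ]
      EuclideanSpace ℝ (Fin m) × (ℝ × EuclideanSpace ℝ (Fin m))}
    (hL : HasFDerivAt (hitMap x₁ ζ τ) (L : (EuclideanSpace ℝ (Fin m) × Covec (m + 1)) →L[ℝ]
      EuclideanSpace ℝ (Fin m) × (ℝ × EuclideanSpace ℝ (Fin m))) w)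
    {γ : ℝ → Cot (𝓡∂ (m + 1)) M} (hγ : IsBichar (Hs 0) 1 γ) (h0 : γ 0 = bdryCot x₀ w)
    (h1 : γ 1 = ζ w) :
    ∃ κ : ℝ × (EuclideanSpace ℝ (Fin m) × EuclideanSpace ℝ (Fin m)) → Covec (m + 1),
      κ (0, (w.1, (hitMap x₁ ζ τ w).2.2)) = w.2 ∧
      ContinuousAt κ (0, (w.1, (hitMap x₁ ζ τ w).2.2)) ∧
      (∀ᶠ p in 𝓝 ((0 : ℝ), (w.1, (hitMap x₁ ζ τ w).2.2)),
        bdryIncl m p.2.1 ∈ (extChartAt (𝓡∂ (m + 1)) x₀).target ∧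
        ∃ γ', IsBichar (Hs p.1) 1 γ' ∧ γ' 0 = bdryCot x₀ (p.2.1, κ p) ∧
          (γ' 1).1 ∈ (chartAt (EuclideanHalfSpace (m + 1)) x₁).source ∧
          extChartAt (𝓡∂ (m + 1)) x₁ (γ' 1).1 = bdryIncl m p.2.2) ∧
      ∃ Λ : ℝ × (EuclideanSpace ℝ (Fin m) × EuclideanSpace ℝ (Fin m)) →L[ℝ] ℝ,
        HasFDerivAt (fun p => Hs p.1 (bdryCot x₀ (p.2.1, κ p))) Λ
          (0, (w.1, (hitMap x₁ ζ τ w).2.2)) ∧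
        ∀ δ, Λ δ = -(δ.1 * ∫ t in (0 : ℝ)..1, deriv (fun s => Hs s (γ t)) 0) -
          w.2 (bdryIncl m δ.2.1) +
          (cotChart (𝓡∂ (m + 1)) x₁ (ζ w)).2 (bdryIncl m δ.2.2) := by
  have hH := hHs.smooth.smooth (s := 0) ⟨by linarith, hε⟩
  obtain ⟨hwt, hw2⟩ := h.start_mem w hw
  obtain ⟨hzs, hzc⟩ := cotChart_bdryCot hwt
  obtain ⟨hx₁, hb₁, hn₁⟩ := h.end_chart w hw
  have hend : ¬ (𝓡∂ (m + 1)).IsInteriorPoint (γ 1).1 := by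
    rw [h1]
    exact h.end_not_interior hw
  obtain ⟨-, -, hint⟩ := h.unique hH hw zero_lt_one hγ h0 hend
  set σ := ContinuousLinearMap.fst ℝ ℝ (EuclideanSpace ℝ (Fin m) × Covec (m + 1)) with hσ
  set q₀ : ℝ × (EuclideanSpace ℝ (Fin m) × Covec (m + 1)) := (0, w) with hq₀
  set Z : ℝ × (EuclideanSpace ℝ (Fin m) × Covec (m + 1)) → Cot (𝓡∂ (m + 1)) M :=
    fun q => bdryCot x₀ q.2 with hZ
  have hmem : ∀ᶠ q in 𝓝 q₀, bdryIncl m q.2.1 ∈ (extChartAt (𝓡∂ (m + 1)) x₀).target := by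
    have hc : ContinuousAt (fun q : ℝ × (EuclideanSpace ℝ (Fin m) × Covec (m + 1)) => q.2.1) q₀ := by
      fun_prop
    exact hc.preimage_mem_nhds ((isOpen_bdryIncl_target x₀).mem_nhds hwt)
  have hσ₀ : σ q₀ ∈ Ioo (-ε) ε := ⟨by simp [hσ, hq₀, hε], by simp [hσ, hq₀, hε]⟩
  obtain ⟨ζ', τ', hseg, hτ', hζ', hend'⟩ := exists_hitting_segment hHs (σ := σ) (q₀ := q₀) (Z := Z)
    (x := x₀) (x' := x₁) (γ := γ) hσ₀
    (hmem.mono fun q hq => contMDiffAt_bdryCot contDiffAt_snd hq) hzs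
    (hmem.mono fun q hq => by rw [hZ, (cotChart_bdryCot hq).2]; exact bdryIncl_zero _)
    (by
      change 0 < (hamLoc x₀ (Hs 0) (cotChart (𝓡∂ (m + 1)) x₀ (bdryCot x₀ w))).1 0
      rw [hzc]
      exact h.start_normal w hw) hγ h0 hint
    (by rwa [h1]) (by rwa [h1]) (by rw [h1]; exact hn₁)
  set g : ℝ × (EuclideanSpace ℝ (Fin m) × Covec (m + 1)) → ℝ × EuclideanSpace ℝ (Fin m) :=
    fun q => (τ' q, bdryProj m (cotChart (𝓡∂ (m + 1)) x₁ (ζ' q)).1) with hg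
  have hgs : ∀ᶠ q in 𝓝 ((0 : ℝ), w), ContDiffAt ℝ ∞ g q := by
    filter_upwards [hseg.smooth_end, hseg.smooth_time, hend'] with q f1 f2 f3
    exact f2.prodMk ((bdryProj m).contDiff.contDiffAt.comp q (contDiffAt_cotChart f1 f3.1).fst)
  -- the family coincides with the given one for the parameter zero
  have hg0 : (fun v : EuclideanSpace ℝ (Fin m) × Covec (m + 1) => (v.1, g (0, v))) =ᶠ[𝓝 w]
      hitMap x₁ ζ τ := by
    have hc : ContinuousAt (fun v : EuclideanSpace ℝ (Fin m) × Covec (m + 1) => ((0 : ℝ), v)) w := by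
      fun_prop
    have f1 := hc.eventually hseg.exists_bichar
    have f2 := hc.eventually hend'
    filter_upwards [hΩ.mem_nhds hw, f1, f2] with v hv f1 f2
    obtain ⟨hp, γ', hγ', g0, g1, -⟩ := f1
    have hni : ¬ (𝓡∂ (m + 1)).IsInteriorPoint (γ' (τ' (0, v))).1 := by
      rw [g1, isInteriorPoint_iff_coord_pos f2.1, f2.2.1]
      exact lt_irrefl _
    obtain ⟨e1, e2, -⟩ := h.unique hH hv hp hγ' g0 hni
    rw [g1] at e2
    simp only [hg, hitMap, e1, e2]
  -- By uniqueness of the exit, g at the parameter 0 agrees with the given exit map near w; its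
  -- derivative is therefore the invertible L.
  obtain ⟨κ', hκ0, hκs, hκg⟩ := exists_implicit_with_parameters hgs
    (hL.congr_of_eventuallyEq hg0)
  have hgw : g (0, w) = (1, (hitMap x₁ ζ τ w).2.2) := by
    have f1 : g (0, w) = (hitMap x₁ ζ τ w).2 := congrArg Prod.snd hg0.self_of_nhds
    rw [f1, ← hτ]
    rfl
  rw [hgw] at hκ0 hκs hκg
  set y := (hitMap x₁ ζ τ w).2.2 with hy
  -- The time coordinate is frozen at 1: κ (s, (x', y')) is the fibre coordinate of the initial
  -- covector of a bicharacteristic of Hs s that leads from x' to y' in unit time.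
  set κ : ℝ × (EuclideanSpace ℝ (Fin m) × EuclideanSpace ℝ (Fin m)) → Covec (m + 1) :=
    fun p => κ' (p.1, (p.2.1, ((1 : ℝ), p.2.2))) with hκ
  have hJ : ContDiff ℝ ∞ (fun p : ℝ × (EuclideanSpace ℝ (Fin m) × EuclideanSpace ℝ (Fin m)) =>
      (p.1, (p.2.1, ((1 : ℝ), p.2.2)))) :=
    contDiff_fst.prodMk ((contDiff_fst.comp contDiff_snd).prodMk
      (contDiff_const.prodMk (contDiff_snd.comp contDiff_snd)))
  have hJ0 : Filter.Tendsto (fun p : ℝ × (EuclideanSpace ℝ (Fin m) × EuclideanSpace ℝ (Fin m)) =>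
      (p.1, (p.2.1, ((1 : ℝ), p.2.2)))) (𝓝 (0, (w.1, y))) (𝓝 (0, (w.1, ((1 : ℝ), y)))) :=
    hJ.continuous.tendsto (0, (w.1, y))
  have hκs' : ContDiffAt ℝ ∞ κ (0, (w.1, y)) :=
    ContDiffAt.comp (0, (w.1, y)) hκs hJ.contDiffAt
  have hgκ : ∀ᶠ p in 𝓝 ((0 : ℝ), (w.1, y)), g (p.1, (p.2.1, κ p)) = (1, p.2.2) :=
    hJ0.eventually hκg
  have hτK : ∀ᶠ p in 𝓝 ((0 : ℝ), (w.1, y)), τ' (p.1, (p.2.1, κ p)) = 1 :=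
    hgκ.mono fun p hp => congrArg Prod.fst hp
  have hK : ContinuousAt (fun p : ℝ × (EuclideanSpace ℝ (Fin m) × EuclideanSpace ℝ (Fin m)) =>
      (p.1, (p.2.1, κ p))) (0, (w.1, y)) :=
    continuousAt_fst.prodMk ((continuousAt_fst.comp continuousAt_snd).prodMk hκs'.continuousAt)
  have hKlim : Filter.Tendsto
      (fun p : ℝ × (EuclideanSpace ℝ (Fin m) × EuclideanSpace ℝ (Fin m)) => (p.1, (p.2.1, κ p)))
      (𝓝 (0, (w.1, y))) (𝓝 (0, w)) := by
    have := hK.tendsto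
    simp only [hκ, hκ0] at this
    exact this
  have hζK : ∀ᶠ p in 𝓝 ((0 : ℝ), (w.1, y)),
      (cotChart (𝓡∂ (m + 1)) x₁ (ζ' (p.1, (p.2.1, κ p)))).1 = bdryIncl m p.2.2 := by
    filter_upwards [hgκ, hKlim.eventually hend'] with p f1 f2
    have f3 : bdryProj m (cotChart (𝓡∂ (m + 1)) x₁ (ζ' (p.1, (p.2.1, κ p)))).1 = p.2.2 :=
      congrArg Prod.snd f1
    rw [← f3, bdryIncl_bdryProj f2.2.1]
  refine ⟨κ, hκ0, hκs'.continuousAt, ?_, ?_⟩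
  · filter_upwards [hKlim.eventually hmem, hKlim.eventually hseg.exists_bichar, hτK, hζK,
      hKlim.eventually hend'] with p f1 f2 f4 f5 f6
    obtain ⟨-, γ', hγ', g0, g1, -⟩ := f2
    rw [f4] at hγ' g1
    refine ⟨f1, γ', hγ', g0, by rw [g1]; exact f6.1, ?_⟩
    rw [g1, ← f5, cotChart_fst]
  · have f1 := hseg.hasFDerivAt_energy hHs hε hwt hw2 hγ h0 hτ' hend'.self_of_nhds.1 hκ0 hκs' hτK hζK
    rwa [hζ', h1] at f1

end EnergyVariation

/-! ### The boundary as a manifold embedded in M. -/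

section BoundaryCoordinates

variable {m : ℕ} {M : Type*} [TopologicalSpace M] [ChartedSpace (EuclideanHalfSpace (m + 1)) M]
  [IsManifold (𝓡∂ (m + 1)) ∞ M]
  {B : Type*} [TopologicalSpace B] [ChartedSpace (EuclideanSpace ℝ (Fin m)) B]
  [IsManifold (𝓡 m) ∞ B] {ι : B → M} {x : M} {p p' : B}

/-- The tangential coordinates of a boundary point in the chart of `M` at `x`. -/
def bdryCoord (ι : B → M) (x : M) (p : B) : EuclideanSpace ℝ (Fin m) :=
  bdryProj m (extChartAt (𝓡∂ (m + 1)) x (ι p))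

theorem IsBoundaryInclusion.not_interior (hι : IsBoundaryInclusion (m := m) ι) (p : B) :
    ¬ (𝓡∂ (m + 1)).IsInteriorPoint (ι p) := by
  have h : ι p ∈ (𝓡∂ (m + 1)).boundary M := hι.range_eq ▸ mem_range_self p
  rwa [← ModelWithCorners.compl_interior] at h

theorem IsBoundaryInclusion.coord_zero (hι : IsBoundaryInclusion (m := m) ι)
    (hp : ι p ∈ (chartAt (EuclideanHalfSpace (m + 1)) x).source) :
    extChartAt (𝓡∂ (m + 1)) x (ι p) 0 = 0 := by
  have h1 := hι.not_interior p
  rw [isInteriorPoint_iff_coord_pos (z := (⟨ι p, 0⟩ : Cot (𝓡∂ (m + 1)) M)) hp] at h1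
  exact le_antisymm (not_lt.1 h1) (cotChart_coord_nonneg x (⟨ι p, 0⟩ : Cot (𝓡∂ (m + 1)) M))

theorem IsBoundaryInclusion.bdryIncl_bdryCoord (hι : IsBoundaryInclusion (m := m) ι)
    (hp : ι p ∈ (chartAt (EuclideanHalfSpace (m + 1)) x).source) :
    bdryIncl m (bdryCoord ι x p) = extChartAt (𝓡∂ (m + 1)) x (ι p) :=
  bdryIncl_bdryProj (hι.coord_zero hp)

theorem IsBoundaryInclusion.contMDiffAt_bdryCoord (hι : IsBoundaryInclusion (m := m) ι)
    (hp : ι p ∈ (chartAt (EuclideanHalfSpace (m + 1)) x).source) :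
    ContMDiffAt (𝓡 m) 𝓘(ℝ, EuclideanSpace ℝ (Fin m)) ∞ (bdryCoord (m := m) ι x) p := by
  have h1 : ContMDiffAt (𝓡∂ (m + 1)) 𝓘(ℝ, EuclideanSpace ℝ (Fin (m + 1))) ∞
      (extChartAt (𝓡∂ (m + 1)) x) (ι p) := contMDiffAt_extChartAt' hp
  have h2 := ContMDiffAt.comp p h1 hι.smooth.contMDiffAt
  exact (bdryProj m).contDiff.contMDiff.contMDiffAt.comp p h2

theorem IsBoundaryInclusion.hasFDerivAt_chart (hι : IsBoundaryInclusion (m := m) ι)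
    (hp : ι p ∈ (chartAt (EuclideanHalfSpace (m + 1)) x).source)
    (hp' : p ∈ (chartAt (EuclideanSpace ℝ (Fin m)) p').source)
    {D : EuclideanSpace ℝ (Fin m) →L[ℝ] EuclideanSpace ℝ (Fin (m + 1))}
    (hD : D = mfderiv (𝓡 m) (𝓡∂ (m + 1)) ι p) :
    HasFDerivAt (fun a => extChartAt (𝓡∂ (m + 1)) x (ι ((extChartAt (𝓡 m) p').symm a)))
      ((tangentCoordChange (𝓡∂ (m + 1)) (ι p) x (ι p)).comp
        (D.comp (tangentCoordChange (𝓡 m) p' p p))) (extChartAt (𝓡 m) p' p) := by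
  have hs : p ∈ (extChartAt (𝓡 m) p').source := by rwa [extChartAt_source]
  have hs' : ι p ∈ (extChartAt (𝓡∂ (m + 1)) x).source := by rwa [extChartAt_source]
  have e0 : (extChartAt (𝓡 m) p').symm (extChartAt (𝓡 m) p' p) = p :=
    (extChartAt (𝓡 m) p').left_inv hs
  have h1 : HasFDerivAt (extChartAt (𝓡 m) p ∘ (extChartAt (𝓡 m) p').symm)
      (tangentCoordChange (𝓡 m) p' p p) (extChartAt (𝓡 m) p' p) := by
    have := hasFDerivWithinAt_tangentCoordChange (I := 𝓡 m) (x := p') (y := p) (z := p)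
      ⟨hs, mem_extChartAt_source _⟩
    rwa [ModelWithCorners.range_eq_univ, hasFDerivWithinAt_univ] at this
  have h2 : HasFDerivAt (fun a => extChartAt (𝓡∂ (m + 1)) (ι p)
      (ι ((extChartAt (𝓡 m) p).symm a))) D (extChartAt (𝓡 m) p p) := by
    have h := ((hι.smooth.mdifferentiable (by simp)) p).hasMFDerivAt
    rw [← hD] at h
    have h' : HasFDerivWithinAt (fun a => extChartAt (𝓡∂ (m + 1)) (ι p)
      (ι ((extChartAt (𝓡 m) p).symm a))) D (range (𝓡 m)) (extChartAt (𝓡 m) p p) := h.2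
    rwa [ModelWithCorners.range_eq_univ, hasFDerivWithinAt_univ] at h'
  have h3 := hasFDerivWithinAt_tangentCoordChange (I := 𝓡∂ (m + 1)) (x := ι p) (y := x) (z := ι p)
    ⟨mem_extChartAt_source _, hs'⟩
  have e1 : (extChartAt (𝓡 m) p ∘ (extChartAt (𝓡 m) p').symm) (extChartAt (𝓡 m) p' p) =
      extChartAt (𝓡 m) p p := by
    simp only [Function.comp_apply, e0]
  rw [← e1] at h2
  have h4 := h2.comp _ h1
  have e2 : (fun a => extChartAt (𝓡∂ (m + 1)) (ι p) (ι ((extChartAt (𝓡 m) p).symm a)))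
      ((extChartAt (𝓡 m) p ∘ (extChartAt (𝓡 m) p').symm) (extChartAt (𝓡 m) p' p)) =
      extChartAt (𝓡∂ (m + 1)) (ι p) (ι p) := by
    rw [e1]
    simp only [extChartAt_to_inv]
  have h5 := HasFDerivWithinAt.comp_hasFDerivAt_of_eq (extChartAt (𝓡 m) p' p) h3 h4
    (.of_forall fun a => mem_range_self _) e2.symm
  refine h5.congr_of_eventuallyEq ?_
  have hc : ContinuousAt (extChartAt (𝓡 m) p').symm (extChartAt (𝓡 m) p' p) :=
    continuousAt_extChartAt_symm' hs
  have n1 : ∀ᶠ a in 𝓝 (extChartAt (𝓡 m) p' p), (extChartAt (𝓡 m) p').symm a ∈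
      (extChartAt (𝓡 m) p).source :=
    hc.preimage_mem_nhds (by rw [e0]; exact extChartAt_source_mem_nhds p)
  have n2 : ∀ᶠ a in 𝓝 (extChartAt (𝓡 m) p' p), ι ((extChartAt (𝓡 m) p').symm a) ∈
      (extChartAt (𝓡∂ (m + 1)) (ι p)).source := by
    have hc' : ContinuousAt (fun a => ι ((extChartAt (𝓡 m) p').symm a)) (extChartAt (𝓡 m) p' p) :=
      hι.smooth.continuous.continuousAt.comp hc
    exact hc'.preimage_mem_nhds (by rw [e0]; exact extChartAt_source_mem_nhds (ι p))
  filter_upwards [n1, n2] with a a1 a2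
  simp only [Function.comp_apply]
  rw [(extChartAt (𝓡 m) p).left_inv a1, (extChartAt (𝓡∂ (m + 1)) (ι p)).left_inv a2]

/-- The normal coordinate vanishes identically on the boundary, so the differential of ι has only a
tangential part. Immersivity makes that part injective, and equality of dimensions makes it
invertible. -/
theorem IsBoundaryInclusion.exists_hasFDerivAt_bdryCoord (hι : IsBoundaryInclusion (m := m) ι)
    (hp : ι p ∈ (chartAt (EuclideanHalfSpace (m + 1)) x).source)
    (hp' : p ∈ (chartAt (EuclideanSpace ℝ (Fin m)) p').source)
    {D : EuclideanSpace ℝ (Fin m) →L[ℝ] EuclideanSpace ℝ (Fin (m + 1))}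
    (hD : D = mfderiv (𝓡 m) (𝓡∂ (m + 1)) ι p) :
    ∃ b : EuclideanSpace ℝ (Fin m) ≃L[ℝ] EuclideanSpace ℝ (Fin m),
      HasFDerivAt (fun a => bdryCoord ι x ((extChartAt (𝓡 m) p').symm a))
        (b : EuclideanSpace ℝ (Fin m) →L[ℝ] EuclideanSpace ℝ (Fin m)) (extChartAt (𝓡 m) p' p) ∧
      ∀ δ, bdryIncl m (b δ) = tangentCoordChange (𝓡∂ (m + 1)) (ι p) x (ι p)
        (D (tangentCoordChange (𝓡 m) p' p p δ)) := by
  have hs : p ∈ (extChartAt (𝓡 m) p').source := by rwa [extChartAt_source]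
  have e0 : (extChartAt (𝓡 m) p').symm (extChartAt (𝓡 m) p' p) = p :=
    (extChartAt (𝓡 m) p').left_inv hs
  have h1 := hι.hasFDerivAt_chart hp hp' hD
  set F := (tangentCoordChange (𝓡∂ (m + 1)) (ι p) x (ι p)).comp
        (D.comp (tangentCoordChange (𝓡 m) p' p p)) with hF
  have h2 : HasFDerivAt (fun a => bdryCoord ι x ((extChartAt (𝓡 m) p').symm a))
      ((bdryProj m).comp F) (extChartAt (𝓡 m) p' p) := (bdryProj m).hasFDerivAt.comp _ h1
  have hc : ContinuousAt (fun a => ι ((extChartAt (𝓡 m) p').symm a)) (extChartAt (𝓡 m) p' p) :=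
    hι.smooth.continuous.continuousAt.comp (continuousAt_extChartAt_symm' hs)
  have hn : ∀ᶠ a in 𝓝 (extChartAt (𝓡 m) p' p), ι ((extChartAt (𝓡 m) p').symm a) ∈
      (chartAt (EuclideanHalfSpace (m + 1)) x).source :=
    hc.preimage_mem_nhds (by
      rw [e0]
      exact (chartAt (EuclideanHalfSpace (m + 1)) x).open_source.mem_nhds hp)
  have h3 : (bdryIncl m).comp ((bdryProj m).comp F) = F := by
    refine ((bdryIncl m).hasFDerivAt.comp _ h2).unique (h1.congr_of_eventuallyEq ?_)
    exact hn.mono fun a ha => hι.bdryIncl_bdryCoord ha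
  have h4 : ∀ δ, bdryIncl m ((bdryProj m).comp F δ) = F δ := DFunLike.congr_fun h3
  have hinj : Function.Injective ((bdryProj m).comp F) := by
    refine (injective_iff_map_eq_zero _).2 fun δ hδ => ?_
    have g1 : F δ = 0 := by rw [← h4, hδ, map_zero]
    have g2 : D (tangentCoordChange (𝓡 m) p' p p δ) = 0 := by
      have k1 : tangentCoordChange (𝓡∂ (m + 1)) x (ι p) (ι p) (F δ) =
          D (tangentCoordChange (𝓡 m) p' p p δ) := by
        change tangentCoordChange (𝓡∂ (m + 1)) x (ι p) (ι p)
          (tangentCoordChange (𝓡∂ (m + 1)) (ι p) x (ι p) _) = _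
        have k2 : ι p ∈ (extChartAt (𝓡∂ (m + 1)) x).source := by rwa [extChartAt_source]
        rw [tangentCoordChange_comp ⟨⟨mem_extChartAt_source _, k2⟩, mem_extChartAt_source _⟩,
          tangentCoordChange_self (mem_extChartAt_source _)]
        rfl
      rw [← k1, g1, map_zero]
    have g3 : tangentCoordChange (𝓡 m) p' p p δ = 0 := by
      subst hD
      exact hι.immersive p (g2.trans (map_zero _).symm)
    rw [← tangentCoordChange_comp_self (I := 𝓡 m) hp' δ, g3, map_zero]
  have h5 : ∀ δ, (LinearEquiv.ofInjectiveEndo ((bdryProj m).comp F).toLinearMap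
      hinj).toContinuousLinearEquiv δ = (bdryProj m).comp F δ := fun δ => rfl
  refine ⟨(LinearEquiv.ofInjectiveEndo ((bdryProj m).comp F).toLinearMap
    hinj).toContinuousLinearEquiv, ?_, fun δ => ?_⟩
  · convert! h2 using 1
  · rw [h5, h4]
    rfl

/-- The restriction of a covector to the boundary, in coordinates. -/
theorem cotChart_restr_snd (hp : ι p ∈ (chartAt (EuclideanHalfSpace (m + 1)) x).source)
    (hp' : p ∈ (chartAt (EuclideanSpace ℝ (Fin m)) p').source)
    {D : EuclideanSpace ℝ (Fin m) →L[ℝ] EuclideanSpace ℝ (Fin (m + 1))}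
    (hD : D = mfderiv (𝓡 m) (𝓡∂ (m + 1)) ι p)
    (ξ : TangentSpace (𝓡∂ (m + 1)) (ι p) →L[ℝ] Trivial M ℝ (ι p)) (δ : EuclideanSpace ℝ (Fin m)) :
    (cotChart (𝓡 m) p' (restr ι p ξ)).2 δ = (cotChart (𝓡∂ (m + 1)) x ⟨ι p, ξ⟩).2
      (tangentCoordChange (𝓡∂ (m + 1)) (ι p) x (ι p) (D (tangentCoordChange (𝓡 m) p' p p δ))) := by
  rw [cotChart_snd_tangentCoordChange (z := (⟨ι p, ξ⟩ : Cot (𝓡∂ (m + 1)) M)) hp,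
    cotChart_snd_apply (z := restr ι p ξ) hp', hD]
  rfl

theorem velocity_eq_hamLoc {H : Cot (𝓡∂ (m + 1)) M → ℝ}
    (hH : ContMDiffOn (cotModel (𝓡∂ (m + 1))) 𝓘(ℝ, ℝ) ∞ H (nonzeroCot (𝓡∂ (m + 1)) M))
    {z : Cot (𝓡∂ (m + 1)) M} (hz : z ∈ nonzeroCot (𝓡∂ (m + 1)) M) :
    velocity H z = (hamLoc z.1 H (cotChart (𝓡∂ (m + 1)) z.1 z)).1 := by
  have h1 : diffCot H z = fderivWithin ℝ (localRep (𝓡∂ (m + 1)) z.1 H)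
      (range (cotModel (𝓡∂ (m + 1)))) (cotChart (𝓡∂ (m + 1)) z.1 z) :=
    (mdifferentiableAt_of_smooth hH hz).mfderiv
  rw [hamLoc, ← h1]
  rfl

/-- A velocity without normal component is tangential in coordinates, and every such vector is in
the range of the differential of ι, because the tangential coordinates have invertible differential
on B. -/
theorem IsTransversal.normal_ne_zero (hι : IsBoundaryInclusion (m := m) ι) {H : Cot (𝓡∂ (m + 1)) M → ℝ}
    (hH : ContMDiffOn (cotModel (𝓡∂ (m + 1))) 𝓘(ℝ, ℝ) ∞ H (nonzeroCot (𝓡∂ (m + 1)) M))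
    {ξ : TangentSpace (𝓡∂ (m + 1)) (ι p) →L[ℝ] Trivial M ℝ (ι p)}
    (hξ : (⟨ι p, ξ⟩ : Cot (𝓡∂ (m + 1)) M) ∈ nonzeroCot (𝓡∂ (m + 1)) M)
    (h : IsTransversal H ι p ξ) :
    (hamLoc (ι p) H (cotChart (𝓡∂ (m + 1)) (ι p) ⟨ι p, ξ⟩)).1 0 ≠ 0 := by
  intro h0
  refine h ?_
  obtain ⟨b, -, hb⟩ := hι.exists_hasFDerivAt_bdryCoord (mem_chart_source _ (ι p))
    (mem_chart_source _ p) rfl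
  refine ⟨b.symm (bdryProj m (hamLoc (ι p) H (cotChart (𝓡∂ (m + 1)) (ι p) ⟨ι p, ξ⟩)).1), ?_⟩
  have h1 := hb (b.symm (bdryProj m (hamLoc (ι p) H (cotChart (𝓡∂ (m + 1)) (ι p) ⟨ι p, ξ⟩)).1))
  rw [b.apply_symm_apply, bdryIncl_bdryProj h0, tangentCoordChange_self (mem_extChartAt_source _),
    tangentCoordChange_self (mem_extChartAt_source _)] at h1
  rw [velocity_eq_hamLoc hH hξ]
  exact h1.symm

end BoundaryCoordinates

/-! ### Bicharacteristics joining pairs of boundary points. -/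

section JoinCharts

variable {m : ℕ} {M : Type*} [TopologicalSpace M] [ChartedSpace (EuclideanHalfSpace (m + 1)) M]
  [IsManifold (𝓡∂ (m + 1)) ∞ M] [T2Space M]
  {B : Type*} [TopologicalSpace B] [ChartedSpace (EuclideanSpace ℝ (Fin m)) B]
  [IsManifold (𝓡 m) ∞ B] {ι : B → M} {H : Cot (𝓡∂ (m + 1)) M → ℝ} {x₀ x₁ : M}
  {e : OpenPartialHomeomorph (EuclideanSpace ℝ (Fin m) × Covec (m + 1))
    (EuclideanSpace ℝ (Fin m) × (ℝ × EuclideanSpace ℝ (Fin m)))}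
  {ζ : EuclideanSpace ℝ (Fin m) × Covec (m + 1) → Cot (𝓡∂ (m + 1)) M}
  {τ : EuclideanSpace ℝ (Fin m) × Covec (m + 1) → ℝ} {W : Set (Cot (𝓡∂ (m + 1)) M)}
  {p q : B} {γ : ℝ → Cot (𝓡∂ (m + 1)) M}

/-- A family of bicharacteristics for which the starting point, the exit time and the exit point
are coordinates. -/
structure JoinChart (H : Cot (𝓡∂ (m + 1)) M → ℝ) (x₀ x₁ : M)
    (e : OpenPartialHomeomorph (EuclideanSpace ℝ (Fin m) × Covec (m + 1))
      (EuclideanSpace ℝ (Fin m) × (ℝ × EuclideanSpace ℝ (Fin m))))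
    (ζ : EuclideanSpace ℝ (Fin m) × Covec (m + 1) → Cot (𝓡∂ (m + 1)) M)
    (τ : EuclideanSpace ℝ (Fin m) × Covec (m + 1) → ℝ) : Prop where
  hit : HitChart H x₀ x₁ e.source ζ τ
  eq_hitMap : ∀ w, e w = hitMap x₁ ζ τ w
  exists_equiv : ∀ w ∈ e.source, ∃ L : (EuclideanSpace ℝ (Fin m) × Covec (m + 1)) ≃L[ℝ]
      EuclideanSpace ℝ (Fin m) × (ℝ × EuclideanSpace ℝ (Fin m)),
    HasFDerivAt (hitMap x₁ ζ τ) (L : (EuclideanSpace ℝ (Fin m) × Covec (m + 1)) →L[ℝ]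
      EuclideanSpace ℝ (Fin m) × (ℝ × EuclideanSpace ℝ (Fin m))) w
  smooth_symm : ContDiffOn ℝ ∞ e.symm e.target

/-- The boundary coordinates of a pair of points, with unit time. -/
def joinTarget (ι : B → M) (x₀ x₁ : M) (x : B × B) :
    EuclideanSpace ℝ (Fin m) × (ℝ × EuclideanSpace ℝ (Fin m)) :=
  (bdryCoord ι x₀ x.1, (1, bdryCoord ι x₁ x.2))

/-- The initial coordinates of the bicharacteristic that joins a pair of boundary points. -/
def joinStart (ι : B → M) (x₀ x₁ : M)
    (e : OpenPartialHomeomorph (EuclideanSpace ℝ (Fin m) × Covec (m + 1))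
      (EuclideanSpace ℝ (Fin m) × (ℝ × EuclideanSpace ℝ (Fin m)))) (x : B × B) :
    EuclideanSpace ℝ (Fin m) × Covec (m + 1) :=
  e.symm (joinTarget ι x₀ x₁ x)

/-- The pairs of boundary points in the range of the coordinates. -/
def joinDomain (ι : B → M) (x₀ x₁ : M)
    (e : OpenPartialHomeomorph (EuclideanSpace ℝ (Fin m) × Covec (m + 1))
      (EuclideanSpace ℝ (Fin m) × (ℝ × EuclideanSpace ℝ (Fin m)))) : Set (B × B) :=
  {x | ι x.1 ∈ (chartAt (EuclideanHalfSpace (m + 1)) x₀).source ∧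
    ι x.2 ∈ (chartAt (EuclideanHalfSpace (m + 1)) x₁).source ∧ joinTarget ι x₀ x₁ x ∈ e.target}

/-- The initial covectors in the range of the coordinates. -/
def startNbhd (x₀ : M) (e : OpenPartialHomeomorph (EuclideanSpace ℝ (Fin m) × Covec (m + 1))
      (EuclideanSpace ℝ (Fin m) × (ℝ × EuclideanSpace ℝ (Fin m)))) : Set (Cot (𝓡∂ (m + 1)) M) :=
  {z | z ∈ (cotChart (𝓡∂ (m + 1)) x₀).source ∧
    (bdryProj m (cotChart (𝓡∂ (m + 1)) x₀ z).1, (cotChart (𝓡∂ (m + 1)) x₀ z).2) ∈ e.source}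

theorem isOpen_startNbhd : IsOpen (startNbhd x₀ e) := by
  have h1 : ContinuousOn (fun z => (bdryProj m (cotChart (𝓡∂ (m + 1)) x₀ z).1,
      (cotChart (𝓡∂ (m + 1)) x₀ z).2)) (cotChart (𝓡∂ (m + 1)) x₀).source := by
    have h2 : ContinuousOn (cotChart (𝓡∂ (m + 1)) x₀) (cotChart (𝓡∂ (m + 1)) x₀).source :=
      continuousOn_extChartAt _
    exact ((bdryProj m).continuous.comp_continuousOn h2.fst).prodMk h2.snd
  exact h1.isOpen_inter_preimage (isOpen_extChartAt_source _) e.open_source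

theorem IsBoundaryInclusion.eq_bdryCot (hι : IsBoundaryInclusion (m := m) ι)
    {z : Cot (𝓡∂ (m + 1)) M} (hz : z.1 = ι p)
    (hp : ι p ∈ (chartAt (EuclideanHalfSpace (m + 1)) x₀).source) :
    bdryCot x₀ (bdryCoord ι x₀ p, (cotChart (𝓡∂ (m + 1)) x₀ z).2) = z := by
  have h1 : (cotChart (𝓡∂ (m + 1)) x₀ z).1 0 = 0 := by
    rw [cotChart_fst, hz]
    exact hι.coord_zero hp
  have h2 := bdryCot_eq (hz ▸ hp) h1
  rwa [cotChart_fst, hz] at h2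

theorem IsBoundaryInclusion.bdryCoord_mem (hι : IsBoundaryInclusion (m := m) ι)
    (hp : ι p ∈ (chartAt (EuclideanHalfSpace (m + 1)) x₀).source) :
    bdryIncl m (bdryCoord ι x₀ p) ∈ (extChartAt (𝓡∂ (m + 1)) x₀).target := by
  rw [hι.bdryIncl_bdryCoord hp]
  exact (extChartAt (𝓡∂ (m + 1)) x₀).map_source (by rwa [extChartAt_source])

theorem IsBoundaryInclusion.eq_of_chart (hι : IsBoundaryInclusion (m := m) ι) {y : M}
    (hp : ι p ∈ (chartAt (EuclideanHalfSpace (m + 1)) x₀).source)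
    (hy : y ∈ (chartAt (EuclideanHalfSpace (m + 1)) x₀).source)
    (h : extChartAt (𝓡∂ (m + 1)) x₀ y = bdryIncl m (bdryCoord ι x₀ p)) : y = ι p := by
  rw [hι.bdryIncl_bdryCoord hp] at h
  exact (extChartAt (𝓡∂ (m + 1)) x₀).injOn (by rwa [extChartAt_source])
    (by rwa [extChartAt_source]) h

theorem IsBoundaryInclusion.bdryCot_fst (hι : IsBoundaryInclusion (m := m) ι)
    (hp : ι p ∈ (chartAt (EuclideanHalfSpace (m + 1)) x₀).source) (ξ : Covec (m + 1)) :
    (bdryCot x₀ (bdryCoord ι x₀ p, ξ)).1 = ι p := by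
  obtain ⟨h1, h2⟩ := cotChart_bdryCot (w := (bdryCoord ι x₀ p, ξ)) (hι.bdryCoord_mem hp)
  refine hι.eq_of_chart hp h1 ?_
  rw [← cotChart_fst, h2]

theorem JoinChart.joinStart_spec (h : JoinChart H x₀ x₁ e ζ τ) {x : B × B}
    (hx : x ∈ joinDomain ι x₀ x₁ e) :
    joinStart ι x₀ x₁ e x ∈ e.source ∧ (joinStart ι x₀ x₁ e x).1 = bdryCoord ι x₀ x.1 ∧
      τ (joinStart ι x₀ x₁ e x) = 1 ∧ bdryProj m (cotChart (𝓡∂ (m + 1)) x₁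
        (ζ (joinStart ι x₀ x₁ e x))).1 = bdryCoord ι x₁ x.2 := by
  have h1 := e.right_inv hx.2.2
  rw [h.eq_hitMap] at h1
  exact ⟨e.map_target hx.2.2, congrArg Prod.fst h1, congrArg (fun v => v.2.1) h1,
    congrArg (fun v => v.2.2) h1⟩

theorem JoinChart.bdryCot_joinStart (hι : IsBoundaryInclusion (m := m) ι)
    (h : JoinChart H x₀ x₁ e ζ τ) {x : B × B} (hx : x ∈ joinDomain ι x₀ x₁ e) :
    (bdryCot x₀ (joinStart ι x₀ x₁ e x)).1 = ι x.1 ∧ (ζ (joinStart ι x₀ x₁ e x)).1 = ι x.2 := by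
  obtain ⟨h1, h2, -, h4⟩ := h.joinStart_spec hx
  obtain ⟨e1, e2, -⟩ := h.hit.end_chart _ h1
  constructor
  · have h5 := hι.bdryCot_fst hx.1 (joinStart ι x₀ x₁ e x).2
    rw [← h2] at h5
    exact h5
  · refine hι.eq_of_chart hx.2.1 e1 ?_
    rw [← h4, bdryIncl_bdryProj e2, cotChart_fst]

theorem JoinChart.exists_joins (hι : IsBoundaryInclusion (m := m) ι)
    (h : JoinChart H x₀ x₁ e ζ τ) {x : B × B} (hx : x ∈ joinDomain ι x₀ x₁ e)
    (hW : bdryCot x₀ (joinStart ι x₀ x₁ e x) ∈ W) : ∃ γ, Joins H ι W x.1 x.2 γ := by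
  obtain ⟨h1, h2, h3, h4⟩ := h.joinStart_spec hx
  obtain ⟨h5, h6⟩ := h.bdryCot_joinStart hι hx
  obtain ⟨-, γ, hγ, g0, g1, -⟩ := h.hit.bichar _ h1
  rw [h3] at hγ g1
  exact ⟨γ, hγ, g0 ▸ hW, g0 ▸ h5, g1 ▸ h6⟩

/-- The initial covector lies in the source of `e`, and by uniqueness of the exit `e` maps it to the
coordinates of p, the time 1 and the coordinates of q. Injectivity of `e` then determines it. This
is the uniqueness of the joining bicharacteristic, for every W inside `startNbhd`. -/
theorem JoinChart.joins_start (hι : IsBoundaryInclusion (m := m) ι) (hH : ContMDiffOn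
    (cotModel (𝓡∂ (m + 1))) 𝓘(ℝ, ℝ) ∞ H (nonzeroCot (𝓡∂ (m + 1)) M))
    (h : JoinChart H x₀ x₁ e ζ τ) (hW : W ⊆ startNbhd x₀ e) (hγ : Joins H ι W p q γ)
    (hq : ι q ∈ (chartAt (EuclideanHalfSpace (m + 1)) x₁).source) :
    (p, q) ∈ joinDomain ι x₀ x₁ e ∧ γ 0 = bdryCot x₀ (joinStart ι x₀ x₁ e (p, q)) ∧
      γ 1 = ζ (joinStart ι x₀ x₁ e (p, q)) ∧
      ∀ t ∈ Ioo (0 : ℝ) 1, (𝓡∂ (m + 1)).IsInteriorPoint (γ t).1 := by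
  obtain ⟨s1, s2⟩ := hW hγ.start_mem
  have hp : ι p ∈ (chartAt (EuclideanHalfSpace (m + 1)) x₀).source :=
    hγ.start_eq ▸ mem_cotChart_source.1 s1
  have h1 := hι.eq_bdryCot hγ.start_eq hp
  set w : EuclideanSpace ℝ (Fin m) × Covec (m + 1) :=
    (bdryCoord ι x₀ p, (cotChart (𝓡∂ (m + 1)) x₀ (γ 0)).2) with hw
  rw [cotChart_fst, hγ.start_eq] at s2
  change w ∈ e.source at s2
  obtain ⟨u1, u2, u3⟩ := h.hit.unique hH s2 zero_lt_one hγ.bichar h1.symm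
    (by rw [hγ.end_eq]; exact hι.not_interior q)
  have h2 : e w = joinTarget ι x₀ x₁ (p, q) := by
    rw [h.eq_hitMap, hitMap, ← u1, ← u2, cotChart_fst, hγ.end_eq]
    rfl
  have h3 : joinStart ι x₀ x₁ e (p, q) = w := by
    rw [joinStart, ← h2, e.left_inv s2]
  rw [h3]
  exact ⟨⟨hp, hq, h2 ▸ e.map_source s2⟩, h1.symm, u2, u3⟩

theorem JoinChart.joins_eqOn (hι : IsBoundaryInclusion (m := m) ι) (hH : ContMDiffOn
    (cotModel (𝓡∂ (m + 1))) 𝓘(ℝ, ℝ) ∞ H (nonzeroCot (𝓡∂ (m + 1)) M))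
    (h : JoinChart H x₀ x₁ e ζ τ) (hW : W ⊆ startNbhd x₀ e) (hγ : Joins H ι W p q γ)
    (hq : ι q ∈ (chartAt (EuclideanHalfSpace (m + 1)) x₁).source)
    {γ' : ℝ → Cot (𝓡∂ (m + 1)) M} (hγ' : Joins H ι W p q γ') : EqOn γ γ' (Icc 0 1) :=
  hγ.bichar.eqOn convex_range_halfSpace hH hγ'.bichar
    ((h.joins_start hι hH hW hγ hq).2.1.trans (h.joins_start hι hH hW hγ' hq).2.1.symm)

theorem IsBoundaryInclusion.isOpen_joinDomain (hι : IsBoundaryInclusion (m := m) ι) :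
    IsOpen (joinDomain ι x₀ x₁ e) := by
  rw [isOpen_iff_mem_nhds]
  rintro ⟨p, q⟩ ⟨h1, h2, h3⟩
  have c1 : ContinuousAt (fun x : B × B => ι x.1) (p, q) :=
    (hι.smooth.continuous.comp continuous_fst).continuousAt
  have c2 : ContinuousAt (fun x : B × B => ι x.2) (p, q) :=
    (hι.smooth.continuous.comp continuous_snd).continuousAt
  have c3 : ContinuousAt (joinTarget (m := m) ι x₀ x₁) (p, q) :=
    ((hι.contMDiffAt_bdryCoord h1).continuousAt.comp (x := (p, q)) continuousAt_fst).prodMk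
      (continuousAt_const.prodMk
        ((hι.contMDiffAt_bdryCoord h2).continuousAt.comp (x := (p, q)) continuousAt_snd))
  filter_upwards [c1.preimage_mem_nhds ((chartAt _ x₀).open_source.mem_nhds h1),
    c2.preimage_mem_nhds ((chartAt _ x₁).open_source.mem_nhds h2),
    c3.preimage_mem_nhds (e.open_target.mem_nhds h3)] with x a1 a2 a3
  exact ⟨a1, a2, a3⟩

theorem JoinChart.contMDiffAt_joinStart (hι : IsBoundaryInclusion (m := m) ι)
    (h : JoinChart H x₀ x₁ e ζ τ) {x : B × B} (hx : x ∈ joinDomain ι x₀ x₁ e) :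
    ContMDiffAt ((𝓡 m).prod (𝓡 m)) 𝓘(ℝ, EuclideanSpace ℝ (Fin m) × Covec (m + 1)) ∞
      (joinStart ι x₀ x₁ e) x := by
  obtain ⟨p, q⟩ := x
  have c1 : ContMDiffAt ((𝓡 m).prod (𝓡 m)) 𝓘(ℝ, EuclideanSpace ℝ (Fin m)) ∞
      (fun x : B × B => bdryCoord (m := m) ι x₀ x.1) (p, q) :=
    ContMDiffAt.comp (I' := 𝓡 m) (g := bdryCoord (m := m) ι x₀) (f := Prod.fst) (p, q)
      (hι.contMDiffAt_bdryCoord hx.1) contMDiffAt_fst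
  have c2 : ContMDiffAt ((𝓡 m).prod (𝓡 m)) 𝓘(ℝ, EuclideanSpace ℝ (Fin m)) ∞
      (fun x : B × B => bdryCoord (m := m) ι x₁ x.2) (p, q) :=
    ContMDiffAt.comp (I' := 𝓡 m) (g := bdryCoord (m := m) ι x₁) (f := Prod.snd) (p, q)
      (hι.contMDiffAt_bdryCoord hx.2.1) contMDiffAt_snd
  have c3 : ContMDiffAt ((𝓡 m).prod (𝓡 m))
      𝓘(ℝ, EuclideanSpace ℝ (Fin m) × (ℝ × EuclideanSpace ℝ (Fin m))) ∞
      (joinTarget (m := m) ι x₀ x₁) (p, q) :=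
    c1.prodMk_space (contMDiffAt_const.prodMk_space c2)
  exact ContMDiffAt.comp (p, q)
    (h.smooth_symm.contDiffAt (e.open_target.mem_nhds hx.2.2)).contMDiffAt c3

/-- The energy of the bicharacteristic that joins a pair of boundary points. -/
def joinEnergy (H : Cot (𝓡∂ (m + 1)) M → ℝ) (ι : B → M) (x₀ x₁ : M)
    (e : OpenPartialHomeomorph (EuclideanSpace ℝ (Fin m) × Covec (m + 1))
      (EuclideanSpace ℝ (Fin m) × (ℝ × EuclideanSpace ℝ (Fin m)))) (x : B × B) : ℝ :=
  H (bdryCot x₀ (joinStart ι x₀ x₁ e x))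

theorem JoinChart.contMDiffAt_bdryCot_joinStart (hι : IsBoundaryInclusion (m := m) ι)
    (h : JoinChart H x₀ x₁ e ζ τ) {x : B × B} (hx : x ∈ joinDomain ι x₀ x₁ e) :
    ContMDiffAt ((𝓡 m).prod (𝓡 m)) (cotModel (𝓡∂ (m + 1))) ∞
      (fun x : B × B => bdryCot x₀ (joinStart ι x₀ x₁ e x)) x := by
  obtain ⟨h1, -, -, -⟩ := h.joinStart_spec hx
  exact ContMDiffAt.comp (g := bdryCot x₀) x (contMDiffAt_bdryCot (w := id) contDiffAt_id
    (h.hit.start_mem _ h1).1) (h.contMDiffAt_joinStart hι hx)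

theorem JoinChart.contMDiffAt_joinEnergy (hι : IsBoundaryInclusion (m := m) ι) (hH : ContMDiffOn
    (cotModel (𝓡∂ (m + 1))) 𝓘(ℝ, ℝ) ∞ H (nonzeroCot (𝓡∂ (m + 1)) M))
    (h : JoinChart H x₀ x₁ e ζ τ) {x : B × B} (hx : x ∈ joinDomain ι x₀ x₁ e) :
    ContMDiffAt ((𝓡 m).prod (𝓡 m)) 𝓘(ℝ, ℝ) ∞ (joinEnergy H ι x₀ x₁ e) x := by
  obtain ⟨h1, -, -, -⟩ := h.joinStart_spec hx
  have h2 := h.hit.start_mem _ h1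
  exact ContMDiffAt.comp x (hH.contMDiffAt (isOpen_nonzeroCot.mem_nhds
    (bdryCot_mem_nonzeroCot h2.1 h2.2))) (h.contMDiffAt_bdryCot_joinStart hι hx)

/-- The bicharacteristics close to a given one, when the endpoints are not conjugate. -/
theorem exists_joinChart (hι : IsBoundaryInclusion (m := m) ι) (hH : IsHomogeneousSmooth H)
    {ξ₀ : TangentSpace (𝓡∂ (m + 1)) (ι p) →L[ℝ] Trivial M ℝ (ι p)}
    {η₀ : TangentSpace (𝓡∂ (m + 1)) (ι q) →L[ℝ] Trivial M ℝ (ι q)}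
    (hγ : IsBichar H 1 γ) (h0 : γ 0 = ⟨ι p, ξ₀⟩) (h1 : γ 1 = ⟨ι q, η₀⟩)
    (hint : ∀ t ∈ Ioo (0 : ℝ) 1, (𝓡∂ (m + 1)).IsInteriorPoint (γ t).1)
    (htrans₀ : IsTransversal H ι p ξ₀) (htrans₁ : IsTransversal H ι q η₀)
    (hconj : NotConjugate H (ι p) ξ₀) :
    ∃ e ζ τ, JoinChart H (ι p) (ι q) e ζ τ ∧ (bdryCoord ι (ι p) p, ξ₀) ∈ e.source ∧
      bdryCot (ι p) (bdryCoord ι (ι p) p, ξ₀) = ⟨ι p, ξ₀⟩ ∧ (p, q) ∈ joinDomain ι (ι p) (ι q) e ∧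
      joinStart ι (ι p) (ι q) e (p, q) = (bdryCoord ι (ι p) p, ξ₀) := by
  have hp := mem_chart_source (EuclideanHalfSpace (m + 1)) (ι p)
  have hq := mem_chart_source (EuclideanHalfSpace (m + 1)) (ι q)
  have hn0 : (⟨ι p, ξ₀⟩ : Cot (𝓡∂ (m + 1)) M) ∈ nonzeroCot (𝓡∂ (m + 1)) M :=
    h0 ▸ hγ.nonzero 0 ⟨le_rfl, zero_le_one⟩
  have hn1 : (⟨ι q, η₀⟩ : Cot (𝓡∂ (m + 1)) M) ∈ nonzeroCot (𝓡∂ (m + 1)) M :=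
    h1 ▸ hγ.nonzero 1 ⟨zero_le_one, le_rfl⟩
  have hs : cotChart (𝓡∂ (m + 1)) (ι p) ⟨ι p, ξ₀⟩ = (extChartAt (𝓡∂ (m + 1)) (ι p) (ι p), ξ₀) :=
    cotChart_self (⟨ι p, ξ₀⟩ : Cot (𝓡∂ (m + 1)) M)
  set w : EuclideanSpace ℝ (Fin m) × Covec (m + 1) := (bdryCoord ι (ι p) p, ξ₀) with hw
  have hwm : bdryIncl m w.1 ∈ (extChartAt (𝓡∂ (m + 1)) (ι p)).target := hι.bdryCoord_mem hp
  have hw0 : bdryCot (ι p) w = ⟨ι p, ξ₀⟩ := by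
    have := hι.eq_bdryCot (z := (⟨ι p, ξ₀⟩ : Cot (𝓡∂ (m + 1)) M)) rfl hp
    rwa [hs] at this
  have hb0 : (cotChart (𝓡∂ (m + 1)) (ι p) (γ 0)).1 0 = 0 := by
    rw [cotChart_fst, h0]
    exact hι.coord_zero hp
  have hb1 : (cotChart (𝓡∂ (m + 1)) (ι q) (γ 1)).1 0 = 0 := by
    rw [cotChart_fst, h1]
    exact hι.coord_zero hq
  -- The curve stays in M, so its normal velocity is nonnegative at the start and nonpositive at the
  -- end; transversality makes both inequalities strict.
  have hN0 : 0 < (hamLoc (ι p) H (bdryIncl m w.1, w.2)).1 0 := by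
    have f1 := hγ.normal_nonneg hH.smooth ⟨le_rfl, zero_lt_one⟩ (x := ι p) (by rw [h0]; exact hp) hb0
    have f2 := htrans₀.normal_ne_zero hι hH.smooth hn0
    rw [h0] at f1
    have f3 := lt_of_le_of_ne f1 f2.symm
    rwa [hs, ← hι.bdryIncl_bdryCoord hp] at f3
  have hN1 : (hamLoc (ι q) H (cotChart (𝓡∂ (m + 1)) (ι q) (γ 1))).1 0 < 0 := by
    have f1 := hγ.normal_nonpos hH.smooth ⟨zero_lt_one, le_rfl⟩ (x := ι q) (by rw [h1]; exact hq) hb1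
    have f2 := htrans₁.normal_ne_zero hι hH.smooth hn1
    rw [← h1] at f2
    exact lt_of_le_of_ne f1 f2
  obtain ⟨Ω, ζ, τ, hhit, hΩ, hwΩ, hτ, hζ⟩ := exists_hitChart hH hwm hγ (h0.trans hw0.symm) hN0 hint
    (by rw [h1]; exact hq) hb1 hN1
  obtain ⟨L, hL⟩ := hhit.exists_hasFDerivAt_equiv hH hΩ hwΩ rfl (hι.coord_zero hp) hτ
    (by rw [hζ, h1]) hconj
  obtain ⟨e, hwe, heΩ, heq, heL, hes⟩ := exists_openPartialHomeomorph_of_contDiffOn hΩ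
    (fun v hv => (hhit.contDiffAt_hitMap hv).contDiffWithinAt) hwΩ hL
  have hew : e w = joinTarget ι (ι p) (ι q) (p, q) := by
    rw [heq, hitMap, hτ, hζ, cotChart_fst, h1]
    rfl
  exact ⟨e, ζ, τ, ⟨hhit.mono heΩ, heq, heL, hes⟩, hwe, hw0, ⟨hp, hq, hew ▸ e.map_source hwe⟩, by
    have f1 := e.left_inv hwe
    rw [hew] at f1
    exact f1⟩

end JoinCharts

/-! ### Comparison of differentials by signs. -/

section Rays

theorem HasDerivAt.eventually_pos {φ : ℝ → ℝ} {d : ℝ} (h : HasDerivAt φ d 0) (h0 : φ 0 = 0)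
    (hd : 0 < d) : ∀ᶠ t in 𝓝[>] (0 : ℝ), 0 < φ t := by
  have h1 := (hasDerivAt_iff_tendsto_slope.1 h).mono_left
    (nhdsWithin_mono (0 : ℝ) (fun t (ht : 0 < t) => ht.ne'))
  filter_upwards [h1.eventually_const_lt hd, self_mem_nhdsWithin] with t h2 h3
  rw [slope_def_field, h0, sub_zero, sub_zero] at h2
  exact (div_pos_iff_of_pos_right h3).1 h2

/-- Two functions that vanish at a point and are positive on the same side have proportional
differentials. -/
theorem exists_pos_smul_of_sign {E : Type*} [NormedAddCommGroup E] [NormedSpace ℝ E]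
    {f g : E → ℝ} {R L : E →L[ℝ] ℝ} {x : E} (hf : HasFDerivAt f R x) (hg : HasFDerivAt g L x)
    (hf0 : f x = 0) (hg0 : g x = 0) (hR : R ≠ 0) (hL : L ≠ 0)
    (h : ∀ᶠ y in 𝓝 x, 0 < g y → 0 < f y) : ∃ ρ : ℝ, 0 < ρ ∧ R = ρ • L := by
  -- Otherwise a small step along v would make g positive and f negative.
  have key : ∀ v, 0 < L v → 0 ≤ R v := by
    intro v hv
    by_contra! hneg
    have hline : HasDerivAt (fun t : ℝ => x + t • v) v 0 := by
      simpa using ((hasDerivAt_id (0 : ℝ)).smul_const v).const_add x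
    have hx : x + (0 : ℝ) • v = x := by simp
    have h1 : HasDerivAt (fun t : ℝ => g (x + t • v)) (L v) 0 := by
      rw [← hx] at hg
      exact hg.comp_hasDerivAt (0 : ℝ) hline
    have h2 : HasDerivAt (fun t : ℝ => -f (x + t • v)) (-R v) 0 := by
      rw [← hx] at hf
      exact (hf.comp_hasDerivAt (0 : ℝ) hline).neg
    have h3 : ∀ᶠ t : ℝ in 𝓝[>] 0, 0 < g (x + t • v) → 0 < f (x + t • v) := by
      have h4 : Filter.Tendsto (fun t : ℝ => x + t • v) (𝓝 0) (𝓝 x) := by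
        have := hline.continuousAt.tendsto
        rwa [hx] at this
      exact (h4.eventually h).filter_mono nhdsWithin_le_nhds
    obtain ⟨t, a1, a2, a3⟩ := ((h1.eventually_pos (by rw [hx, hg0]) hv).and
      ((h2.eventually_pos (by rw [hx, hf0, neg_zero]) (by linarith)).and h3)).exists
    linarith [a3 a1]
  obtain ⟨u, hu⟩ : ∃ u, L u = 1 := by
    obtain ⟨v, hv⟩ : ∃ v, L v ≠ 0 := by
      by_contra! hc
      exact hL (ContinuousLinearMap.ext hc)
    exact ⟨(L v)⁻¹ • v, by rw [map_smul, smul_eq_mul, inv_mul_cancel₀ hv]⟩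
  -- Adding a multiple of such a v to u leaves L at 1; the multiple is chosen so that R takes the
  -- value -1, against `key`.
  have hker : ∀ v, L v = 0 → R v = 0 := by
    intro v hv
    by_contra hne
    have h1 := key (u + (-(R u + 1) / R v) • v) (by rw [map_add, map_smul, hu, hv]; simp)
    rw [map_add, map_smul, smul_eq_mul, div_mul_cancel₀ _ hne] at h1
    linarith
  have hRL : R = R u • L := by
    ext v
    have h1 := hker (v - L v • u) (by rw [map_sub, map_smul, hu]; simp)
    rw [map_sub, map_smul, smul_eq_mul] at h1
    rw [smul_apply, smul_eq_mul]
    linarith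
  refine ⟨R u, lt_of_le_of_ne (key u (by rw [hu]; exact one_pos)) fun h0 => hR ?_, hRL⟩
  rw [hRL, ← h0, zero_smul]

end Rays

/-! ### The energy in charts of the boundary. -/

section JoinEnergy

variable {m : ℕ} {M : Type*} [TopologicalSpace M] [ChartedSpace (EuclideanHalfSpace (m + 1)) M]
  [IsManifold (𝓡∂ (m + 1)) ∞ M]

/-- The family at s = 0 agrees with H only away from the zero section, whereas the charts are built
from H. Replacing its member at s = 0 by H gives literal equality and changes nothing on nonzero
covectors. -/
theorem HamFamily.update_zero {n : ℕ} {X : Type*} [TopologicalSpace X]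
    {I : ModelWithCorners ℝ (EuclideanSpace ℝ (Fin n)) X}
    {M : Type*} [TopologicalSpace M] [ChartedSpace X M] [IsManifold I ∞ M]
    {ε : ℝ} {Hs : ℝ → Cot I M → ℝ} {H : Cot I M → ℝ} (h : HamFamily ε Hs)
    (h0 : EqOn (Hs 0) H (nonzeroCot I M)) : HamFamily ε (Function.update Hs 0 H) := by
  have h1 : ∀ s, EqOn (Function.update Hs 0 H s) (Hs s) (nonzeroCot I M) := by
    intro s z hz
    by_cases hs : s = 0
    · rw [hs, Function.update_self, h0 hz]
    · rw [Function.update_of_ne hs]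
  refine ⟨ContMDiffOn.congr h.smooth fun w hw => h1 _ hw.2, fun s hs z hz c hc => ?_⟩
  rw [h1 s hz, h1 s (dilate_mem_nonzeroCot hc.ne' hz)]
  exact h.homogeneous s hs z hz c hc

/-- The tangential vectors together with one transversal vector span the whole space. -/
theorem covec_eq_zero_of_tangential {Y : EuclideanSpace ℝ (Fin (m + 1))} (hY : Y 0 ≠ 0)
    {ξ : Covec (m + 1)} (h1 : ∀ v, ξ (bdryIncl m v) = 0) (h2 : ξ Y = 0) : ξ = 0 := by
  refine ContinuousLinearMap.ext fun u => ?_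
  have h3 : (u - (u 0 / Y 0) • Y) 0 = 0 := by
    simp only [PiLp.sub_apply, PiLp.smul_apply, smul_eq_mul]
    field_simp
    ring
  have h4 := h1 (bdryProj m (u - (u 0 / Y 0) • Y))
  rw [bdryIncl_bdryProj h3, map_sub, map_smul, h2, smul_zero, sub_zero] at h4
  rw [h4]
  rfl

/-- The covectors with zero energy that are transversal to the boundary have a nonzero restriction
to the boundary. -/
theorem HitChart.exists_tangential_ne_zero {H : Cot (𝓡∂ (m + 1)) M → ℝ} {x₀ x₁ : M}
    {Ω : Set (EuclideanSpace ℝ (Fin m) × Covec (m + 1))}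
    {ζ : EuclideanSpace ℝ (Fin m) × Covec (m + 1) → Cot (𝓡∂ (m + 1)) M}
    {τ : EuclideanSpace ℝ (Fin m) × Covec (m + 1) → ℝ}
    {w : EuclideanSpace ℝ (Fin m) × Covec (m + 1)} (hH : IsHomogeneousSmooth H)
    (h : HitChart H x₀ x₁ Ω ζ τ) (hw : w ∈ Ω) (h0 : H (bdryCot x₀ w) = 0) :
    ∃ v, w.2 (bdryIncl m v) ≠ 0 := by
  by_contra! hc
  obtain ⟨h1, h2⟩ := h.start_mem w hw
  have h3 := h.start_normal w hw
  have h4 : w.2 (hamLoc x₀ H (bdryIncl m w.1, w.2)).1 = 0 := by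
    have h5 := hH.euler (x := x₀) (w := (bdryIncl m w.1, w.2)) h1 h2
    have h6 : localRep (𝓡∂ (m + 1)) x₀ H (bdryIncl m w.1, w.2) = 0 := h0
    rwa [h6, mul_zero] at h5
  exact h2 (covec_eq_zero_of_tangential h3.ne' hc h4)

variable [T2Space M]
  {B : Type*} [TopologicalSpace B] [ChartedSpace (EuclideanSpace ℝ (Fin m)) B]
  [IsManifold (𝓡 m) ∞ B] {ι : B → M} {H : Cot (𝓡∂ (m + 1)) M → ℝ} {x₀ x₁ : M}
  {e : OpenPartialHomeomorph (EuclideanSpace ℝ (Fin m) × Covec (m + 1))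
    (EuclideanSpace ℝ (Fin m) × (ℝ × EuclideanSpace ℝ (Fin m)))}
  {ζ : EuclideanSpace ℝ (Fin m) × Covec (m + 1) → Cot (𝓡∂ (m + 1)) M}
  {τ : EuclideanSpace ℝ (Fin m) × Covec (m + 1) → ℝ} {W : Set (Cot (𝓡∂ (m + 1)) M)}
  {p q p' q' : B} {γ : ℝ → Cot (𝓡∂ (m + 1)) M} {ε : ℝ} {Hs : ℝ → Cot (𝓡∂ (m + 1)) M → ℝ}

/-- The energy from `HitChart.exists_energy` is pulled back to charts of B along the tangential
coordinates, whose differentials are b₀ and b₁. Continuity of the initial covector in the parameters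
keeps it in the open set W. -/
theorem JoinChart.exists_energy_zero (hι : IsBoundaryInclusion (m := m) ι)
    (h : JoinChart (Hs 0) x₀ x₁ e ζ τ)
    (hW : W ⊆ startNbhd x₀ e) (hWo : IsOpen W) (hHs : HamFamily ε Hs) (hε : 0 < ε)
    (hγ : Joins (Hs 0) ι W p q γ)
    (hq : ι q ∈ (chartAt (EuclideanHalfSpace (m + 1)) x₁).source)
    (hp' : p ∈ (chartAt (EuclideanSpace ℝ (Fin m)) p').source)
    (hq' : q ∈ (chartAt (EuclideanSpace ℝ (Fin m)) q').source)
    {b₀ b₁ : EuclideanSpace ℝ (Fin m) →L[ℝ] EuclideanSpace ℝ (Fin m)}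
    (hb₀ : HasFDerivAt (fun a => bdryCoord ι x₀ ((extChartAt (𝓡 m) p').symm a)) b₀
      (extChartAt (𝓡 m) p' p))
    (hb₁ : HasFDerivAt (fun a => bdryCoord ι x₁ ((extChartAt (𝓡 m) q').symm a)) b₁
      (extChartAt (𝓡 m) q' q)) :
    ∃ (E : ℝ × (EuclideanSpace ℝ (Fin m) × EuclideanSpace ℝ (Fin m)) → ℝ)
      (Λ : ℝ × (EuclideanSpace ℝ (Fin m) × EuclideanSpace ℝ (Fin m)) →L[ℝ] ℝ),
      HasFDerivAt E Λ (0, (extChartAt (𝓡 m) p' p, extChartAt (𝓡 m) q' q)) ∧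
      (∀ δ, Λ δ = -(δ.1 * ∫ t in (0 : ℝ)..1, deriv (fun s => Hs s (γ t)) 0) -
        (cotChart (𝓡∂ (m + 1)) x₀ (γ 0)).2 (bdryIncl m (b₀ δ.2.1)) +
        (cotChart (𝓡∂ (m + 1)) x₁ (γ 1)).2 (bdryIncl m (b₁ δ.2.2))) ∧
      ∀ᶠ v in 𝓝 ((0 : ℝ), (extChartAt (𝓡 m) p' p, extChartAt (𝓡 m) q' q)),
        ∃ γ', Joins (Hs v.1) ι W ((extChartAt (𝓡 m) p').symm v.2.1)
          ((extChartAt (𝓡 m) q').symm v.2.2) γ' ∧ Hs v.1 (γ' 0) = E v := by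
  have hH : ContMDiffOn (cotModel (𝓡∂ (m + 1))) 𝓘(ℝ, ℝ) ∞ (Hs 0) (nonzeroCot (𝓡∂ (m + 1)) M) :=
    hHs.smooth.smooth (s := 0) ⟨by linarith, hε⟩
  obtain ⟨hd, g0, g1, -⟩ := h.joins_start hι hH hW hγ hq
  obtain ⟨w1, w2, w3, w4⟩ := h.joinStart_spec hd
  have hp := hd.1
  set w := joinStart ι x₀ x₁ e (p, q) with hw
  have w5 : (hitMap x₁ ζ τ w).2.2 = bdryCoord ι x₁ q := w4
  obtain ⟨L, hL⟩ := h.exists_equiv w w1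
  obtain ⟨κ, k0, kc, kev, Λ, hΛ, hΛf⟩ := h.hit.exists_energy hHs hε e.open_source w1 w3 hL
    hγ.bichar g0 g1
  rw [w5, w2] at k0 kc kev hΛ
  have hpr : (extChartAt (𝓡 m) p').symm (extChartAt (𝓡 m) p' p) = p :=
    (extChartAt (𝓡 m) p').left_inv (by rwa [extChartAt_source])
  have hqr : (extChartAt (𝓡 m) q').symm (extChartAt (𝓡 m) q' q) = q :=
    (extChartAt (𝓡 m) q').left_inv (by rwa [extChartAt_source])
  let A := EuclideanSpace ℝ (Fin m)
  let P1 : ℝ × (A × A) →L[ℝ] A :=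
    (ContinuousLinearMap.fst ℝ A A).comp (ContinuousLinearMap.snd ℝ ℝ (A × A))
  let P2 : ℝ × (A × A) →L[ℝ] A :=
    (ContinuousLinearMap.snd ℝ A A).comp (ContinuousLinearMap.snd ℝ ℝ (A × A))
  set v₀ : ℝ × (A × A) := (0, (extChartAt (𝓡 m) p' p, extChartAt (𝓡 m) q' q)) with hv₀
  set P : ℝ × (A × A) → ℝ × (A × A) := fun v => (v.1,
    (bdryCoord ι x₀ ((extChartAt (𝓡 m) p').symm v.2.1),
      bdryCoord ι x₁ ((extChartAt (𝓡 m) q').symm v.2.2))) with hP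
  have hPv : P v₀ = (0, (bdryCoord ι x₀ p, bdryCoord ι x₁ q)) := by
    simp only [hP, hv₀, hpr, hqr]
  set P' : ℝ × (A × A) →L[ℝ] ℝ × (A × A) :=
    (ContinuousLinearMap.fst ℝ ℝ (A × A)).prod ((b₀.comp P1).prod (b₁.comp P2)) with hP'
  have hP0 : HasFDerivAt (fun v : ℝ × (A × A) => bdryCoord ι x₀ ((extChartAt (𝓡 m) p').symm v.2.1))
      (b₀.comp P1) v₀ := HasFDerivAt.comp (f := P1) v₀ hb₀ P1.hasFDerivAt
  have hP1 : HasFDerivAt (fun v : ℝ × (A × A) => bdryCoord ι x₁ ((extChartAt (𝓡 m) q').symm v.2.2))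
      (b₁.comp P2) v₀ := HasFDerivAt.comp (f := P2) v₀ hb₁ P2.hasFDerivAt
  have hPd : HasFDerivAt P P' v₀ := hasFDerivAt_fst.prodMk (hP0.prodMk hP1)
  have hPt : Filter.Tendsto P (𝓝 v₀) (𝓝 (0, (bdryCoord ι x₀ p, bdryCoord ι x₁ q))) := by
    have := hPd.continuousAt.tendsto
    rwa [hPv] at this
  refine ⟨fun v => Hs (P v).1 (bdryCot x₀ ((P v).2.1, κ (P v))), Λ.comp P', ?_, fun δ => ?_, ?_⟩
  · rw [← hPv] at hΛ
    exact hΛ.comp v₀ hPd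
  · rw [ContinuousLinearMap.comp_apply, hΛf, g0, (cotChart_bdryCot (h.hit.start_mem w w1).1).2, g1]
    rfl
  · have hcov : Filter.Tendsto (fun v => ((P v).2.1, κ (P v))) (𝓝 v₀) (𝓝 w) := by
      have f1 : ContinuousAt (fun p : ℝ × (A × A) => (p.2.1, κ p))
          (0, (bdryCoord ι x₀ p, bdryCoord ι x₁ q)) :=
        (continuousAt_fst.comp continuousAt_snd).prodMk kc
      have f2 := f1.tendsto.comp hPt
      have f3 : ((bdryCoord ι x₀ p, κ (0, (bdryCoord ι x₀ p, bdryCoord ι x₁ q))) :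
          A × Covec (m + 1)) = w := by
        rw [k0, ← w2]
      simp only [f3] at f2
      exact f2
    have hWe : ∀ᶠ v in 𝓝 v₀, bdryCot x₀ ((P v).2.1, κ (P v)) ∈ W := by
      have f1 : ContinuousAt (bdryCot (M := M) x₀) w := (contMDiffAt_bdryCot (w := id)
        contDiffAt_id (h.hit.start_mem w w1).1).continuousAt
      exact (f1.tendsto.comp hcov).eventually (hWo.mem_nhds (g0 ▸ hγ.start_mem))
    have hse : ∀ᶠ v in 𝓝 v₀, ι ((extChartAt (𝓡 m) p').symm v.2.1) ∈
        (chartAt (EuclideanHalfSpace (m + 1)) x₀).source := by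
      have f1 : ContinuousAt (fun v : ℝ × (A × A) => ι ((extChartAt (𝓡 m) p').symm v.2.1)) v₀ :=
        hι.smooth.continuous.continuousAt.comp (ContinuousAt.comp (x := v₀)
          (f := fun v : ℝ × (A × A) => v.2.1)
          (continuousAt_extChartAt_symm' (by rwa [extChartAt_source])) (by fun_prop))
      exact f1.preimage_mem_nhds (by
        simp only [hv₀, hpr]
        exact (chartAt (EuclideanHalfSpace (m + 1)) x₀).open_source.mem_nhds hp)
    have hte : ∀ᶠ v in 𝓝 v₀, ι ((extChartAt (𝓡 m) q').symm v.2.2) ∈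
        (chartAt (EuclideanHalfSpace (m + 1)) x₁).source := by
      have f1 : ContinuousAt (fun v : ℝ × (A × A) => ι ((extChartAt (𝓡 m) q').symm v.2.2)) v₀ :=
        hι.smooth.continuous.continuousAt.comp (ContinuousAt.comp (x := v₀)
          (f := fun v : ℝ × (A × A) => v.2.2)
          (continuousAt_extChartAt_symm' (by rwa [extChartAt_source])) (by fun_prop))
      exact f1.preimage_mem_nhds (by
        simp only [hv₀, hqr]
        exact (chartAt (EuclideanHalfSpace (m + 1)) x₁).open_source.mem_nhds hq)
    filter_upwards [hWe, hse, hte, hPt.eventually kev] with v a1 a2 a3 a4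
    obtain ⟨-, γ', hγ', c0, c1, c2⟩ := a4
    refine ⟨γ', ⟨hγ', by rwa [c0], ?_, hι.eq_of_chart a3 c1 c2⟩, by rw [c0]⟩
    rw [c0]
    exact hι.bdryCot_fst a2 _

/-- The energy of the bicharacteristics that join pairs of boundary points, for a family of
Hamiltonians, in charts of the boundary, and its differential. -/
theorem JoinChart.exists_energy (hι : IsBoundaryInclusion (m := m) ι)
    (h : JoinChart H x₀ x₁ e ζ τ)
    (hW : W ⊆ startNbhd x₀ e) (hWo : IsOpen W) (hHs : HamFamily ε Hs) (hε : 0 < ε)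
    (h0 : EqOn (Hs 0) H (nonzeroCot (𝓡∂ (m + 1)) M)) (hγ : Joins H ι W p q γ)
    (hq : ι q ∈ (chartAt (EuclideanHalfSpace (m + 1)) x₁).source)
    (hp' : p ∈ (chartAt (EuclideanSpace ℝ (Fin m)) p').source)
    (hq' : q ∈ (chartAt (EuclideanSpace ℝ (Fin m)) q').source)
    {b₀ b₁ : EuclideanSpace ℝ (Fin m) →L[ℝ] EuclideanSpace ℝ (Fin m)}
    (hb₀ : HasFDerivAt (fun a => bdryCoord ι x₀ ((extChartAt (𝓡 m) p').symm a)) b₀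
      (extChartAt (𝓡 m) p' p))
    (hb₁ : HasFDerivAt (fun a => bdryCoord ι x₁ ((extChartAt (𝓡 m) q').symm a)) b₁
      (extChartAt (𝓡 m) q' q)) :
    ∃ (E : ℝ × (EuclideanSpace ℝ (Fin m) × EuclideanSpace ℝ (Fin m)) → ℝ)
      (Λ : ℝ × (EuclideanSpace ℝ (Fin m) × EuclideanSpace ℝ (Fin m)) →L[ℝ] ℝ),
      HasFDerivAt E Λ (0, (extChartAt (𝓡 m) p' p, extChartAt (𝓡 m) q' q)) ∧
      (∀ δ, Λ δ = -(δ.1 * ∫ t in (0 : ℝ)..1, deriv (fun s => Hs s (γ t)) 0) -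
        (cotChart (𝓡∂ (m + 1)) x₀ (γ 0)).2 (bdryIncl m (b₀ δ.2.1)) +
        (cotChart (𝓡∂ (m + 1)) x₁ (γ 1)).2 (bdryIncl m (b₁ δ.2.2))) ∧
      ∀ᶠ v in 𝓝 ((0 : ℝ), (extChartAt (𝓡 m) p' p, extChartAt (𝓡 m) q' q)),
        ∃ γ', Joins (Hs v.1) ι W ((extChartAt (𝓡 m) p').symm v.2.1)
          ((extChartAt (𝓡 m) q').symm v.2.2) γ' ∧ Hs v.1 (γ' 0) = E v := by
  have e0 : Function.update Hs 0 H 0 = H := Function.update_self ..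
  have e1 : ∀ s, EqOn (Function.update Hs 0 H s) (Hs s) (nonzeroCot (𝓡∂ (m + 1)) M) := by
    intro s z hz
    by_cases hs : s = 0
    · rw [hs, Function.update_self, h0 hz]
    · rw [Function.update_of_ne hs]
  obtain ⟨E, Λ, h1, h2, h3⟩ := JoinChart.exists_energy_zero (Hs := Function.update Hs 0 H) hι
    (by rwa [e0]) hW hWo (hHs.update_zero h0) hε (by rwa [e0]) hq hp' hq' hb₀ hb₁
  refine ⟨E, Λ, h1, fun δ => ?_, h3.mono ?_⟩
  · rw [h2]
    have f1 : ∫ t in (0 : ℝ)..1, deriv (fun s => Function.update Hs 0 H s (γ t)) 0 =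
        ∫ t in (0 : ℝ)..1, deriv (fun s => Hs s (γ t)) 0 := by
      refine intervalIntegral.integral_congr fun t ht => ?_
      rw [uIcc_of_le zero_le_one] at ht
      simp only [e1 _ (hγ.bichar.nonzero t ht)]
    rw [f1]
  · rintro v ⟨γ', hγ', hE⟩
    refine ⟨γ', ⟨hγ'.bichar.congr_ham (e1 v.1), hγ'.start_mem, hγ'.start_eq, hγ'.end_eq⟩, ?_⟩
    rw [← hE, e1 v.1 (hγ'.bichar.nonzero 0 ⟨le_rfl, zero_le_one⟩)]

end JoinEnergy

/-! ### Defining functions and the covectors at the endpoints. -/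

section GeneratingFunction

theorem MDifferentiableAt.hasFDerivAt_chart {F : Type*} [NormedAddCommGroup F] [NormedSpace ℝ F]
    {Y : Type*} [TopologicalSpace Y] {J : ModelWithCorners ℝ F Y} [J.Boundaryless]
    {P : Type*} [TopologicalSpace P] [ChartedSpace Y P] {f : P → ℝ} {x : P}
    (h : MDifferentiableAt J 𝓘(ℝ, ℝ) f x) {D : F →L[ℝ] ℝ} (hD : D = mfderiv J 𝓘(ℝ, ℝ) f x) :
    HasFDerivAt (fun y => f ((extChartAt J x).symm y)) D (extChartAt J x x) := by
  have h1 := h.hasMFDerivAt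
  rw [← hD] at h1
  have h2 : HasFDerivWithinAt (fun y => f ((extChartAt J x).symm y)) D (range J)
    (extChartAt J x x) := h1.2
  rwa [ModelWithCorners.range_eq_univ, hasFDerivWithinAt_univ] at h2

variable {m : ℕ} {M : Type*} [TopologicalSpace M] [ChartedSpace (EuclideanHalfSpace (m + 1)) M]
  [IsManifold (𝓡∂ (m + 1)) ∞ M] [T2Space M]
  {B : Type*} [TopologicalSpace B] [ChartedSpace (EuclideanSpace ℝ (Fin m)) B]
  [IsManifold (𝓡 m) ∞ B] {ι : B → M} {H : Cot (𝓡∂ (m + 1)) M → ℝ} {x₀ x₁ : M}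
  {e : OpenPartialHomeomorph (EuclideanSpace ℝ (Fin m) × Covec (m + 1))
    (EuclideanSpace ℝ (Fin m) × (ℝ × EuclideanSpace ℝ (Fin m)))}
  {ζ : EuclideanSpace ℝ (Fin m) × Covec (m + 1) → Cot (𝓡∂ (m + 1)) M}
  {τ : EuclideanSpace ℝ (Fin m) × Covec (m + 1) → ℝ} {W : Set (Cot (𝓡∂ (m + 1)) M)}
  {p q p' q' : B} {γ : ℝ → Cot (𝓡∂ (m + 1)) M} {U V : Set B} {r : B × B → ℝ}

theorem exists_eq_mk {n : ℕ} {X : Type*} [TopologicalSpace X]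
    {I : ModelWithCorners ℝ (EuclideanSpace ℝ (Fin n)) X}
    {M : Type*} [TopologicalSpace M] [ChartedSpace X M] [IsManifold I ∞ M] {z : Cot I M} {y : M}
    (h : z.1 = y) : ∃ ξ : TangentSpace I y →L[ℝ] Trivial M ℝ y, z = ⟨y, ξ⟩ := by
  subst h
  exact ⟨z.2, rfl⟩

theorem JoinChart.bdryCot_mem_startNbhd (h : JoinChart H x₀ x₁ e ζ τ)
    {w : EuclideanSpace ℝ (Fin m) × Covec (m + 1)} (hw : w ∈ e.source) :
    bdryCot x₀ w ∈ startNbhd x₀ e := by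
  obtain ⟨h1, h2⟩ := cotChart_bdryCot (h.hit.start_mem w hw).1
  refine ⟨mem_cotChart_source.2 h1, ?_⟩
  rw [h2]
  simp only [bdryProj_bdryIncl]
  exact hw

theorem JoinChart.energy_eq (hι : IsBoundaryInclusion (m := m) ι) (hH : IsHomogeneousSmooth H)
    (h : JoinChart H x₀ x₁ e ζ τ) (hW : W ⊆ startNbhd x₀ e) (hγ : Joins H ι W p q γ)
    (hq : ι q ∈ (chartAt (EuclideanHalfSpace (m + 1)) x₁).source) :
    H (γ 0) = joinEnergy H ι x₀ x₁ e (p, q) := by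
  rw [(h.joins_start hι hH.smooth hW hγ hq).2.1]
  rfl

theorem JoinChart.mem_nullPairs_iff (hι : IsBoundaryInclusion (m := m) ι)
    (hH : IsHomogeneousSmooth H) (h : JoinChart H x₀ x₁ e ζ τ) (hW : W ⊆ startNbhd x₀ e)
    {x : B × B} (hxU : x ∈ U ×ˢ V) (hx : x ∈ joinDomain ι x₀ x₁ e)
    (hxW : bdryCot x₀ (joinStart ι x₀ x₁ e x) ∈ W) :
    x ∈ nullPairs H ι W U V ↔ joinEnergy H ι x₀ x₁ e x = 0 := by
  constructor
  · rintro ⟨-, γ, hγ, h0⟩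
    rwa [h.energy_eq hι hH hW hγ hx.2.1] at h0
  · intro h0
    obtain ⟨γ, hγ⟩ := h.exists_joins hι hx hxW
    exact ⟨hxU, γ, hγ, by rwa [h.energy_eq hι hH hW hγ hx.2.1]⟩

/-- The differential of the energy of the joining bicharacteristics in terms of the covectors at
the endpoints. -/
theorem JoinChart.exists_energy_restr (hι : IsBoundaryInclusion (m := m) ι)
    (hH : IsHomogeneousSmooth H) (h : JoinChart H x₀ x₁ e ζ τ) (hW : W ⊆ startNbhd x₀ e)
    (hWo : IsOpen W) (hγ : Joins H ι W p q γ)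
    (hq : ι q ∈ (chartAt (EuclideanHalfSpace (m + 1)) x₁).source)
    {ξ : TangentSpace (𝓡∂ (m + 1)) (ι p) →L[ℝ] Trivial M ℝ (ι p)}
    {η : TangentSpace (𝓡∂ (m + 1)) (ι q) →L[ℝ] Trivial M ℝ (ι q)}
    (h0 : γ 0 = ⟨ι p, ξ⟩) (h1 : γ 1 = ⟨ι q, η⟩) :
    ∃ (E : EuclideanSpace ℝ (Fin m) × EuclideanSpace ℝ (Fin m) → ℝ)
      (Λ : EuclideanSpace ℝ (Fin m) × EuclideanSpace ℝ (Fin m) →L[ℝ] ℝ),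
      HasFDerivAt E Λ (extChartAt (𝓡 m) p p, extChartAt (𝓡 m) q q) ∧
      (∀ δ, Λ δ = -covec (restr ι p ξ) δ.1 + covec (restr ι q η) δ.2) ∧
      (H (γ 0) = 0 → Λ ≠ 0) ∧
      ∀ᶠ v in 𝓝 (extChartAt (𝓡 m) p p, extChartAt (𝓡 m) q q),
        ∃ γ', Joins H ι W ((extChartAt (𝓡 m) p).symm v.1)
          ((extChartAt (𝓡 m) q).symm v.2) γ' ∧ H (γ' 0) = E v := by
  obtain ⟨hd, g0, -, -⟩ := h.joins_start hι hH.smooth hW hγ hq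
  obtain ⟨w1, w2, -, -⟩ := h.joinStart_spec hd
  have hps := mem_chart_source (EuclideanSpace ℝ (Fin m)) p
  have hqs := mem_chart_source (EuclideanSpace ℝ (Fin m)) q
  obtain ⟨b₀, hb₀, hc₀⟩ := hι.exists_hasFDerivAt_bdryCoord hd.1 hps rfl
  obtain ⟨b₁, hb₁, hc₁⟩ := hι.exists_hasFDerivAt_bdryCoord hd.2.1 hqs rfl
  obtain ⟨E, Λ, hE, hΛ, hev⟩ := h.exists_energy hι hW hWo (hamFamily_const hH 1) one_pos
    (fun _ _ => rfl) hγ hq hps hqs hb₀ hb₁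
  have r₀ : ∀ δ, (cotChart (𝓡∂ (m + 1)) x₀ (γ 0)).2 (bdryIncl m (b₀ δ)) =
      covec (restr ι p ξ) δ := by
    intro δ
    rw [hc₀, h0, ← cotChart_restr_snd hd.1 hps rfl]
    have f1 := cotChart_self (restr ι p ξ)
    exact DFunLike.congr_fun (congrArg Prod.snd f1) δ
  have r₁ : ∀ δ, (cotChart (𝓡∂ (m + 1)) x₁ (γ 1)).2 (bdryIncl m (b₁ δ)) =
      covec (restr ι q η) δ := by
    intro δ
    rw [hc₁, h1, ← cotChart_restr_snd hd.2.1 hqs rfl]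
    have f1 := cotChart_self (restr ι q η)
    exact DFunLike.congr_fun (congrArg Prod.snd f1) δ
  let A := EuclideanSpace ℝ (Fin m)
  have hin : HasFDerivAt (fun v : A × A => ((0 : ℝ), v)) (ContinuousLinearMap.inr ℝ ℝ (A × A))
      (extChartAt (𝓡 m) p p, extChartAt (𝓡 m) q q) := hasFDerivAt_prodMk_right _ _
  have hform : ∀ δ : A × A, (Λ.comp (ContinuousLinearMap.inr ℝ ℝ (A × A))) δ =
      -covec (restr ι p ξ) δ.1 + covec (restr ι q η) δ.2 := by
    intro δ
    have f1 := hΛ (0, δ)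
    simp only [ContinuousLinearEquiv.coe_coe] at f1
    rw [r₀, r₁, zero_mul, neg_zero, zero_sub] at f1
    exact f1
  refine ⟨fun v => E (0, v), Λ.comp (ContinuousLinearMap.inr ℝ ℝ (A × A)),
    HasFDerivAt.comp (extChartAt (𝓡 m) p p, extChartAt (𝓡 m) q q) hE hin, hform, ?_, ?_⟩
  -- If Λ were zero, the tangential part of the initial covector would vanish, which is impossible
  -- for a null covector with transversal velocity.
  · intro hnull hL
    rw [g0] at hnull
    obtain ⟨v, hv⟩ := h.hit.exists_tangential_ne_zero hH w1 hnull
    have f1 := hform (b₀.symm v, 0)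
    rw [hL] at f1
    simp only [map_zero, add_zero] at f1
    rw [← r₀, b₀.apply_symm_apply, g0, (cotChart_bdryCot (h.hit.start_mem _ w1).1).2] at f1
    exact hv (neg_eq_zero.1 f1.symm)
  · exact hin.continuousAt.tendsto.eventually hev

theorem eventually_mem_of_chart (hU : IsOpen U) (hV : IsOpen V) (hp : p ∈ U) (hq : q ∈ V) :
    ∀ᶠ v in 𝓝 (extChartAt (𝓡 m) p p, extChartAt (𝓡 m) q q),
      ((extChartAt (𝓡 m) p).symm v.1, (extChartAt (𝓡 m) q).symm v.2) ∈ U ×ˢ V := by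
  have h1 : ∀ᶠ a in 𝓝 (extChartAt (𝓡 m) p p), (extChartAt (𝓡 m) p).symm a ∈ U :=
    (continuousAt_extChartAt_symm p).preimage_mem_nhds
      (by rw [extChartAt_to_inv]; exact hU.mem_nhds hp)
  have h2 : ∀ᶠ a in 𝓝 (extChartAt (𝓡 m) q q), (extChartAt (𝓡 m) q).symm a ∈ V :=
    (continuousAt_extChartAt_symm q).preimage_mem_nhds
      (by rw [extChartAt_to_inv]; exact hV.mem_nhds hq)
  filter_upwards [h1.prod_inl_nhds _, h2.prod_inr_nhds _] with v a1 a2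
  exact ⟨a1, a2⟩

/-- The differentials of a defining function are multiples of the restrictions to the boundary of
the covectors at the endpoints of the null bicharacteristic. -/
theorem JoinChart.exists_diff_eq (hι : IsBoundaryInclusion (m := m) ι)
    (hH : IsHomogeneousSmooth H) (h : JoinChart H x₀ x₁ e ζ τ) (hW : W ⊆ startNbhd x₀ e)
    (hWo : IsOpen W) (hU : IsOpen U) (hV : IsOpen V) (hr : IsDefiningFunction H ι W U V r)
    (hp : p ∈ U) (hqV : q ∈ V) (hγ : Joins H ι W p q γ) (hnull : H (γ 0) = 0)
    (hq : ι q ∈ (chartAt (EuclideanHalfSpace (m + 1)) x₁).source)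
    {ξ : TangentSpace (𝓡∂ (m + 1)) (ι p) →L[ℝ] Trivial M ℝ (ι p)}
    {η : TangentSpace (𝓡∂ (m + 1)) (ι q) →L[ℝ] Trivial M ℝ (ι q)}
    (h0 : γ 0 = ⟨ι p, ξ⟩) (h1 : γ 1 = ⟨ι q, η⟩) :
    ∃ ρ : ℝ, 0 < ρ ∧ diffFst r p q = -(ρ • (restr ι p ξ).2) ∧
      diffSnd r p q = ρ • (restr ι q η).2 := by
  obtain ⟨E, Λ, hE, hΛ, hΛ0, hev⟩ := h.exists_energy_restr hι hH hW hWo hγ hq h0 h1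
  have hx : (p, q) ∈ nullPairs H ι W U V := ⟨⟨hp, hqV⟩, γ, hγ, hnull⟩
  have hsm : ContMDiffAt ((𝓡 m).prod (𝓡 m)) 𝓘(ℝ, ℝ) ∞ r (p, q) :=
    hr.smooth.contMDiffAt ((hU.prod hV).mem_nhds ⟨hp, hqV⟩)
  have hmd : MDifferentiableAt ((𝓡 m).prod (𝓡 m)) 𝓘(ℝ, ℝ) r (p, q) :=
    hsm.mdifferentiableAt (by simp)
  let A := EuclideanSpace ℝ (Fin m)
  obtain ⟨D, hD⟩ : ∃ D : A × A →L[ℝ] ℝ, D = mfderiv ((𝓡 m).prod (𝓡 m)) 𝓘(ℝ, ℝ) r (p, q) :=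
    ⟨_, rfl⟩
  have hR : HasFDerivAt (fun v : A × A => r ((extChartAt (𝓡 m) p).symm v.1,
      (extChartAt (𝓡 m) q).symm v.2)) D (extChartAt (𝓡 m) p p, extChartAt (𝓡 m) q q) := by
    have f1 := hmd.hasFDerivAt_chart hD
    simp only [extChartAt_prod] at f1
    exact f1
  have hev0 := hev.self_of_nhds
  simp only [extChartAt_to_inv] at hev0
  obtain ⟨γ', hγ', hE0⟩ := hev0
  have hE1 : E (extChartAt (𝓡 m) p p, extChartAt (𝓡 m) q q) = 0 := by
    rw [← hE0, h.energy_eq hι hH hW hγ' hq, ← h.energy_eq hι hH hW hγ hq, hnull]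
  -- Both functions vanish here with nonzero differential, and where E is positive the curve
  -- realizing it shows that r is positive.
  obtain ⟨ρ, hρ, hDρ⟩ := exists_pos_smul_of_sign hR hE
    (by simp only [extChartAt_to_inv]; exact (hr.zero_iff _ ⟨hp, hqV⟩).1 hx) hE1
    (by rw [hD]; exact hr.diff_ne_zero _ hx) (hΛ0 hnull) (by
      filter_upwards [hev, eventually_mem_of_chart hU hV hp hqV] with v f1 f2 f3
      obtain ⟨γ', hγ', hE'⟩ := f1
      exact (hr.pos_iff _ f2).2 ⟨γ', hγ', by rwa [hE']⟩)
  have hq0 : (extChartAt (𝓡 m) q).symm (extChartAt (𝓡 m) q q) = q := extChartAt_to_inv q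
  have hp0 : (extChartAt (𝓡 m) p).symm (extChartAt (𝓡 m) p p) = p := extChartAt_to_inv p
  refine ⟨ρ, hρ, ?_, ?_⟩
  · have f1 : MDifferentiableAt (𝓡 m) 𝓘(ℝ, ℝ) (fun p' => r (p', q)) p :=
      (ContMDiffAt.comp p hsm (contMDiffAt_id.prodMk contMDiffAt_const)).mdifferentiableAt (by simp)
    obtain ⟨D₁, hD₁⟩ : ∃ D₁ : A →L[ℝ] ℝ, D₁ = mfderiv (𝓡 m) 𝓘(ℝ, ℝ) (fun p' => r (p', q)) p :=
      ⟨_, rfl⟩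
    have f2 := f1.hasFDerivAt_chart hD₁
    have f3 := HasFDerivAt.comp (extChartAt (𝓡 m) p p) hR
      (hasFDerivAt_prodMk_left (𝕜 := ℝ) (extChartAt (𝓡 m) p p) (extChartAt (𝓡 m) q q))
    simp only [Function.comp_def, hq0] at f3
    have f4 : D₁ = -(ρ • covec (restr ι p ξ)) := by
      rw [f2.unique f3, hDρ]
      ext δ
      have f5 := hΛ (δ, 0)
      simp only [map_zero, add_zero] at f5
      simp [f5]
    exact hD₁.symm.trans f4
  · have f1 : MDifferentiableAt (𝓡 m) 𝓘(ℝ, ℝ) (fun q' => r (p, q')) q :=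
      (ContMDiffAt.comp q hsm (contMDiffAt_const.prodMk contMDiffAt_id)).mdifferentiableAt (by simp)
    obtain ⟨D₁, hD₁⟩ : ∃ D₁ : A →L[ℝ] ℝ, D₁ = mfderiv (𝓡 m) 𝓘(ℝ, ℝ) (fun q' => r (p, q')) q :=
      ⟨_, rfl⟩
    have f2 := f1.hasFDerivAt_chart hD₁
    have f3 := HasFDerivAt.comp (extChartAt (𝓡 m) q q) hR
      (hasFDerivAt_prodMk_right (𝕜 := ℝ) (extChartAt (𝓡 m) p p) (extChartAt (𝓡 m) q q))
    simp only [Function.comp_def, hp0] at f3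
    have f4 : D₁ = ρ • covec (restr ι q η) := by
      rw [f2.unique f3, hDρ]
      ext δ
      have f5 := hΛ (0, δ)
      simp only [map_zero, neg_zero, zero_add] at f5
      simp [f5]
    exact hD₁.symm.trans f4

/-- The energy of the joining bicharacteristics has no critical zero. -/
theorem JoinChart.mfderiv_joinEnergy_ne_zero (hι : IsBoundaryInclusion (m := m) ι)
    (hH : IsHomogeneousSmooth H) (h : JoinChart H x₀ x₁ e ζ τ) {x : B × B}
    (hx : x ∈ joinDomain ι x₀ x₁ e) (h0 : joinEnergy H ι x₀ x₁ e x = 0) :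
    mfderiv ((𝓡 m).prod (𝓡 m)) 𝓘(ℝ, ℝ) (joinEnergy H ι x₀ x₁ e) x ≠ 0 := by
  obtain ⟨p, q⟩ := x
  obtain ⟨γ, hγ⟩ := h.exists_joins hι hx (h.bdryCot_mem_startNbhd (h.joinStart_spec hx).1)
  obtain ⟨ξ, hξ⟩ := exists_eq_mk hγ.start_eq
  obtain ⟨η, hη⟩ := exists_eq_mk hγ.end_eq
  obtain ⟨E, Λ, hE, -, hΛ0, hev⟩ := h.exists_energy_restr hι hH Subset.rfl isOpen_startNbhd hγ
    hx.2.1 hξ hη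
  let A := EuclideanSpace ℝ (Fin m)
  have hR : HasFDerivAt (fun v : A × A => joinEnergy H ι x₀ x₁ e ((extChartAt (𝓡 m) p).symm v.1,
      (extChartAt (𝓡 m) q).symm v.2)) Λ (extChartAt (𝓡 m) p p, extChartAt (𝓡 m) q q) := by
    refine hE.congr_of_eventuallyEq ?_
    have f1 : ∀ᶠ a in 𝓝 (extChartAt (𝓡 m) q q), ι ((extChartAt (𝓡 m) q).symm a) ∈
        (chartAt (EuclideanHalfSpace (m + 1)) x₁).source := by
      have f2 : ContinuousAt (fun a => ι ((extChartAt (𝓡 m) q).symm a)) (extChartAt (𝓡 m) q q) :=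
        hι.smooth.continuous.continuousAt.comp (continuousAt_extChartAt_symm q)
      refine f2.preimage_mem_nhds ?_
      rw [extChartAt_to_inv]
      exact (chartAt (EuclideanHalfSpace (m + 1)) x₁).open_source.mem_nhds hx.2.1
    filter_upwards [hev, f1.prod_inr_nhds _] with v f3 f4
    obtain ⟨γ', hγ', hE'⟩ := f3
    rw [← hE', h.energy_eq hι hH Subset.rfl hγ' f4]
  intro hc
  have hmd : MDifferentiableAt ((𝓡 m).prod (𝓡 m)) 𝓘(ℝ, ℝ) (joinEnergy H ι x₀ x₁ e) (p, q) :=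
    (h.contMDiffAt_joinEnergy hι hH.smooth hx).mdifferentiableAt (by simp)
  have f1 := hmd.hasFDerivAt_chart (D := (0 : A × A →L[ℝ] ℝ)) hc.symm
  simp only [extChartAt_prod] at f1
  refine hΛ0 ?_ (hR.unique f1)
  rwa [h.energy_eq hι hH Subset.rfl hγ hx.2.1]

end GeneratingFunction

/-! ### The parameter derivative of a family of defining functions. -/

section DerivativeFormula

section Chart

variable {F : Type*} [NormedAddCommGroup F] [NormedSpace ℝ F]
    {Y : Type*} [TopologicalSpace Y] {J : ModelWithCorners ℝ F Y} [J.Boundaryless]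
    {P : Type*} [TopologicalSpace P] [ChartedSpace Y P] [IsManifold J ∞ P] {f : P → ℝ} {x x₀ : P}

theorem contMDiffAt_extChartAt_symm_of_boundaryless (hx : x ∈ (extChartAt J x₀).source) :
    ContMDiffAt 𝓘(ℝ, F) J ∞ (extChartAt J x₀).symm (extChartAt J x₀ x) := by
  have h1 : ContMDiffWithinAt 𝓘(ℝ, F) J ∞ (extChartAt J x₀).symm (range J) (extChartAt J x₀ x) :=
    contMDiffWithinAt_extChartAt_symm_range _ ((extChartAt J x₀).map_source hx)
  rw [ModelWithCorners.range_eq_univ] at h1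
  exact h1.contMDiffAt Filter.univ_mem

theorem contDiffAt_of_chart (hx : x ∈ (extChartAt J x₀).source) (hf : ContMDiffAt J 𝓘(ℝ, ℝ) ∞ f x) :
    ContDiffAt ℝ ∞ (fun y => f ((extChartAt J x₀).symm y)) (extChartAt J x₀ x) := by
  refine ContMDiffAt.contDiffAt (ContMDiffAt.comp (g := f) _ ?_
    (contMDiffAt_extChartAt_symm_of_boundaryless hx))
  rwa [(extChartAt J x₀).left_inv hx]

/-- The derivatives of a smooth function in a chart are smooth. -/
theorem contMDiffAt_fderiv_chart (hx : x ∈ (extChartAt J x₀).source)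
    (hf : ContMDiffAt J 𝓘(ℝ, ℝ) ∞ f x) (δ : F) :
    ContMDiffAt J 𝓘(ℝ, ℝ) ∞ (fun x =>
      fderiv ℝ (fun y => f ((extChartAt J x₀).symm y)) (extChartAt J x₀ x) δ) x := by
  have h1 : ContDiffAt ℝ ∞ (fun y => fderiv ℝ (fun y => f ((extChartAt J x₀).symm y)) y δ)
      (extChartAt J x₀ x) :=
    ((contDiffAt_of_chart hx hf).fderiv_right (m := ∞) (by simp)).clm_apply contDiffAt_const
  exact ContMDiffAt.comp x h1.contMDiffAt
    (contMDiffAt_extChartAt' (by rwa [extChartAt_source] at hx))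

theorem fderiv_chart_ne_zero (hx : x ∈ (extChartAt J x₀).source)
    (hf : ContMDiffAt J 𝓘(ℝ, ℝ) ∞ f x) (h0 : mfderiv J 𝓘(ℝ, ℝ) f x ≠ 0) :
    fderiv ℝ (fun y => f ((extChartAt J x₀).symm y)) (extChartAt J x₀ x) ≠ 0 := by
  intro hc
  have h1 : HasFDerivAt (fun y => f ((extChartAt J x₀).symm y)) (0 : F →L[ℝ] ℝ)
      (extChartAt J x₀ x) := by
    rw [← hc]
    exact ((contDiffAt_of_chart hx hf).differentiableAt (by simp)).hasFDerivAt
  have h2 : MDifferentiableAt J 𝓘(ℝ, F) (extChartAt J x₀) x :=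
    (contMDiffAt_extChartAt' (n := ∞) (by rwa [extChartAt_source] at hx)).mdifferentiableAt (by simp)
  have h3 := HasMFDerivAt.comp x h1.hasMFDerivAt h2.hasMFDerivAt
  have h4 : (fun y => f ((extChartAt J x₀).symm y)) ∘ extChartAt J x₀ =ᶠ[𝓝 x] f := by
    filter_upwards [(isOpen_extChartAt_source (I := J) x₀).mem_nhds hx] with z hz
    simp only [Function.comp_apply, (extChartAt J x₀).left_inv hz]
  refine h0 ((h3.congr_of_eventuallyEq h4.symm).mfderiv.trans ?_)
  exact ContinuousLinearMap.zero_comp _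

end Chart

variable {m : ℕ} {M : Type*} [TopologicalSpace M] [ChartedSpace (EuclideanHalfSpace (m + 1)) M]
  [IsManifold (𝓡∂ (m + 1)) ∞ M] [T2Space M]
  {B : Type*} [TopologicalSpace B] [ChartedSpace (EuclideanSpace ℝ (Fin m)) B]
  [IsManifold (𝓡 m) ∞ B] {ι : B → M} {H : Cot (𝓡∂ (m + 1)) M → ℝ} {x₀ x₁ : M}
  {e : OpenPartialHomeomorph (EuclideanSpace ℝ (Fin m) × Covec (m + 1))
    (EuclideanSpace ℝ (Fin m) × (ℝ × EuclideanSpace ℝ (Fin m)))}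
  {ζ : EuclideanSpace ℝ (Fin m) × Covec (m + 1) → Cot (𝓡∂ (m + 1)) M}
  {τ : EuclideanSpace ℝ (Fin m) × Covec (m + 1) → ℝ} {W : Set (Cot (𝓡∂ (m + 1)) M)}
  {p₀ q₀ : B} {U V : Set B} {ε : ℝ} {Hs : ℝ → Cot (𝓡∂ (m + 1)) M → ℝ} {r : ℝ → B × B → ℝ}

/-- The derivative of a family of defining functions, with the factor of proportionality between
the differentials of the defining function and of the energy. -/
theorem JoinChart.exists_hasDerivAt (hι : IsBoundaryInclusion (m := m) ι)
    (hH : IsHomogeneousSmooth H) (h : JoinChart H x₀ x₁ e ζ τ) (hW : W ⊆ startNbhd x₀ e)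
    (hWo : IsOpen W) (hU : IsOpen U) (hV : IsOpen V) {x : B × B} (hxU : x ∈ U ×ˢ V)
    (hUV : U ×ˢ V ⊆ joinDomain ι x₀ x₁ e)
    (hp₀ : x.1 ∈ (chartAt (EuclideanSpace ℝ (Fin m)) p₀).source)
    (hq₀ : x.2 ∈ (chartAt (EuclideanSpace ℝ (Fin m)) q₀).source)
    (hHs : HamFamily ε Hs) (hε : 0 < ε) (h0 : EqOn (Hs 0) H (nonzeroCot (𝓡∂ (m + 1)) M))
    (hr : ContMDiffOn (𝓘(ℝ, ℝ).prod ((𝓡 m).prod (𝓡 m))) 𝓘(ℝ, ℝ) ∞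
      (fun w : ℝ × (B × B) => r w.1 w.2) (Ioo (-ε) ε ×ˢ (U ×ˢ V)))
    (hrs : ∀ s ∈ Ioo (-ε) ε, IsDefiningFunction (Hs s) ι W U V (r s))
    {γ : ℝ → Cot (𝓡∂ (m + 1)) M} (hγ : Joins H ι W x.1 x.2 γ) (hnull : H (γ 0) = 0) :
    ∃ ρ : ℝ, 0 < ρ ∧
      fderiv ℝ (fun y => r 0 ((extChartAt ((𝓡 m).prod (𝓡 m)) (p₀, q₀)).symm y))
        (extChartAt ((𝓡 m).prod (𝓡 m)) (p₀, q₀) x) =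
      ρ • fderiv ℝ (fun y => joinEnergy H ι x₀ x₁ e
        ((extChartAt ((𝓡 m).prod (𝓡 m)) (p₀, q₀)).symm y))
        (extChartAt ((𝓡 m).prod (𝓡 m)) (p₀, q₀) x) ∧
      HasDerivAt (fun s => r s x) (-ρ * ∫ t in (0 : ℝ)..1, deriv (fun s => Hs s (γ t)) 0) 0 := by
  obtain ⟨p, q⟩ := x
  have hd := hUV hxU
  have hε0 : (0 : ℝ) ∈ Ioo (-ε) ε := ⟨by linarith, hε⟩
  let A := EuclideanSpace ℝ (Fin m)
  set Φ := extChartAt ((𝓡 m).prod (𝓡 m)) (p₀, q₀) with hΦ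
  have hΦs : ∀ v : A × A, Φ.symm v = ((extChartAt (𝓡 m) p₀).symm v.1,
      (extChartAt (𝓡 m) q₀).symm v.2) := fun v => rfl
  have hΦa : ∀ y : B × B, Φ y = (extChartAt (𝓡 m) p₀ y.1, extChartAt (𝓡 m) q₀ y.2) :=
    fun y => rfl
  have hx : (p, q) ∈ Φ.source := by
    rw [hΦ, extChartAt_source, prodChartedSpace_chartAt]
    exact ⟨hp₀, hq₀⟩
  have hinv : Φ.symm (Φ (p, q)) = (p, q) := Φ.left_inv hx
  obtain ⟨b₀, hb₀, -⟩ := hι.exists_hasFDerivAt_bdryCoord hd.1 hp₀ rfl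
  obtain ⟨b₁, hb₁, -⟩ := hι.exists_hasFDerivAt_bdryCoord hd.2.1 hq₀ rfl
  obtain ⟨E, Λ, hE, hΛ, hev⟩ := h.exists_energy hι hW hWo hHs hε h0 hγ hd.2.1 hp₀ hq₀ hb₀ hb₁
  set v₀ : ℝ × (A × A) := (0, Φ (p, q)) with hv₀
  change HasFDerivAt E Λ v₀ at hE
  change ∀ᶠ v in 𝓝 v₀, ∃ γ', Joins (Hs v.1) ι W (Φ.symm v.2).1 (Φ.symm v.2).2 γ' ∧
    Hs v.1 (γ' 0) = E v at hev
  have hzero : ∀ y γ', Joins (Hs 0) ι W (Φ.symm y).1 (Φ.symm y).2 γ' → Φ.symm y ∈ U ×ˢ V →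
      Hs 0 (γ' 0) = joinEnergy H ι x₀ x₁ e (Φ.symm y) := by
    intro y γ' hγ' hy
    rw [h0 (hγ'.bichar.nonzero 0 ⟨le_rfl, zero_le_one⟩)]
    exact h.energy_eq hι hH hW ⟨hγ'.bichar.congr_ham h0, hγ'.start_mem, hγ'.start_eq,
      hγ'.end_eq⟩ (hUV hy).2.1
  have hmem : ∀ᶠ y in 𝓝 (Φ (p, q)), Φ.symm y ∈ U ×ˢ V :=
    (contMDiffAt_extChartAt_symm_of_boundaryless hx).continuousAt.preimage_mem_nhds
      (by rw [hinv]; exact (hU.prod hV).mem_nhds hxU)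
  have hin : HasFDerivAt (fun v : A × A => ((0 : ℝ), v)) (ContinuousLinearMap.inr ℝ ℝ (A × A))
      (Φ (p, q)) := hasFDerivAt_prodMk_right _ _
  have hE0 : (fun y => E (0, y)) =ᶠ[𝓝 (Φ (p, q))] fun y => joinEnergy H ι x₀ x₁ e (Φ.symm y) := by
    filter_upwards [hin.continuousAt.tendsto.eventually hev, hmem] with y f1 f2
    obtain ⟨γ', hγ', hE'⟩ := f1
    rw [← hE', hzero y γ' hγ' f2]
  have hEf : fderiv ℝ (fun y => joinEnergy H ι x₀ x₁ e (Φ.symm y)) (Φ (p, q)) =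
      Λ.comp (ContinuousLinearMap.inr ℝ ℝ (A × A)) :=
    ((HasFDerivAt.comp (Φ (p, q)) hE hin).congr_of_eventuallyEq hE0.symm).fderiv
  have hE1 : E v₀ = 0 := by
    have f1 : E v₀ = joinEnergy H ι x₀ x₁ e (Φ.symm (Φ (p, q))) := hE0.self_of_nhds
    rw [f1, hinv, ← h.energy_eq hι hH hW hγ hd.2.1, hnull]
  have hnp : (p, q) ∈ nullPairs (Hs 0) ι W U V := by
    have f1 : EqOn H (Hs 0) (nonzeroCot (𝓡∂ (m + 1)) M) := fun z hz => (h0 hz).symm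
    exact ⟨hxU, γ, ⟨hγ.bichar.congr_ham f1, hγ.start_mem, hγ.start_eq, hγ.end_eq⟩, by
      rwa [h0 (hγ.bichar.nonzero 0 ⟨le_rfl, zero_le_one⟩)]⟩
  have hEne : fderiv ℝ (fun y => joinEnergy H ι x₀ x₁ e (Φ.symm y)) (Φ (p, q)) ≠ 0 :=
    fderiv_chart_ne_zero hx (h.contMDiffAt_joinEnergy hι hH.smooth hd)
      (h.mfderiv_joinEnergy_ne_zero hι hH hd (by rw [← h.energy_eq hι hH hW hγ hd.2.1, hnull]))
  have hΛne : Λ ≠ 0 := by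
    rintro rfl
    exact hEne (hEf.trans (ContinuousLinearMap.zero_comp _))
  set R : ℝ × (A × A) → ℝ := fun v => r v.1 (Φ.symm v.2) with hR
  have hRd : DifferentiableAt ℝ R v₀ := by
    have f1 : ContMDiffAt (𝓘(ℝ, ℝ).prod ((𝓡 m).prod (𝓡 m))) 𝓘(ℝ, ℝ) ∞
        (fun w : ℝ × (B × B) => r w.1 w.2) (v₀.1, Φ.symm v₀.2) := by
      simp only [hv₀, hinv]
      exact hr.contMDiffAt ((isOpen_Ioo.prod (hU.prod hV)).mem_nhds ⟨hε0, hxU⟩)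
    have f2 : ContMDiffAt 𝓘(ℝ, ℝ × (A × A)) (𝓘(ℝ, ℝ).prod ((𝓡 m).prod (𝓡 m))) ∞
        (fun v : ℝ × (A × A) => (v.1, Φ.symm v.2)) v₀ :=
      contDiff_fst.contMDiff.contMDiffAt.prodMk (ContMDiffAt.comp (g := Φ.symm) v₀
        (contMDiffAt_extChartAt_symm_of_boundaryless hx) contDiff_snd.contMDiff.contMDiffAt)
    exact (ContMDiffAt.comp v₀ f1 f2).contDiffAt.differentiableAt (by simp)
  have hRf : fderiv ℝ (fun y => r 0 (Φ.symm y)) (Φ (p, q)) =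
      (fderiv ℝ R v₀).comp (ContinuousLinearMap.inr ℝ ℝ (A × A)) :=
    (HasFDerivAt.comp (Φ (p, q)) hRd.hasFDerivAt hin).fderiv
  have hdef := hrs 0 hε0
  have hRne : fderiv ℝ R v₀ ≠ 0 := by
    intro hc
    refine fderiv_chart_ne_zero hx (hdef.smooth.contMDiffAt ((hU.prod hV).mem_nhds hxU))
      (hdef.diff_ne_zero _ hnp) ?_
    rw [← hΦ, hRf, hc, ContinuousLinearMap.zero_comp]
  -- The signs are compared jointly in (s, x, y), so one factor ρ relates the s-derivatives as well
  -- as the differentials in (x, y).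
  obtain ⟨ρ, hρ, hRρ⟩ := exists_pos_smul_of_sign hRd.hasFDerivAt hE
    (by simp only [hR, hv₀, hinv]; exact (hdef.zero_iff _ hxU).1 hnp) hE1 hRne hΛne (by
      have f1 : ∀ᶠ v in 𝓝 v₀, v.1 ∈ Ioo (-ε) ε :=
        continuousAt_fst.preimage_mem_nhds (isOpen_Ioo.mem_nhds hε0)
      have f2 : ∀ᶠ v in 𝓝 v₀, Φ.symm v.2 ∈ U ×ˢ V :=
        (continuousAt_snd (p := v₀)).tendsto.eventually hmem
      filter_upwards [hev, f1, f2] with v f3 f4 f5 f6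
      obtain ⟨γ', hγ', hE'⟩ := f3
      exact ((hrs v.1 f4).pos_iff _ f5).2 ⟨γ', hγ', by rwa [hE']⟩)
  refine ⟨ρ, hρ, ?_, ?_⟩
  · rw [hRf, hEf, hRρ]
    rfl
  · have f1 : HasDerivAt (fun s : ℝ => (s, Φ (p, q))) ((1 : ℝ), (0 : A × A)) 0 :=
      (hasDerivAt_id (0 : ℝ)).prodMk (hasDerivAt_const _ _)
    have f2 := HasFDerivAt.comp_hasDerivAt (0 : ℝ) hRd.hasFDerivAt f1
    have f3 : fderiv ℝ R v₀ (1, 0) = -ρ * ∫ t in (0 : ℝ)..1, deriv (fun s => Hs s (γ t)) 0 := by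
      rw [hRρ, smul_apply, hΛ]
      simp
    rw [f3] at f2
    simp only [hR, Function.comp_def, hinv] at f2
    exact f2

/-- On Σ the factor is the quotient g of the derivatives of r 0 and of the energy E in a fixed
direction δ in which E has no critical point on U × V. This g is smooth on U × V, but its positivity
is known only on Σ. The function √(g² + E²) is smooth and positive everywhere and equals g on Σ. -/
theorem JoinChart.exists_factor (hι : IsBoundaryInclusion (m := m) ι)
    (hH : IsHomogeneousSmooth H) (h : JoinChart H x₀ x₁ e ζ τ) (hW : W ⊆ startNbhd x₀ e)
    (hWo : IsOpen W) (hU : IsOpen U) (hV : IsOpen V)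
    (hUV : U ×ˢ V ⊆ joinDomain ι x₀ x₁ e)
    (hUW : ∀ x ∈ U ×ˢ V, bdryCot x₀ (joinStart ι x₀ x₁ e x) ∈ W)
    (hUp : U ⊆ (chartAt (EuclideanSpace ℝ (Fin m)) p₀).source)
    (hVq : V ⊆ (chartAt (EuclideanSpace ℝ (Fin m)) q₀).source)
    {δ : EuclideanSpace ℝ (Fin m) × EuclideanSpace ℝ (Fin m)}
    (hδ : ∀ x ∈ U ×ˢ V, fderiv ℝ (fun y => joinEnergy H ι x₀ x₁ e
        ((extChartAt ((𝓡 m).prod (𝓡 m)) (p₀, q₀)).symm y))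
        (extChartAt ((𝓡 m).prod (𝓡 m)) (p₀, q₀) x) δ ≠ 0)
    (hHs : HamFamily ε Hs) (hε : 0 < ε) (h0 : EqOn (Hs 0) H (nonzeroCot (𝓡∂ (m + 1)) M))
    (hr : ContMDiffOn (𝓘(ℝ, ℝ).prod ((𝓡 m).prod (𝓡 m))) 𝓘(ℝ, ℝ) ∞
      (fun w : ℝ × (B × B) => r w.1 w.2) (Ioo (-ε) ε ×ˢ (U ×ˢ V)))
    (hrs : ∀ s ∈ Ioo (-ε) ε, IsDefiningFunction (Hs s) ι W U V (r s)) :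
    ∃ ρ : B × B → ℝ, ContMDiffOn ((𝓡 m).prod (𝓡 m)) 𝓘(ℝ, ℝ) ∞ ρ (U ×ˢ V) ∧
      (∀ x ∈ U ×ˢ V, 0 < ρ x) ∧
      ∀ x ∈ nullPairs H ι W U V, ∀ γ, Joins H ι W x.1 x.2 γ →
        HasDerivAt (fun s => r s x)
          (-ρ x * ∫ t in (0 : ℝ)..1, deriv (fun s => Hs s (γ t)) 0) 0 := by
  set Φ := extChartAt ((𝓡 m).prod (𝓡 m)) (p₀, q₀) with hΦ
  have hΦs : ∀ x ∈ U ×ˢ V, x ∈ Φ.source := by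
    rintro ⟨p, q⟩ hx
    rw [hΦ, extChartAt_source, prodChartedSpace_chartAt]
    exact ⟨hUp hx.1, hVq hx.2⟩
  have hε0 : (0 : ℝ) ∈ Ioo (-ε) ε := ⟨by linarith, hε⟩
  set g : B × B → ℝ := fun x => fderiv ℝ (fun y => r 0 (Φ.symm y)) (Φ x) δ /
    fderiv ℝ (fun y => joinEnergy H ι x₀ x₁ e (Φ.symm y)) (Φ x) δ with hg
  have hgs : ∀ x ∈ U ×ˢ V, ContMDiffAt ((𝓡 m).prod (𝓡 m)) 𝓘(ℝ, ℝ) ∞ g x := fun x hx =>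
    (contMDiffAt_fderiv_chart (hΦs x hx)
      ((hrs 0 hε0).smooth.contMDiffAt ((hU.prod hV).mem_nhds hx)) δ).div₀
      (contMDiffAt_fderiv_chart (hΦs x hx) (h.contMDiffAt_joinEnergy hι hH.smooth (hUV hx)) δ)
      (hδ x hx)
  have hnull : ∀ x ∈ U ×ˢ V, joinEnergy H ι x₀ x₁ e x = 0 → ∀ γ, Joins H ι W x.1 x.2 γ →
      0 < g x ∧ HasDerivAt (fun s => r s x)
        (-g x * ∫ t in (0 : ℝ)..1, deriv (fun s => Hs s (γ t)) 0) 0 := by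
    intro x hx hx0 γ hγ
    obtain ⟨ρ, hρ, e1, e2⟩ := h.exists_hasDerivAt hι hH hW hWo hU hV hx hUV (hUp hx.1) (hVq hx.2)
      hHs hε h0 hr hrs hγ (by rw [h.energy_eq hι hH hW hγ (hUV hx).2.1]; exact hx0)
    have e3 : g x = ρ := by
      simp only [hg, hΦ]
      rw [e1, smul_apply, smul_eq_mul, mul_div_cancel_right₀ _ (hδ x hx)]
    rw [e3]
    exact ⟨hρ, e2⟩
  -- Off Σ the energy is nonzero; on Σ the quotient g is positive.
  have hpos : ∀ x ∈ U ×ˢ V, 0 < g x ^ 2 + joinEnergy H ι x₀ x₁ e x ^ 2 := by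
    intro x hx
    by_cases hx0 : joinEnergy H ι x₀ x₁ e x = 0
    · obtain ⟨γ, hγ⟩ := h.exists_joins hι (hUV hx) (hUW x hx)
      have := (hnull x hx hx0 γ hγ).1
      positivity
    · positivity
  refine ⟨fun x => √(g x ^ 2 + joinEnergy H ι x₀ x₁ e x ^ 2), fun x hx => ?_,
    fun x hx => Real.sqrt_pos.2 (hpos x hx), fun x hx γ hγ => ?_⟩
  · refine ContMDiffAt.contMDiffWithinAt ?_
    exact ContMDiffAt.comp x (Real.contDiffAt_sqrt (hpos x hx).ne').contMDiffAt
      (((hgs x hx).pow 2).add ((h.contMDiffAt_joinEnergy hι hH.smooth (hUV hx)).pow 2))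
  · have hx0 := (h.mem_nullPairs_iff hι hH hW hx.1 (hUV hx.1) (hUW x hx.1)).1 hx
    obtain ⟨e1, e2⟩ := hnull x hx.1 hx0 γ hγ
    simp only [hx0, ne_eq, OfNat.ofNat_ne_zero, not_false_eq_true, zero_pow, add_zero,
      Real.sqrt_sq e1.le]
    exact e2

end DerivativeFormula

/-! ### Null covectors over the boundary and their restrictions. -/

section NullCovectors

variable {m : ℕ} {M : Type*} [TopologicalSpace M] [T2Space M]
  [ChartedSpace (EuclideanHalfSpace (m + 1)) M]
  [IsManifold (𝓡∂ (m + 1)) ∞ M]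
  {B : Type*} [TopologicalSpace B] [ChartedSpace (EuclideanSpace ℝ (Fin m)) B]
  [IsManifold (𝓡 m) ∞ B] {ι : B → M} {H : Cot (𝓡∂ (m + 1)) M → ℝ} {x₀ : M} {p p₀ : B}

/-- The restriction to the boundary and the energy, as coordinates of the covectors over boundary
points. -/
def restrCoord (H : Cot (𝓡∂ (m + 1)) M → ℝ) (ι : B → M) (x₀ : M) (p₀ : B)
    (v : EuclideanSpace ℝ (Fin m) × Covec (m + 1)) : (EuclideanSpace ℝ (Fin m) × Covec m) × ℝ :=
  ((v.1, v.2.comp ((bdryIncl m).comp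
    (fderiv ℝ (fun a => bdryCoord ι x₀ ((extChartAt (𝓡 m) p₀).symm a)) v.1))),
    H (bdryCot x₀ (bdryCoord ι x₀ ((extChartAt (𝓡 m) p₀).symm v.1), v.2)))

theorem restrCoord_eq (hι : IsBoundaryInclusion (m := m) ι)
    (hp : ι p ∈ (chartAt (EuclideanHalfSpace (m + 1)) x₀).source)
    (hp₀ : p ∈ (chartAt (EuclideanSpace ℝ (Fin m)) p₀).source)
    (ξ : TangentSpace (𝓡∂ (m + 1)) (ι p) →L[ℝ] Trivial M ℝ (ι p)) :
    restrCoord H ι x₀ p₀ (extChartAt (𝓡 m) p₀ p, (cotChart (𝓡∂ (m + 1)) x₀ ⟨ι p, ξ⟩).2) =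
      (cotChart (𝓡 m) p₀ (restr ι p ξ), H ⟨ι p, ξ⟩) := by
  have hpi : (extChartAt (𝓡 m) p₀).symm (extChartAt (𝓡 m) p₀ p) = p :=
    (extChartAt (𝓡 m) p₀).left_inv (by rwa [extChartAt_source])
  obtain ⟨b, hb, hbδ⟩ := hι.exists_hasFDerivAt_bdryCoord hp hp₀ rfl
  refine Prod.ext (Prod.ext ?_ ?_) ?_
  · exact (cotChart_fst p₀ (restr ι p ξ)).symm
  · refine ContinuousLinearMap.ext fun δ => ?_
    simp only [restrCoord]
    rw [hb.fderiv, cotChart_restr_snd hp hp₀ rfl, ← hbδ]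
    rfl
  · simp only [restrCoord, hpi]
    rw [hι.eq_bdryCot (z := (⟨ι p, ξ⟩ : Cot (𝓡∂ (m + 1)) M)) rfl hp]

theorem contDiffAt_bdryCoord_symm (hι : IsBoundaryInclusion (m := m) ι)
    {u : EuclideanSpace ℝ (Fin m)} (hu : u ∈ (extChartAt (𝓡 m) p₀).target)
    (hx : ι ((extChartAt (𝓡 m) p₀).symm u) ∈ (chartAt (EuclideanHalfSpace (m + 1)) x₀).source) :
    ContDiffAt ℝ ∞ (fun a => bdryCoord (m := m) ι x₀ ((extChartAt (𝓡 m) p₀).symm a)) u := by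
  have h1 := contMDiffAt_extChartAt_symm_of_boundaryless ((extChartAt (𝓡 m) p₀).map_target hu)
  rw [(extChartAt (𝓡 m) p₀).right_inv hu] at h1
  exact (ContMDiffAt.comp u (hι.contMDiffAt_bdryCoord hx) h1).contDiffAt

theorem contDiffAt_restrCoord (hι : IsBoundaryInclusion (m := m) ι)
    (hH : ContMDiffOn (cotModel (𝓡∂ (m + 1))) 𝓘(ℝ, ℝ) ∞ H (nonzeroCot (𝓡∂ (m + 1)) M))
    {v : EuclideanSpace ℝ (Fin m) × Covec (m + 1)} (hu : v.1 ∈ (extChartAt (𝓡 m) p₀).target)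
    (hx : ι ((extChartAt (𝓡 m) p₀).symm v.1) ∈ (chartAt (EuclideanHalfSpace (m + 1)) x₀).source)
    (hv : v.2 ≠ 0) : ContDiffAt ℝ ∞ (restrCoord H ι x₀ p₀) v := by
  have h1 := contDiffAt_bdryCoord_symm hι hu hx
  have h2 : ContDiffAt ℝ ∞ (fun v : EuclideanSpace ℝ (Fin m) × Covec (m + 1) =>
      fderiv ℝ (fun a => bdryCoord (m := m) ι x₀ ((extChartAt (𝓡 m) p₀).symm a)) v.1) v :=
    (h1.fderiv_right (m := ∞) (by simp)).comp v contDiffAt_fst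
  have h3 : ContDiffAt ℝ ∞ (fun v : EuclideanSpace ℝ (Fin m) × Covec (m + 1) =>
      (bdryCoord (m := m) ι x₀ ((extChartAt (𝓡 m) p₀).symm v.1), v.2)) v :=
    (ContDiffAt.comp v h1 contDiffAt_fst).prodMk contDiffAt_snd
  have hm := hι.bdryCoord_mem hx
  have h4 := ContMDiffAt.comp v (hH.contMDiffAt (isOpen_nonzeroCot.mem_nhds
    (bdryCot_mem_nonzeroCot (w := (bdryCoord ι x₀ ((extChartAt (𝓡 m) p₀).symm v.1), v.2)) hm hv)))
    (contMDiffAt_bdryCot h3 hm)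
  exact (contDiffAt_fst.prodMk (contDiffAt_snd.clm_comp (contDiffAt_const.clm_comp h2))).prodMk
    h4.contDiffAt

/-- At a covector that is transversal to the boundary, the restriction to the boundary and the
energy are coordinates. -/
theorem exists_restrChart (hι : IsBoundaryInclusion (m := m) ι)
    (hH : ContMDiffOn (cotModel (𝓡∂ (m + 1))) 𝓘(ℝ, ℝ) ∞ H (nonzeroCot (𝓡∂ (m + 1)) M))
    (hp₀ : ι p₀ ∈ (chartAt (EuclideanHalfSpace (m + 1)) x₀).source) {ξ : Covec (m + 1)}
    (hξ : ξ ≠ 0) (hn : (hamLoc x₀ H (bdryIncl m (bdryCoord ι x₀ p₀), ξ)).1 0 ≠ 0) :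
    ∃ e₂ : OpenPartialHomeomorph (EuclideanSpace ℝ (Fin m) × Covec (m + 1))
      ((EuclideanSpace ℝ (Fin m) × Covec m) × ℝ), (extChartAt (𝓡 m) p₀ p₀, ξ) ∈ e₂.source ∧
      ∀ v, e₂ v = restrCoord H ι x₀ p₀ v := by
  set u₀ := extChartAt (𝓡 m) p₀ p₀ with hu₀
  have hus : (extChartAt (𝓡 m) p₀).symm u₀ = p₀ := extChartAt_to_inv p₀
  have hut : u₀ ∈ (extChartAt (𝓡 m) p₀).target := mem_extChartAt_target p₀
  set Ω : Set (EuclideanSpace ℝ (Fin m) × Covec (m + 1)) :=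
    {v | v.1 ∈ (extChartAt (𝓡 m) p₀).target ∧
      ι ((extChartAt (𝓡 m) p₀).symm v.1) ∈ (chartAt (EuclideanHalfSpace (m + 1)) x₀).source ∧
      v.2 ≠ 0} with hΩ
  have hΩn : Ω ∈ 𝓝 (u₀, ξ) := by
    have c1 : ∀ᶠ v : EuclideanSpace ℝ (Fin m) × Covec (m + 1) in 𝓝 (u₀, ξ),
        v.1 ∈ (extChartAt (𝓡 m) p₀).target :=
      ((isOpen_extChartAt_target (I := 𝓡 m) p₀).preimage continuous_fst).mem_nhds hut
    have c2 : ∀ᶠ v : EuclideanSpace ℝ (Fin m) × Covec (m + 1) in 𝓝 (u₀, ξ),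
        ι ((extChartAt (𝓡 m) p₀).symm v.1) ∈
          (chartAt (EuclideanHalfSpace (m + 1)) x₀).source := by
      have c3 : ContinuousAt (fun a => ι ((extChartAt (𝓡 m) p₀).symm a)) u₀ :=
        hι.smooth.continuous.continuousAt.comp (continuousAt_extChartAt_symm p₀)
      have c4 : ∀ᶠ a in 𝓝 u₀, ι ((extChartAt (𝓡 m) p₀).symm a) ∈
          (chartAt (EuclideanHalfSpace (m + 1)) x₀).source :=
        c3.preimage_mem_nhds (by
          rw [hus]
          exact (chartAt (EuclideanHalfSpace (m + 1)) x₀).open_source.mem_nhds hp₀)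
      exact c4.prod_inl_nhds ξ
    have c3 : ∀ᶠ v : EuclideanSpace ℝ (Fin m) × Covec (m + 1) in 𝓝 (u₀, ξ), v.2 ≠ 0 :=
      continuousAt_snd.eventually_ne hξ
    filter_upwards [c1, c2, c3] with v a1 a2 a3
    exact ⟨a1, a2, a3⟩
  obtain ⟨Ω', hΩ', hΩo, hmem⟩ := mem_nhds_iff.1 hΩn
  have hsm : ∀ v ∈ Ω', ContDiffAt ℝ ∞ (restrCoord H ι x₀ p₀) v := fun v hv =>
    contDiffAt_restrCoord hι hH (hΩ' hv).1 (hΩ' hv).2.1 (hΩ' hv).2.2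
  let A := EuclideanSpace ℝ (Fin m)
  obtain ⟨D, hD⟩ : ∃ D : A × Covec (m + 1) →L[ℝ] (A × Covec m) × ℝ,
      HasFDerivAt (restrCoord H ι x₀ p₀) D (u₀, ξ) :=
    ⟨_, ((hsm _ hmem).differentiableAt (by simp)).hasFDerivAt⟩
  obtain ⟨b, hb, -⟩ := hι.exists_hasFDerivAt_bdryCoord hp₀
    (mem_chart_source (EuclideanSpace ℝ (Fin m)) p₀) rfl
  have hD1 : ∀ δ, (D δ).1.1 = δ.1 := by
    intro δ
    have f1 : HasFDerivAt (fun v => (restrCoord H ι x₀ p₀ v).1.1)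
        ((ContinuousLinearMap.fst ℝ A (Covec m)).comp
          ((ContinuousLinearMap.fst ℝ (A × Covec m) ℝ).comp D)) (u₀, ξ) := hD.fst.fst
    exact DFunLike.congr_fun (f1.unique hasFDerivAt_fst) δ
  have hfib := HasFDerivAt.comp ξ hD (hasFDerivAt_prodMk_right (𝕜 := ℝ) u₀ ξ)
  have hD2 : ∀ δ v, (D (0, δ)).1.2 v = δ (bdryIncl m (b v)) := by
    intro δ v
    have f1 : HasFDerivAt (fun ξ : Covec (m + 1) => (restrCoord H ι x₀ p₀ (u₀, ξ)).1.2)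
        ((ContinuousLinearMap.snd ℝ A (Covec m)).comp
          ((ContinuousLinearMap.fst ℝ (A × Covec m) ℝ).comp
            (D.comp (ContinuousLinearMap.inr ℝ A (Covec (m + 1)))))) ξ := hfib.fst.snd
    have f2 := ((ContinuousLinearMap.compL ℝ A (EuclideanSpace ℝ (Fin (m + 1))) ℝ).flip
      ((bdryIncl m).comp (fderiv ℝ (fun a => bdryCoord (m := m) ι x₀
        ((extChartAt (𝓡 m) p₀).symm a)) u₀))).hasFDerivAt (x := ξ)
    have f3 := DFunLike.congr_fun (DFunLike.congr_fun (f1.unique f2) δ) v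
    rw [hb.fderiv] at f3
    exact f3
  -- In fibre directions the derivative of the energy is the pairing with the velocity H_ξ, and this
  -- detects the direction that restriction to the boundary forgets.
  have hD3 : ∀ δ, (D (0, δ)).2 = δ (hamLoc x₀ H (bdryIncl m (bdryCoord ι x₀ p₀), ξ)).1 := by
    intro δ
    have f1 : HasFDerivAt (fun ξ : Covec (m + 1) => (restrCoord H ι x₀ p₀ (u₀, ξ)).2)
        ((ContinuousLinearMap.snd ℝ (A × Covec m) ℝ).comp
            (D.comp (ContinuousLinearMap.inr ℝ A (Covec (m + 1))))) ξ := hfib.snd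
    have f2 := hasFDerivWithinAt_localRep_fderivWithin hH (x := x₀)
      (w := (bdryIncl m (bdryCoord ι x₀ p₀), ξ)) (hι.bdryCoord_mem hp₀) hξ
    have f3 := HasFDerivWithinAt.comp_hasFDerivAt_of_eq ξ f2
      (hasFDerivAt_prodMk_right (𝕜 := ℝ) (bdryIncl m (bdryCoord (m := m) ι x₀ p₀)) ξ)
      (.of_forall fun ξ => by
        rw [range_cotModel]
        exact ⟨bdryIncl_mem_range _, mem_univ _⟩) rfl
    have f4 : (fun ξ : Covec (m + 1) => (restrCoord H ι x₀ p₀ (u₀, ξ)).2) =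
        localRep (𝓡∂ (m + 1)) x₀ H ∘ fun ξ => (bdryIncl m (bdryCoord ι x₀ p₀), ξ) := by
      funext ξ
      simp only [restrCoord, hus]
      rfl
    rw [f4] at f1
    have f5 := DFunLike.congr_fun (f1.unique f3) δ
    exact f5.trans (sgrad_fst_apply _ δ).symm
  have hinj : Function.Injective D := by
    refine (injective_iff_map_eq_zero D).2 fun δ hδ => ?_
    have g1 : δ.1 = 0 := by rw [← hD1 δ, hδ]; rfl
    have g2 : δ = (0, δ.2) := Prod.ext g1 rfl
    -- δ.2 annihilates all tangential vectors and the transversal velocity.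
    have g3 : δ.2 = 0 := by
      refine covec_eq_zero_of_tangential hn (fun v => ?_) ?_
      · have := hD2 δ.2 (b.symm v)
        rw [b.apply_symm_apply, ← g2, hδ] at this
        exact this.symm
      · have := hD3 δ.2
        rw [← g2, hδ] at this
        exact this.symm
    rw [g2, g3]
    rfl
  have hrank : Module.finrank ℝ (A × Covec (m + 1)) = Module.finrank ℝ ((A × Covec m) × ℝ) := by
    rw [Module.finrank_prod, Module.finrank_prod, Module.finrank_prod, finrank_covec, finrank_covec]
    simp [add_assoc]
  have hD' : HasFDerivAt (restrCoord H ι x₀ p₀) ((LinearEquiv.ofInjectiveOfFinrankEq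
      (D : A × Covec (m + 1) →ₗ[ℝ] _) hinj hrank).toContinuousLinearEquiv : _ →L[ℝ] _) (u₀, ξ) := by
    convert! hD using 1
  obtain ⟨e₂, h1, -, h2, -, -⟩ := exists_openPartialHomeomorph_of_contDiffOn hΩo
    (fun v hv => (hsm v hv).contDiffWithinAt) hmem hD'
  exact ⟨e₂, h1, h2⟩

/-- Near a null covector that is transversal to the boundary, the null covectors are determined by
their restrictions to the boundary, which are arbitrary. -/
theorem exists_null_covectors (hι : IsBoundaryInclusion (m := m) ι)
    (hH : ContMDiffOn (cotModel (𝓡∂ (m + 1))) 𝓘(ℝ, ℝ) ∞ H (nonzeroCot (𝓡∂ (m + 1)) M))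
    (hp₀ : ι p₀ ∈ (chartAt (EuclideanHalfSpace (m + 1)) x₀).source)
    {ξ₀ : TangentSpace (𝓡∂ (m + 1)) (ι p₀) →L[ℝ] Trivial M ℝ (ι p₀)}
    (hξ₀ : (⟨ι p₀, ξ₀⟩ : Cot (𝓡∂ (m + 1)) M) ∈ nonzeroCot (𝓡∂ (m + 1)) M)
    (hnull : H ⟨ι p₀, ξ₀⟩ = 0)
    (hn : (hamLoc x₀ H (cotChart (𝓡∂ (m + 1)) x₀ ⟨ι p₀, ξ₀⟩)).1 0 ≠ 0) :
    (∃ (O : Set B) (D : Set (Covec (m + 1))), IsOpen O ∧ p₀ ∈ O ∧ IsOpen D ∧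
      (cotChart (𝓡∂ (m + 1)) x₀ ⟨ι p₀, ξ₀⟩).2 ∈ D ∧
      ∀ p ∈ O, ι p ∈ (chartAt (EuclideanHalfSpace (m + 1)) x₀).source →
        ∀ ξ ξ' : TangentSpace (𝓡∂ (m + 1)) (ι p) →L[ℝ] Trivial M ℝ (ι p),
        (cotChart (𝓡∂ (m + 1)) x₀ ⟨ι p, ξ⟩).2 ∈ D → (cotChart (𝓡∂ (m + 1)) x₀ ⟨ι p, ξ'⟩).2 ∈ D →
        H ⟨ι p, ξ⟩ = H ⟨ι p, ξ'⟩ → restr ι p ξ = restr ι p ξ' → ξ = ξ') ∧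
    ∀ N ∈ 𝓝 (⟨ι p₀, ξ₀⟩ : Cot (𝓡∂ (m + 1)) M), ∀ᶠ a in 𝓝 (restr ι p₀ ξ₀),
      ∃ ξ : TangentSpace (𝓡∂ (m + 1)) (ι a.1) →L[ℝ] Trivial M ℝ (ι a.1),
        ⟨ι a.1, ξ⟩ ∈ N ∧ H ⟨ι a.1, ξ⟩ = 0 ∧ restr ι a.1 ξ = a := by
  set ξc := (cotChart (𝓡∂ (m + 1)) x₀ ⟨ι p₀, ξ₀⟩).2 with hξc
  have hξc0 : ξc ≠ 0 := (mem_chart_of_mem_cotChart_source hp₀ hξ₀).2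
  have hcc : cotChart (𝓡∂ (m + 1)) x₀ ⟨ι p₀, ξ₀⟩ = (bdryIncl m (bdryCoord ι x₀ p₀), ξc) := by
    refine Prod.ext ?_ rfl
    rw [hι.bdryIncl_bdryCoord hp₀, cotChart_fst]
  rw [hcc] at hn
  obtain ⟨e₂, hs, he₂⟩ := exists_restrChart hι hH hp₀ hξc0 hn
  have hps := mem_chart_source (EuclideanSpace ℝ (Fin m)) p₀
  constructor
  · obtain ⟨O₁, hO₁, D, hD, hOD⟩ := mem_nhds_prod_iff.1 (e₂.open_source.mem_nhds hs)
    obtain ⟨D', hD', hDo, hξD⟩ := mem_nhds_iff.1 hD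
    have h1 : (extChartAt (𝓡 m) p₀) ⁻¹' O₁ ∩ (chartAt (EuclideanSpace ℝ (Fin m)) p₀).source ∈
        𝓝 p₀ := Filter.inter_mem ((continuousAt_extChartAt p₀).preimage_mem_nhds hO₁)
          ((chartAt (EuclideanSpace ℝ (Fin m)) p₀).open_source.mem_nhds hps)
    obtain ⟨O, hO, hOo, hpO⟩ := mem_nhds_iff.1 h1
    refine ⟨O, D', hOo, hpO, hDo, hξD, fun p hp hpx ξ ξ' hξ hξ' hE hr => ?_⟩
    have e1 := restrCoord_eq (H := H) hι hpx (hO hp).2 ξ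
    have e2 := restrCoord_eq (H := H) hι hpx (hO hp).2 ξ'
    rw [← hr, ← hE, ← e1, ← he₂, ← he₂] at e2
    have m1 : (extChartAt (𝓡 m) p₀ p, (cotChart (𝓡∂ (m + 1)) x₀ ⟨ι p, ξ'⟩).2) ∈ e₂.source :=
      hOD ⟨(hO hp).1, hD' hξ'⟩
    have m2 : (extChartAt (𝓡 m) p₀ p, (cotChart (𝓡∂ (m + 1)) x₀ ⟨ι p, ξ⟩).2) ∈ e₂.source :=
      hOD ⟨(hO hp).1, hD' hξ⟩
    have e3 := congrArg Prod.snd (e₂.injOn m1 m2 e2)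
    have e4 : cotChart (𝓡∂ (m + 1)) x₀ ⟨ι p, ξ'⟩ = cotChart (𝓡∂ (m + 1)) x₀ ⟨ι p, ξ⟩ :=
      Prod.ext (by rw [cotChart_fst, cotChart_fst]) e3
    have e5 := (cotChart (𝓡∂ (m + 1)) x₀).injOn (mem_cotChart_source.2 hpx)
      (mem_cotChart_source.2 hpx) e4
    exact (TotalSpace.mk_injective _ e5).symm
  · intro N hN
    have hv₀ : e₂ (extChartAt (𝓡 m) p₀ p₀, ξc) = (cotChart (𝓡 m) p₀ (restr ι p₀ ξ₀), 0) := by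
      rw [he₂, restrCoord_eq hι hp₀ hps, hnull]
    have ht : (cotChart (𝓡 m) p₀ (restr ι p₀ ξ₀), (0 : ℝ)) ∈ e₂.target :=
      hv₀ ▸ e₂.map_source hs
    have hcont : ContinuousAt (cotChart (𝓡 m) p₀) (restr ι p₀ ξ₀) :=
      continuousAt_extChartAt' (mem_cotChart_source.2 hps)
    have hcont2 : ContinuousAt (fun a => (cotChart (𝓡 m) p₀ a, (0 : ℝ))) (restr ι p₀ ξ₀) :=
      hcont.prodMk continuousAt_const
    have hsymm : Filter.Tendsto (fun a => e₂.symm (cotChart (𝓡 m) p₀ a, (0 : ℝ)))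
        (𝓝 (restr ι p₀ ξ₀)) (𝓝 (extChartAt (𝓡 m) p₀ p₀, ξc)) := by
      have f1 : Filter.Tendsto e₂.symm (𝓝 (cotChart (𝓡 m) p₀ (restr ι p₀ ξ₀), (0 : ℝ)))
          (𝓝 (e₂.symm (cotChart (𝓡 m) p₀ (restr ι p₀ ξ₀), (0 : ℝ)))) :=
        e₂.continuousAt_symm ht
      have f2 := f1.comp hcont2.tendsto
      rwa [← hv₀, e₂.left_inv hs] at f2
    have hz : Filter.Tendsto (fun v : EuclideanSpace ℝ (Fin m) × Covec (m + 1) =>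
        bdryCot x₀ (bdryCoord ι x₀ ((extChartAt (𝓡 m) p₀).symm v.1), v.2))
        (𝓝 (extChartAt (𝓡 m) p₀ p₀, ξc)) (𝓝 (⟨ι p₀, ξ₀⟩ : Cot (𝓡∂ (m + 1)) M)) := by
      have f0 : (extChartAt (𝓡 m) p₀).symm (extChartAt (𝓡 m) p₀ p₀) = p₀ := extChartAt_to_inv p₀
      have f1 := contDiffAt_bdryCoord_symm hι (x₀ := x₀) (mem_extChartAt_target (I := 𝓡 m) p₀)
        (by rwa [f0])
      have f2 : ContDiffAt ℝ ∞ (fun v : EuclideanSpace ℝ (Fin m) × Covec (m + 1) =>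
          (bdryCoord (m := m) ι x₀ ((extChartAt (𝓡 m) p₀).symm v.1), v.2))
          (extChartAt (𝓡 m) p₀ p₀, ξc) :=
        (ContDiffAt.comp (extChartAt (𝓡 m) p₀ p₀, ξc) f1 contDiffAt_fst).prodMk contDiffAt_snd
      have f3 := (contMDiffAt_bdryCot (M := M) (x := x₀) f2
        (by simp only [f0]; exact hι.bdryCoord_mem hp₀)).continuousAt.tendsto
      simp only [f0] at f3
      have f4 : bdryCot x₀ (bdryCoord ι x₀ p₀, ξc) = (⟨ι p₀, ξ₀⟩ : Cot (𝓡∂ (m + 1)) M) :=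
        hι.eq_bdryCot (z := (⟨ι p₀, ξ₀⟩ : Cot (𝓡∂ (m + 1)) M)) rfl hp₀
      rwa [f4] at f3
    have hbase : ∀ᶠ a in 𝓝 (restr ι p₀ ξ₀),
        a.1 ∈ (chartAt (EuclideanSpace ℝ (Fin m)) p₀).source ∧
        ι a.1 ∈ (chartAt (EuclideanHalfSpace (m + 1)) x₀).source := by
      have f1 : ContinuousAt (fun a : Cot (𝓡 m) B => a.1) (restr ι p₀ ξ₀) :=
        continuous_cot_proj.continuousAt
      have f2 : ContinuousAt (fun a : Cot (𝓡 m) B => ι a.1) (restr ι p₀ ξ₀) :=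
        (hι.smooth.continuous.comp continuous_cot_proj).continuousAt
      have f3 : ∀ᶠ a in 𝓝 (restr ι p₀ ξ₀),
          a.1 ∈ (chartAt (EuclideanSpace ℝ (Fin m)) p₀).source := f1.preimage_mem_nhds
        ((chartAt (EuclideanSpace ℝ (Fin m)) p₀).open_source.mem_nhds hps)
      have f4 : ∀ᶠ a in 𝓝 (restr ι p₀ ξ₀),
          ι a.1 ∈ (chartAt (EuclideanHalfSpace (m + 1)) x₀).source := f2.preimage_mem_nhds
        ((chartAt (EuclideanHalfSpace (m + 1)) x₀).open_source.mem_nhds hp₀)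
      exact f3.and f4
    filter_upwards [(hz.comp hsymm).eventually hN, hcont2.preimage_mem_nhds
      (e₂.open_target.mem_nhds ht), hbase] with a a1 a2 a3
    -- The null covector is the preimage of the prescribed restriction with energy coordinate 0;
    -- continuity of the inverse puts it in N.
    set v := e₂.symm (cotChart (𝓡 m) p₀ a, (0 : ℝ)) with hv
    have h1 : restrCoord H ι x₀ p₀ v = (cotChart (𝓡 m) p₀ a, 0) := by
      rw [← he₂, hv, e₂.right_inv a2]
    have h2 : v.1 = extChartAt (𝓡 m) p₀ a.1 := by
      rw [← cotChart_fst p₀ a]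
      exact congrArg (fun y => y.1.1) h1
    have h3 : (extChartAt (𝓡 m) p₀).symm v.1 = a.1 := by
      rw [h2]
      exact (extChartAt (𝓡 m) p₀).left_inv (by rw [extChartAt_source]; exact a3.1)
    change bdryCot x₀ (bdryCoord ι x₀ ((extChartAt (𝓡 m) p₀).symm v.1), v.2) ∈ N at a1
    rw [h3] at a1
    obtain ⟨ξ, hξ⟩ := exists_eq_mk (hι.bdryCot_fst a3.2 v.2)
    have h4 : (cotChart (𝓡∂ (m + 1)) x₀ ⟨ι a.1, ξ⟩).2 = v.2 := by
      rw [← hξ, (cotChart_bdryCot (w := (bdryCoord ι x₀ a.1, v.2)) (hι.bdryCoord_mem a3.2)).2]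
    have h5 := restrCoord_eq (H := H) hι a3.2 a3.1 ξ
    rw [h4, ← h2] at h5
    have h6 := h5.symm.trans h1
    refine ⟨ξ, hξ ▸ a1, congrArg Prod.snd h6, ?_⟩
    have h7 : cotChart (𝓡 m) p₀ (restr ι a.1 ξ) = cotChart (𝓡 m) p₀ a := congrArg Prod.fst h6
    have m1 : restr ι a.1 ξ ∈ (cotChart (𝓡 m) p₀).source := mem_cotChart_source.2 a3.1
    exact (cotChart (𝓡 m) p₀).injOn m1 (mem_cotChart_source.2 a3.1) h7

end NullCovectors

/-! ### The scattering map. -/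

section ScatteringRelation

variable {m : ℕ} {M : Type*} [TopologicalSpace M] [T2Space M]
  [ChartedSpace (EuclideanHalfSpace (m + 1)) M] [IsManifold (𝓡∂ (m + 1)) ∞ M]
  {B : Type*} [TopologicalSpace B] [ChartedSpace (EuclideanSpace ℝ (Fin m)) B]
  [IsManifold (𝓡 m) ∞ B] {ι : B → M} {H : Cot (𝓡∂ (m + 1)) M → ℝ} {x₀ x₁ : M}
  {e : OpenPartialHomeomorph (EuclideanSpace ℝ (Fin m) × Covec (m + 1))
    (EuclideanSpace ℝ (Fin m) × (ℝ × EuclideanSpace ℝ (Fin m)))}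
  {ζ : EuclideanSpace ℝ (Fin m) × Covec (m + 1) → Cot (𝓡∂ (m + 1)) M}
  {τ : EuclideanSpace ℝ (Fin m) × Covec (m + 1) → ℝ} {A : Set (Cot (𝓡∂ (m + 1)) M)}
  {p p₀ q : B} {U V : Set B} {a b b' : Cot (𝓡 m) B}

theorem restr_smul (k : ℝ) (ξ : TangentSpace (𝓡∂ (m + 1)) (ι p) →L[ℝ] Trivial M ℝ (ι p)) :
    restr ι p (k • ξ) = dilate k (restr ι p ξ) := by
  change (⟨p, _⟩ : Cot (𝓡 m) B) = ⟨p, _⟩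
  congr 1

theorem mk_smul {y : M} (k : ℝ) (ξ : TangentSpace (𝓡∂ (m + 1)) y →L[ℝ] Trivial M ℝ y) :
    (⟨y, k • ξ⟩ : Cot (𝓡∂ (m + 1)) M) = dilate k ⟨y, ξ⟩ := rfl

theorem dilate_inv_dilate {k : ℝ} (hk : k ≠ 0) (a : Cot (𝓡 m) B) :
    dilate k⁻¹ (dilate k a) = a := by
  rw [dilate_dilate, inv_mul_cancel₀ hk, dilate_one]

theorem IsHomogeneousSmooth.dilate_eq_zero (hH : IsHomogeneousSmooth H)
    {z : Cot (𝓡∂ (m + 1)) M} (hz : z ∈ nonzeroCot (𝓡∂ (m + 1)) M) (h : H z = 0) {k : ℝ}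
    (hk : 0 < k) : H (dilate k z) = 0 := by
  rw [hH.homogeneous z hz k hk, h, mul_zero]

/-- A dilation changes the speed along the base curve and not the curve itself, so the first hit of
V stays the first hit. -/
theorem scatteringRel_dilate (hH : IsHomogeneousSmooth H) (hA : IsConic A) {k : ℝ} (hk : 0 < k)
    (h : (a, b) ∈ scatteringRel H ι A V) : (dilate k a, dilate k b) ∈ scatteringRel H ι A V := by
  obtain ⟨p, q, ξ, η, T, γ, hab, hξA, hξ, hT, hγ, h0, h1, hq, hfirst⟩ := h
  obtain ⟨rfl, rfl⟩ := Prod.mk.inj hab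
  have hkT : k * (T / k) = T := by field_simp
  refine ⟨p, q, k • ξ, k • η, T / k, _, ?_, hA _ hξA k hk, ?_, div_pos hT hk, hγ.rescale hH hk,
    ?_, ?_, hq, fun t ht => ?_⟩
  · rw [restr_smul, restr_smul]
  · exact hH.dilate_eq_zero (h0 ▸ hγ.nonzero 0 ⟨le_rfl, hT.le⟩) hξ hk
  · simp only [mul_zero, h0]
    rfl
  · simp only [hkT, h1]
    rfl
  · exact hfirst (k * t) ⟨mul_nonneg hk.le ht.1, by
      have := (lt_div_iff₀ hk).1 ht.2
      rwa [mul_comm]⟩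

/-- The restriction determines the null covector in A and hence the bicharacteristic. Of two
different hitting times the smaller one would be a hit of V before the first hit. -/
theorem scatteringRel_unique (hH : ContMDiffOn (cotModel (𝓡∂ (m + 1))) 𝓘(ℝ, ℝ) ∞ H
      (nonzeroCot (𝓡∂ (m + 1)) M))
    (hA : ∀ p, ∀ ξ ξ' : TangentSpace (𝓡∂ (m + 1)) (ι p) →L[ℝ] Trivial M ℝ (ι p),
      restr ι p ξ = a → restr ι p ξ' = a → ⟨ι p, ξ⟩ ∈ A → ⟨ι p, ξ'⟩ ∈ A → H ⟨ι p, ξ⟩ = 0 →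
      H ⟨ι p, ξ'⟩ = 0 → ξ = ξ')
    (hι : IsBoundaryInclusion (m := m) ι)
    (h : (a, b) ∈ scatteringRel H ι A V) (h' : (a, b') ∈ scatteringRel H ι A V) : b = b' := by
  obtain ⟨p, q, ξ, η, T, γ, hab, hξA, hξ, hT, hγ, h0, h1, hq, hfirst⟩ := h
  obtain ⟨p', q', ξ', η', T', γ', hab', hξA', hξ', hT', hγ', h0', h1', hq', hfirst'⟩ := h'
  obtain ⟨ha, hb⟩ := Prod.mk.inj hab
  obtain ⟨ha', hb'⟩ := Prod.mk.inj hab'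
  obtain rfl : p = p' := congrArg (fun a => a.1) (ha.symm.trans ha')
  obtain rfl := hA p ξ ξ' ha.symm ha'.symm hξA hξA' hξ hξ'
  have hTT : T = T' := by
    rcases lt_trichotomy T T' with hlt | heq | hgt
    · refine absurd ?_ (hfirst' T ⟨hT.le, hlt⟩)
      rw [(hγ'.mono hlt.le).eqOn convex_range_halfSpace hH hγ (h0'.trans h0.symm) ⟨hT.le, le_rfl⟩,
        h1]
      exact mem_image_of_mem ι hq
    · exact heq
    · refine absurd ?_ (hfirst T' ⟨hT'.le, hgt⟩)
      rw [(hγ.mono hgt.le).eqOn convex_range_halfSpace hH hγ' (h0.trans h0'.symm) ⟨hT'.le, le_rfl⟩,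
        h1']
      exact mem_image_of_mem ι hq'
  subst hTT
  have h2 := hγ.eqOn convex_range_halfSpace hH hγ' (h0.trans h0'.symm) ⟨hT.le, le_rfl⟩
  rw [h1, h1'] at h2
  obtain rfl : q = q' := hι.embedding.injective (congrArg (fun z => z.1) h2)
  rw [hb, hb', TotalSpace.mk_injective _ h2]

theorem IsBoundaryInclusion.startNbhd_coord (hι : IsBoundaryInclusion (m := m) ι)
    {z : Cot (𝓡∂ (m + 1)) M} (hz : z ∈ startNbhd x₀ e) (hp : z.1 = ι p) :
    ι p ∈ (chartAt (EuclideanHalfSpace (m + 1)) x₀).source ∧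
      (bdryCoord ι x₀ p, (cotChart (𝓡∂ (m + 1)) x₀ z).2) ∈ e.source ∧
      bdryCot x₀ (bdryCoord ι x₀ p, (cotChart (𝓡∂ (m + 1)) x₀ z).2) = z := by
  have hs : ι p ∈ (chartAt (EuclideanHalfSpace (m + 1)) x₀).source :=
    hp ▸ mem_cotChart_source.1 hz.1
  refine ⟨hs, ?_, hι.eq_bdryCot hp hs⟩
  have h1 := hz.2
  rw [cotChart_fst, hp] at h1
  exact h1

/-- The bicharacteristics in a chart define elements of the scattering relation. -/
theorem JoinChart.exists_scattering (hι : IsBoundaryInclusion (m := m) ι)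
    (h : JoinChart H x₀ x₁ e ζ τ) (hUV : Disjoint U V) {O : Set M} (hO : ι ⁻¹' O = V)
    {ξ : TangentSpace (𝓡∂ (m + 1)) (ι p) →L[ℝ] Trivial M ℝ (ι p)} (hp : p ∈ U)
    (hz : (⟨ι p, ξ⟩ : Cot (𝓡∂ (m + 1)) M) ∈ startNbhd x₀ e) (hA : ⟨ι p, ξ⟩ ∈ A) (hnull : H ⟨ι p, ξ⟩ = 0)
    (hζ : (ζ (bdryCoord ι x₀ p, (cotChart (𝓡∂ (m + 1)) x₀ ⟨ι p, ξ⟩).2)).1 ∈ O) :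
    ∃ b, (restr ι p ξ, b) ∈ scatteringRel H ι A V := by
  obtain ⟨-, h2, h3⟩ := hι.startNbhd_coord hz rfl
  set w : EuclideanSpace ℝ (Fin m) × Covec (m + 1) :=
    (bdryCoord ι x₀ p, (cotChart (𝓡∂ (m + 1)) x₀ ⟨ι p, ξ⟩).2)
  obtain ⟨hT, γ, hγ, g0, g1, hi⟩ := h.hit.bichar w h2
  have hb : (ζ w).1 ∈ range ι := by
    rw [hι.range_eq, ← ModelWithCorners.compl_interior]
    exact h.hit.end_not_interior h2
  obtain ⟨q, hq⟩ := hb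
  have hqV : q ∈ V := by
    rw [← hO, mem_preimage, hq]
    exact hζ
  obtain ⟨η, hη⟩ := exists_eq_mk hq.symm
  refine ⟨restr ι q η, p, q, ξ, η, τ w, γ, rfl, hA, hnull, hT, hγ, g0.trans h3, g1.trans hη, hqV,
    fun t ht => ?_⟩
  -- No earlier hit is possible: at time 0 the point lies in U, which is disjoint from V, and
  -- afterwards the curve is in the interior.
  rintro ⟨q', hq', hqt⟩
  rcases ht.1.eq_or_lt with rfl | ht0
  · rw [g0, h3] at hqt
    obtain rfl := hι.embedding.injective hqt
    exact disjoint_left.1 hUV hp hq'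
  · exact hι.not_interior q' (hqt ▸ hi t ⟨ht0, ht.2⟩)

/-- A conic neighbourhood in which the null covectors are determined by their restrictions to the
boundary. -/
theorem exists_conic_nhd (hι : IsBoundaryInclusion (m := m) ι) (hH : IsHomogeneousSmooth H)
    (hp₀ : ι p₀ ∈ (chartAt (EuclideanHalfSpace (m + 1)) x₀).source)
    {ξ₀ : TangentSpace (𝓡∂ (m + 1)) (ι p₀) →L[ℝ] Trivial M ℝ (ι p₀)} {v : EuclideanSpace ℝ (Fin m)}
    (hv : (cotChart (𝓡∂ (m + 1)) x₀ ⟨ι p₀, ξ₀⟩).2 (bdryIncl m v) ≠ 0)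
    {O : Set B} {D : Set (Covec (m + 1))} (hO : IsOpen O) (hpO : p₀ ∈ O) (hD : IsOpen D)
    (hξD : (cotChart (𝓡∂ (m + 1)) x₀ ⟨ι p₀, ξ₀⟩).2 ∈ D)
    (hu : ∀ p ∈ O, ι p ∈ (chartAt (EuclideanHalfSpace (m + 1)) x₀).source →
        ∀ ξ ξ' : TangentSpace (𝓡∂ (m + 1)) (ι p) →L[ℝ] Trivial M ℝ (ι p),
        (cotChart (𝓡∂ (m + 1)) x₀ ⟨ι p, ξ⟩).2 ∈ D → (cotChart (𝓡∂ (m + 1)) x₀ ⟨ι p, ξ'⟩).2 ∈ D →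
        H ⟨ι p, ξ⟩ = H ⟨ι p, ξ'⟩ → restr ι p ξ = restr ι p ξ' → ξ = ξ') :
    ∃ A : Set (Cot (𝓡∂ (m + 1)) M), IsOpen A ∧ IsConic A ∧ A ⊆ nonzeroCot (𝓡∂ (m + 1)) M ∧
      ⟨ι p₀, ξ₀⟩ ∈ A ∧ ∀ p, ∀ ξ ξ' : TangentSpace (𝓡∂ (m + 1)) (ι p) →L[ℝ] Trivial M ℝ (ι p),
        ⟨ι p, ξ⟩ ∈ A → ⟨ι p, ξ'⟩ ∈ A → H ⟨ι p, ξ⟩ = 0 → H ⟨ι p, ξ'⟩ = 0 →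
        restr ι p ξ = restr ι p ξ' → ξ = ξ' := by
  set c := (cotChart (𝓡∂ (m + 1)) x₀ ⟨ι p₀, ξ₀⟩).2 (bdryIncl m v) with hc
  -- Over the boundary s depends only on the restriction of the covector, because it pairs with a
  -- tangential vector. It is homogeneous of degree one and equals 1 at the reference covector. The
  -- cone A consists of the covectors whose normalization by s lies in D; two covectors with the
  -- same restriction have the same normalizing factor, so uniqueness in D passes to A.
  set s : Cot (𝓡∂ (m + 1)) M → ℝ := fun z => (cotChart (𝓡∂ (m + 1)) x₀ z).2 (bdryIncl m v) / c
    with hs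
  obtain ⟨OM, hOM, hOι⟩ := hι.embedding.isInducing.isOpen_iff.1 hO
  have hsd : ∀ z : Cot (𝓡∂ (m + 1)) M, z ∈ (cotChart (𝓡∂ (m + 1)) x₀).source → ∀ k : ℝ,
      s (dilate k z) = k * s z := by
    intro z hz k
    simp only [hs]
    rw [cotChart_dilate k (mem_cotChart_source.1 hz)]
    exact mul_div_assoc _ _ _
  set A : Set (Cot (𝓡∂ (m + 1)) M) := {z | z ∈ (cotChart (𝓡∂ (m + 1)) x₀).source ∧ z.1 ∈ OM ∧
    0 < s z ∧ (s z)⁻¹ • (cotChart (𝓡∂ (m + 1)) x₀ z).2 ∈ D} with hA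
  have hnz : A ⊆ nonzeroCot (𝓡∂ (m + 1)) M := by
    rintro z ⟨h1, -, h3, -⟩
    refine (covec_eq_zero_iff (mem_cotChart_source.1 h1)).not.2 fun h0 => ?_
    simp only [hs, h0, zero_apply, zero_div, lt_irrefl] at h3
  refine ⟨A, ?_, ?_, hnz, ?_, ?_⟩
  · rw [isOpen_iff_mem_nhds]
    rintro z ⟨h1, h2, h3, h4⟩
    have c0 : ContinuousAt (cotChart (𝓡∂ (m + 1)) x₀) z :=
      (continuousOn_extChartAt _).continuousAt ((isOpen_extChartAt_source _).mem_nhds h1)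
    have c1 : ContinuousAt s z := (c0.snd.clm_apply continuousAt_const).div_const c
    have c2 : ContinuousAt (fun z => (s z)⁻¹ • (cotChart (𝓡∂ (m + 1)) x₀ z).2) z :=
      (c1.inv₀ h3.ne').smul c0.snd
    filter_upwards [(isOpen_extChartAt_source _).mem_nhds h1,
      continuous_cot_proj.continuousAt.preimage_mem_nhds (hOM.mem_nhds h2),
      c1.eventually (lt_mem_nhds h3), c2.preimage_mem_nhds (hD.mem_nhds h4)] with z a1 a2 a3 a4
    exact ⟨a1, a2, a3, a4⟩
  · rintro z ⟨h1, h2, h3, h4⟩ k hk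
    refine ⟨mem_cotChart_source.2 (mem_cotChart_source.1 h1), h2, ?_, ?_⟩
    · rw [hsd z h1]
      exact mul_pos hk h3
    · rw [hsd z h1, cotChart_dilate k (mem_cotChart_source.1 h1), smul_smul, mul_inv_rev, mul_assoc,
        inv_mul_cancel₀ hk.ne', mul_one]
      exact h4
  · have h1 : s ⟨ι p₀, ξ₀⟩ = 1 := div_self hv
    refine ⟨mem_cotChart_source.2 hp₀, ?_, ?_, ?_⟩
    · rw [← hOι] at hpO
      exact hpO
    · rw [h1]
      exact one_pos
    · rw [h1, inv_one, one_smul]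
      exact hξD
  · intro p ξ ξ' hξ hξ' h0 h0' hr
    obtain ⟨h1, h2, h3, h4⟩ := hξ
    obtain ⟨h1', -, h3', h4'⟩ := hξ'
    have hp : ι p ∈ (chartAt (EuclideanHalfSpace (m + 1)) x₀).source := mem_cotChart_source.1 h1
    obtain ⟨β, -, hβ⟩ := hι.exists_hasFDerivAt_bdryCoord hp (mem_chart_source _ p) rfl
    have e1 := cotChart_restr_snd hp (mem_chart_source _ p) rfl ξ (β.symm v)
    have e2 := cotChart_restr_snd hp (mem_chart_source _ p) rfl ξ' (β.symm v)
    rw [← hβ, β.apply_symm_apply] at e1 e2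
    have hss : s ⟨ι p, ξ⟩ = s ⟨ι p, ξ'⟩ := by
      simp only [hs]
      rw [← e1, ← e2, hr]
    rw [← hss] at h4'
    have hk := inv_pos.2 h3
    have key := hu p (by rw [← hOι]; exact h2) hp ((s ⟨ι p, ξ⟩)⁻¹ • ξ) ((s ⟨ι p, ξ⟩)⁻¹ • ξ')
      (by rw [mk_smul, cotChart_dilate _ hp]; exact h4)
      (by rw [mk_smul, cotChart_dilate _ hp]; exact h4')
      (by
        rw [mk_smul, mk_smul,
          hH.dilate_eq_zero (hnz ⟨h1, h2, h3, h4⟩) h0 hk,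
          hH.dilate_eq_zero (hnz ⟨h1', h2, h3', hss ▸ h4'⟩) h0' hk])
      (by rw [restr_smul, restr_smul, hr])
    exact smul_right_injective _ hk.ne' key

/-- Near the reference covector, null covectors with prescribed restriction exist and their
bicharacteristics exit through V, by openness. Homogeneity extends this to the cone C generated by a
neighbourhood of the reference restriction, while uniqueness holds throughout the conic set A. -/
theorem exists_isScatteringMap (hι : IsBoundaryInclusion (m := m) ι) (hH : IsHomogeneousSmooth H)
    (h : JoinChart H x₀ x₁ e ζ τ) (hU : IsOpen U) (hV : IsOpen V) (hUV : Disjoint U V)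
    (hp : p₀ ∈ U) (hq : q ∈ V) {ξ₀ : TangentSpace (𝓡∂ (m + 1)) (ι p₀) →L[ℝ] Trivial M ℝ (ι p₀)}
    (hz : (⟨ι p₀, ξ₀⟩ : Cot (𝓡∂ (m + 1)) M) ∈ startNbhd x₀ e) (hnull : H ⟨ι p₀, ξ₀⟩ = 0)
    (hζ : (ζ (bdryCoord ι x₀ p₀, (cotChart (𝓡∂ (m + 1)) x₀ ⟨ι p₀, ξ₀⟩).2)).1 = ι q) :
    ∃ A C S, IsScatteringMap H ι U V p₀ ξ₀ A C S := by
  obtain ⟨hp₀, hw, hwz⟩ := hι.startNbhd_coord hz rfl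
  set w₀ : EuclideanSpace ℝ (Fin m) × Covec (m + 1) :=
    (bdryCoord ι x₀ p₀, (cotChart (𝓡∂ (m + 1)) x₀ ⟨ι p₀, ξ₀⟩).2) with hw₀
  obtain ⟨v, hv⟩ := h.hit.exists_tangential_ne_zero hH hw (by rw [hwz, hnull])
  have hnz : (⟨ι p₀, ξ₀⟩ : Cot (𝓡∂ (m + 1)) M) ∈ nonzeroCot (𝓡∂ (m + 1)) M := by
    rw [← hwz]
    exact bdryCot_mem_nonzeroCot (h.hit.start_mem _ hw).1 (h.hit.start_mem _ hw).2
  have hn : (hamLoc x₀ H (cotChart (𝓡∂ (m + 1)) x₀ ⟨ι p₀, ξ₀⟩)).1 0 ≠ 0 := by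
    have h1 := (h.hit.start_normal _ hw).ne'
    rwa [← (cotChart_bdryCot (h.hit.start_mem _ hw).1).2, hwz] at h1
  obtain ⟨⟨O, D, hO, hpO, hD, hξD, hu⟩, hsol⟩ :=
    exists_null_covectors hι hH.smooth hp₀ hnz hnull hn
  obtain ⟨A, hAo, hAc, hAn, hξA, hAu⟩ := exists_conic_nhd hι hH hp₀ hv hO hpO hD hξD hu
  obtain ⟨OV, hOV, hOι⟩ := hι.embedding.isInducing.isOpen_iff.1 hV
  have hN : ∀ᶠ z in 𝓝 (⟨ι p₀, ξ₀⟩ : Cot (𝓡∂ (m + 1)) M), z ∈ A ∧ z ∈ startNbhd x₀ e ∧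
      (ζ (bdryProj m (cotChart (𝓡∂ (m + 1)) x₀ z).1, (cotChart (𝓡∂ (m + 1)) x₀ z).2)).1 ∈ OV := by
    have c0 : ContinuousAt (cotChart (𝓡∂ (m + 1)) x₀) (⟨ι p₀, ξ₀⟩ : Cot (𝓡∂ (m + 1)) M) :=
      (continuousOn_extChartAt _).continuousAt ((isOpen_extChartAt_source _).mem_nhds hz.1)
    have c1 : ContinuousAt (fun z => (bdryProj m (cotChart (𝓡∂ (m + 1)) x₀ z).1,
        (cotChart (𝓡∂ (m + 1)) x₀ z).2)) (⟨ι p₀, ξ₀⟩ : Cot (𝓡∂ (m + 1)) M) :=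
      ((bdryProj m).continuous.continuousAt.comp c0.fst).prodMk c0.snd
    have e0 : (bdryProj m (cotChart (𝓡∂ (m + 1)) x₀ (⟨ι p₀, ξ₀⟩ : Cot (𝓡∂ (m + 1)) M)).1,
        (cotChart (𝓡∂ (m + 1)) x₀ (⟨ι p₀, ξ₀⟩ : Cot (𝓡∂ (m + 1)) M)).2) = w₀ := by
      rw [cotChart_fst]
      rfl
    have c2 : ContinuousAt (fun w => (ζ w).1) w₀ :=
      continuous_cot_proj.continuousAt.comp (h.hit.smooth_end _ hw).continuousAt
    have c3 : ContinuousAt (fun z => (ζ (bdryProj m (cotChart (𝓡∂ (m + 1)) x₀ z).1,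
        (cotChart (𝓡∂ (m + 1)) x₀ z).2)).1) (⟨ι p₀, ξ₀⟩ : Cot (𝓡∂ (m + 1)) M) :=
      ContinuousAt.comp_of_eq (g := fun w => (ζ w).1) c2 c1 e0
    have c4 := c3.preimage_mem_nhds (hOV.mem_nhds (by
      rw [e0, hζ]
      rw [← hOι] at hq
      exact hq))
    filter_upwards [hAo.mem_nhds hξA, isOpen_startNbhd.mem_nhds hz, c4] with z a1 a2 a3
    exact ⟨a1, a2, a3⟩
  have hC : ∀ᶠ a in 𝓝 (restr ι p₀ ξ₀), a.1 ∈ U ∧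
      ∃ ξ : TangentSpace (𝓡∂ (m + 1)) (ι a.1) →L[ℝ] Trivial M ℝ (ι a.1), (⟨ι a.1, ξ⟩ ∈ A ∧
        H ⟨ι a.1, ξ⟩ = 0 ∧ restr ι a.1 ξ = a) ∧ ∃ b, (a, b) ∈ scatteringRel H ι A V := by
    have c1 : ∀ᶠ a in 𝓝 (restr ι p₀ ξ₀), a.1 ∈ U :=
      continuous_cot_proj.continuousAt.preimage_mem_nhds (hU.mem_nhds hp)
    filter_upwards [c1, hsol _ hN] with a haU ha
    obtain ⟨ξ, ⟨a1, a2, a3⟩, h0, hr⟩ := ha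
    rw [cotChart_fst] at a3
    refine ⟨haU, ξ, ⟨a1, h0, hr⟩, ?_⟩
    have := h.exists_scattering hι hUV hOι haU a2 a1 h0 a3
    rwa [hr] at this
  obtain ⟨C₀, hC₀, hC₀o, hC₀m⟩ := eventually_nhds_iff.1 hC
  set C : Set (Cot (𝓡 m) B) := {a | ∃ k : ℝ, 0 < k ∧ dilate k a ∈ C₀} with hCdef
  have hCsol : ∀ a ∈ C, a.1 ∈ U ∧
      ∃ ξ : TangentSpace (𝓡∂ (m + 1)) (ι a.1) →L[ℝ] Trivial M ℝ (ι a.1), (⟨ι a.1, ξ⟩ ∈ A ∧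
        H ⟨ι a.1, ξ⟩ = 0 ∧ restr ι a.1 ξ = a) ∧ ∃ b, (a, b) ∈ scatteringRel H ι A V := by
    rintro a ⟨k, hk, hka⟩
    obtain ⟨h1, ξ, ⟨h2, h3, h4⟩, b, hb⟩ := hC₀ _ hka
    have hk' := inv_pos.2 hk
    refine ⟨h1, k⁻¹ • ξ, ⟨hAc _ h2 _ hk', ?_, ?_⟩, dilate k⁻¹ b, ?_⟩
    · exact hH.dilate_eq_zero (hAn h2) h3 hk'
    · exact (restr_smul (p := a.1) k⁻¹ ξ).trans
        ((congrArg (dilate k⁻¹) h4).trans (dilate_inv_dilate hk.ne' a))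
    · have := scatteringRel_dilate hH hAc hk' hb
      rwa [dilate_inv_dilate hk.ne'] at this
  -- Outside C the value of the map is irrelevant; a itself is used there.
  have hS : ∀ a, ∃ b, a ∈ C → (a, b) ∈ scatteringRel H ι A V := by
    intro a
    by_cases ha : a ∈ C
    · obtain ⟨-, -, -, b, hb⟩ := hCsol a ha
      exact ⟨b, fun _ => hb⟩
    · exact ⟨a, fun h => absurd h ha⟩
  choose S hS using hS
  refine ⟨A, C, S, ⟨hAo, hAc, hAn, hξA, ?_, ?_, ⟨1, one_pos, by rwa [dilate_one]⟩,
    fun a ha => (hCsol a ha).1, ?_, ?_⟩⟩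
  · have h1 : C = ⋃ k : {k : ℝ // 0 < k}, (fun a => dilate k.1 a) ⁻¹' C₀ := by
      ext a
      simp [hCdef]
    rw [h1]
    exact isOpen_iUnion fun k => hC₀o.preimage
      (continuous_dilate.comp (continuous_const.prodMk continuous_id))
  · rintro a ⟨k, hk, hka⟩ c hc
    refine ⟨k / c, div_pos hk hc, ?_⟩
    rwa [dilate_dilate, div_mul_cancel₀ _ hc.ne']
  · intro a ha
    obtain ⟨-, ξ, hξ, -⟩ := hCsol a ha
    exact ⟨ξ, hξ, fun ξ' hξ' => hAu _ _ _ hξ'.1 hξ.1 hξ'.2.1 hξ.2.1 (hξ'.2.2.trans hξ.2.2.symm)⟩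
  · intro a ha b
    refine ⟨fun hb => ?_, fun hb => hb ▸ hS a ha⟩
    exact scatteringRel_unique hH.smooth (fun p ξ ξ' hr hr' hξ hξ' h0 h0' =>
      hAu p ξ ξ' hξ hξ' h0 h0' (hr.trans hr'.symm)) hι hb (hS a ha)

end ScatteringRelation

/-! ### The generated relation as the graph of the scattering map. -/

section GeneratedRelation

variable {m : ℕ} {M : Type*} [TopologicalSpace M] [T2Space M]
  [ChartedSpace (EuclideanHalfSpace (m + 1)) M] [IsManifold (𝓡∂ (m + 1)) ∞ M]
  {B : Type*} [TopologicalSpace B] [ChartedSpace (EuclideanSpace ℝ (Fin m)) B]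
  [IsManifold (𝓡 m) ∞ B] {ι : B → M} {H : Cot (𝓡∂ (m + 1)) M → ℝ} {x₀ x₁ : M}
  {e : OpenPartialHomeomorph (EuclideanSpace ℝ (Fin m) × Covec (m + 1))
    (EuclideanSpace ℝ (Fin m) × (ℝ × EuclideanSpace ℝ (Fin m)))}
  {ζ : EuclideanSpace ℝ (Fin m) × Covec (m + 1) → Cot (𝓡∂ (m + 1)) M}
  {τ : EuclideanSpace ℝ (Fin m) × Covec (m + 1) → ℝ} {A W : Set (Cot (𝓡∂ (m + 1)) M)}
  {p p₀ q q₀ : B} {U V : Set B} {C : Set (Cot (𝓡 m) B)} {S : Cot (𝓡 m) B → Cot (𝓡 m) B}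
  {r : B × B → ℝ}

theorem mk_smul_smul (c k : ℝ) (b : Cot (𝓡 m) B) :
    (⟨b.1, c • k • b.2⟩ : Cot (𝓡 m) B) = dilate (c * k) b :=
  dilate_dilate c k b

theorem mk_neg_smul_neg_smul (c k : ℝ) (b : Cot (𝓡 m) B) :
    (⟨b.1, -(c • -(k • b.2))⟩ : Cot (𝓡 m) B) = dilate (c * k) b := by
  rw [smul_neg, neg_neg]
  exact mk_smul_smul c k b

/-- The relation generated by a defining function is the graph of the scattering map. -/
theorem JoinChart.generatedRel_eq_graph (hι : IsBoundaryInclusion (m := m) ι)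
    (hH : IsHomogeneousSmooth H) (h : JoinChart H x₀ x₁ e ζ τ) (hW : W ⊆ startNbhd x₀ e)
    (hWo : IsOpen W) (hU : IsOpen U) (hV : IsOpen V) (hdisj : Disjoint U V)
    (hUV : U ×ˢ V ⊆ joinDomain ι x₀ x₁ e) (hp : p₀ ∈ U) (hq : q₀ ∈ V)
    {ξ₀ : TangentSpace (𝓡∂ (m + 1)) (ι p₀) →L[ℝ] Trivial M ℝ (ι p₀)}
    {η₀ : TangentSpace (𝓡∂ (m + 1)) (ι q₀) →L[ℝ] Trivial M ℝ (ι q₀)}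
    (hz : (⟨ι p₀, ξ₀⟩ : Cot (𝓡∂ (m + 1)) M) ∈ W) (hnull : H ⟨ι p₀, ξ₀⟩ = 0)
    (hstart : joinStart ι x₀ x₁ e (p₀, q₀) =
      (bdryCoord ι x₀ p₀, (cotChart (𝓡∂ (m + 1)) x₀ ⟨ι p₀, ξ₀⟩).2))
    (hS : IsScatteringMap H ι U V p₀ ξ₀ A C S) (hr : IsDefiningFunction H ι W U V r) :
    ∃ O : Set (Cot (𝓡 m) B × Cot (𝓡 m) B), IsOpen O ∧ (restr ι p₀ ξ₀, restr ι q₀ η₀) ∈ O ∧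
      generatedRel r (nullPairs H ι W U V) ∩ O = {w | w.1 ∈ C ∧ w.2 = S w.1} ∩ O := by
  obtain ⟨hp₀, hw, hwz⟩ := hι.startNbhd_coord (hW hz) rfl
  set w₀ : EuclideanSpace ℝ (Fin m) × Covec (m + 1) :=
    (bdryCoord ι x₀ p₀, (cotChart (𝓡∂ (m + 1)) x₀ ⟨ι p₀, ξ₀⟩).2) with hw₀
  have hdom := hUV (mk_mem_prod hp hq)
  have hτ : τ w₀ = 1 := by
    rw [← hstart]
    exact (h.joinStart_spec hdom).2.2.1
  have hnz : (⟨ι p₀, ξ₀⟩ : Cot (𝓡∂ (m + 1)) M) ∈ nonzeroCot (𝓡∂ (m + 1)) M :=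
    hS.nonzero_upstairs hS.mem_upstairs
  have hn : (hamLoc x₀ H (cotChart (𝓡∂ (m + 1)) x₀ ⟨ι p₀, ξ₀⟩)).1 0 ≠ 0 := by
    have h1 := (h.hit.start_normal _ hw).ne'
    rwa [← (cotChart_bdryCot (h.hit.start_mem _ hw).1).2, hwz] at h1
  obtain ⟨-, hsol⟩ := exists_null_covectors hι hH.smooth hp₀ hnz hnull hn
  -- Dilation of z by its exit time normalizes that time to 1. The exit time is 1 at the reference
  -- covector, so the dilated covector is still in W for z close to it.
  have hN : ∀ᶠ z in 𝓝 (⟨ι p₀, ξ₀⟩ : Cot (𝓡∂ (m + 1)) M), z ∈ A ∧ z ∈ startNbhd x₀ e ∧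
      dilate (τ (bdryProj m (cotChart (𝓡∂ (m + 1)) x₀ z).1, (cotChart (𝓡∂ (m + 1)) x₀ z).2)) z
        ∈ W := by
    have c0 : ContinuousAt (cotChart (𝓡∂ (m + 1)) x₀) (⟨ι p₀, ξ₀⟩ : Cot (𝓡∂ (m + 1)) M) :=
      (continuousOn_extChartAt _).continuousAt ((isOpen_extChartAt_source _).mem_nhds (hW hz).1)
    have c1 : ContinuousAt (fun z => (bdryProj m (cotChart (𝓡∂ (m + 1)) x₀ z).1,
        (cotChart (𝓡∂ (m + 1)) x₀ z).2)) (⟨ι p₀, ξ₀⟩ : Cot (𝓡∂ (m + 1)) M) :=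
      ((bdryProj m).continuous.continuousAt.comp c0.fst).prodMk c0.snd
    have e0 : (bdryProj m (cotChart (𝓡∂ (m + 1)) x₀ (⟨ι p₀, ξ₀⟩ : Cot (𝓡∂ (m + 1)) M)).1,
        (cotChart (𝓡∂ (m + 1)) x₀ (⟨ι p₀, ξ₀⟩ : Cot (𝓡∂ (m + 1)) M)).2) = w₀ := by
      rw [cotChart_fst]
      rfl
    have c2 : ContinuousAt (fun z => τ (bdryProj m (cotChart (𝓡∂ (m + 1)) x₀ z).1,
        (cotChart (𝓡∂ (m + 1)) x₀ z).2)) (⟨ι p₀, ξ₀⟩ : Cot (𝓡∂ (m + 1)) M) :=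
      ContinuousAt.comp_of_eq (g := τ) (h.hit.smooth_time _ hw).continuousAt c1 e0
    have c3 := ContinuousAt.comp (g := fun p : ℝ × Cot (𝓡∂ (m + 1)) M => dilate p.1 p.2)
      (continuous_dilate.continuousAt) (c2.prodMk continuousAt_id)
    have c4 := c3.preimage_mem_nhds (hWo.mem_nhds (by
      simp only [Function.comp_apply, e0, hτ, id, dilate_one]
      exact hz))
    filter_upwards [hS.isOpen_upstairs.mem_nhds hS.mem_upstairs,
      isOpen_startNbhd.mem_nhds (hW hz), c4] with z a1 a2 a3
    exact ⟨a1, a2, a3⟩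
  have hN2 : ∀ᶠ x in 𝓝 (p₀, q₀), x ∈ U ×ˢ V ∧ bdryCot x₀ (joinStart ι x₀ x₁ e x) ∈ A := by
    have c1 := (h.contMDiffAt_bdryCot_joinStart hι hdom).continuousAt.preimage_mem_nhds
      (hS.isOpen_upstairs.mem_nhds (by
        rw [hstart, hwz]
        exact hS.mem_upstairs))
    filter_upwards [(hU.prod hV).mem_nhds ⟨hp, hq⟩, c1] with x a1 a2
    exact ⟨a1, a2⟩
  have hev : ∀ᶠ w : Cot (𝓡 m) B × Cot (𝓡 m) B in 𝓝 (restr ι p₀ ξ₀, restr ι q₀ η₀), w.1 ∈ C ∧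
      ((w.1.1, w.2.1) ∈ U ×ˢ V ∧ bdryCot x₀ (joinStart ι x₀ x₁ e (w.1.1, w.2.1)) ∈ A) ∧
      ∃ ξ : TangentSpace (𝓡∂ (m + 1)) (ι w.1.1) →L[ℝ] Trivial M ℝ (ι w.1.1),
        ((⟨ι w.1.1, ξ⟩ : Cot (𝓡∂ (m + 1)) M) ∈ A ∧
          (⟨ι w.1.1, ξ⟩ : Cot (𝓡∂ (m + 1)) M) ∈ startNbhd x₀ e ∧
          dilate (τ (bdryProj m (cotChart (𝓡∂ (m + 1)) x₀ ⟨ι w.1.1, ξ⟩).1,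
            (cotChart (𝓡∂ (m + 1)) x₀ ⟨ι w.1.1, ξ⟩).2)) ⟨ι w.1.1, ξ⟩ ∈ W) ∧
        H ⟨ι w.1.1, ξ⟩ = 0 ∧ restr ι w.1.1 ξ = w.1 := by
    have c1 : ContinuousAt (fun w : Cot (𝓡 m) B × Cot (𝓡 m) B => (w.1.1, w.2.1))
        (restr ι p₀ ξ₀, restr ι q₀ η₀) :=
      ((continuous_cot_proj.comp continuous_fst).prodMk
        (continuous_cot_proj.comp continuous_snd)).continuousAt
    have c2 : ∀ᶠ a in 𝓝 (restr ι p₀ ξ₀), a ∈ C := hS.isOpen_source.mem_nhds hS.mem_source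
    exact (c2.prod_inl_nhds _).and
      ((c1.tendsto.eventually hN2).and ((hsol _ hN).prod_inl_nhds _))
  obtain ⟨O, hO, hOo, hOm⟩ := eventually_nhds_iff.1 hev
  refine ⟨O, hOo, hOm, ?_⟩
  ext ⟨a, b⟩
  refine and_congr_left fun hwO => ?_
  obtain ⟨hC, ⟨hwU, hwA⟩, hξ⟩ := hO (a, b) hwO
  constructor
  · rintro ⟨c, hc, ⟨p, q⟩, ⟨hx, γ, hγ, hγ0⟩, hab⟩
    obtain ⟨rfl, rfl⟩ := Prod.mk.inj hab
    refine ⟨hC, (hS.value _ hC _).1 ?_⟩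
    obtain ⟨-, g0, -, hint⟩ := h.joins_start hι hH.smooth hW hγ (hUV hx).2.1
    obtain ⟨ξ, hξ⟩ := exists_eq_mk hγ.start_eq
    obtain ⟨η, hη⟩ := exists_eq_mk hγ.end_eq
    obtain ⟨ρ, hρ, e1, e2⟩ := h.exists_diff_eq hι hH hW hWo hU hV hr hx.1 hx.2 hγ hγ0
      (hUV hx).2.1 hξ hη
    -- The joining curve itself realizes the relation: it starts in U, away from V, is interior
    -- afterwards, and first meets V at time 1. The element generated by r is a positive dilation of
    -- this pair, and A is conic.
    have hrel : (restr ι p ξ, restr ι q η) ∈ scatteringRel H ι A V := by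
      refine ⟨p, q, ξ, η, 1, γ, rfl, ?_, hξ ▸ hγ0, one_pos, hγ.bichar, hξ, hη, hx.2, fun t ht => ?_⟩
      · rw [← hξ, g0]
        exact hwA
      · rintro ⟨q', hq', hqt⟩
        rcases ht.1.eq_or_lt with rfl | ht0
        · rw [hγ.start_eq] at hqt
          obtain rfl := hι.embedding.injective hqt
          exact disjoint_left.1 hdisj hx.1 hq'
        · exact hι.not_interior q' (hqt ▸ hint t ⟨ht0, ht.2⟩)
    have h1 := scatteringRel_dilate hH hS.conic_upstairs (mul_pos hc hρ) hrel
    have f1 : (⟨p, -(c • diffFst r p q)⟩ : Cot (𝓡 m) B) = dilate (c * ρ) (restr ι p ξ) := by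
      rw [e1]
      exact mk_neg_smul_neg_smul c ρ (restr ι p ξ)
    have f2 : (⟨q, c • diffSnd r p q⟩ : Cot (𝓡 m) B) = dilate (c * ρ) (restr ι q η) := by
      rw [e2]
      exact mk_smul_smul c ρ (restr ι q η)
    rw [← f1, ← f2] at h1
    exact h1
  · rintro ⟨-, hwS⟩
    obtain ⟨p, q, ξ, η, T, γ, hab, hξA, hξ0, hT, hγ, h0, h1, hqV, -⟩ := (hS.value _ hC _).2 hwS
    obtain ⟨rfl, rfl⟩ := Prod.mk.inj hab
    obtain ⟨ξ', ⟨a1, a2, a3⟩, a4, a5⟩ := hξ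
    -- The null covector behind the value of S is a priori known only to be in A. Uniqueness
    -- identifies it with the one found close to the reference covector, for which the conditions in
    -- `hN` hold.
    obtain rfl : ξ = ξ' := (hS.solvable _ hC).unique ⟨hξA, hξ0, rfl⟩ ⟨a1, a4, a5⟩
    obtain ⟨-, hwe, hwz'⟩ := hι.startNbhd_coord (p := p) a2 rfl
    have hTe := (h.hit.unique hH.smooth hwe hT hγ (h0.trans hwz'.symm)
      (by rw [h1]; exact hι.not_interior q)).1
    have a6 : dilate T (⟨ι p, ξ⟩ : Cot (𝓡∂ (m + 1)) M) ∈ W := by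
      rw [hTe]
      rw [cotChart_fst] at a3
      exact a3
    -- The curve of duration T becomes a unit-time bicharacteristic after dilation by T, and r
    -- controls the covectors of the latter.
    obtain ⟨γ', hγ', g0, g1⟩ : ∃ γ', IsBichar H 1 γ' ∧ γ' 0 = ⟨ι p, T • ξ⟩ ∧
        γ' 1 = ⟨ι q, T • η⟩ := by
      refine ⟨_, div_self hT.ne' ▸ hγ.rescale hH hT, ?_, ?_⟩
      · simp only [mul_zero, h0]
        rfl
      · simp only [mul_one, h1]
        rfl
    have hJ : Joins H ι W p q γ' :=
      ⟨hγ', by rw [g0]; exact a6, by rw [g0], by rw [g1]⟩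
    have hJ0 : H (γ' 0) = 0 := by
      rw [g0]
      exact hH.dilate_eq_zero (hS.nonzero_upstairs hξA) hξ0 hT
    have hpq : (p, q) ∈ U ×ˢ V := hwU
    obtain ⟨ρ, hρ, e1, e2⟩ := h.exists_diff_eq hι hH hW hWo hU hV hr hpq.1 hpq.2 hJ hJ0
      (hUV hpq).2.1 g0 g1
    have hc : (ρ * T)⁻¹ * ρ * T = 1 := by
      field_simp
    -- The differentials of r are ∓ρT times the restrictions of ξ and η: ρ comes from comparing r
    -- with the energy, T from normalizing the time.
    refine ⟨(ρ * T)⁻¹, inv_pos.2 (mul_pos hρ hT), (p, q), ⟨hwU, _, hJ, hJ0⟩, ?_⟩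
    have f1 : (⟨p, -((ρ * T)⁻¹ • diffFst r p q)⟩ : Cot (𝓡 m) B) = restr ι p ξ := by
      rw [e1]
      refine (mk_neg_smul_neg_smul _ ρ (restr ι p (T • ξ))).trans ?_
      rw [restr_smul, dilate_dilate, hc, dilate_one]
    have f2 : (⟨q, (ρ * T)⁻¹ • diffSnd r p q⟩ : Cot (𝓡 m) B) = restr ι q η := by
      rw [e2]
      refine (mk_smul_smul _ ρ (restr ι q (T • η))).trans ?_
      rw [restr_smul, dilate_dilate, hc, dilate_one]
    exact (Prod.ext f1 f2).symm

end GeneratedRelation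

theorem theorem4p3 {m : ℕ} (hm : 1 ≤ m)
    {M : Type*} [TopologicalSpace M] [T2Space M] [ChartedSpace (EuclideanHalfSpace (m + 1)) M]
    [IsManifold (𝓡∂ (m + 1)) ∞ M]
    {B : Type*} [TopologicalSpace B] [ChartedSpace (EuclideanSpace ℝ (Fin m)) B]
    [IsManifold (𝓡 m) ∞ B]
    (ι : B → M) (hι : IsBoundaryInclusion (m := m) ι)
    (H : Cot (𝓡∂ (m + 1)) M → ℝ) (hH : IsHamiltonian H)
    -- the reference null bicharacteristic, parameterized by `[0, 1]`
    (p₀ q₀ : B) (hpq : p₀ ≠ q₀)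
    (ξ₀ : TangentSpace (𝓡∂ (m + 1)) (ι p₀) →L[ℝ] Trivial M ℝ (ι p₀))
    (η₀ : TangentSpace (𝓡∂ (m + 1)) (ι q₀) →L[ℝ] Trivial M ℝ (ι q₀))
    (γ₀ : ℝ → Cot (𝓡∂ (m + 1)) M) (hγ₀ : IsBichar H 1 γ₀)
    (hstart : γ₀ 0 = ⟨ι p₀, ξ₀⟩) (hend : γ₀ 1 = ⟨ι q₀, η₀⟩) (hnull : H ⟨ι p₀, ξ₀⟩ = 0)
    (hint : ∀ t ∈ Ioo (0 : ℝ) 1, (𝓡∂ (m + 1)).IsInteriorPoint (γ₀ t).1)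
    (htrans₀ : IsTransversal H ι p₀ ξ₀) (htrans₁ : IsTransversal H ι q₀ η₀)
    (hconj : NotConjugate H (ι p₀) ξ₀) :
    ∃ W₀ : Set (Cot (𝓡∂ (m + 1)) M), IsOpen W₀ ∧ ⟨ι p₀, ξ₀⟩ ∈ W₀ ∧
    ∀ W ⊆ W₀, IsOpen W → ⟨ι p₀, ξ₀⟩ ∈ W →
    ∃ U₀ V₀ : Set B, IsOpen U₀ ∧ p₀ ∈ U₀ ∧ IsOpen V₀ ∧ q₀ ∈ V₀ ∧
    ∀ U ⊆ U₀, IsOpen U → p₀ ∈ U → ∀ V ⊆ V₀, IsOpen V → q₀ ∈ V →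
      -- points of `U` and `V` are joined by a unique bicharacteristic close to `γ₀`
      (∀ p ∈ U, ∀ q ∈ V, (∃ γ, Joins H ι W p q γ) ∧
        ∀ γ γ', Joins H ι W p q γ → Joins H ι W p q γ' → EqOn γ γ' (Icc 0 1)) ∧
      -- (a)
      IsHypersurface ((𝓡 m).prod (𝓡 m)) (nullPairs H ι W U V) (U ×ˢ V) ∧
      -- (b)
      (∃ A C S, IsScatteringMap H ι U V p₀ ξ₀ A C S) ∧
      (∀ A C S, IsScatteringMap H ι U V p₀ ξ₀ A C S →
        ∀ r, IsDefiningFunction H ι W U V r →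
          ∃ O : Set (Cot (𝓡 m) B × Cot (𝓡 m) B), IsOpen O ∧
            (restr ι p₀ ξ₀, restr ι q₀ η₀) ∈ O ∧
            generatedRel r (nullPairs H ι W U V) ∩ O = {w | w.1 ∈ C ∧ w.2 = S w.1} ∩ O) ∧
      -- (c)
      (∀ (ε : ℝ) (Hs : ℝ → Cot (𝓡∂ (m + 1)) M → ℝ) (r : ℝ → B × B → ℝ), 0 < ε →
        (∀ z ∈ nonzeroCot (𝓡∂ (m + 1)) M, Hs 0 z = H z) →
        ContMDiffOn (𝓘(ℝ, ℝ).prod (cotModel (𝓡∂ (m + 1)))) 𝓘(ℝ, ℝ) ∞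
          (fun w : ℝ × Cot (𝓡∂ (m + 1)) M => Hs w.1 w.2)
          (Ioo (-ε) ε ×ˢ nonzeroCot (𝓡∂ (m + 1)) M) →
        (∀ s ∈ Ioo (-ε) ε, IsHamiltonian (Hs s)) →
        ContMDiffOn (𝓘(ℝ, ℝ).prod ((𝓡 m).prod (𝓡 m))) 𝓘(ℝ, ℝ) ∞
          (fun w : ℝ × (B × B) => r w.1 w.2) (Ioo (-ε) ε ×ˢ (U ×ˢ V)) →
        (∀ s ∈ Ioo (-ε) ε, IsDefiningFunction (Hs s) ι W U V (r s)) →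
        ∃ ρ : B × B → ℝ, ContMDiffOn ((𝓡 m).prod (𝓡 m)) 𝓘(ℝ, ℝ) ∞ ρ (U ×ˢ V) ∧
          (∀ x ∈ U ×ˢ V, 0 < ρ x) ∧
          ∀ x ∈ nullPairs H ι W U V, ∀ γ, Joins H ι W x.1 x.2 γ →
            HasDerivAt (fun s => r s x)
              (-ρ x * ∫ t in (0 : ℝ)..1, deriv (fun s => Hs s (γ t)) 0) 0) := by
  have hHs := hH.isHomogeneousSmooth
  obtain ⟨e, ζ, τ, h, hwe, hwz, hdom, hstart₀⟩ :=
    exists_joinChart hι hHs hγ₀ hstart hend hint htrans₀ htrans₁ hconj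
  have hcov : (cotChart (𝓡∂ (m + 1)) (ι p₀) ⟨ι p₀, ξ₀⟩).2 = ξ₀ :=
    congrArg Prod.snd (cotChart_self (⟨ι p₀, ξ₀⟩ : Cot (𝓡∂ (m + 1)) M))
  have hz₀ : (⟨ι p₀, ξ₀⟩ : Cot (𝓡∂ (m + 1)) M) ∈ startNbhd (ι p₀) e :=
    hwz ▸ h.bdryCot_mem_startNbhd hwe
  have hζ₀ : (ζ (bdryCoord ι (ι p₀) p₀, ξ₀)).1 = ι q₀ :=
    hstart₀ ▸ (h.bdryCot_joinStart hι hdom).2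
  have hjs : bdryCot (ι p₀) (joinStart ι (ι p₀) (ι q₀) e (p₀, q₀)) = ⟨ι p₀, ξ₀⟩ :=
    (congrArg (bdryCot (ι p₀)) hstart₀).trans hwz
  have hE₀ : joinEnergy H ι (ι p₀) (ι q₀) e (p₀, q₀) = 0 := by
    rw [joinEnergy, hjs, hnull]
  have hsrc : (p₀, q₀) ∈ (extChartAt ((𝓡 m).prod (𝓡 m)) (p₀, q₀)).source :=
    mem_extChartAt_source _
  have hEs := h.contMDiffAt_joinEnergy hι hHs.smooth hdom
  -- The reference pair is a regular zero of the energy. A direction δ of nonzero derivative there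
  -- remains one on small U × V and serves as the denominator of the factor in (c).
  obtain ⟨δ, hδ⟩ := DFunLike.ne_iff.1
    (fderiv_chart_ne_zero hsrc hEs (h.mfderiv_joinEnergy_ne_zero hι hHs hdom hE₀))
  have : T2Space B := hι.embedding.t2Space
  -- U and V are kept disjoint so that a curve issued from U is not in V at time 0, which would
  -- spoil the notion of first hit.
  obtain ⟨U₁, V₁, hU₁, hV₁, hpU₁, hqV₁, hdisj⟩ := t2_separation hpq
  refine ⟨startNbhd (ι p₀) e, isOpen_startNbhd, hz₀, fun W hW hWo hzW => ?_⟩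
  -- U and V depend on W only through the second condition: the initial covector of the joining
  -- bicharacteristic has to lie in W.
  have hev : ∀ᶠ x in 𝓝 (p₀, q₀), x ∈ joinDomain ι (ι p₀) (ι q₀) e ∧
      bdryCot (ι p₀) (joinStart ι (ι p₀) (ι q₀) e x) ∈ W ∧
      fderiv ℝ (fun y => joinEnergy H ι (ι p₀) (ι q₀) e
        ((extChartAt ((𝓡 m).prod (𝓡 m)) (p₀, q₀)).symm y))
        (extChartAt ((𝓡 m).prod (𝓡 m)) (p₀, q₀) x) δ ≠ 0 := by
    have c1 := (h.contMDiffAt_bdryCot_joinStart hι hdom).continuousAt.preimage_mem_nhds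
      (hWo.mem_nhds (by rwa [hjs]))
    have c2 := (contMDiffAt_fderiv_chart hsrc hEs δ).continuousAt.eventually_ne hδ
    filter_upwards [hι.isOpen_joinDomain.mem_nhds hdom, c1, c2] with x a1 a2 a3
    exact ⟨a1, a2, a3⟩
  obtain ⟨U₂, hU₂, V₂, hV₂, hUV₂⟩ := mem_nhds_prod_iff.1 hev
  obtain ⟨U₃, hU₃, hU₃o, hpU₃⟩ := mem_nhds_iff.1 hU₂
  obtain ⟨V₃, hV₃, hV₃o, hqV₃⟩ := mem_nhds_iff.1 hV₂
  refine ⟨U₃ ∩ (U₁ ∩ (chartAt (EuclideanSpace ℝ (Fin m)) p₀).source),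
    V₃ ∩ (V₁ ∩ (chartAt (EuclideanSpace ℝ (Fin m)) q₀).source),
    hU₃o.inter (hU₁.inter (chartAt _ p₀).open_source), ⟨hpU₃, hpU₁, mem_chart_source _ p₀⟩,
    hV₃o.inter (hV₁.inter (chartAt _ q₀).open_source), ⟨hqV₃, hqV₁, mem_chart_source _ q₀⟩, ?_⟩
  intro U hU hUo hpU V hV hVo hqV
  have hgood : ∀ x ∈ U ×ˢ V, x ∈ joinDomain ι (ι p₀) (ι q₀) e ∧
      bdryCot (ι p₀) (joinStart ι (ι p₀) (ι q₀) e x) ∈ W ∧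
      fderiv ℝ (fun y => joinEnergy H ι (ι p₀) (ι q₀) e
        ((extChartAt ((𝓡 m).prod (𝓡 m)) (p₀, q₀)).symm y))
        (extChartAt ((𝓡 m).prod (𝓡 m)) (p₀, q₀) x) δ ≠ 0 :=
    fun x hx => hUV₂ ⟨hU₃ (hU hx.1).1, hV₃ (hV hx.2).1⟩
  have hUV : U ×ˢ V ⊆ joinDomain ι (ι p₀) (ι q₀) e := fun x hx => (hgood x hx).1
  have hUVd : Disjoint U V :=
    hdisj.mono (fun p hp => (hU hp).2.1) (fun q hq => (hV hq).2.1)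
  refine ⟨fun p hp q hq => ⟨?_, fun γ γ' hγ hγ' => ?_⟩, ⟨fun x hx => hx.1, fun x hx => ?_⟩, ?_, ?_, ?_⟩
  · obtain ⟨h1, h2, -⟩ := hgood (p, q) ⟨hp, hq⟩
    exact h.exists_joins hι h1 h2
  · exact h.joins_eqOn hι hHs.smooth hW hγ (hUV (mk_mem_prod hp hq)).2.1 hγ'
  · have hiff : ∀ y ∈ U ×ˢ V, y ∈ nullPairs H ι W U V ↔ joinEnergy H ι (ι p₀) (ι q₀) e y = 0 :=
      fun y hy => h.mem_nullPairs_iff hι hHs hW hy (hgood y hy).1 (hgood y hy).2.1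
    exact ⟨U ×ˢ V, joinEnergy H ι (ι p₀) (ι q₀) e, hUo.prod hVo, hx.1, Subset.rfl,
      fun y hy => (h.contMDiffAt_joinEnergy hι hHs.smooth (hUV hy)).contMDiffWithinAt, hiff,
      fun y hy => h.mfderiv_joinEnergy_ne_zero hι hHs (hUV hy.1) ((hiff y hy.1).1 hy.2)⟩
  · exact exists_isScatteringMap hι hHs h hUo hVo hUVd hpU hqV hz₀ hnull (by rw [hcov]; exact hζ₀)
  · intro A C S hS r hr
    exact h.generatedRel_eq_graph hι hHs hW hWo hUo hVo hUVd hUV hpU hqV hzW hnull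
      (by rw [hcov]; exact hstart₀) hS hr
  · intro ε Hs r hε h0 hsm hHam hr hrs
    exact h.exists_factor hι hHs hW hWo hUo hVo hUV (fun x hx => (hgood x hx).2.1)
      (fun p hp => (hU hp).2.2) (fun q hq => (hV hq).2.2) (fun x hx => (hgood x hx).2.2)
      ⟨hsm, fun s hs => (hHam s hs).homogeneous⟩ hε h0 hr hrs

end
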